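/- **Conventions.** $R$ is a commutative ring, $RS$ denotes the (unnormalized) chain complex of free $R$-modules on the simplices of a simplicial set $S$, with $d=\sum_i(-1)^id_i$. For $x\in X_n$ and a monotone map $f:[m]\to[n]$, $[f_0,\dots,f_m]_x=f^*x\in X_m$; so $x=[0,\dots,n]_x$. *Twisting functions and twisted products.* A twisting function $\tau:X\to\Gamma$ into a simplicial group is a family $\tau:X_n\to\Gamma_{n-1}$, $n\ge1$, with $d_i\tau x=\tau d_ix$ for $i<n-1$, $d_{n-1}\tau x=(\tau d_nx)^{-1}(\tau d_{n-1}x)$, $s_i\tau x=\tau s_ix$ for $0\le i\le n-1$ ($x\in X_n$), and $\tau s_ny=1$ ($y\in X_n$). If $\Gamma$ acts on a simplicial set $Z$ from the left, $X\times_\tau Z$ has the simplices $(x,z)\in X_n\times Z_n$, with $d_i(x,z)=(d_ix,d_iz)$ for $i<n$, $d_n(x,z)=(d_nx,\tau x\, d_nz)$ for $n\ge 1$ and $s_i(x,z)=(s_ix,s_iz)$. Kan's simplicial group $GX$ has $G_nX$ generated by the symbols $\tau x$, $x\in X_{n+1}$, subject to $\tau s_ny=1$ ($y\in X_n$), with operators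 such that $\tau:X\to GX$ is a twisting function. Every twisting function $X\to\Gamma$ factors through a unique morphism $GX\to\Gamma$ of simplicial groups, so $GX$ acts on $Z$. *Shuffle products.* For $s\in S_p$, $t\in T_q$ let $\nabla(s\otimes t)=\sum_A(-1)^{\operatorname{sign}A}(\sigma_A^*s,\sigma_{A^c}^*t)\in R(S\times T)_{p+q}$, where $A$ runs through the $p$-element subsets of $\{1,\dots,p+q\}$, $\sigma_A(k)=|A\cap\{1,\dots,k\}|$, and $\operatorname{sign}A$ is the number of pairs $i<j$ with $i\notin A$, $j\in A$. Together with the action of $GX$ on $Z$ and the map $((x,g),z)\mapsto(x,gz)$, it gives products $\cdot: RGX\otimes RZ\to RZ$ and $\cdot: R(X\times_\tau GX)\otimes RZ\to R(X\times_\tau Z)$. *Twisted tensor product.* For $x\in X_{n+1}$ and a permutation $g=(g_1,\dots,g_n)$ of $\{1,\dots,n\}$ let $$Tcx(g)=\prod_{r=0}^{n}\tau[0,\alpha_{r1},\dots,\alpha_{rn},r+1]_x\in G_nX,\qquad \alpha_{rj}=\max(\{0,\dots,r\}\cap\{0,g_1,\dots,g_j\}).$$ Let $\phi:RX\to RGX$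 be the linear map of degree $-1$ with $\phi x=0$ for $x\in X_0$, $\phi x=\tau x-1$ for $x\in X_1$, and $\phi x=\sum_{g\in S_n}(-1)^{\operatorname{sign}(g)}Tcx(g)$ for $x\in X_{n+1}$, $n\ge1$. Let $RX\otimes_\phi RZ$ be the graded module $RX\otimes RZ$ with $d=d_\otimes+d_\phi$, where for $x\in X_n$ $$d_\otimes(x\otimes z)=dx\otimes z+(-1)^nx\otimes dz,\qquad d_\phi(x\otimes z)=(-1)^n\sum_{i=0}^{n}[0,\dots,i]_x\otimes(\phi[i,\dots,n]_x\cdot z).$$ *The operator $D_x$.* For $x\in X_n$, the operator $D_x$ acts on $R$-linear combinations of formal expressions $(I_x,\tau(J^1_x)^{k_1}\cdots\tau(J^l_x)^{k_l})$ in (possibly degenerate) faces of $x$, i.e. on $R(\Delta^n\times_\tau G\Delta^n)$, whose elements are then evaluated at $x$ in $R(X\times_\tau GX)$. With $\tilde f=[0,f_0,\dots,f_m]:[m+1]\to[n]$ for $f:[m]\to[n]$, $$D_x\bigl(I_x,\tau(J^1_x)^{k_1}\cdots\tau(J^l_x)^{k_l}\bigr)=\bigl(\tilde I_x,\tau(\tilde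 J^1_x)^{k_1}\cdots\tau(\tilde J^l_x)^{k_l}\bigr).$$ **Theorem.** Let $X$ be a reduced simplicial set ($X_0=\{v\}$), $\tau:X\to\Gamma$ a twisting function into a simplicial group, and $Z$ a simplicial set with a left action of $\Gamma$. Define the $R$-linear map $\Psi:RX\otimes_\phi RZ\to R(X\times_\tau Z)$ by $\Psi(x\otimes z)=\Psi(x\otimes1)\cdot z$, where $1\in G_0X$ and $\Psi(x\otimes 1)\in R(X\times_\tau GX)$ is defined by induction on $\dim x$ by $\Psi(v\otimes1)=(v,1)$ and $\Psi(x\otimes1)=D_x\Psi(d(x\otimes1))$ for $\dim x\ge1$; here $d(x\otimes 1)$ is taken in $RX\otimes_\phi RGX$, and all terms are read as expressions in the faces of $x$. Then $d^2=0$ on $RX\otimes_\phi RZ$, and a) $\Psi$ is a chain map; b) for all $n\ge 0$ and $x\in X_n$, $\Psi(x\otimes1)\equiv(x,1_n)$ modulo $F_{n-1}R(X\times_\tau GX)$, the submodule spanned by the $(y,g)$ with $y$ in the $(n-1)$-skeleton of $X$ (so $F_{-1}=0$), where $1_n\in G_nX$ is the identity; c) $\Psi$ is a chain homotopy equivalence.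 -/

import Mathlib

open CategoryTheory Simplicial Opposite

universe u v w r

noncomputable section

namespace Brown

/-! ### Monotone maps -/

/-- For `f : [m] → [n]`, the map `[f 0, …, f m, n] : [m+1] → [n]`. -/
def snocMap {a b : SimplexCategory} (f : a ⟶ b) : ⦋a.len + 1⦌ ⟶ b :=
  SimplexCategory.Hom.mk
    ⟨Fin.snoc (α := fun _ => Fin (b.len + 1)) (fun k => f.toOrderHom k) (Fin.last b.len), by
      intro i j hij
      induction j using Fin.lastCases with
      | last => simpa using Fin.le_last _
      | cast j =>
        induction i using Fin.lastCases with
        | last => exact absurd hij (by simpa [Fin.le_def] using Nat.le_of_lt_succ j.isLt)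
        | cast i => simpa using f.toOrderHom.monotone (by simpa using hij)⟩

/-- For `f : [m] → [n]`, the map `[f 0, …, f m, n+1] : [m+1] → [n+1]`. -/
def extMap {a b : SimplexCategory} (f : a ⟶ b) : ⦋a.len + 1⦌ ⟶ ⦋b.len + 1⦌ :=
  SimplexCategory.Hom.mk
    ⟨Fin.snoc (α := fun _ => Fin (b.len + 2)) (fun k => (f.toOrderHom k).castSucc)
      (Fin.last (b.len + 1)), by
      intro i j hij
      induction j using Fin.lastCases with
      | last => simpa using Fin.le_last _
      | cast j =>
        induction i using Fin.lastCases with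
        | last => exact absurd hij (by simpa [Fin.le_def] using Nat.le_of_lt_succ j.isLt)
        | cast i => simpa using f.toOrderHom.monotone (by simpa using hij)⟩

/-- For `f : [m] → [n]`, the derived map `[0, f 0, …, f m] : [m+1] → [n]`. -/
def derivedMap {a b : SimplexCategory} (f : a ⟶ b) : ⦋a.len + 1⦌ ⟶ b :=
  SimplexCategory.Hom.mk
    ⟨Fin.cons (α := fun _ => Fin (b.len + 1)) 0 (fun k => f.toOrderHom k), by
      intro i j hij
      induction i using Fin.cases with
      | zero => simp
      | succ i =>
        induction j using Fin.cases with
        | zero => exact absurd hij (by simp)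
        | succ j => simpa using f.toOrderHom.monotone (by simpa using hij)⟩

/-- The inclusion `[0, …, i]` of the front face. -/
def frontMap {i n : ℕ} (h : i ≤ n) : ⦋i⦌ ⟶ ⦋n⦌ :=
  SimplexCategory.Hom.mk ⟨fun k => ⟨k.val, by have := k.isLt; simp at this ⊢; omega⟩,
    fun _ _ hab => hab⟩

/-- The inclusion `[i, …, i + k]` of the back face. -/
def backMap {i k n : ℕ} (h : i + k = n) : ⦋k⦌ ⟶ ⦋n⦌ :=
  SimplexCategory.Hom.mk ⟨fun j => ⟨i + j.val, by have := j.isLt; simp at this ⊢; omega⟩,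
    fun _ _ hab => Nat.add_le_add_left hab i⟩

theorem hom_ext_apply {a b : SimplexCategory} {f g : a ⟶ b}
    (h : ∀ k, f.toOrderHom k = g.toOrderHom k) : f = g := by
  apply SimplexCategory.Hom.ext
  ext k : 2
  exact h k

theorem comp_apply' {a b c : SimplexCategory} (f : a ⟶ b) (g : b ⟶ c) (k : Fin (a.len + 1)) :
    (f ≫ g).toOrderHom k = g.toOrderHom (f.toOrderHom k) := rfl

theorem snocMap_castSucc {a b : SimplexCategory} (f : a ⟶ b) (k : Fin (a.len + 1)) :
    (snocMap f).toOrderHom k.castSucc = f.toOrderHom k :=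
  Fin.snoc_castSucc (α := fun _ => Fin (b.len + 1)) _ _ _

theorem snocMap_last {a b : SimplexCategory} (f : a ⟶ b) :
    (snocMap f).toOrderHom (Fin.last (a.len + 1)) = Fin.last b.len :=
  Fin.snoc_last (α := fun _ => Fin (b.len + 1)) _ _

theorem extMap_castSucc {a b : SimplexCategory} (f : a ⟶ b) (k : Fin (a.len + 1)) :
    (extMap f).toOrderHom k.castSucc = (f.toOrderHom k).castSucc :=
  Fin.snoc_castSucc (α := fun _ => Fin (b.len + 2)) (Fin.last (b.len + 1))
    (fun k => (f.toOrderHom k).castSucc) k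

theorem extMap_last {a b : SimplexCategory} (f : a ⟶ b) :
    (extMap f).toOrderHom (Fin.last (a.len + 1)) = Fin.last (b.len + 1) :=
  Fin.snoc_last (α := fun _ => Fin (b.len + 2)) (Fin.last (b.len + 1))
    (fun k => (f.toOrderHom k).castSucc)

/-- `[0, …, n] : [n] → [n+1]`. -/
abbrev lastFace (a : SimplexCategory) : a ⟶ ⦋a.len + 1⦌ := SimplexCategory.δ (Fin.last (a.len + 1))

/-- `[0, …, n, n] : [n+1] → [n]`. -/
abbrev lastDegen (a : SimplexCategory) : ⦋a.len + 1⦌ ⟶ a := SimplexCategory.σ (Fin.last a.len)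

theorem lastFace_apply (a : SimplexCategory) (k : Fin (a.len + 1)) :
    (lastFace a).toOrderHom k = k.castSucc :=
  Fin.succAbove_last_apply k

theorem lastDegen_castSucc (a : SimplexCategory) (k : Fin (a.len + 1)) :
    (lastDegen a).toOrderHom k.castSucc = k :=
  Fin.predAbove_castSucc_of_le _ _ (Fin.le_last k)

theorem lastDegen_last (a : SimplexCategory) :
    (lastDegen a).toOrderHom (Fin.last (a.len + 1)) = Fin.last a.len :=
  Fin.predAbove_right_last

theorem derivedMap_succ {a b : SimplexCategory} (f : a ⟶ b) (k : Fin (a.len + 1)) :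
    (derivedMap f).toOrderHom k.succ = f.toOrderHom k := rfl

theorem lastFace_snocMap {a b : SimplexCategory} (f : a ⟶ b) : lastFace a ≫ snocMap f = f :=
  hom_ext_apply fun k => by
    rw [comp_apply', lastFace_apply, snocMap_castSucc]

theorem lastFace_extMap {a b : SimplexCategory} (f : a ⟶ b) :
    lastFace a ≫ extMap f = f ≫ lastFace b :=
  hom_ext_apply fun k => by
    rw [comp_apply', comp_apply', lastFace_apply, extMap_castSucc, lastFace_apply]

theorem extMap_snocMap {c a b : SimplexCategory} (g : c ⟶ a) (f : a ⟶ b) :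
    extMap g ≫ snocMap f = snocMap (g ≫ f) :=
  hom_ext_apply fun k => by
    induction k using Fin.lastCases with
    | last => rw [comp_apply', extMap_last, snocMap_last, snocMap_last]
    | cast k => rw [comp_apply', extMap_castSucc, snocMap_castSucc, snocMap_castSucc, comp_apply']

theorem extMap_comp {c a b : SimplexCategory} (g : c ⟶ a) (f : a ⟶ b) :
    extMap (g ≫ f) = extMap g ≫ extMap f :=
  hom_ext_apply fun k => by
    induction k using Fin.lastCases with
    | last => rw [comp_apply', extMap_last, extMap_last, extMap_last]
    | cast k => rw [comp_apply', extMap_castSucc, extMap_castSucc, extMap_castSucc, comp_apply']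

theorem extMap_id (a : SimplexCategory) : extMap (𝟙 a) = 𝟙 _ :=
  hom_ext_apply fun k => by
    induction k using Fin.lastCases with
    | last => rw [extMap_last]; rfl
    | cast k => rw [extMap_castSucc]; rfl

theorem snocMap_id (a : SimplexCategory) : snocMap (𝟙 a) = lastDegen a :=
  hom_ext_apply fun k => by
    induction k using Fin.lastCases with
    | last => rw [snocMap_last, lastDegen_last]
    | cast k => rw [snocMap_castSucc, lastDegen_castSucc]; rfl

theorem extMap_lastDegen {a b : SimplexCategory} (f : a ⟶ b) :
    extMap f ≫ lastDegen b = snocMap f := by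
  rw [← snocMap_id, extMap_snocMap, Category.comp_id]

theorem snocMap_lastFace_lastDegen {a b : SimplexCategory} (f : a ⟶ b) :
    snocMap f ≫ lastFace b ≫ lastDegen b = snocMap f := by
  rw [← snocMap_id, lastFace_snocMap, Category.comp_id]

theorem snocMap_lastFace (a : SimplexCategory) : snocMap (lastFace a) = 𝟙 _ :=
  hom_ext_apply fun k => by
    induction k using Fin.lastCases with
    | last => rw [snocMap_last]; rfl
    | cast k => rw [snocMap_castSucc, lastFace_apply]; rfl

theorem snocMap_of_last {a b : SimplexCategory} (f : a ⟶ b)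
    (hf : f.toOrderHom (Fin.last a.len) = Fin.last b.len) : snocMap f = lastDegen a ≫ f :=
  hom_ext_apply fun k => by
    induction k using Fin.lastCases with
    | last => rw [snocMap_last, comp_apply', lastDegen_last, hf]
    | cast k => rw [snocMap_castSucc, comp_apply', lastDegen_castSucc]

theorem extMap_δ {n : ℕ} (i : Fin (n + 2)) :
    extMap (SimplexCategory.δ i) = SimplexCategory.δ i.castSucc :=
  hom_ext_apply fun k => by
    induction k using Fin.lastCases with
    | last =>
      rw [extMap_last]
      exact (Fin.succAbove_of_le_castSucc i.castSucc (Fin.last (n + 1))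
        (Fin.castSucc_le_castSucc_iff.2 (Fin.le_last i))).symm
    | cast k =>
      rw [extMap_castSucc]
      exact (Fin.castSucc_succAbove_castSucc).symm

theorem castSucc_predAbove {n : ℕ} (i : Fin (n + 1)) (k : Fin (n + 2)) :
    i.castSucc.predAbove k.castSucc = (i.predAbove k).castSucc := by
  rcases lt_or_ge i.castSucc k with h | h
  · rw [Fin.predAbove_of_castSucc_lt _ _ h, Fin.predAbove_of_castSucc_lt _ _ (by simpa using h)]
    rfl
  · rw [Fin.predAbove_of_le_castSucc _ _ h, Fin.predAbove_of_le_castSucc _ _ (by simpa using h)]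
    rfl

theorem extMap_σ {n : ℕ} (i : Fin (n + 1)) :
    extMap (SimplexCategory.σ i) = SimplexCategory.σ i.castSucc :=
  hom_ext_apply fun k => by
    induction k using Fin.lastCases with
    | last =>
      rw [extMap_last]
      exact Fin.predAbove_right_last.symm
    | cast k =>
      rw [extMap_castSucc]
      exact (castSucc_predAbove i k).symm

/-! ### Twisting functions -/

/-- A twisting function `τ : X → Γ` of degree `-1` into a simplicial group: for `x ∈ X_n`,
`d_i τ x = τ d_i x` for `i < n - 1`, `d_{n-1} τ x = (τ d_n x)⁻¹ (τ d_{n-1} x)`,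
`s_i τ x = τ s_i x` for `i ≤ n - 1`, and `τ s_n x = 1`. -/
structure TwistingFunction (X : SSet.{u}) (Γ : SimplicialObject GrpCat.{w}) where
  /-- The underlying functions `X_{n+1} → Γ_n`. -/
  tau : ∀ {n : ℕ}, X _⦋n + 1⦌ → Γ _⦋n⦌
  face : ∀ {n : ℕ} (x : X _⦋n + 2⦌) (i : Fin (n + 1)),
    Γ.δ i.castSucc (tau x) = tau (X.δ i.castSucc.castSucc x)
  face_last : ∀ {n : ℕ} (x : X _⦋n + 2⦌),
    Γ.δ (Fin.last (n + 1)) (tau x) =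
      (tau (X.δ (Fin.last (n + 2)) x))⁻¹ * tau (X.δ (Fin.last (n + 1)).castSucc x)
  degen : ∀ {n : ℕ} (x : X _⦋n + 1⦌) (i : Fin (n + 1)),
    Γ.σ i (tau x) = tau (X.σ i.castSucc x)
  degen_last : ∀ {n : ℕ} (y : X _⦋n⦌), tau (X.σ (Fin.last n) y) = 1

theorem map_comp_op {C : SSet.{u}} {a b c : SimplexCategory} (f : a ⟶ b) (g : b ⟶ c)
    (x : C.obj (op c)) : C.map f.op (C.map g.op x) = C.map (f ≫ g).op x := by
  rw [op_comp, C.map_comp]; rfl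

namespace TwistingFunction

variable {X : SSet.{u}} {Γ : SimplicialObject GrpCat.{w}} (τ : TwistingFunction X Γ)

theorem tau_map_lastDegen {n : ℕ} (y : X _⦋n⦌) : τ.tau (X.map (lastDegen ⦋n⦌).op y) = 1 :=
  τ.degen_last y

/-- The effect on `τ x` of an arbitrary simplicial operator. -/
def MapTau {a b : SimplexCategory} (f : a ⟶ b) : Prop :=
  ∀ x : X _⦋b.len + 1⦌, Γ.map f.op (τ.tau x) =
    (τ.tau (X.map (snocMap f ≫ lastFace b).op x))⁻¹ * τ.tau (X.map (extMap f).op x)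

theorem mapTau_of_last {a b : SimplexCategory} (f : a ⟶ b)
    (hf : f.toOrderHom (Fin.last a.len) = Fin.last b.len)
    (h : ∀ x : X _⦋b.len + 1⦌, Γ.map f.op (τ.tau x) = τ.tau (X.map (extMap f).op x)) :
    τ.MapTau f := by
  intro x
  rw [h, snocMap_of_last f hf, Category.assoc, ← map_comp_op, τ.tau_map_lastDegen, inv_one,
    one_mul]

theorem mapTau_comp {c a b : SimplexCategory} (g : c ⟶ a) (f : a ⟶ b)
    (hg : τ.MapTau g) (hf : τ.MapTau f) : τ.MapTau (g ≫ f) := by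
  intro x
  have h1 : Γ.map (g ≫ f).op (τ.tau x) = Γ.map g.op (Γ.map f.op (τ.tau x)) := by
    rw [op_comp, Γ.map_comp]; rfl
  rw [h1, hf, map_mul, map_inv, hg, hg]
  simp only [map_comp_op]
  have e1 : (snocMap g ≫ lastFace a) ≫ snocMap f ≫ lastFace b =
      (snocMap g ≫ lastFace a) ≫ extMap f := by
    rw [Category.assoc, Category.assoc, lastFace_extMap, ← Category.assoc (lastFace a),
      lastFace_snocMap]
  have e2 : extMap g ≫ snocMap f ≫ lastFace b = snocMap (g ≫ f) ≫ lastFace b := by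
    rw [← Category.assoc, extMap_snocMap]
  rw [e1, e2, extMap_comp]
  group

theorem mapTau {a b : SimplexCategory} (f : a ⟶ b) : τ.MapTau f := by
  let W : MorphismProperty SimplexCategory := fun _ _ f => τ.MapTau f
  have : W.IsMultiplicative :=
    { id_mem := fun a => τ.mapTau_of_last _ rfl fun x => by
        rw [extMap_id, op_id, op_id, Γ.map_id, X.map_id]; rfl
      comp_mem := fun g f hg hf => τ.mapTau_comp g f hg hf }
  have hW : W = ⊤ := by
    apply SimplexCategory.morphismProperty_eq_top
    · intro n i
      induction i using Fin.lastCases with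
      | last =>
        intro x
        rw [snocMap_lastFace, Category.id_comp, extMap_δ]
        exact τ.face_last x
      | cast i =>
        refine τ.mapTau_of_last _ ?_ fun x => ?_
        · exact Fin.succAbove_of_le_castSucc i.castSucc (Fin.last n)
            (Fin.castSucc_le_castSucc_iff.2 (Fin.le_last i))
        · rw [extMap_δ]
          exact τ.face x i
    · intro n i
      refine τ.mapTau_of_last _ Fin.predAbove_right_last fun x => ?_
      rw [extMap_σ]
      exact τ.degen x i
  exact (show W f from hW ▸ trivial)

end TwistingFunction

/-! ### Kan's group `GX` -/

/-- The group `G_n X`, generated by the symbols `τ x`, `x ∈ X_{n+1}`, subject to the relations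
`τ (s_n y) = 1`, `y ∈ X_n`; so it is free on the `τ x` with `x` not of the form `s_n y`. -/
abbrev KanGroup (X : SSet.{u}) (a : SimplexCategory) : Type u :=
  PresentedGroup (α := X _⦋a.len + 1⦌)
    (Set.range fun y : X.obj (op a) => FreeGroup.of (X.map (lastDegen a).op y))

/-- The generator `τ x ∈ G_n X` given by `x ∈ X_{n+1}`. -/
def kanTau {X : SSet.{u}} {a : SimplexCategory} (x : X _⦋a.len + 1⦌) : KanGroup X a :=
  PresentedGroup.of x

theorem kanTau_lastDegen {X : SSet.{u}} {a : SimplexCategory} (y : X.obj (op a)) :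
    kanTau (X.map (lastDegen a).op y) = 1 :=
  PresentedGroup.one_of_mem (Set.mem_range_self y)

/-- A homomorphism out of `G_n X` is given by its values on the `τ x`. -/
def kanLift {X : SSet.{u}} {a : SimplexCategory} {H : Type w} [Group H]
    (f : X _⦋a.len + 1⦌ → H) (hf : ∀ y : X.obj (op a), f (X.map (lastDegen a).op y) = 1) :
    KanGroup X a →* H :=
  PresentedGroup.toGroup (f := f) (by rintro _ ⟨y, rfl⟩; simpa using hf y)

theorem kanLift_kanTau {X : SSet.{u}} {a : SimplexCategory} {H : Type w} [Group H]
    (f : X _⦋a.len + 1⦌ → H) (hf : ∀ y : X.obj (op a), f (X.map (lastDegen a).op y) = 1)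
    (x : X _⦋a.len + 1⦌) : kanLift f hf (kanTau x) = f x :=
  PresentedGroup.toGroup.of _

theorem kanHom_ext {X : SSet.{u}} {a : SimplexCategory} {H : Type w} [Group H]
    {f g : KanGroup X a →* H} (h : ∀ x, f (kanTau x) = g (kanTau x)) : f = g :=
  PresentedGroup.ext h

/-- The simplicial operator `f^*` on `GX`,
`f^* (τ x) = (τ [f 0, …, f m, n]_x)⁻¹ (τ [f 0, …, f m, n + 1]_x)` for `f : [m] → [n]`. -/
def kanMap (X : SSet.{u}) {a b : SimplexCategory} (f : a ⟶ b) : KanGroup X b →* KanGroup X a :=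
  kanLift
    (fun x => (kanTau (X.map (snocMap f ≫ lastFace b).op x))⁻¹ * kanTau (X.map (extMap f).op x))
    (fun y => by
      rw [map_comp_op, map_comp_op, Category.assoc, snocMap_lastFace_lastDegen, extMap_lastDegen,
        inv_mul_cancel])

theorem kanMap_kanTau (X : SSet.{u}) {a b : SimplexCategory} (f : a ⟶ b) (x : X _⦋b.len + 1⦌) :
    kanMap X f (kanTau x) =
      (kanTau (X.map (snocMap f ≫ lastFace b).op x))⁻¹ * kanTau (X.map (extMap f).op x) :=
  kanLift_kanTau _ _ x

theorem kanMap_id (X : SSet.{u}) (a : SimplexCategory) : kanMap X (𝟙 a) = MonoidHom.id _ := by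
  apply kanHom_ext
  intro x
  rw [kanMap_kanTau, snocMap_id, ← map_comp_op, kanTau_lastDegen, extMap_id, op_id, X.map_id,
    inv_one, one_mul]
  rfl

theorem kanMap_comp (X : SSet.{u}) {c a b : SimplexCategory} (g : c ⟶ a) (f : a ⟶ b) :
    kanMap X (g ≫ f) = (kanMap X g).comp (kanMap X f) := by
  apply kanHom_ext
  intro x
  rw [MonoidHom.comp_apply, kanMap_kanTau, kanMap_kanTau, map_mul, map_inv, kanMap_kanTau,
    kanMap_kanTau]
  simp only [map_comp_op]
  have e1 : (snocMap g ≫ lastFace a) ≫ snocMap f ≫ lastFace b =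
      (snocMap g ≫ lastFace a) ≫ extMap f := by
    rw [Category.assoc, Category.assoc, lastFace_extMap, ← Category.assoc (lastFace a),
      lastFace_snocMap]
  have e2 : extMap g ≫ snocMap f ≫ lastFace b = snocMap (g ≫ f) ≫ lastFace b := by
    rw [← Category.assoc, extMap_snocMap]
  rw [e1, e2, extMap_comp]
  group

/-- Kan's simplicial group `GX`. -/
def kanG (X : SSet.{u}) : SimplicialObject GrpCat.{u} where
  obj a := GrpCat.of (KanGroup X a.unop)
  map f := GrpCat.ofHom (kanMap X f.unop)
  map_id a := by rw [unop_id, kanMap_id]; rfl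
  map_comp f g := by rw [unop_comp, kanMap_comp]; rfl

/-- The universal twisting function `τ : X → GX`. -/
def universalTwisting (X : SSet.{u}) : TwistingFunction X (kanG X) where
  tau {n} x := kanTau (a := ⦋n⦌) x
  face {n} x i := by
    refine (kanMap_kanTau X (SimplexCategory.δ i.castSucc) x).trans ?_
    rw [snocMap_of_last, Category.assoc, ← map_comp_op, kanTau_lastDegen, inv_one, one_mul,
      extMap_δ]
    · rfl
    · exact Fin.succAbove_of_le_castSucc i.castSucc (Fin.last n)
        (Fin.castSucc_le_castSucc_iff.2 (Fin.le_last i))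
  face_last {n} x := by
    refine (kanMap_kanTau X (SimplexCategory.δ (Fin.last (n + 1))) x).trans ?_
    rw [show SimplexCategory.δ (Fin.last (n + 1)) = lastFace ⦋n⦌ from rfl, snocMap_lastFace,
      Category.id_comp, extMap_δ]
    rfl
  degen {n} x i := by
    refine (kanMap_kanTau X (SimplexCategory.σ i) x).trans ?_
    rw [snocMap_of_last, Category.assoc, ← map_comp_op, kanTau_lastDegen, inv_one, one_mul,
      extMap_σ]
    · rfl
    · exact Fin.predAbove_right_last
  degen_last {n} y := kanTau_lastDegen (a := ⦋n⦌) y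

/-- The homomorphism `G_n X → G_n Y` induced by a simplicial map `X → Y`. -/
def kanFunctor {X Y : SSet.{u}} (f : X ⟶ Y) (a : SimplexCategory) :
    KanGroup X a →* KanGroup Y a :=
  kanLift (fun x => kanTau (f.app _ x)) (fun y => by
    have : f.app _ (X.map (lastDegen a).op y) = Y.map (lastDegen a).op (f.app _ y) :=
      ConcreteCategory.congr_hom (f.naturality (lastDegen a).op) y
    rw [this, kanTau_lastDegen])

/-- The homomorphism of simplicial groups `GX → Γ` through which a twisting function `τ : X → Γ`
factors, `τ x ↦ τ x`. -/
def TwistingFunction.toHom {X : SSet.{u}} {Γ : SimplicialObject GrpCat.{w}}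
    (τ : TwistingFunction X Γ) {a : SimplexCategory} : KanGroup X a →* Γ.obj (op a) :=
  kanLift (fun x => τ.tau x) (fun y => τ.tau_map_lastDegen (n := a.len) y)

/-! ### Twisted cartesian products -/

/-- A left action of a simplicial group on a simplicial set. -/
structure SimplicialAction (Γ : SimplicialObject GrpCat.{w}) (Z : SSet.{v}) where
  /-- The action of `Γ_n` on `Z_n`. -/
  act : ∀ {a : SimplexCategoryᵒᵖ}, Γ.obj a → Z.obj a → Z.obj a
  one_act : ∀ {a : SimplexCategoryᵒᵖ} (z : Z.obj a), act 1 z = z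
  mul_act : ∀ {a : SimplexCategoryᵒᵖ} (g h : Γ.obj a) (z : Z.obj a),
    act (g * h) z = act g (act h z)
  map_act : ∀ {a b : SimplexCategoryᵒᵖ} (f : a ⟶ b) (g : Γ.obj a) (z : Z.obj a),
    Z.map f (act g z) = act (Γ.map f g) (Z.map f z)

/-- The underlying simplicial set of a simplicial group. -/
abbrev underlying (Γ : SimplicialObject GrpCat.{w}) : SSet.{w} := Γ ⋙ forget GrpCat

/-- A simplicial group acting on itself by left multiplication. -/
def selfAction (Γ : SimplicialObject GrpCat.{w}) : SimplicialAction Γ (underlying Γ) where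
  act {a} (g h : Γ.obj a) := (g * h : Γ.obj a)
  one_act {a} z := one_mul (M := Γ.obj a) z
  mul_act {a} g h z := mul_assoc (G := Γ.obj a) g h z
  map_act f g z := map_mul (Γ.map f).hom g z

section TCP

variable {X : SSet.{u}} {Γ : SimplicialObject GrpCat.{w}} {Z : SSet.{v}}

/-- The twisted cartesian product `X ×_τ Z`. The simplicial operator of `f : [m] → [n]` sends
`(x, z)` to `(f^* x, τ [f 0, …, f m, n]_x • f^* z)`; see `tcp_face`, `tcp_face_last`, `tcp_degen`
for its values on faces and degeneracies. -/
def tcp (τ : TwistingFunction X Γ) (ρ : SimplicialAction Γ Z) : SSet.{max u v} where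
  obj a := X.obj a × Z.obj a
  map {a b} f := TypeCat.ofHom fun s =>
    (X.map f s.1,
      ρ.act (a := b) (τ.tau (n := b.unop.len) (X.map (snocMap f.unop).op s.1)) (Z.map f s.2))
  map_id a := by
    ext s
    · exact ConcreteCategory.congr_hom (X.map_id a) s.1
    have h : τ.tau (n := a.unop.len) (X.map (lastDegen a.unop).op s.1) = 1 :=
      τ.tau_map_lastDegen (n := a.unop.len) s.1
    change ρ.act (a := a) (τ.tau (n := a.unop.len) (X.map (snocMap (𝟙 a.unop)).op s.1))
      (Z.map (𝟙 a) s.2) = s.2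
    rw [snocMap_id, h, Z.map_id]
    exact ρ.one_act _
  map_comp {a b c} f g := by
    ext s
    · exact ConcreteCategory.congr_hom (X.map_comp f g) s.1
    change ρ.act (a := c) (τ.tau (n := c.unop.len) (X.map (snocMap (f ≫ g).unop).op s.1))
      (Z.map (f ≫ g) s.2) =
      ρ.act (a := c) (τ.tau (n := c.unop.len) (X.map (snocMap g.unop).op (X.map f s.1)))
        (Z.map g (ρ.act (a := b)
          (τ.tau (n := b.unop.len) (X.map (snocMap f.unop).op s.1)) (Z.map f s.2)))
    have h := τ.mapTau g.unop (X.map (snocMap f.unop).op s.1)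
    have e : (snocMap g.unop ≫ lastFace b.unop) ≫ snocMap f.unop = snocMap g.unop ≫ f.unop := by
      rw [Category.assoc, lastFace_snocMap]
    have e' : X.map (snocMap g.unop ≫ f.unop).op s.1 =
        X.map (snocMap g.unop).op (X.map f s.1) := (map_comp_op _ f.unop _).symm
    rw [map_comp_op, map_comp_op, e, extMap_snocMap, e'] at h
    rw [ρ.map_act, ← ρ.mul_act]
    rw [Quiver.Hom.op_unop] at h
    rw [h, unop_comp, mul_inv_cancel_left, Z.map_comp]
    rfl

variable (τ : TwistingFunction X Γ) (ρ : SimplicialAction Γ Z)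

theorem tcp_map_of_last {a b : SimplexCategory} (f : a ⟶ b)
    (hf : f.toOrderHom (Fin.last a.len) = Fin.last b.len) (x : X.obj (op b)) (z : Z.obj (op b)) :
    (tcp τ ρ).map f.op (x, z) = (X.map f.op x, Z.map f.op z) := by
  refine Prod.ext rfl ?_
  change ρ.act (a := op a) (τ.tau (n := a.len) (X.map (snocMap f).op x)) (Z.map f.op z) = _
  have h : τ.tau (n := a.len) (X.map (lastDegen a).op (X.map f.op x)) = 1 :=
    τ.tau_map_lastDegen (n := a.len) _
  rw [snocMap_of_last f hf, ← map_comp_op, h]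
  exact ρ.one_act _

theorem tcp_face {n : ℕ} (x : X _⦋n + 1⦌) (z : Z _⦋n + 1⦌) (i : Fin (n + 1)) :
    (tcp τ ρ).δ i.castSucc (x, z) = (X.δ i.castSucc x, Z.δ i.castSucc z) :=
  tcp_map_of_last τ ρ (SimplexCategory.δ i.castSucc)
    (Fin.succAbove_of_le_castSucc i.castSucc (Fin.last n)
        (Fin.castSucc_le_castSucc_iff.2 (Fin.le_last i))) x z

theorem tcp_face_last {n : ℕ} (x : X _⦋n + 1⦌) (z : Z _⦋n + 1⦌) :
    (tcp τ ρ).δ (Fin.last (n + 1)) (x, z) =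
      (X.δ (Fin.last (n + 1)) x, ρ.act (τ.tau x) (Z.δ (Fin.last (n + 1)) z)) := by
  refine Prod.ext rfl ?_
  change ρ.act (a := op ⦋n⦌) (τ.tau (n := n) (X.map (snocMap (lastFace ⦋n⦌)).op x)) _ = _
  rw [snocMap_lastFace, op_id, X.map_id]
  rfl

theorem tcp_degen {n : ℕ} (x : X _⦋n⦌) (z : Z _⦋n⦌) (i : Fin (n + 1)) :
    (tcp τ ρ).σ i (x, z) = (X.σ i x, Z.σ i z) :=
  tcp_map_of_last τ ρ (SimplexCategory.σ i) Fin.predAbove_right_last x z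

end TCP

/-- The action of `GX` on `Z` induced by a twisting function `X → Γ` and an action of `Γ` on `Z`. -/
def kanAct {X : SSet.{u}} {Γ : SimplicialObject GrpCat.{w}} {Z : SSet.{v}}
    (τ : TwistingFunction X Γ) (ρ : SimplicialAction Γ Z) {m : ℕ}
    (g : KanGroup X ⦋m⦌) (z : Z _⦋m⦌) : Z _⦋m⦌ :=
  ρ.act (a := op ⦋m⦌) (τ.toHom g) z

/-- The principal object `X ×_τ GX`. -/
abbrev principal (X : SSet.{u}) : SSet.{u} :=
  tcp (universalTwisting X) (selfAction (kanG X))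

/-! ### Shuffles -/

/-- A word `x_m … x_1` in `p` letters `a` and `m - p` letters `b` is encoded by the set of positions
of one of the letters; `stepMap A` is the monotone map `[m] → [p]` that increases by `1` exactly at
the positions in `A`. If `A` is the set of positions of the letter `a` (resp. `b`), the
operator of `stepMap A` is the iterated degeneracy indexed by the positions of `b` (resp. `a`). -/
def stepMap {p m : ℕ} (A : Finset (Fin m)) (hA : A.card = p) : ⦋m⦌ ⟶ ⦋p⦌ :=
  SimplexCategory.Hom.mk
    ⟨fun k => ⟨(A.filter fun i => i.val < k.val).card,
        Nat.lt_succ_of_le ((Finset.card_filter_le _ _).trans hA.le)⟩,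
      fun _ _ hkl => Finset.card_le_card fun i hi => by
        rw [Finset.mem_filter] at hi ⊢
        exact ⟨hi.1, lt_of_lt_of_le hi.2 hkl⟩⟩

/-- The sign of a shuffle with set `A` of positions of the letter `a`: the number of pairs of
positions `i < j` that carry `b` and `a`, respectively. -/
def shuffleSign {m : ℕ} (A : Finset (Fin m)) : ℤ :=
  (-1) ^ (Finset.univ.filter fun ij : Fin m × Fin m => ij.1 < ij.2 ∧ ij.1 ∉ A ∧ ij.2 ∈ A).card

theorem card_compl_of_add {p q m : ℕ} (h : p + q = m) {A : Finset (Fin m)} (hA : A.card = p) :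
    Aᶜ.card = q := by
  rw [Finset.card_compl, Fintype.card_fin]; omega

variable (R : Type r) [CommRing R]

/-- The shuffle product `∇ (s ⊗ t)` of `s ∈ S_p` and `t ∈ T_q` in `R(S × T)_m`, `m = p + q`. -/
def shuffle {S : SSet.{u}} {T : SSet.{v}} {p q m : ℕ} (h : p + q = m)
    (s : S _⦋p⦌) (t : T _⦋q⦌) : S _⦋m⦌ × T _⦋m⦌ →₀ R :=
  ∑ A : {A : Finset (Fin m) // A.card = p},
    Finsupp.single (S.map (stepMap A.1 A.2).op s,
      T.map (stepMap A.1ᶜ (card_compl_of_add h A.2)).op t) (shuffleSign A.1 : R)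

/-! ### The twisting cochain `φ` -/

/-- `α_{rj} = max ({0, …, r} ∩ {0, g_1, …, g_j})`, where the permutation `g` of `{1, …, n}` is
encoded by a permutation of `Fin n`, shifted by one. -/
def alpha {n : ℕ} (g : Equiv.Perm (Fin n)) (r j : ℕ) : ℕ :=
  (Finset.range (r + 1) ∩
    insert 0 ((Finset.univ.filter fun i : Fin n => i.val < j).image fun i => (g i).val + 1)).sup id

theorem alpha_le {n : ℕ} (g : Equiv.Perm (Fin n)) (r j : ℕ) : alpha g r j ≤ r :=
  Finset.sup_le fun k hk => by
    rw [Finset.mem_inter, Finset.mem_range] at hk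
    exact Nat.le_of_lt_succ hk.1

theorem alpha_mono {n : ℕ} (g : Equiv.Perm (Fin n)) (r : ℕ) {j k : ℕ} (h : j ≤ k) :
    alpha g r j ≤ alpha g r k :=
  Finset.sup_mono (Finset.inter_subset_inter_left (Finset.insert_subset_insert _
    (Finset.image_subset_image (Finset.monotone_filter_right _ fun _ _ hi => lt_of_lt_of_le hi h))))

/-- The map `[0, α_{r1}, …, α_{rn}, r + 1] : [n+1] → [n+1]`, `0 ≤ r ≤ n`. -/
def rowMap {n : ℕ} (g : Equiv.Perm (Fin n)) (r : Fin (n + 1)) : ⦋n + 1⦌ ⟶ ⦋n + 1⦌ :=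
  SimplexCategory.Hom.mk
    ⟨fun k => if k.val ≤ n then ⟨alpha g r k, by have := alpha_le g r k; simp; omega⟩ else r.succ, by
      intro j k hjk
      have hjk' : j.val ≤ k.val := hjk
      have h1 := alpha_mono g r hjk'
      have h2 := alpha_le g r j
      by_cases hk : k.val ≤ n
      · have hj : j.val ≤ n := hjk'.trans hk
        simpa [hk, hj, Fin.le_def] using h1
      · by_cases hj : j.val ≤ n
        · simp [hk, hj, Fin.le_def]; omega
        · simp [hk, hj]⟩

/-- `Tcx(g) = ∏_{r=0}^n τ [0, α_{r1}, …, α_{rn}, r + 1]_x ∈ G_n X` for `x ∈ X_{n+1}`. -/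
def tcGroup {X : SSet.{u}} {n : ℕ} (x : X _⦋n + 1⦌) (g : Equiv.Perm (Fin n)) : KanGroup X ⦋n⦌ :=
  (List.ofFn fun r : Fin (n + 1) => kanTau (a := ⦋n⦌) (X.map (rowMap g r).op x)).prod

/-- `φ x ∈ RG_n X` for `x ∈ X_{n+1}`. On `X_0` the map `φ` is zero. -/
def phi {X : SSet.{u}} {n : ℕ} (x : X _⦋n + 1⦌) : KanGroup X ⦋n⦌ →₀ R :=
  (∑ g : Equiv.Perm (Fin n), Finsupp.single (tcGroup x g) ((Equiv.Perm.sign g : ℤ) : R)) -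
    if n = 0 then Finsupp.single 1 1 else 0

/-! ### The twisted tensor product -/

/-- The basis of `(RX ⊗ RZ)_m` that consists of the `x ⊗ z` with `x ∈ X_p`, `z ∈ Z_q` and
`p + q = m`. -/
structure TensorBasis (X : SSet.{u}) (Z : SSet.{v}) (m : ℕ) : Type (max u v) where
  /-- The dimension of `x`. -/
  p : ℕ
  /-- The dimension of `z`. -/
  q : ℕ
  add_eq : p + q = m
  /-- The first factor. -/
  x : X _⦋p⦌
  /-- The second factor. -/
  z : Z _⦋q⦌

/-- `(RX ⊗ RZ)_m`, the free `R`-module on the `x ⊗ z`. -/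
abbrev Tensor (X : SSet.{u}) (Z : SSet.{v}) (m : ℕ) : Type (max u v r) :=
  TensorBasis X Z m →₀ R

/-- The basis as a disjoint union over the pairs of dimensions. -/
def tensorBasisEquiv (X : SSet.{u}) (Z : SSet.{v}) (m : ℕ) :
    TensorBasis X Z m ≃
      Σ pq : {pq : ℕ × ℕ // pq.1 + pq.2 = m}, X _⦋pq.1.1⦌ × Z _⦋pq.1.2⦌ where
  toFun e := ⟨⟨(e.p, e.q), e.add_eq⟩, (e.x, e.z)⟩
  invFun e := ⟨e.1.1.1, e.1.1.2, e.1.2, e.2.1, e.2.2⟩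
  left_inv _ := rfl
  right_inv _ := rfl

/-- `(RX ⊗ RZ)_m` is the direct sum of the tensor products `RX_p ⊗ RZ_q` with `p + q = m`. -/
def tensorEquiv (X : SSet.{u}) (Z : SSet.{v}) (m : ℕ) :
    Tensor R X Z m ≃ₗ[R] DirectSum {pq : ℕ × ℕ // pq.1 + pq.2 = m} fun pq =>
      TensorProduct R (X _⦋pq.1.1⦌ →₀ R) (Z _⦋pq.1.2⦌ →₀ R) :=
  (Finsupp.domLCongr (tensorBasisEquiv X Z m)).trans <|
    (sigmaFinsuppLequivDFinsupp R).trans <|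
      DFinsupp.mapRange.linearEquiv fun pq =>
        (finsuppTensorFinsupp' R (X _⦋pq.1.1⦌) (Z _⦋pq.1.2⦌)).symm

section

variable {X : SSet.{u}} {Γ : SimplicialObject GrpCat.{w}} {Z : SSet.{v}}
variable (τ : TwistingFunction X Γ) (ρ : SimplicialAction Γ Z)

/-- The product `RGX ⊗ RZ → RZ` of `c ∈ RG_k X` and `z ∈ Z_q`, `m = k + q`. -/
def gDot {k q m : ℕ} (h : k + q = m) (c : KanGroup X ⦋k⦌ →₀ R) (z : Z _⦋q⦌) : Z _⦋m⦌ →₀ R :=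
  c.sum fun g a => a • Finsupp.mapDomain
    (fun s : KanGroup X ⦋m⦌ × Z _⦋m⦌ => kanAct τ ρ s.1 s.2)
    (shuffle R (S := underlying (kanG X)) h g z)

/-- The product `R(X ×_τ GX) ⊗ RZ → R(X ×_τ Z)` of `c ∈ R(X ×_τ GX)_p` and `z ∈ Z_q`,
`m = p + q`. -/
def principalDot {p q m : ℕ} (h : p + q = m) (c : (principal X) _⦋p⦌ →₀ R) (z : Z _⦋q⦌) :
    (tcp τ ρ) _⦋m⦌ →₀ R :=
  c.sum fun s a => a • Finsupp.mapDomain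
    (fun t : (X _⦋m⦌ × KanGroup X ⦋m⦌) × Z _⦋m⦌ => (t.1.1, kanAct τ ρ t.1.2 t.2))
    (shuffle R (S := principal X) h s z)

/-- `dx ⊗ z`. -/
def dLeft {m : ℕ} (p q : ℕ) (h : p + q = m + 1) (x : X _⦋p⦌) (z : Z _⦋q⦌) : Tensor R X Z m :=
  match p, h, x with
  | 0, _, _ => 0
  | p + 1, h, x => ∑ i : Fin (p + 2),
      Finsupp.single ⟨p, q, by omega, X.δ i x, z⟩ ((-1) ^ i.val)

/-- `(-1)^p x ⊗ dz`. -/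
def dRight {m : ℕ} (p q : ℕ) (h : p + q = m + 1) (x : X _⦋p⦌) (z : Z _⦋q⦌) : Tensor R X Z m :=
  match q, h, z with
  | 0, _, _ => 0
  | q + 1, h, z => ∑ j : Fin (q + 2),
      Finsupp.single ⟨p, q, by omega, x, Z.δ j z⟩ ((-1) ^ p * (-1) ^ j.val)

/-- `d_φ (x ⊗ z) = (-1)^n ∑_{i=0}^{n} [0, …, i]_x ⊗ (φ [i, …, n]_x · z)`, `n = dim x`; the summand
with `i = n` vanishes, since `φ` is zero on `X_0`. -/
def dPhi {m : ℕ} (p q : ℕ) (h : p + q = m + 1) (x : X _⦋p⦌) (z : Z _⦋q⦌) : Tensor R X Z m :=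
  match p, h, x with
  | 0, _, _ => 0
  | p + 1, h, x => (-1 : R) ^ (p + 1) • ∑ i : Fin (p + 1),
      Finsupp.mapDomain
        (fun z' : Z _⦋p - i.val + q⦌ => (⟨i.val, p - i.val + q, by omega,
          X.map (frontMap (n := p + 1) (by omega)).op x, z'⟩ : TensorBasis X Z m))
        (gDot R τ ρ rfl
          (phi R (X.map (backMap (i := i.val) (k := p - i.val + 1) (n := p + 1)
            (by omega)).op x)) z)

/-- The differential `d = d_⊗ + d_φ` of the twisted tensor product `RX ⊗_φ RZ`. -/
def tensorDiff (m : ℕ) : Tensor R X Z (m + 1) →ₗ[R] Tensor R X Z m :=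
  Finsupp.linearCombination R fun e =>
    dLeft R e.p e.q e.add_eq e.x e.z + dRight R e.p e.q e.add_eq e.x e.z +
      dPhi R τ ρ e.p e.q e.add_eq e.x e.z

/-! ### The map `Ψ` -/

/-- The map `R(Δ^n ×_τ GΔ^n) → R(X ×_τ GX)` induced by `x ∈ X_n`, which evaluates the symbols
`I` and `τ J` at `I_x` and `τ (J_x)`. -/
def evalAt {n m : ℕ} (x : X _⦋n⦌) :
    ((principal Δ[n]) _⦋m⦌ →₀ R) →ₗ[R] ((principal X) _⦋m⦌ →₀ R) :=
  Finsupp.lmapDomain R R fun s : Δ[n] _⦋m⦌ × KanGroup Δ[n] ⦋m⦌ =>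
    ((SSet.yonedaEquiv.symm x).app _ s.1, kanFunctor (SSet.yonedaEquiv.symm x) ⦋m⦌ s.2)

/-- The map `Ψ (x ⊗ z) = Ψ (x ⊗ 1) · z` that belongs to the values `Ψ (x ⊗ 1)` obtained by
evaluating given universal elements `U n ∈ R(Δ^n ×_τ GΔ^n)_n` at `x ∈ X_n`. -/
def psiOf (U : ∀ n : ℕ, (principal (Δ[n] : SSet.{u})) _⦋n⦌ →₀ R) (m : ℕ) :
    Tensor R X Z m →ₗ[R] ((tcp τ ρ) _⦋m⦌ →₀ R) :=
  Finsupp.linearCombination R fun e =>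
    principalDot R τ ρ e.add_eq (evalAt R e.x (U e.p)) e.z

end

/-- The derived simplex of a simplex of `Δ^n`. -/
def derivedSimplex {n m : ℕ} (J : (Δ[n] : SSet.{u}) _⦋m⦌) : (Δ[n] : SSet.{u}) _⦋m + 1⦌ :=
  SSet.stdSimplex.objEquiv.symm (derivedMap (SSet.stdSimplex.objEquiv J))

theorem derivedMap_lastDegen {a b : SimplexCategory} (f : a ⟶ b) :
    derivedMap (lastDegen a ≫ f) = lastDegen ⦋a.len + 1⦌ ≫ derivedMap f :=
  hom_ext_apply fun k => by
    induction k using Fin.lastCases with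
    | last =>
      rw [comp_apply', lastDegen_last, ← Fin.succ_last, ← Fin.succ_last, derivedMap_succ,
        derivedMap_succ, comp_apply', Fin.succ_last, lastDegen_last]
    | cast k =>
      rw [comp_apply', lastDegen_castSucc]
      induction k using Fin.cases with
      | zero => rfl
      | succ k =>
        rw [← Fin.succ_castSucc, derivedMap_succ, derivedMap_succ, comp_apply', lastDegen_castSucc]

theorem derivedSimplex_lastDegen {n m : ℕ} (y : (Δ[n] : SSet.{u}) _⦋m⦌) :
    derivedSimplex (Δ[n].map (lastDegen ⦋m⦌).op y) =
      Δ[n].map (lastDegen ⦋m + 1⦌).op (derivedSimplex y) :=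
  congrArg SSet.stdSimplex.objEquiv.symm (derivedMap_lastDegen (SSet.stdSimplex.objEquiv y))

/-- The homomorphism `τ J₁^{k₁} ⋯ τ J_l^{k_l} ↦ τ J̃₁^{k₁} ⋯ τ J̃_l^{k_l}`. -/
def derivedWord (n m : ℕ) :
    KanGroup (Δ[n] : SSet.{u}) ⦋m⦌ →* KanGroup (Δ[n] : SSet.{u}) ⦋m + 1⦌ :=
  kanLift (a := ⦋m⦌) (fun J => kanTau (a := ⦋m + 1⦌) (derivedSimplex J)) (fun y => by
    rw [derivedSimplex_lastDegen, kanTau_lastDegen])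

/-- The operator `D (I, τ J₁^{k₁} ⋯ τ J_l^{k_l}) = (Ĩ, τ J̃₁^{k₁} ⋯ τ J̃_l^{k_l})`. It acts on symbols
for faces `I, J₁, …` of an `n`-simplex, that is, on `R(Δ^n ×_τ GΔ^n)`. -/
def derivedOp (n m : ℕ) :
    ((principal (Δ[n] : SSet.{u})) _⦋m⦌ →₀ R) →ₗ[R]
      ((principal (Δ[n] : SSet.{u})) _⦋m + 1⦌ →₀ R) :=
  Finsupp.lmapDomain R R
    fun s : (Δ[n] : SSet.{u}) _⦋m⦌ × KanGroup (Δ[n] : SSet.{u}) ⦋m⦌ =>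
      (derivedSimplex s.1, derivedWord n m s.2)

/-- The fundamental simplex of `Δ^n`. -/
def fundamental (n : ℕ) : (Δ[n] : SSet.{u}) _⦋n⦌ := SSet.stdSimplex.objEquiv.symm (𝟙 _)

/-- `x ⊗ 1` in `(RX ⊗ RGX)_n`, where `x ∈ X_n` and `1 ∈ G_0 X`. -/
def tensorOne {X : SSet.{u}} {n : ℕ} (x : X _⦋n⦌) : Tensor R X (underlying (kanG X)) n :=
  Finsupp.single ⟨n, 0, rfl, x, (1 : KanGroup X ⦋0⦌)⟩ 1

/-- The value of `Ψ (x ⊗ 1)` for the fundamental simplex `x` of `Δ^n`, as an expression in the faces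
of `x`: it is `(x, 1)` for `n = 0`, and `D Ψ (d (x ⊗ 1))` for `n ≥ 1`. -/
def psiUniv (n : ℕ) : (principal (Δ[n] : SSet.{u})) _⦋n⦌ →₀ R :=
  match n with
  | 0 => Finsupp.single (fundamental 0, (1 : KanGroup (Δ[0] : SSet.{u}) ⦋0⦌)) 1
  | n + 1 => derivedOp R (n + 1) n
      (psiOf R (universalTwisting Δ[n + 1]) (selfAction (kanG Δ[n + 1]))
        (fun k => if _h : k < n + 1 then psiUniv k else 0) n
        (tensorDiff R (universalTwisting Δ[n + 1]) (selfAction (kanG Δ[n + 1])) n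
          (tensorOne R (fundamental (n + 1)))))

section

variable {X : SSet.{u}} {Γ : SimplicialObject GrpCat.{w}} {Z : SSet.{v}}

/-- `Ψ (x ⊗ 1) ∈ R(X ×_τ GX)`. -/
def psiOne {n : ℕ} (x : X _⦋n⦌) : (principal X) _⦋n⦌ →₀ R := evalAt R x (psiUniv R n)

/-- The element `(x, 1_n)` of `R(X ×_τ GX)_n`, for `x ∈ X_n`. -/
def pairOne {n : ℕ} (x : X _⦋n⦌) : (principal X) _⦋n⦌ →₀ R :=
  Finsupp.single (x, (1 : KanGroup X ⦋n⦌)) 1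

variable (τ : TwistingFunction X Γ) (ρ : SimplicialAction Γ Z)

/-- The map `Ψ : RX ⊗_φ RZ → R(X ×_τ Z)`, `Ψ (x ⊗ z) = Ψ (x ⊗ 1) · z`. -/
def psi (m : ℕ) : Tensor R X Z m →ₗ[R] ((tcp τ ρ) _⦋m⦌ →₀ R) := psiOf R τ ρ (psiUniv R) m

/-! ### Chain complexes -/

/-- The free simplicial `R`-module on a simplicial set. -/
def freeSimplicial (S : SSet.{v}) : SimplicialObject (ModuleCat.{max v r} R) where
  obj a := ModuleCat.of R (S.obj a →₀ R)
  map f := ModuleCat.ofHom (Finsupp.lmapDomain R R (S.map f))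
  map_id a := by
    rw [S.map_id]
    exact congrArg ModuleCat.ofHom (Finsupp.lmapDomain_id R R)
  map_comp f g := by
    rw [S.map_comp]
    exact congrArg ModuleCat.ofHom (Finsupp.lmapDomain_comp R R (S.map f) (S.map g))

/-- The chain complex `RS` of a simplicial set `S`, with `d = ∑ (-1)^i d_i`. -/
abbrev chains (S : SSet.{v}) : ChainComplex (ModuleCat.{max v r} R) ℕ :=
  (AlgebraicTopology.alternatingFaceMapComplex _).obj (freeSimplicial R S)

/-- The chain complex `RX ⊗_φ RZ`. -/
abbrev twistedTensor
    (hd : ∀ m, tensorDiff R τ ρ m ∘ₗ tensorDiff R τ ρ (m + 1) = 0) :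
    ChainComplex (ModuleCat.{max u v r} R) ℕ :=
  ChainComplex.of (fun m => ModuleCat.of R (Tensor R X Z m))
    (fun m => ModuleCat.ofHom (tensorDiff R τ ρ m))
    (fun m => by rw [← ModuleCat.ofHom_comp, hd]; rfl)

/-- `Ψ` in degree `m`, as a morphism of `R`-modules. -/
abbrev psiHom (m : ℕ) :
    ModuleCat.of R (Tensor R X Z m) ⟶ (chains R (tcp τ ρ)).X m :=
  ModuleCat.ofHom (psi R τ ρ m)

/-- `F_k R(X ×_τ GX)_n` is spanned by the `(x, g)` with `x` in the `k`-skeleton of `X`. The first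
argument is `k + 1`, so that `skeletalFiltration R X 0 n` is `F_{-1} = 0`. -/
def skeletalFiltration (X : SSet.{u}) (k n : ℕ) : Submodule R ((principal X) _⦋n⦌ →₀ R) :=
  Submodule.span R {c | ∃ (x : X _⦋n⦌) (g : KanGroup X ⦋n⦌),
    x ∈ (X.skeleton k).obj (op ⦋n⦌) ∧ c = Finsupp.single (x, g) 1}

end

end Brown

end

universe u' v' w'

noncomputable section

namespace Brown

/-! ### Ungraded simplices and chains -/

/-! The proof rests on two principles. The first is naturality: shuffle products, `φ` and `Ψ (x ⊗
1)` are natural in the simplices that they depend on, so their properties need only be checked on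
the fundamental simplices of standard simplices. The second is a recursion by cones: on a standard
simplex the operator `D J = [0, J]` satisfies `d_0 D = 1` and `d_{i+1} D = D d_i`, hence `∂ D = 1 -
D ∂` in positive degrees (`bd_cD`). This operator is carried over to products, to `GX` and to `X ×_τ
GX`. A simplex that starts at the vertex `0` is "based", that is, `D x = s_0 x`; in positive
dimension it is then `D (d_0 x)`. Every construction below is written as `D` of something smaller,
and its boundary follows by induction.

For shuffles the recursion is `x ∇ y = D (d_0 x ∇ y ± x ∇ d_0 y)` (`nab_based`); it yields the
Leibniz rule and associativity. For the cochain, permutations are sorted by their first letter `i`.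
In rows `r < i` this letter is invisible, while the rows `r ≥ i` begin with `[0, i, …]`, and `Tcx`
splits into a part over `[0, …, i]` and a part over `[i, …, n]`. This gives `φ x = -D (∑ (-1)^i φ[0,
…, i]_x · φ[i, …, n]_x)` in dimensions at least two (`phiT_based'`), and from it the twisting
cochain equation `bd_phiT`. There the summand `-1` of `φ` on edges is dropped; it cancels exactly
against the last face `d_n x ⊗ z` of `dx ⊗ z`. The identity `d² = 0` (`td_td`) is then bookkeeping
with faces.

a) Since `Ψ (x ⊗ 1) = D Ψ (d (x ⊗ 1))`, one has `∂ Ψ (x ⊗ 1) = Ψ (d (x ⊗ 1)) - D ∂ Ψ (d (x ⊗ 1))`,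
and the last term vanishes by induction and `d² = 0` (`bd_Pone`). Dimension one, where the formula
for `∂ D` is not available, is computed by hand. The Leibniz rule and associativity extend the
result from `x ⊗ 1` to `x ⊗ z` (`bd_Psi_te`).

b) All terms of `Ψ (d (x ⊗ 1))` other than the leading term `(d_0 x, 1)` of `Ψ (d_0 x ⊗ 1)` lie over
faces of `x` that miss a vertex other than `0`. After applying `D` they still miss it, and the
leading term becomes `(x, 1)` (`Pone_sub_lead`).

c) The mapping cone of `Ψ` is natural in the base, together with the twisting function on it. A
filtration by skeleta, together with the uniqueness of the nondegenerate simplex under a given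
simplex, reduces acyclicity to the bases `Δ[n]` (`Lab.acyclic`). There `D` contracts the twisted
tensor product to the fibre over `0`, and a trivialization contracts the twisted product to the same
fibre (`coneD_acyclic_stdSimplex`). A chain map with acyclic cone between complexes of projective
modules starting in degree `0` is a homotopy equivalence (`exists_homotopyEquiv`).

Most of the work takes place in ungraded modules spanned by the simplices of all dimensions, which
avoids transport along equations between dimensions. The graded modules embed by `gr` and `grT`, and
`part` and `partT` lead back. -/

/-- The monotone map `k ↦ min (f k) n`. -/
def toHom (m n : ℕ) (f : ℕ →o ℕ) : ⦋m⦌ ⟶ ⦋n⦌ :=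
  SimplexCategory.Hom.mk ⟨fun k => ⟨min (f k.val) n, by simp⟩,
    fun _ _ h => min_le_min_right n (f.monotone h)⟩

theorem toHom_apply (m n : ℕ) (f : ℕ →o ℕ) (k : Fin (m + 1)) :
    ((toHom m n f).toOrderHom k).val = min (f k.val) n := rfl

theorem hom_ext_val {m n : ℕ} {f g : ⦋m⦌ ⟶ ⦋n⦌}
    (h : ∀ k : Fin (m + 1), (f.toOrderHom k).val = (g.toOrderHom k).val) : f = g :=
  hom_ext_apply fun k => Fin.ext (h k)

theorem toHom_congr {m n : ℕ} {f g : ℕ →o ℕ} (h : ∀ k ≤ m, min (f k) n = min (g k) n) :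
    toHom m n f = toHom m n g :=
  hom_ext_val fun k => h k.val (Nat.le_of_lt_succ k.isLt)

/-- The bound says that the truncation at `m` never affects the values of `g` on `[l]`. It reappears
in every lemma on iterated faces. -/
theorem toHom_comp {l m n : ℕ} (g f : ℕ →o ℕ) (h : g l ≤ m) :
    toHom l m g ≫ toHom m n f = toHom l n (f.comp g) :=
  hom_ext_val fun k => by
    have h1 : g k.val ≤ m := (g.monotone (Nat.le_of_lt_succ k.isLt)).trans h
    change min (f (min (g k.val) m)) n = min (f (g k.val)) n
    rw [min_eq_left h1]

theorem toHom_of_le_id {n : ℕ} {f : ℕ →o ℕ} (h : ∀ k ≤ n, f k = k) : toHom n n f = 𝟙 _ :=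
  hom_ext_val fun k => by
    have hk := Nat.le_of_lt_succ k.isLt
    change min (f k.val) n = k.val
    rw [h _ hk, min_eq_left hk]

/-- A self-map of `ℕ` that extends a given monotone map. -/
def homFun {m n : ℕ} (f : ⦋m⦌ ⟶ ⦋n⦌) : ℕ →o ℕ :=
  ⟨fun k => (f.toOrderHom (⟨min k m, by simp⟩ : Fin (m + 1))).val, fun _ _ h =>
    f.toOrderHom.monotone (Fin.mk_le_mk.2 (min_le_min_right m h))⟩

theorem homFun_apply {m n : ℕ} (f : ⦋m⦌ ⟶ ⦋n⦌) (k : Fin (m + 1)) :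
    homFun f k.val = (f.toOrderHom k).val := by
  have : (⟨min k.val m, by simp⟩ : Fin (m + 1)) = k :=
    Fin.ext (min_eq_left (Nat.le_of_lt_succ k.isLt))
  exact congrArg (fun i => (f.toOrderHom i).val) this

theorem toHom_homFun {m n : ℕ} (f : ⦋m⦌ ⟶ ⦋n⦌) : toHom m n (homFun f) = f :=
  hom_ext_val fun k => by rw [toHom_apply, homFun_apply, min_eq_left (Nat.le_of_lt_succ (Fin.isLt _))]

/-- The map that omits the value `i`. -/
def del (i : ℕ) : ℕ →o ℕ := ⟨fun k => if k < i then k else k + 1, fun a b h => by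
  dsimp only; split_ifs <;> omega⟩

/-- The map that takes the value `i` twice. -/
def dup (i : ℕ) : ℕ →o ℕ := ⟨fun k => if k ≤ i then k else k - 1, fun a b h => by
  dsimp only; split_ifs <;> omega⟩

/-- The translation `k ↦ i + k`. -/
def iv (i : ℕ) : ℕ →o ℕ := ⟨fun k => i + k, fun a b h => by dsimp only; omega⟩

/-- The map `0 ↦ 0`, `k + 1 ↦ f k + 1`. -/
def sh (f : ℕ →o ℕ) : ℕ →o ℕ := ⟨fun k => if k = 0 then 0 else f (k - 1) + 1, fun a b h => by
  have := f.monotone (show a - 1 ≤ b - 1 by omega)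
  dsimp only; split_ifs <;> omega⟩

/-- The map `0 ↦ 0`, `k + 1 ↦ f k`. -/
def cz (f : ℕ →o ℕ) : ℕ →o ℕ := ⟨fun k => if k = 0 then 0 else f (k - 1), fun a b h => by
  have := f.monotone (show a - 1 ≤ b - 1 by omega)
  dsimp only; split_ifs <;> omega⟩

theorem del_apply (i k : ℕ) : del i k = if k < i then k else k + 1 := rfl
theorem dup_apply (i k : ℕ) : dup i k = if k ≤ i then k else k - 1 := rfl
theorem iv_apply (i k : ℕ) : iv i k = i + k := rfl
theorem sh_apply (f : ℕ →o ℕ) (k : ℕ) : sh f k = if k = 0 then 0 else f (k - 1) + 1 := rfl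
theorem cz_apply (f : ℕ →o ℕ) (k : ℕ) : cz f k = if k = 0 then 0 else f (k - 1) := rfl
theorem sh_zero (f : ℕ →o ℕ) : sh f 0 = 0 := rfl
theorem sh_succ (f : ℕ →o ℕ) (k : ℕ) : sh f (k + 1) = f k + 1 := rfl
theorem cz_zero (f : ℕ →o ℕ) : cz f 0 = 0 := rfl
theorem cz_succ (f : ℕ →o ℕ) (k : ℕ) : cz f (k + 1) = f k := rfl
theorem ocomp_apply (f g : ℕ →o ℕ) (k : ℕ) : f.comp g k = f (g k) := rfl
theorem oid_apply (k : ℕ) : (OrderHom.id : ℕ →o ℕ) k = k := rfl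

theorem sh_del (i : ℕ) : sh (del i) = del (i + 1) := by
  ext k
  rw [sh_apply, del_apply, del_apply]
  split_ifs <;> omega

theorem del_zero : del 0 = iv 1 := by
  ext k
  rw [iv_apply, del_apply]
  split_ifs <;> omega

theorem δ_eq_toHom {n : ℕ} (i : Fin (n + 2)) : SimplexCategory.δ i = toHom n (n + 1) (del i.val) :=
  hom_ext_val fun k => by
    change (i.succAbove k).val = min (if k.val < i.val then k.val else k.val + 1) (n + 1)
    have := k.isLt
    rw [Fin.succAbove]
    simp only [Fin.lt_def, Fin.val_castSucc]
    split_ifs <;> simp; omega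

theorem σ_eq_toHom {n : ℕ} (i : Fin (n + 1)) : SimplexCategory.σ i = toHom (n + 1) n (dup i.val) :=
  hom_ext_val fun k => by
    change (i.predAbove k).val = min (if k.val ≤ i.val then k.val else k.val - 1) n
    have := k.isLt
    have := i.isLt
    rw [Fin.predAbove]
    simp only [Fin.lt_def, Fin.val_castSucc]
    split_ifs <;> simp <;> omega

/-- The simplices of all dimensions. -/
abbrev Smp (S : SSet.{u}) : Type u := Σ n : ℕ, S _⦋n⦌

/-- The simplex `[f 0, …, f m]_x`, for a map `f` truncated at the dimension of `x`. -/
def sbv {S : SSet.{u}} (x : Smp S) (m : ℕ) (f : ℕ →o ℕ) : S _⦋m⦌ := S.map (toHom m x.1 f).op x.2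

/-- The simplex `[f 0, …, f m]_x` together with its dimension. -/
def sb {S : SSet.{u}} (x : Smp S) (m : ℕ) (f : ℕ →o ℕ) : Smp S := ⟨m, sbv x m f⟩

section

variable {S : SSet.{u}}

theorem sb_fst (x : Smp S) (m : ℕ) (f : ℕ →o ℕ) : (sb x m f).1 = m := rfl

theorem sbv_congr (x : Smp S) {m : ℕ} {f g : ℕ →o ℕ}
    (h : ∀ k ≤ m, min (f k) x.1 = min (g k) x.1) : sbv x m f = sbv x m g := by
  rw [sbv, sbv, toHom_congr h]

theorem sb_congr_min (x : Smp S) {m m' : ℕ} {f g : ℕ →o ℕ} (hm : m = m')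
    (h : ∀ k ≤ m, min (f k) x.1 = min (g k) x.1) : sb x m f = sb x m' g := by
  subst hm
  rw [sb, sb, sbv_congr x h]

theorem sb_congr (x : Smp S) {m m' : ℕ} {f g : ℕ →o ℕ} (hm : m = m')
    (h : ∀ k ≤ m, f k = g k) : sb x m f = sb x m' g :=
  sb_congr_min x hm fun k hk => by rw [h k hk]

theorem sbv_sb (x : Smp S) {m l : ℕ} (f g : ℕ →o ℕ) (h : g l ≤ m) :
    sbv (sb x m f) l g = sbv x l (f.comp g) := by
  rw [sbv, sbv, sb]
  dsimp only
  rw [sbv, map_comp_op, toHom_comp g f h]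

theorem sb_sb (x : Smp S) {m l : ℕ} (f g : ℕ →o ℕ) (h : g l ≤ m) :
    sb (sb x m f) l g = sb x l (f.comp g) := by
  rw [sb, sbv_sb x f g h, sb]

theorem sbv_id (x : Smp S) {f : ℕ →o ℕ} (h : ∀ k ≤ x.1, f k = k) : sbv x x.1 f = x.2 := by
  rw [sbv, toHom_of_le_id h, op_id, S.map_id]
  rfl

theorem sb_id (x : Smp S) {m : ℕ} {f : ℕ →o ℕ} (hm : m = x.1) (h : ∀ k ≤ m, f k = k) :
    sb x m f = x := by
  subst hm
  rw [sb, sbv_id x h]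

theorem sb_eq_map {m n : ℕ} (x : S _⦋n⦌) (f : ⦋m⦌ ⟶ ⦋n⦌) :
    sb ⟨n, x⟩ m (homFun f) = ⟨m, S.map f.op x⟩ := by
  rw [sb, sbv]
  dsimp only
  rw [toHom_homFun]

theorem mk_map_eq {m n : ℕ} (x : S _⦋n⦌) (f : ⦋m⦌ ⟶ ⦋n⦌) (g : ℕ →o ℕ)
    (h : ∀ k : Fin (m + 1), (f.toOrderHom k).val = min (g k.val) n) :
    (⟨m, S.map f.op x⟩ : Smp S) = sb ⟨n, x⟩ m g := by
  rw [sb, sbv]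
  have : f = toHom m n g := hom_ext_val h
  rw [this]

end

/-! ### Natural families of maps -/

/-- A natural family of maps between simplicial sets in possibly different universes. -/
structure SMap (S : SSet.{u}) (T : SSet.{v}) where
  /-- The maps in the family. -/
  app : ∀ n : ℕ, S _⦋n⦌ → T _⦋n⦌
  nat : ∀ {m n : ℕ} (f : ⦋m⦌ ⟶ ⦋n⦌) (s : S _⦋n⦌), app m (S.map f.op s) = T.map f.op (app n s)

/-- The action on simplices of all dimensions. -/
def SMap.fn {S : SSet.{u}} {T : SSet.{v}} (F : SMap S T) (x : Smp S) : Smp T := ⟨x.1, F.app x.1 x.2⟩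

theorem SMap.fn_sb {S : SSet.{u}} {T : SSet.{v}} (F : SMap S T) (x : Smp S) (m : ℕ) (f : ℕ →o ℕ) :
    F.fn (sb x m f) = sb (F.fn x) m f := by
  rw [SMap.fn, sb, sb]
  dsimp only
  rw [sbv, F.nat]
  rfl

/-- The product of simplicial sets in possibly different universes. -/
def prodS (S : SSet.{u}) (T : SSet.{v}) : SSet.{max u v} where
  obj a := S.obj a × T.obj a
  map f := TypeCat.ofHom fun s => (S.map f s.1, T.map f s.2)
  map_id a := by
    ext s
    · exact ConcreteCategory.congr_hom (S.map_id a) s.1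
    · exact ConcreteCategory.congr_hom (T.map_id a) s.2
  map_comp f g := by
    ext s
    · exact ConcreteCategory.congr_hom (S.map_comp f g) s.1
    · exact ConcreteCategory.congr_hom (T.map_comp f g) s.2

/-- A pair of simplices, as a simplex of the product. -/
def pairS {S : SSet.{u}} {T : SSet.{v}} {n : ℕ} (s : S _⦋n⦌) (t : T _⦋n⦌) : (prodS S T) _⦋n⦌ := (s, t)

/-- The simplex `([f 0, …, f m]_x, [g 0, …, g m]_y)`. -/
def pr {S : SSet.{u}} {T : SSet.{v}} (x : Smp S) (y : Smp T) (m : ℕ) (f g : ℕ →o ℕ) :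
    Smp (prodS S T) := ⟨m, pairS (sbv x m f) (sbv y m g)⟩

theorem sb_pr {S : SSet.{u}} {T : SSet.{v}} (x : Smp S) (y : Smp T) {m l : ℕ} (f g h : ℕ →o ℕ)
    (hl : h l ≤ m) : sb (pr x y m f g) l h = pr x y l (f.comp h) (g.comp h) := by
  rw [pr, pr, ← sbv_sb x f h hl, ← sbv_sb y g h hl]
  rfl

theorem pr_congr {S : SSet.{u}} {T : SSet.{v}} {x x' : Smp S} {y y' : Smp T} {m m' : ℕ}
    {f f' g g' : ℕ →o ℕ} (hm : m = m') (h1 : sb x m f = sb x' m f') (h2 : sb y m g = sb y' m g') :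
    pr x y m f g = pr x' y' m' f' g' := by
  subst hm
  rw [sb, sb] at h1 h2
  rw [pr, pr, eq_of_heq (Sigma.mk.inj h1).2, eq_of_heq (Sigma.mk.inj h2).2]

/-- The product of natural families. -/
def SMap.prod {S : SSet.{u}} {S' : SSet.{u'}} {T : SSet.{v}} {T' : SSet.{v'}} (F : SMap S S') (G : SMap T T') :
    SMap (prodS S T) (prodS S' T') where
  app n s := (F.app n s.1, G.app n s.2)
  nat f s := Prod.ext (F.nat f s.1) (G.nat f s.2)

theorem SMap.prod_pr {S : SSet.{u}} {S' : SSet.{u'}} {T : SSet.{v}} {T' : SSet.{v'}} (F : SMap S S') (G : SMap T T')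
    (x : Smp S) (y : Smp T) (m : ℕ) (f g : ℕ →o ℕ) :
    (F.prod G).fn (pr x y m f g) = pr (F.fn x) (G.fn y) m f g := by
  have h1 : F.app m (sbv x m f) = sbv (F.fn x) m f := F.nat _ _
  have h2 : G.app m (sbv y m g) = sbv (G.fn y) m g := G.nat _ _
  rw [pr, pr, ← h1, ← h2]
  rfl

/-- The natural family that belongs to a morphism of simplicial sets. -/
def SMap.ofHom {S T : SSet.{u}} (F : S ⟶ T) : SMap S T where
  app _ s := F.app _ s
  nat f s := ConcreteCategory.congr_hom (F.naturality f.op) s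

/-- The classifying map of a simplex. -/
def SMap.cls {S : SSet.{u}} {n : ℕ} (x : S _⦋n⦌) : SMap Δ[n] S :=
  SMap.ofHom (SSet.yonedaEquiv.symm x)

theorem SMap.cls_app {S : SSet.{u}} {n m : ℕ} (x : S _⦋n⦌) (f : ⦋m⦌ ⟶ ⦋n⦌) :
    (SMap.cls x).app m (SSet.stdSimplex.objEquiv.symm f) = S.map f.op x := rfl

theorem SMap.cls_fundamental {S : SSet.{u}} {n : ℕ} (x : S _⦋n⦌) :
    (SMap.cls x).fn ⟨n, fundamental n⟩ = ⟨n, x⟩ := by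
  rw [SMap.fn, fundamental]
  dsimp only
  rw [SMap.cls_app, op_id, S.map_id]
  rfl

/-! ### Cones -/

/-- A cone operator on a simplicial set, which adds a vertex at the beginning of a simplex. -/
structure Cone (S : SSet.{u}) where
  /-- The operator. -/
  D : ∀ n : ℕ, S _⦋n⦌ → S _⦋n + 1⦌
  zero : ∀ {n : ℕ} (s : S _⦋n⦌), S.map (toHom n (n + 1) (iv 1)).op (D n s) = s
  nat : ∀ {m n : ℕ} (f : ℕ →o ℕ) (s : S _⦋n⦌),
    S.map (toHom (m + 1) (n + 1) (sh f)).op (D n s) = D m (S.map (toHom m n f).op s)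

namespace Cone

variable {S : SSet.{u}} {T : SSet.{v}} (C : Cone S)

/-- The cone operator on simplices of all dimensions. -/
def fn (x : Smp S) : Smp S := ⟨x.1 + 1, C.D x.1 x.2⟩

theorem sb_zero (x : Smp S) : sb (C.fn x) x.1 (del 0) = x := by
  rw [del_zero]
  exact Sigma.ext rfl (heq_of_eq (C.zero x.2))

theorem sb_sh (x : Smp S) (m : ℕ) (f : ℕ →o ℕ) :
    sb (C.fn x) (m + 1) (sh f) = C.fn (sb x m f) :=
  Sigma.ext rfl (heq_of_eq (C.nat f x.2))

/-- A simplex that starts at the vertex of the cone. -/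
def Based (x : Smp S) : Prop := C.fn x = sb x (x.1 + 1) (dup 0)

variable {C}

/-- Naturality describes the cone over `[f 0, …, f m]_x` as the operator of `sh f` on `D x`. For
based `x` one has `D x = s_0 x`, and `dup 0` after `sh f` is `cz f`. -/
theorem Based.sb_cz {x : Smp S} (hx : C.Based x) (m : ℕ) (f : ℕ →o ℕ) :
    sb x (m + 1) (cz f) = C.fn (sb x m f) := by
  -- Truncating `f` beforehand does not change the simplex, but supplies the bound required by
  -- `sb_sb`.
  let f' : ℕ →o ℕ := ⟨fun k => min (f k) x.1, fun a b h => min_le_min_right _ (f.monotone h)⟩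
  have hf' : ∀ k, f' k = min (f k) x.1 := fun _ => rfl
  have h1 : Brown.sb (C.fn x) (m + 1) (sh f) = Brown.sb (C.fn x) (m + 1) (sh f') :=
    sb_congr_min _ rfl fun k hk => by
      change min (sh f k) (x.1 + 1) = min (sh f' k) (x.1 + 1)
      rw [sh_apply, sh_apply, hf']
      split_ifs <;> omega
  rw [← C.sb_sh, h1, hx, sb_sb]
  · refine sb_congr_min _ rfl fun k hk => ?_
    rw [cz_apply, ocomp_apply, dup_apply, sh_apply, hf']
    split_ifs <;> omega
  · rw [sh_apply, hf']
    split_ifs <;> omega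

theorem Based.sb {x : Smp S} (hx : C.Based x) (m : ℕ) {f : ℕ →o ℕ} (hf : f 0 = 0) :
    C.Based (sb x m f) := by
  rw [Based, ← hx.sb_cz, sb_sb x f (dup 0)]
  · refine sb_congr _ rfl fun k hk => ?_
    rw [cz_apply, ocomp_apply, dup_apply]
    rcases k with _ | k
    · simp [hf]
    · simp
  · rw [sb_fst, dup_apply]; split_ifs <;> omega

/-- This allows recursion along `d_0`: a based simplex is recovered from the face opposite to the
cone vertex. -/
theorem Based.fn_face {x : Smp S} (hx : C.Based x) (h : 1 ≤ x.1) :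
    C.fn (Brown.sb x (x.1 - 1) (del 0)) = x := by
  rw [← hx.sb_cz]
  refine sb_id _ (by omega) fun k hk => ?_
  rw [cz_apply, del_apply]
  split_ifs <;> omega

variable (C)

/-- The product of two cones. -/
def prod (C' : Cone T) : Cone (prodS S T) where
  D n s := (C.D n s.1, C'.D n s.2)
  zero s := Prod.ext (C.zero s.1) (C'.zero s.2)
  nat f s := Prod.ext (C.nat f s.1) (C'.nat f s.2)

theorem prod_fn_pr (C' : Cone T) (x : Smp S) (y : Smp T) (m : ℕ) (f g : ℕ →o ℕ) :
    (C.prod C').fn (pr x y m f g) = pr (C.fn x) (C'.fn y) (m + 1) (sh f) (sh g) := by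
  have h1 : sbv (C.fn x) (m + 1) (sh f) = C.D m (sbv x m f) := C.nat _ _
  have h2 : sbv (C'.fn y) (m + 1) (sh g) = C'.D m (sbv y m g) := C'.nat _ _
  rw [pr, pr, h1, h2]
  rfl

theorem Based.pr_cz {C : Cone S} {C' : Cone T} {x : Smp S} {y : Smp T} (hx : C.Based x)
    (hy : C'.Based y) (m : ℕ) (f g : ℕ →o ℕ) :
    pr x y (m + 1) (cz f) (cz g) = (C.prod C').fn (pr x y m f g) := by
  rw [prod_fn_pr]
  exact pr_congr rfl (by rw [hx.sb_cz, C.sb_sh]) (by rw [hy.sb_cz, C'.sb_sh])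

theorem Based.pr {C : Cone S} {C' : Cone T} {x : Smp S} {y : Smp T} (hx : C.Based x)
    (hy : C'.Based y) (m : ℕ) {f g : ℕ →o ℕ} (hf : f 0 = 0) (hg : g 0 = 0) :
    (C.prod C').Based (pr x y m f g) := by
  rw [Based, ← hx.pr_cz hy, sb_pr]
  · refine pr_congr rfl (sb_congr _ rfl fun k hk => ?_) (sb_congr _ rfl fun k hk => ?_)
    all_goals
      rw [cz_apply, ocomp_apply, dup_apply]
      rcases k with _ | k
      · simp [hf, hg]
      · simp
  · change dup 0 (m + 1) ≤ m
    rw [dup_apply]; split_ifs <;> omega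

end Cone

/-! ### The standard simplex as a cone -/

theorem derivedSimplex_symm {n m : ℕ} (f : ⦋m⦌ ⟶ ⦋n⦌) :
    derivedSimplex (SSet.stdSimplex.objEquiv.symm f : (Δ[n] : SSet.{u}) _⦋m⦌) =
      SSet.stdSimplex.objEquiv.symm (derivedMap f) := rfl

theorem derivedMap_val {m n : ℕ} (f : ⦋m⦌ ⟶ ⦋n⦌) (k : Fin (m + 2)) :
    ((derivedMap f).toOrderHom k).val = cz (homFun f) k.val := by
  induction k using Fin.cases with
  | zero => rfl
  | succ k =>
    rw [Fin.val_succ, cz_succ, homFun_apply]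
    rfl

/-- The standard simplex is a cone with vertex `0`. -/
def stdCone (n : ℕ) : Cone (Δ[n] : SSet.{u}) where
  D _ J := derivedSimplex J
  zero {m} s := by
    obtain ⟨f, rfl⟩ := SSet.stdSimplex.objEquiv.symm.surjective s
    rw [derivedSimplex_symm, SSet.stdSimplex.map_objEquiv_symm]
    congr 1
    refine hom_ext_val fun k => ?_
    change ((derivedMap f).toOrderHom ((toHom m (m + 1) (iv 1)).toOrderHom k)).val = _
    have hk : k.val ≤ m := Nat.le_of_lt_succ k.isLt
    rw [derivedMap_val, toHom_apply, iv_apply, min_eq_left (by omega), add_comm,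
      cz_succ, homFun_apply]
  nat {m l} f s := by
    obtain ⟨g, rfl⟩ := SSet.stdSimplex.objEquiv.symm.surjective s
    rw [derivedSimplex_symm, SSet.stdSimplex.map_objEquiv_symm, SSet.stdSimplex.map_objEquiv_symm,
      derivedSimplex_symm]
    congr 1
    refine hom_ext_val fun k => ?_
    change ((derivedMap g).toOrderHom ((toHom (m + 1) (l + 1) (sh f)).toOrderHom k)).val = _
    rw [derivedMap_val, derivedMap_val, toHom_apply]
    induction k using Fin.cases with
    | zero => simp [sh_zero, cz_zero]
    | succ k =>
      rw [Fin.val_succ, sh_succ, cz_succ, homFun_apply, Nat.add_min_add_right, cz_succ,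
        ← toHom_apply m l f k, homFun_apply]
      rfl

/-- The entry point of the reduction to universal examples: every simplex is the image of a
fundamental one under `SMap.cls`, so a natural identity may be checked on a based simplex. -/
theorem stdCone_based (n : ℕ) : (stdCone.{u} n).Based ⟨n, fundamental n⟩ := by
  rw [Cone.Based]
  refine Sigma.ext rfl (heq_of_eq ?_)
  change derivedSimplex (fundamental n) = (Δ[n] : SSet.{u}).map (toHom (n + 1) n (dup 0)).op _
  rw [fundamental, derivedSimplex_symm, SSet.stdSimplex.map_objEquiv_symm]
  congr 1
  refine hom_ext_val fun k => ?_
  change _ = ((𝟙 ⦋n⦌ : ⦋n⦌ ⟶ ⦋n⦌).toOrderHom ((toHom (n + 1) n (dup 0)).toOrderHom k)).val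
  rw [derivedMap_val]
  change _ = ((toHom (n + 1) n (dup 0)).toOrderHom k).val
  rw [toHom_apply, dup_apply]
  induction k using Fin.cases with
  | zero => simp [cz_zero]
  | succ k =>
    rw [Fin.val_succ, cz_succ, homFun_apply]
    have hk : k.val ≤ n := Nat.le_of_lt_succ k.isLt
    change k.val = _
    split_ifs <;> omega

/-! ### Ungraded chains -/

section

variable (R : Type r) [CommRing R]

/-- The free module on the simplices of all dimensions. -/
abbrev Ch (S : SSet.{u}) : Type (max u r) := Smp S →₀ R

/-- The basis vector of a simplex. -/
def bs {α : Type u} (x : α) : α →₀ R := Finsupp.single x 1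

variable {R}

theorem lin_bs {α : Type u} {M : Type v} [AddCommGroup M] [Module R M] (f : α → M) (x : α) :
    Finsupp.linearCombination R f (bs R x) = f x := by
  rw [bs, Finsupp.linearCombination_single, one_smul]

theorem lin_ext {α : Type u} {M : Type v} [AddCommGroup M] [Module R M] {f g : (α →₀ R) →ₗ[R] M}
    (h : ∀ x, f (bs R x) = g (bs R x)) : f = g :=
  Finsupp.lhom_ext' fun x => LinearMap.ext_ring (h x)

theorem lin_ext_apply {α : Type u} {M : Type v} [AddCommGroup M] [Module R M]
    {f g : (α →₀ R) →ₗ[R] M} (h : ∀ x, f (bs R x) = g (bs R x)) (c : α →₀ R) : f c = g c := by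
  rw [lin_ext h]

variable (R)

/-- The bilinear extension of a function on bases. -/
def bil {α : Type u} {β : Type v} {M : Type w} [AddCommGroup M] [Module R M] (f : α → β → M) :
    (α →₀ R) →ₗ[R] (β →₀ R) →ₗ[R] M :=
  Finsupp.linearCombination R fun a => Finsupp.linearCombination R (f a)

variable {R}

theorem bil_bs {α : Type u} {β : Type v} {M : Type w} [AddCommGroup M] [Module R M] (f : α → β → M)
    (a : α) (b : β) : bil R f (bs R a) (bs R b) = f a b := by
  rw [bil, lin_bs, lin_bs]

variable (R)

/-- The boundary `∑ (-1)^i d_i`. -/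
def bd (S : SSet.{u}) : Ch R S →ₗ[R] Ch R S :=
  Finsupp.linearCombination R fun x => if x.1 = 0 then 0 else
    ∑ i ∈ Finset.range (x.1 + 1), (-1 : R) ^ i • bs R (sb x (x.1 - 1) (del i))

/-- The face operator `d_0`. -/
def dz (S : SSet.{u}) : Ch R S →ₗ[R] Ch R S :=
  Finsupp.linearCombination R fun x => if x.1 = 0 then 0 else bs R (sb x (x.1 - 1) (del 0))

/-- The alternating sum `∑ (-1)^i d_{i+1}` of the remaining face operators. -/
def dp (S : SSet.{u}) : Ch R S →ₗ[R] Ch R S :=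
  Finsupp.linearCombination R fun x => if x.1 = 0 then 0 else
    ∑ i ∈ Finset.range x.1, (-1 : R) ^ i • bs R (sb x (x.1 - 1) (del (i + 1)))

/-- The map on chains induced by a natural family. -/
def cm {S : SSet.{u}} {T : SSet.{v}} (F : SMap S T) : Ch R S →ₗ[R] Ch R T :=
  Finsupp.linearCombination R fun x => bs R (F.fn x)

/-- The cone operator on chains. -/
def cD {S : SSet.{u}} (C : Cone S) : Ch R S →ₗ[R] Ch R S :=
  Finsupp.linearCombination R fun x => bs R (C.fn x)

variable {R}

theorem bd_bs {S : SSet.{u}} (x : Smp S) : bd R S (bs R x) = if x.1 = 0 then 0 else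
    ∑ i ∈ Finset.range (x.1 + 1), (-1 : R) ^ i • bs R (sb x (x.1 - 1) (del i)) := lin_bs _ _

theorem bd_bs_zero {S : SSet.{u}} {x : Smp S} (h : x.1 = 0) : bd R S (bs R x) = 0 := by
  rw [bd_bs, if_pos h]

theorem bd_bs_pos {S : SSet.{u}} {x : Smp S} (h : x.1 ≠ 0) : bd R S (bs R x) =
    ∑ i ∈ Finset.range (x.1 + 1), (-1 : R) ^ i • bs R (sb x (x.1 - 1) (del i)) := by
  rw [bd_bs, if_neg h]

theorem dz_bs {S : SSet.{u}} (x : Smp S) :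
    dz R S (bs R x) = if x.1 = 0 then 0 else bs R (sb x (x.1 - 1) (del 0)) := lin_bs _ _

theorem dp_bs {S : SSet.{u}} (x : Smp S) : dp R S (bs R x) = if x.1 = 0 then 0 else
    ∑ i ∈ Finset.range x.1, (-1 : R) ^ i • bs R (sb x (x.1 - 1) (del (i + 1))) := lin_bs _ _

theorem cm_bs {S : SSet.{u}} {T : SSet.{v}} (F : SMap S T) (x : Smp S) :
    cm R F (bs R x) = bs R (F.fn x) := lin_bs _ _

theorem cD_bs {S : SSet.{u}} (C : Cone S) (x : Smp S) : cD R C (bs R x) = bs R (C.fn x) := lin_bs _ _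

/-- The two halves behave differently under a cone operator: `d_0` cancels it, while the remaining
faces pass through it and turn into the full boundary. -/
theorem bd_eq {S : SSet.{u}} (c : Ch R S) : bd R S c = dz R S c - dp R S c := by
  rw [← LinearMap.sub_apply]
  refine lin_ext_apply (fun x => ?_) c
  rw [LinearMap.sub_apply, bd_bs, dz_bs, dp_bs]
  split_ifs
  · rw [sub_zero]
  · rw [Finset.sum_range_succ', pow_zero, one_smul, add_comm, sub_eq_add_neg, ← Finset.sum_neg_distrib]
    congr 1
    refine Finset.sum_congr rfl fun i _ => ?_
    rw [pow_succ, mul_neg_one, neg_smul]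

theorem bd_cm {S : SSet.{u}} {T : SSet.{v}} (F : SMap S T) (c : Ch R S) :
    bd R T (cm R F c) = cm R F (bd R S c) := by
  rw [← LinearMap.comp_apply, ← LinearMap.comp_apply]
  refine lin_ext_apply (fun x => ?_) c
  rw [LinearMap.comp_apply, LinearMap.comp_apply, cm_bs, bd_bs, bd_bs]
  change (if x.1 = 0 then 0 else _) = _
  split_ifs
  · rw [map_zero]
  · rw [map_sum]
    refine Finset.sum_congr rfl fun i _ => ?_
    rw [map_smul, cm_bs, SMap.fn_sb]
    rfl

theorem del_le {i k n : ℕ} (h : k ≤ n) : del i k ≤ n + 1 := by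
  rw [del_apply]; split_ifs <;> omega

theorem bd_bd {S : SSet.{u}} (c : Ch R S) : bd R S (bd R S c) = 0 := by
  rw [← LinearMap.comp_apply, ← LinearMap.zero_apply (M₂ := Ch R S) (σ₁₂ := RingHom.id R) c]
  refine lin_ext_apply (fun x => ?_) c
  obtain ⟨n, x⟩ := x
  rw [LinearMap.comp_apply, LinearMap.zero_apply]
  rcases n with _ | _ | n
  · rw [bd_bs_zero rfl, map_zero]
  · rw [bd_bs_pos (by simp), map_sum]
    refine Finset.sum_eq_zero fun i _ => ?_
    rw [map_smul, bd_bs_zero rfl, smul_zero]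
  rw [bd_bs_pos (by simp), map_sum]
  have key : ∀ i ∈ Finset.range (n + 2 + 1),
      bd R S ((-1 : R) ^ i • bs R (sb (⟨n + 2, x⟩ : Smp S) (n + 2 - 1) (del i))) =
        ∑ j ∈ Finset.range (n + 2),
          (-1 : R) ^ (i + j) • bs R (sb (⟨n + 2, x⟩ : Smp S) n ((del i).comp (del j))) := by
    intro i _
    rw [map_smul, bd_bs_pos (by simp [sb_fst]), Finset.smul_sum]
    refine Finset.sum_congr rfl fun j _ => ?_
    rw [smul_smul, ← pow_add, sb_sb]
    · rfl
    · exact del_le le_rfl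
  rw [Finset.sum_congr rfl key, ← Finset.sum_product']
  -- The terms cancel in pairs by `d_j d_i = d_i d_{j+1}` for `i ≤ j`.
  refine Finset.sum_involution
    (fun p _ => if p.1 ≤ p.2 then (p.2 + 1, p.1) else (p.2, p.1 - 1)) ?_ ?_ ?_ ?_
  · rintro ⟨i, j⟩ h
    dsimp only
    split_ifs with hij
    · have : sb (⟨n + 2, x⟩ : Smp S) n ((del (j + 1)).comp (del i)) =
          sb (⟨n + 2, x⟩ : Smp S) n ((del i).comp (del j)) := by
        refine sb_congr _ rfl fun k hk => ?_
        simp only [ocomp_apply, del_apply]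
        split_ifs <;> omega
      dsimp only
      rw [this, ← add_smul, show j + 1 + i = i + j + 1 by omega, pow_succ, mul_neg_one,
        add_neg_cancel, zero_smul]
    · have : sb (⟨n + 2, x⟩ : Smp S) n ((del j).comp (del (i - 1))) =
          sb (⟨n + 2, x⟩ : Smp S) n ((del i).comp (del j)) := by
        refine sb_congr _ rfl fun k hk => ?_
        simp only [ocomp_apply, del_apply]
        split_ifs <;> omega
      dsimp only
      rw [this, ← add_smul, show i + j = j + (i - 1) + 1 by omega, pow_succ, mul_neg_one,
        neg_add_cancel, zero_smul]
  · rintro ⟨i, j⟩ h _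
    dsimp only
    split_ifs <;> simp <;> omega
  · rintro ⟨i, j⟩ h
    simp only [Finset.mem_product, Finset.mem_range] at h ⊢
    split_ifs <;> simp <;> omega
  · rintro ⟨i, j⟩ h
    simp only [Finset.mem_product, Finset.mem_range] at h
    dsimp only
    split_ifs <;> simp <;> omega

theorem dz_cD {S : SSet.{u}} (C : Cone S) (c : Ch R S) : dz R S (cD R C c) = c := by
  rw [← LinearMap.comp_apply]
  refine (lin_ext_apply (g := LinearMap.id) (fun x => ?_) c)
  rw [LinearMap.comp_apply, cD_bs, dz_bs, if_neg (by simp [Cone.fn])]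
  exact congrArg (bs R) (C.sb_zero x)

/-- Chains without component in dimension `0`. -/
theorem dp_cD_bs {S : SSet.{u}} (C : Cone S) {x : Smp S} (hx : x.1 ≠ 0) :
    dp R S (cD R C (bs R x)) = cD R C (bd R S (bs R x)) := by
  rw [cD_bs, dp_bs, bd_bs_pos hx, if_neg (by simp [Cone.fn]), map_sum]
  refine Finset.sum_congr rfl fun i _ => ?_
  rw [map_smul, cD_bs, ← C.sb_sh, sh_del]
  congr 3
  change x.1 + 1 - 1 = _
  omega

theorem bd_cD_bs {S : SSet.{u}} (C : Cone S) {x : Smp S} (hx : x.1 ≠ 0) :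
    bd R S (cD R C (bs R x)) = bs R x - cD R C (bd R S (bs R x)) := by
  rw [bd_eq, dz_cD, dp_cD_bs C hx]

/-- The span of the simplices of dimension `n`. -/
def deg (R : Type r) [CommRing R] (S : SSet.{u}) (n : ℕ) : Submodule R (Ch R S) :=
  Submodule.span R {c | ∃ x : Smp S, x.1 = n ∧ c = bs R x}

theorem bs_mem_deg {S : SSet.{u}} {x : Smp S} {n : ℕ} (h : x.1 = n) : bs R x ∈ deg R S n :=
  Submodule.subset_span ⟨x, h, rfl⟩

theorem deg_ext {S : SSet.{u}} {n : ℕ} {M : Type v} [AddCommGroup M] [Module R M]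
    {f g : Ch R S →ₗ[R] M} (h : ∀ x : Smp S, x.1 = n → f (bs R x) = g (bs R x)) {c : Ch R S}
    (hc : c ∈ deg R S n) : f c = g c := by
  refine LinearMap.eqOn_span ?_ hc
  rintro _ ⟨x, hx, rfl⟩
  exact h x hx

theorem deg_map {S : SSet.{u}} {n : ℕ} {M : Type v} [AddCommGroup M] [Module R M]
    {f : Ch R S →ₗ[R] M} {N : Submodule R M} (h : ∀ x : Smp S, x.1 = n → f (bs R x) ∈ N) {c : Ch R S}
    (hc : c ∈ deg R S n) : f c ∈ N := by
  have : deg R S n ≤ N.comap f := by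
    refine Submodule.span_le.2 ?_
    rintro _ ⟨x, hx, rfl⟩
    exact h x hx
  exact this hc

/-- The cone operator is a contracting homotopy in positive degrees. In degree `0` a term `d_1 D x`
would remain, about which the cone axioms say nothing; this is why low dimensions are treated
separately below. -/
theorem bd_cD {S : SSet.{u}} (C : Cone S) {n : ℕ} {c : Ch R S} (hc : c ∈ deg R S (n + 1)) :
    bd R S (cD R C c) = c - cD R C (bd R S c) := by
  refine deg_ext (f := bd R S ∘ₗ cD R C) (g := LinearMap.id - cD R C ∘ₗ bd R S) (fun x hx => ?_) hc
  exact bd_cD_bs C (by omega)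

theorem bd_deg_zero {S : SSet.{u}} {c : Ch R S} (hc : c ∈ deg R S 0) : bd R S c = 0 :=
  deg_ext (f := bd R S) (g := 0) (fun _ hx => bd_bs_zero hx) hc

theorem cm_deg {S : SSet.{u}} {T : SSet.{v}} (F : SMap S T) {n : ℕ} {c : Ch R S}
    (hc : c ∈ deg R S n) : cm R F c ∈ deg R T n := by
  refine deg_map (fun x hx => ?_) hc
  rw [cm_bs]
  exact bs_mem_deg hx

end

/-! ### Signed sums over words -/

section

variable (R : Type r) [CommRing R]

/-- The sum over the words `w` of length `m` in the letters `true`, `false`, with `p` letters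
`true`, with the sign given by the number of pairs of a `false` before a `true`. -/
def W {M : Type v} [AddCommGroup M] [Module R M] (m p : ℕ) (F : List Bool → M) : M :=
  match m, p with
  | 0, 0 => F []
  | 0, _ + 1 => 0
  | m + 1, 0 => W m 0 fun w => F (false :: w)
  | m + 1, p + 1 => W m p (fun w => F (true :: w)) +
      (-1 : R) ^ (p + 1) • W m (p + 1) fun w => F (false :: w)

variable {R}
variable {M : Type v} [AddCommGroup M] [Module R M]

/-- A leading `false` stands before all `p` letters `true`, whence the sign; a leading `true`
creates no inversion. -/
theorem W_succ (m p : ℕ) (F : List Bool → M) :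
    W R (m + 1) p F = (if p = 0 then 0 else W R m (p - 1) fun w => F (true :: w)) +
      (-1 : R) ^ p • W R m p fun w => F (false :: w) := by
  rcases p with _ | p
  · simp [W]
  · simp [W]

theorem W_of_lt {m p : ℕ} (h : m < p) (F : List Bool → M) : W R m p F = 0 := by
  induction m generalizing p F with
  | zero =>
    obtain ⟨p, rfl⟩ : ∃ k, p = k + 1 := ⟨p - 1, by omega⟩
    rfl
  | succ m ih =>
    rw [W_succ, ih (by omega), if_neg (by omega), ih (by omega), smul_zero, add_zero]

theorem W_congr {m p : ℕ} {F G : List Bool → M}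
    (h : ∀ w : List Bool, w.length = m → w.count true = p → F w = G w) : W R m p F = W R m p G := by
  induction m generalizing p F G with
  | zero =>
    rcases p with _ | p
    · exact h [] rfl rfl
    · rfl
  | succ m ih =>
    rw [W_succ, W_succ]
    congr 1
    · rcases p with _ | p
      · rfl
      · rw [if_neg (by simp), if_neg (by simp)]
        exact ih fun w h1 h2 => h _ (by simp [h1]) (by simp [h2])
    · congr 1
      exact ih fun w h1 h2 => h _ (by simp [h1]) (by simp [h2])

theorem W_map {N : Type w} [AddCommGroup N] [Module R N] (φ : M →ₗ[R] N) (m p : ℕ)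
    (F : List Bool → M) : φ (W R m p F) = W R m p fun w => φ (F w) := by
  induction m generalizing p F with
  | zero =>
    rcases p with _ | p
    · rfl
    · exact map_zero φ
  | succ m ih =>
    rw [W_succ, W_succ, map_add, map_smul, ih]
    congr 1
    split_ifs
    · exact map_zero φ
    · exact ih _ _

/-- Compatibility with linear maps, applied to the two projections of `M × M` and to their sum. -/
theorem W_add (m p : ℕ) (F G : List Bool → M) :
    W R m p (fun w => F w + G w) = W R m p F + W R m p G := by
  have h1 := W_map (LinearMap.fst R M M) m p fun w => (F w, G w)
  have h2 := W_map (LinearMap.snd R M M) m p fun w => (F w, G w)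
  have h3 := W_map (LinearMap.fst R M M + LinearMap.snd R M M) m p fun w => (F w, G w)
  rw [LinearMap.add_apply, h1, h2] at h3
  exact h3.symm

theorem W_smul (m p : ℕ) (a : R) (F : List Bool → M) :
    W R m p (fun w => a • F w) = a • W R m p F :=
  (W_map (a • (LinearMap.id : M →ₗ[R] M)) m p F).symm

theorem W_zero (m p : ℕ) : W R m p (fun _ => (0 : M)) = 0 :=
  (W_map (0 : M →ₗ[R] M) m p fun _ => 0).symm

theorem W_sum {ι : Type w} (s : Finset ι) (m p : ℕ) (F : ι → List Bool → M) :
    W R m p (fun w => ∑ i ∈ s, F i w) = ∑ i ∈ s, W R m p (F i) := by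
  classical
  induction s using Finset.induction_on with
  | empty => simpa using W_zero m p
  | insert i s hi ih =>
    rw [Finset.sum_insert hi, ← ih, ← W_add]
    exact W_congr fun w _ _ => Finset.sum_insert hi

theorem W_mem {m p : ℕ} {F : List Bool → M} {N : Submodule R M}
    (h : ∀ w : List Bool, w.length = m → w.count true = p → F w ∈ N) : W R m p F ∈ N := by
  rw [← Submodule.Quotient.mk_eq_zero]
  change N.mkQ _ = 0
  rw [W_map, ← W_zero (R := R) m p]
  refine W_congr fun w h1 h2 => ?_
  exact (Submodule.Quotient.mk_eq_zero N).2 (h w h1 h2)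

theorem W_zero_right (m : ℕ) (F : List Bool → M) : W R m 0 F = F (List.replicate m false) := by
  induction m generalizing F with
  | zero => rfl
  | succ m ih => exact ih _

theorem W_self (m : ℕ) (F : List Bool → M) : W R m m F = F (List.replicate m true) := by
  induction m generalizing F with
  | zero => rfl
  | succ m ih =>
    rw [W_succ, if_neg (by simp), W_of_lt (Nat.lt_succ_self m), smul_zero, add_zero]
    exact ih _

/-- The number of letters `c` among the first `k` letters of a word. -/
def stp (c : Bool) (w : List Bool) : ℕ →o ℕ :=
  ⟨fun k => (w.take k).count c, fun _ _ h => (List.take_sublist_take_left h).count_le c⟩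

theorem stp_apply (c : Bool) (w : List Bool) (k : ℕ) : stp c w k = (w.take k).count c := rfl

theorem stp_zero (c : Bool) (w : List Bool) : stp c w 0 = 0 := rfl

theorem stp_cons_self (c : Bool) (w : List Bool) : stp c (c :: w) = sh (stp c w) := by
  ext k
  rcases k with _ | k
  · rfl
  · rw [sh_succ, stp_apply, stp_apply, List.take_succ_cons, List.count_cons_self]

theorem stp_cons_ne {c c' : Bool} (h : c' ≠ c) (w : List Bool) : stp c (c' :: w) = cz (stp c w) := by
  ext k
  rcases k with _ | k
  · rfl
  · rw [cz_succ, stp_apply, stp_apply, List.take_succ_cons, List.count_cons_of_ne h]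

theorem stp_replicate_self (c : Bool) (m k : ℕ) : stp c (List.replicate m c) k = min k m := by
  rw [stp_apply, List.take_replicate, List.count_replicate_self]

theorem stp_replicate_ne {c c' : Bool} (h : c' ≠ c) (m k : ℕ) :
    stp c (List.replicate m c') k = 0 := by
  rw [stp_apply, List.take_replicate, List.count_replicate]
  simp [h]

end

/-! ### The shuffle product -/

section

variable (R : Type r) [CommRing R]

/-- The shuffle product of ungraded chains. -/
def nab (S : SSet.{u}) (T : SSet.{v}) : Ch R S →ₗ[R] Ch R T →ₗ[R] Ch R (prodS S T) :=
  bil R fun x y => W R (x.1 + y.1) x.1 fun w =>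
    bs R (pr x y (x.1 + y.1) (stp true w) (stp false w))

variable {R}
variable {S : SSet.{u}} {T : SSet.{v}}

theorem nab_bs (x : Smp S) (y : Smp T) {m p : ℕ} (hm : m = x.1 + y.1) (hp : p = x.1) :
    nab R S T (bs R x) (bs R y) =
      W R m p fun w => bs R (pr x y m (stp true w) (stp false w)) := by
  subst hm hp
  rw [nab, bil_bs]

theorem nab_deg {p q : ℕ} {c : Ch R S} {c' : Ch R T} (hc : c ∈ deg R S p) (hc' : c' ∈ deg R T q) :
    nab R S T c c' ∈ deg R (prodS S T) (p + q) := by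
  refine deg_map (f := (nab R S T).flip c') (fun x hx => ?_) hc
  refine deg_map (f := nab R S T (bs R x)) (fun y hy => ?_) hc'
  rw [nab_bs x y (m := p + q) (by omega) rfl]
  exact W_mem fun w _ _ => bs_mem_deg rfl

theorem nab_cm {S' : SSet.{u'}} {T' : SSet.{v'}} (F : SMap S S') (G : SMap T T') (c : Ch R S)
    (c' : Ch R T) : nab R S' T' (cm R F c) (cm R G c') = cm R (F.prod G) (nab R S T c c') := by
  refine lin_ext_apply (f := (nab R S' T').flip (cm R G c') ∘ₗ cm R F)
    (g := cm R (F.prod G) ∘ₗ (nab R S T).flip c') (fun x => ?_) c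
  refine lin_ext_apply (f := nab R S' T' (cm R F (bs R x)) ∘ₗ cm R G)
    (g := cm R (F.prod G) ∘ₗ nab R S T (bs R x)) (fun y => ?_) c'
  rw [LinearMap.comp_apply, LinearMap.comp_apply, cm_bs, cm_bs, nab_bs _ _ rfl rfl,
    nab_bs _ _ rfl rfl, W_map]
  refine W_congr fun w _ _ => ?_
  rw [cm_bs, SMap.prod_pr]
  rfl

theorem nab_zero_left {x : Smp S} {y : Smp T} (hx : x.1 = 0) {m : ℕ} (hm : m = y.1) :
    nab R S T (bs R x) (bs R y) =
      bs R (pr x y m (stp true (List.replicate m false)) OrderHom.id) := by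
  rw [nab_bs x y (m := m) (by omega) hx.symm, W_zero_right]
  congr 1
  refine pr_congr rfl rfl (sb_congr _ rfl fun k hk => ?_)
  rw [stp_replicate_self, min_eq_left hk, oid_apply]

theorem nab_zero_right {x : Smp S} {y : Smp T} (hy : y.1 = 0) {m : ℕ} (hm : m = x.1) :
    nab R S T (bs R x) (bs R y) =
      bs R (pr x y m OrderHom.id (stp false (List.replicate m true))) := by
  rw [nab_bs x y (m := m) (by omega) hm, W_self]
  congr 1
  refine pr_congr rfl (sb_congr _ rfl fun k hk => ?_) rfl
  rw [stp_replicate_self, min_eq_left hk, oid_apply]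

/-- A shuffle is a lattice path. If its first step goes in the direction of `x`, then the rest is a
shuffle of `d_0 x` and `y`, and the path itself is the cone over this rest, because `x` and `y` are
based; likewise for `y`. The sign is the one in `W_succ`. -/
theorem nab_based {C : Cone S} {C' : Cone T} {x : Smp S} {y : Smp T} (hx : C.Based x)
    (hy : C'.Based y) (h : x.1 + y.1 ≠ 0) :
    nab R S T (bs R x) (bs R y) = cD R (C.prod C')
      (nab R S T (dz R S (bs R x)) (bs R y) +
        (-1 : R) ^ x.1 • nab R S T (bs R x) (dz R T (bs R y))) := by
  obtain ⟨m, hm⟩ : ∃ m, x.1 + y.1 = m + 1 := ⟨x.1 + y.1 - 1, by omega⟩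
  rw [nab_bs x y (m := m + 1) hm.symm rfl, W_succ, map_add, map_smul, dz_bs, dz_bs]
  congr 2
  · split_ifs with hp
    · rw [map_zero, LinearMap.zero_apply, map_zero]
    · rw [nab_bs _ _ (m := m) (p := x.1 - 1) (by rw [sb_fst]; omega) rfl, W_map]
      refine W_congr fun w _ _ => ?_
      rw [cD_bs, Cone.prod_fn_pr, hx.fn_face (by omega)]
      congr 1
      refine pr_congr rfl (by rw [stp_cons_self]) ?_
      rw [C'.sb_sh, ← hy.sb_cz, stp_cons_ne (by simp)]
  · by_cases hq : y.1 = 0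
    · rw [if_pos hq, map_zero, map_zero, W_of_lt (by omega)]
    · rw [if_neg hq, nab_bs _ _ (m := m) (p := x.1) (by rw [sb_fst]; omega) rfl, W_map]
      refine W_congr fun w _ _ => ?_
      rw [cD_bs, Cone.prod_fn_pr, hy.fn_face (by omega)]
      congr 1
      refine pr_congr rfl ?_ (by rw [stp_cons_self])
      rw [C.sb_sh, ← hx.sb_cz, stp_cons_ne (by simp)]

theorem dz_nab_based {C : Cone S} {C' : Cone T} {x : Smp S} {y : Smp T} (hx : C.Based x)
    (hy : C'.Based y) : dz R (prodS S T) (nab R S T (bs R x) (bs R y)) =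
      nab R S T (dz R S (bs R x)) (bs R y) +
        (-1 : R) ^ x.1 • nab R S T (bs R x) (dz R T (bs R y)) := by
  by_cases h : x.1 + y.1 = 0
  · have h1 : dz R S (bs R x) = 0 := by rw [dz_bs, if_pos (by omega)]
    have h2 : dz R T (bs R y) = 0 := by rw [dz_bs, if_pos (by omega)]
    rw [h1, h2, map_zero, map_zero, LinearMap.zero_apply, smul_zero, add_zero,
      nab_zero_left (by omega) rfl, dz_bs, if_pos (by change y.1 = 0; omega)]
  · rw [nab_based hx hy h, dz_cD]

/-- The span of the based simplices of dimension `n`. -/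
def bsd (R : Type r) [CommRing R] (C : Cone S) (n : ℕ) : Submodule R (Ch R S) :=
  Submodule.span R {c | ∃ x : Smp S, x.1 = n ∧ C.Based x ∧ c = bs R x}

theorem bs_mem_bsd {C : Cone S} {x : Smp S} {n : ℕ} (h : x.1 = n) (hx : C.Based x) :
    bs R x ∈ bsd R C n := Submodule.subset_span ⟨x, h, hx, rfl⟩

theorem bsd_ext {C : Cone S} {n : ℕ} {M : Type w} [AddCommGroup M] [Module R M]
    {f g : Ch R S →ₗ[R] M} (h : ∀ x : Smp S, x.1 = n → C.Based x → f (bs R x) = g (bs R x))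
    {c : Ch R S} (hc : c ∈ bsd R C n) : f c = g c := by
  refine LinearMap.eqOn_span ?_ hc
  rintro _ ⟨x, hx, hb, rfl⟩
  exact h x hx hb

theorem nab_bsd {C : Cone S} {C' : Cone T} {p q : ℕ} {c : Ch R S} {c' : Ch R T}
    (hc : c ∈ bsd R C p) (hc' : c' ∈ bsd R C' q) (h : p + q ≠ 0) :
    nab R S T c c' = cD R (C.prod C') (nab R S T (dz R S c) c' +
        (-1 : R) ^ p • nab R S T c (dz R T c')) := by
  refine bsd_ext (f := (nab R S T).flip c') (g := cD R (C.prod C') ∘ₗ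
    ((nab R S T).flip c' ∘ₗ dz R S + (-1 : R) ^ p • (nab R S T).flip (dz R T c')))
    (fun x hx hb => ?_) hc
  refine bsd_ext (f := nab R S T (bs R x)) (g := cD R (C.prod C') ∘ₗ
    (nab R S T (dz R S (bs R x)) + (-1 : R) ^ p • nab R S T (bs R x) ∘ₗ dz R T))
    (fun y hy hb' => ?_) hc'
  subst hx hy
  exact nab_based hb hb' h

theorem nab_mem_bsd {C : Cone S} {C' : Cone T} {x : Smp S} {y : Smp T} (hx : C.Based x)
    (hy : C'.Based y) : nab R S T (bs R x) (bs R y) ∈ bsd R (C.prod C') (x.1 + y.1) := by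
  rw [nab_bs x y rfl rfl]
  exact W_mem fun w _ _ => bs_mem_bsd rfl (hx.pr hy _ (stp_zero _ _) (stp_zero _ _))

theorem dp_mem_bsd {C : Cone S} {x : Smp S} (hx : C.Based x) :
    dp R S (bs R x) ∈ bsd R C (x.1 - 1) := by
  rw [dp_bs]
  split_ifs
  · exact Submodule.zero_mem _
  · exact Submodule.sum_mem _ fun i _ => Submodule.smul_mem _ _
      (bs_mem_bsd rfl (hx.sb _ (by rw [del_apply]; simp)))

/-- This is the identity `d_0 d_{i+1} = d_i d_0`, summed over `i`. -/
theorem dz_dp {c : Ch R S} : dz R S (dp R S c) = bd R S (dz R S c) := by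
  rw [← LinearMap.comp_apply, ← LinearMap.comp_apply]
  refine lin_ext_apply (fun x => ?_) c
  obtain ⟨n, x⟩ := x
  rw [LinearMap.comp_apply, LinearMap.comp_apply, dp_bs, dz_bs]
  rcases n with _ | _ | n
  · simp
  · simp only [Nat.reduceAdd, one_ne_zero, if_false]
    rw [bd_bs_zero rfl, map_sum]
    refine Finset.sum_eq_zero fun i _ => ?_
    rw [map_smul, dz_bs, if_pos (by rw [sb_fst]), smul_zero]
  · rw [if_neg (by simp), if_neg (by simp), bd_bs_pos (by simp [sb_fst]), map_sum]
    refine Finset.sum_congr rfl fun i _ => ?_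
    rw [map_smul, dz_bs, if_neg (by simp [sb_fst]), sb_sb, sb_sb]
    · congr 2
      refine sb_congr _ rfl fun k hk => ?_
      simp only [ocomp_apply, del_apply]
      split_ifs <;> omega
    · exact del_le le_rfl
    · exact del_le le_rfl

theorem bd_nab_zero_left {x : Smp S} {y : Smp T} (hx : x.1 = 0) :
    bd R (prodS S T) (nab R S T (bs R x) (bs R y)) = nab R S T (bs R x) (bd R T (bs R y)) := by
  rw [nab_zero_left hx rfl]
  by_cases hy : y.1 = 0
  · rw [bd_bs_zero (S := prodS S T) hy, bd_bs_zero hy, map_zero]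
  · rw [bd_bs_pos (S := prodS S T) hy, bd_bs_pos hy, map_sum]
    refine Finset.sum_congr rfl fun i _ => ?_
    rw [map_smul, nab_zero_left hx rfl, sb_pr]
    · congr 2
      refine pr_congr rfl (sb_congr _ rfl fun k _ => ?_) ?_
      · rw [ocomp_apply, stp_replicate_ne (by simp), stp_replicate_ne (by simp)]
      · exact (sb_sb y (del i) OrderHom.id (m := y.1 - 1) (l := y.1 - 1) le_rfl).symm
    · change del i (y.1 - 1) ≤ y.1
      exact (del_le le_rfl).trans (by omega)

theorem bd_nab_zero_right {x : Smp S} {y : Smp T} (hy : y.1 = 0) :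
    bd R (prodS S T) (nab R S T (bs R x) (bs R y)) = nab R S T (bd R S (bs R x)) (bs R y) := by
  rw [nab_zero_right hy rfl]
  by_cases hx : x.1 = 0
  · rw [bd_bs_zero (S := prodS S T) hx, bd_bs_zero hx, map_zero, LinearMap.zero_apply]
  · rw [bd_bs_pos (S := prodS S T) hx, bd_bs_pos hx, map_sum, LinearMap.sum_apply]
    refine Finset.sum_congr rfl fun i _ => ?_
    rw [map_smul, LinearMap.smul_apply, nab_zero_right hy rfl, sb_pr]
    · congr 2
      refine pr_congr rfl ?_ (sb_congr _ rfl fun k _ => ?_)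
      · exact (sb_sb x (del i) OrderHom.id (m := x.1 - 1) (l := x.1 - 1) le_rfl).symm
      · rw [ocomp_apply, stp_replicate_ne (by simp), stp_replicate_ne (by simp)]
    · change del i (x.1 - 1) ≤ x.1
      exact (del_le le_rfl).trans (by omega)

/-- Apply `∂ D = 1 - D ∂` to the recursion for `x ∇ y`. The terms that involve `d_0` are covered by
the induction hypothesis, and the products with the other faces obey the same recursion, so both
sides become the same combination of `D`-terms. -/
theorem bd_nab_of_pos {C : Cone S} {C' : Cone T} {x : Smp S} {y : Smp T} (hx : C.Based x)
    (hy : C'.Based y) (hp : x.1 ≠ 0) (hq : y.1 ≠ 0)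
    (ih : ∀ (x' : Smp S) (y' : Smp T), x'.1 + y'.1 < x.1 + y.1 →
      bd R (prodS S T) (nab R S T (bs R x') (bs R y')) = nab R S T (bd R S (bs R x')) (bs R y') +
        (-1 : R) ^ x'.1 • nab R S T (bs R x') (bd R T (bs R y'))) :
    bd R (prodS S T) (nab R S T (bs R x) (bs R y)) = nab R S T (bd R S (bs R x)) (bs R y) +
        (-1 : R) ^ x.1 • nab R S T (bs R x) (bd R T (bs R y)) := by
  obtain ⟨p, hp'⟩ : ∃ p, x.1 = p + 1 := ⟨x.1 - 1, by omega⟩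
  obtain ⟨q, hq'⟩ : ∃ q, y.1 = q + 1 := ⟨y.1 - 1, by omega⟩
  have hdx : dz R S (bs R x) = bs R (sb x p (del 0)) := by
    rw [dz_bs, if_neg hp, hp']; rfl
  have hdy : dz R T (bs R y) = bs R (sb y q (del 0)) := by
    rw [dz_bs, if_neg hq, hq']; rfl
  have i1 := ih (sb x p (del 0)) y (by rw [sb_fst]; omega)
  have i2 := ih x (sb y q (del 0)) (by rw [sb_fst]; omega)
  rw [← hdx, sb_fst] at i1
  rw [← hdy, hp'] at i2
  have hdeg : nab R S T (dz R S (bs R x)) (bs R y) +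
      (-1 : R) ^ x.1 • nab R S T (bs R x) (dz R T (bs R y)) ∈ deg R (prodS S T) (p + q + 1) := by
    refine Submodule.add_mem _ ?_ (Submodule.smul_mem _ _ ?_)
    · rw [hdx]
      exact nab_deg (p := p) (q := q + 1) (bs_mem_deg rfl) (bs_mem_deg hq')
    · rw [hdy, show p + q + 1 = p + 1 + q by omega]
      exact nab_deg (bs_mem_deg hp') (bs_mem_deg rfl)
  -- The faces `d_i` with `i > 0` keep the initial vertex, so they are based and the recursion
  -- applies to them too.
  have m1 : dp R S (bs R x) ∈ bsd R C p := by simpa [hp'] using dp_mem_bsd (R := R) hx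
  have m2 : dp R T (bs R y) ∈ bsd R C' q := by simpa [hq'] using dp_mem_bsd (R := R) hy
  have r1 := nab_bsd m1 (bs_mem_bsd hq' hy) (by omega)
  have r2 := nab_bsd (bs_mem_bsd hp' hx) m2 (by omega)
  rw [nab_based hx hy (by omega), bd_cD _ hdeg, bd_eq (bs R x), bd_eq (bs R y), map_sub, map_sub,
    LinearMap.sub_apply, r1, r2, map_add (bd R _), map_smul (bd R _), i1, i2, hp',
    bd_eq (bs R x), bd_eq (bs R y), dz_dp, dz_dp]
  simp only [map_add, map_sub, map_smul, LinearMap.sub_apply, smul_add, smul_sub, smul_smul, pow_succ]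
  have hs : (-1 : R) ^ p * (-1 : R) ^ p = 1 := by
    rw [← mul_pow]; simp
  simp only [mul_neg, mul_one, neg_mul, neg_neg, hs, one_smul, neg_smul]
  abel

/-- The shuffle product is a chain map. -/
theorem bd_nab_bs (x : Smp S) (y : Smp T) :
    bd R (prodS S T) (nab R S T (bs R x) (bs R y)) = nab R S T (bd R S (bs R x)) (bs R y) +
        (-1 : R) ^ x.1 • nab R S T (bs R x) (bd R T (bs R y)) := by
  induction hn : x.1 + y.1 using Nat.strong_induction_on generalizing S T with
  | _ n ih =>
  by_cases hp : x.1 = 0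
  · rw [bd_nab_zero_left hp, bd_bs_zero hp, map_zero, LinearMap.zero_apply, zero_add, hp, pow_zero,
      one_smul]
  by_cases hq : y.1 = 0
  · rw [bd_nab_zero_right hq, bd_bs_zero hq, map_zero, smul_zero, add_zero]
  obtain ⟨p, x⟩ := x
  obtain ⟨q, y⟩ := y
  -- The identity is proved for the pair of fundamental simplices and then pushed forward along the
  -- classifying maps of `x` and `y`.
  have h := bd_nab_of_pos (R := R) (stdCone_based.{u} p) (stdCone_based.{v} q) hp hq
    fun x' y' h => ih _ (hn ▸ h) x' y' rfl
  have h' := congrArg (cm R ((SMap.cls x).prod (SMap.cls y))) h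
  rw [← bd_cm, map_add, map_smul, ← nab_cm, ← nab_cm, ← nab_cm, ← bd_cm, ← bd_cm, cm_bs, cm_bs,
    SMap.cls_fundamental, SMap.cls_fundamental] at h'
  exact h'

theorem bd_nab {p : ℕ} {c : Ch R S} (hc : c ∈ deg R S p) (c' : Ch R T) :
    bd R (prodS S T) (nab R S T c c') = nab R S T (bd R S c) c' +
        (-1 : R) ^ p • nab R S T c (bd R T c') := by
  refine deg_ext (f := bd R (prodS S T) ∘ₗ (nab R S T).flip c') (g := (nab R S T).flip c' ∘ₗ bd R S +
    (-1 : R) ^ p • (nab R S T).flip (bd R T c')) (fun x hx => ?_) hc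
  refine lin_ext_apply (f := bd R (prodS S T) ∘ₗ nab R S T (bs R x))
    (g := nab R S T (bd R S (bs R x)) + (-1 : R) ^ p • nab R S T (bs R x) ∘ₗ bd R T)
    (fun y => ?_) c'
  subst hx
  exact bd_nab_bs x y

end

section

variable {R : Type r} [CommRing R]

/-! ### Associativity of the shuffle product -/

theorem SMap.fn_bs_congr {S : SSet.{u}} {T : SSet.{v}} {F G : SMap S T} (h : ∀ x, F.fn x = G.fn x)
    (c : Ch R S) : cm R F c = cm R G c :=
  lin_ext_apply (fun x => by rw [cm_bs, cm_bs, h]) c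

/-- The composition of natural families. -/
def SMap.comp {S : SSet.{u}} {T : SSet.{v}} {U : SSet.{w}} (G : SMap T U) (F : SMap S T) :
    SMap S U where
  app n s := G.app n (F.app n s)
  nat f s := by rw [F.nat, G.nat]

/-- The identity family. -/
def SMap.id (S : SSet.{u}) : SMap S S where
  app _ s := s
  nat _ _ := rfl

theorem cm_cm {S : SSet.{u}} {T : SSet.{v}} {U : SSet.{w}} (G : SMap T U) (F : SMap S T)
    (c : Ch R S) : cm R G (cm R F c) = cm R (G.comp F) c := by
  rw [← LinearMap.comp_apply]
  refine lin_ext_apply (fun x => ?_) c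
  rw [LinearMap.comp_apply, cm_bs, cm_bs, cm_bs]
  rfl

theorem cm_id {S : SSet.{u}} (c : Ch R S) : cm R (SMap.id S) c = c :=
  lin_ext_apply (g := LinearMap.id) (fun x => by rw [cm_bs]; rfl) c

theorem cm_cD {S : SSet.{u}} {T : SSet.{v}} {C : Cone S} {C' : Cone T} {F : SMap S T}
    (h : ∀ n (s : S _⦋n⦌), F.app (n + 1) (C.D n s) = C'.D n (F.app n s)) (c : Ch R S) :
    cm R F (cD R C c) = cD R C' (cm R F c) := by
  rw [← LinearMap.comp_apply, ← LinearMap.comp_apply]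
  refine lin_ext_apply (fun x => ?_) c
  rw [LinearMap.comp_apply, LinearMap.comp_apply, cm_bs, cD_bs, cm_bs, cD_bs]
  exact congrArg (bs R) (Sigma.ext rfl (heq_of_eq (h _ _)))

theorem nab_zero_zero {S : SSet.{u}} {T : SSet.{v}} (x : S _⦋0⦌) (y : T _⦋0⦌) :
    nab R S T (bs R ⟨0, x⟩) (bs R ⟨0, y⟩) = bs R ⟨0, pairS x y⟩ := by
  rw [nab_zero_left rfl rfl]
  congr 1
  rw [pr, sbv_id, sbv_id]
  · exact fun _ _ => rfl
  · intro k hk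
    obtain rfl : k = 0 := Nat.le_zero.1 hk
    rfl

/-- The associativity isomorphism of products. -/
def assocS (S : SSet.{u}) (T : SSet.{v}) (V : SSet.{w}) :
    SMap (prodS (prodS S T) V) (prodS S (prodS T V)) where
  app _ s := (s.1.1, (s.1.2, s.2))
  nat _ _ := rfl

/-- Both bracketings satisfy the recursion `D (d_0 x · y · z ± x · d_0 y · z ± x · y · d_0 z)` for
the product cone, and they agree on triples of vertices. -/
theorem nab_assoc_based {S : SSet.{u}} {T : SSet.{v}} {V : SSet.{w}} {C : Cone S} {C' : Cone T}
    {C'' : Cone V} {x : Smp S} {y : Smp T} {z : Smp V} (hx : C.Based x) (hy : C'.Based y)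
    (hz : C''.Based z)
    (ih : ∀ (x' : Smp S) (y' : Smp T) (z' : Smp V), x'.1 + y'.1 + z'.1 < x.1 + y.1 + z.1 →
      cm R (assocS S T V) (nab R _ V (nab R S T (bs R x') (bs R y')) (bs R z')) =
        nab R S _ (bs R x') (nab R T V (bs R y') (bs R z'))) :
    cm R (assocS S T V) (nab R _ V (nab R S T (bs R x) (bs R y)) (bs R z)) =
        nab R S _ (bs R x) (nab R T V (bs R y) (bs R z)) := by
  by_cases h0 : x.1 + y.1 + z.1 = 0
  · obtain ⟨p, x⟩ := x
    obtain ⟨q, y⟩ := y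
    obtain ⟨l, z⟩ := z
    obtain rfl : p = 0 := by simp at h0; omega
    obtain rfl : q = 0 := by simp at h0; omega
    obtain rfl : l = 0 := by simp at h0; omega
    rw [nab_zero_zero, nab_zero_zero, nab_zero_zero, nab_zero_zero, cm_bs]
    rfl
  have i1 : cm R (assocS S T V) (nab R _ V (nab R S T (dz R S (bs R x)) (bs R y)) (bs R z)) =
      nab R S _ (dz R S (bs R x)) (nab R T V (bs R y) (bs R z)) := by
    rw [dz_bs]
    split_ifs with h
    · simp only [map_zero, LinearMap.zero_apply]
    · exact ih _ _ _ (by rw [sb_fst]; omega)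
  have i2 : cm R (assocS S T V) (nab R _ V (nab R S T (bs R x) (dz R T (bs R y))) (bs R z)) =
      nab R S _ (bs R x) (nab R T V (dz R T (bs R y)) (bs R z)) := by
    rw [dz_bs]
    split_ifs with h
    · simp only [map_zero, LinearMap.zero_apply]
    · exact ih _ _ _ (by rw [sb_fst]; omega)
  have i3 : cm R (assocS S T V) (nab R _ V (nab R S T (bs R x) (bs R y)) (dz R V (bs R z))) =
      nab R S _ (bs R x) (nab R T V (bs R y) (dz R V (bs R z))) := by
    rw [dz_bs]
    split_ifs with h
    · simp only [map_zero]
    · exact ih _ _ _ (by rw [sb_fst]; omega)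
  rw [nab_bsd (nab_mem_bsd hx hy) (bs_mem_bsd rfl hz) (by omega), dz_nab_based hx hy,
    nab_bsd (bs_mem_bsd rfl hx) (nab_mem_bsd hy hz) (by omega), dz_nab_based hy hz,
    cm_cD (C' := C.prod (C'.prod C'')) (fun _ _ => rfl)]
  congr 1
  simp only [map_add, map_smul, LinearMap.add_apply, LinearMap.smul_apply, i1, i2, i3, smul_add,
    smul_smul, pow_add]
  abel

theorem nab_assoc_bs {S : SSet.{u}} {T : SSet.{v}} {V : SSet.{w}} (x : Smp S) (y : Smp T)
    (z : Smp V) : cm R (assocS S T V) (nab R _ V (nab R S T (bs R x) (bs R y)) (bs R z)) =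
        nab R S _ (bs R x) (nab R T V (bs R y) (bs R z)) := by
  induction hn : x.1 + y.1 + z.1 using Nat.strong_induction_on generalizing S T V with
  | _ n ih =>
  obtain ⟨p, x⟩ := x
  obtain ⟨q, y⟩ := y
  obtain ⟨l, z⟩ := z
  have h := nab_assoc_based (R := R) (stdCone_based.{u} p) (stdCone_based.{v} q)
    (stdCone_based.{w} l) fun x' y' z' h => ih _ (hn ▸ h) x' y' z' rfl
  have h' := congrArg (cm R ((SMap.cls x).prod ((SMap.cls y).prod (SMap.cls z)))) h
  rw [← nab_cm, ← nab_cm, cm_bs, cm_bs, cm_bs, SMap.cls_fundamental, SMap.cls_fundamental,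
    SMap.cls_fundamental] at h'
  rw [← h', ← SMap.cls_fundamental x, ← SMap.cls_fundamental y, ← SMap.cls_fundamental z,
    ← cm_bs, ← cm_bs, ← cm_bs, nab_cm, nab_cm, cm_cm, cm_cm]
  exact SMap.fn_bs_congr (fun _ => rfl) _

/-- The shuffle product is associative. -/
theorem nab_assoc {S : SSet.{u}} {T : SSet.{v}} {V : SSet.{w}} (a : Ch R S) (b : Ch R T)
    (c : Ch R V) : cm R (assocS S T V) (nab R _ V (nab R S T a b) c) =
        nab R S _ a (nab R T V b c) := by
  refine lin_ext_apply (f := cm R (assocS S T V) ∘ₗ (nab R _ V).flip c ∘ₗ (nab R S T).flip b)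
    (g := (nab R S _).flip (nab R T V b c)) (fun x => ?_) a
  refine lin_ext_apply (f := cm R (assocS S T V) ∘ₗ (nab R _ V).flip c ∘ₗ nab R S T (bs R x))
    (g := nab R S _ (bs R x) ∘ₗ (nab R T V).flip c) (fun y => ?_) b
  exact lin_ext_apply (f := cm R (assocS S T V) ∘ₗ nab R _ V (nab R S T (bs R x) (bs R y)))
    (g := nab R S _ (bs R x) ∘ₗ nab R T V (bs R y)) (fun z => nab_assoc_bs x y z) c

theorem nab_cm_left {S : SSet.{u}} {S' : SSet.{u'}} {T : SSet.{v}} (F : SMap S S') (c : Ch R S) (c' : Ch R T) :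
    nab R S' T (cm R F c) c' = cm R (F.prod (SMap.id T)) (nab R S T c c') := by
  rw [← nab_cm, cm_id]

theorem nab_cm_right {S : SSet.{u}} {T : SSet.{v}} {T' : SSet.{v'}} (F : SMap T T') (c : Ch R S) (c' : Ch R T) :
    nab R S T' c (cm R F c') = cm R ((SMap.id S).prod F) (nab R S T c c') := by
  rw [← nab_cm, cm_id]

end

/-! ### Products induced by natural families -/

section

variable (R : Type r) [CommRing R]
variable {S : SSet.{u}} {T : SSet.{v}} {U : SSet.{w}}

/-- The bilinear map on chains induced by a natural family of maps `S_n × T_n → U_n`. -/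
def dot (μ : SMap (prodS S T) U) : Ch R S →ₗ[R] Ch R T →ₗ[R] Ch R U :=
  (nab R S T).compr₂ (cm R μ)

variable {R}

theorem dot_apply (μ : SMap (prodS S T) U) (c : Ch R S) (c' : Ch R T) :
    dot R μ c c' = cm R μ (nab R S T c c') := rfl

theorem bd_dot (μ : SMap (prodS S T) U) {p : ℕ} {c : Ch R S} (hc : c ∈ deg R S p) (c' : Ch R T) :
    bd R U (dot R μ c c') = dot R μ (bd R S c) c' + (-1 : R) ^ p • dot R μ c (bd R T c') := by
  rw [dot_apply, bd_cm, bd_nab hc, map_add, map_smul]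
  rfl

theorem dot_deg (μ : SMap (prodS S T) U) {p q : ℕ} {c : Ch R S} {c' : Ch R T}
    (hc : c ∈ deg R S p) (hc' : c' ∈ deg R T q) : dot R μ c c' ∈ deg R U (p + q) :=
  cm_deg μ (nab_deg hc hc')

/-- Products are natural. -/
theorem dot_cm {S' : SSet.{u'}} {T' : SSet.{v'}} {U' : SSet.{w'}} {μ : SMap (prodS S T) U}
    {μ' : SMap (prodS S' T') U'} {F : SMap S S'} {G : SMap T T'} {H : SMap U U'}
    (h : ∀ n (s : S _⦋n⦌) (t : T _⦋n⦌),
      μ'.app n (pairS (F.app n s) (G.app n t)) = H.app n (μ.app n (pairS s t)))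
    (c : Ch R S) (c' : Ch R T) :
    dot R μ' (cm R F c) (cm R G c') = cm R H (dot R μ c c') := by
  rw [dot_apply, dot_apply, nab_cm, cm_cm, cm_cm]
  refine SMap.fn_bs_congr (fun x => ?_) _
  obtain ⟨n, s, t⟩ := x
  exact Sigma.ext rfl (heq_of_eq (h n s t))

end

section

variable {R : Type r} [CommRing R]

/-- Associativity of products. -/
theorem dot_assoc {S : SSet.{u}} {T : SSet.{v}} {V : SSet.{w}} {A : SSet.{u'}} {B : SSet.{v'}}
    {E : SSet.{w'}}
    {μ : SMap (prodS S T) A} {μ' : SMap (prodS A V) E} {ν : SMap (prodS T V) B}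
    {ν' : SMap (prodS S B) E}
    (h : ∀ n (s : S _⦋n⦌) (t : T _⦋n⦌) (v : V _⦋n⦌),
      μ'.app n (pairS (μ.app n (pairS s t)) v) = ν'.app n (pairS s (ν.app n (pairS t v))))
    (a : Ch R S) (b : Ch R T) (c : Ch R V) :
    dot R μ' (dot R μ a b) c = dot R ν' a (dot R ν b c) := by
  rw [dot_apply, dot_apply, dot_apply, dot_apply, nab_cm_left, nab_cm_right, ← nab_assoc, cm_cm, cm_cm,
    cm_cm]
  refine SMap.fn_bs_congr (fun x => ?_) _
  obtain ⟨n, ⟨s, t⟩, v⟩ := x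
  exact Sigma.ext rfl (heq_of_eq (h n s t v))

end

/-! ### Comparison with sums over finite sets -/

section

variable (R : Type r) [CommRing R]

/-- The inclusion of the chains of dimension `m`. -/
def gr (S : SSet.{u}) (m : ℕ) : (S _⦋m⦌ →₀ R) →ₗ[R] Ch R S :=
  Finsupp.lmapDomain R R fun s => (⟨m, s⟩ : Smp S)

variable {R}

theorem gr_single (S : SSet.{u}) {m : ℕ} (s : S _⦋m⦌) (a : R) :
    gr R S m (Finsupp.single s a) = a • bs R ⟨m, s⟩ := by
  rw [gr, Finsupp.lmapDomain_apply, Finsupp.mapDomain_single, bs, Finsupp.smul_single_one]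

theorem gr_injective (S : SSet.{u}) (m : ℕ) : Function.Injective (gr R S m) :=
  Finsupp.mapDomain_injective fun _ _ h => eq_of_heq (Sigma.mk.inj h).2

/-- The word of length `m` with the letter `true` at the positions in `A`. -/
def wordOf {m : ℕ} (A : Finset (Fin m)) : List Bool := List.ofFn fun i => decide (i ∈ A)

/-- The new position `0` is outside the set, so it forms an inversion with every element. -/
theorem shuffleSign_map_succ {m : ℕ} (A : Finset (Fin m)) :
    shuffleSign (A.map (Fin.succEmb m)) = (-1) ^ A.card * shuffleSign A := by
  rw [shuffleSign, shuffleSign, ← pow_add]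
  congr 1
  rw [Finset.card_filter, Finset.card_filter, Fintype.sum_prod_type, Fintype.sum_prod_type,
    Fin.sum_univ_succ]
  simp only [Fin.sum_univ_succ, Fin.succ_lt_succ_iff, Finset.mem_map, Fin.coe_succEmb,
    Fin.succ_inj, exists_eq_right, Fin.succ_pos, Fin.not_lt_zero, Fin.succ_ne_zero, and_false,
    exists_false, not_false_iff, true_and, if_false, zero_add, lt_irrefl]
  congr 1
  rw [← Finset.card_filter, Finset.filter_univ_mem]

theorem shuffleSign_insert_zero {m : ℕ} (A : Finset (Fin m)) :
    shuffleSign (insert 0 (A.map (Fin.succEmb m))) = shuffleSign A := by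
  rw [shuffleSign, shuffleSign]
  congr 1
  rw [Finset.card_filter, Finset.card_filter, Fintype.sum_prod_type, Fintype.sum_prod_type,
    Fin.sum_univ_succ]
  simp only [Fin.sum_univ_succ, Fin.succ_lt_succ_iff, Finset.mem_insert, Finset.mem_map,
    Fin.coe_succEmb, Fin.succ_inj, exists_eq_right, Fin.not_lt_zero, Fin.succ_ne_zero,
    not_true_eq_false, false_or, true_or, and_false, false_and, if_false, zero_add,
    Finset.sum_const_zero]

theorem wordOf_map_succ {m : ℕ} (A : Finset (Fin m)) :
    wordOf (A.map (Fin.succEmb m)) = false :: wordOf A := by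
  rw [wordOf, List.ofFn_succ, wordOf]
  simp

theorem wordOf_insert_zero {m : ℕ} (A : Finset (Fin m)) :
    wordOf (insert 0 (A.map (Fin.succEmb m))) = true :: wordOf A := by
  rw [wordOf, List.ofFn_succ, wordOf]
  simp

/-- Splitting the subsets according to whether they contain the position `0` reproduces the
recursion for `W`. -/
theorem sum_powersetCard_word {M : Type v} [AddCommGroup M] [Module R M] (m p : ℕ)
    (F : List Bool → M) :
    ∑ A ∈ Finset.powersetCard p (Finset.univ : Finset (Fin m)),
      ((shuffleSign A : ℤ) : R) • F (wordOf A) = W R m p F := by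
  induction m generalizing p F with
  | zero =>
    rcases p with _ | p
    · rw [Finset.powersetCard_zero, Finset.sum_singleton]
      simp [shuffleSign, wordOf, W]
    · rw [Finset.powersetCard_eq_empty.2 (by simp), Finset.sum_empty]
      rfl
  | succ m ih =>
    have huniv : (Finset.univ : Finset (Fin (m + 1))) =
        insert 0 ((Finset.univ : Finset (Fin m)).map (Fin.succEmb m)) := by
      rw [Fin.univ_succ, Finset.cons_eq_insert]
      rfl
    have h0 : (0 : Fin (m + 1)) ∉ (Finset.univ : Finset (Fin m)).map (Fin.succEmb m) := by
      simp
    have hA : ∀ p, ∑ A ∈ Finset.powersetCard p ((Finset.univ : Finset (Fin m)).map (Fin.succEmb m)),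
        ((shuffleSign A : ℤ) : R) • F (wordOf A) =
          (-1 : R) ^ p • W R m p fun w => F (false :: w) := by
      intro p
      rw [Finset.powersetCard_map, Finset.sum_map, ← ih, Finset.smul_sum]
      refine Finset.sum_congr rfl fun A hA => ?_
      rw [RelEmbedding.coe_toEmbedding, Finset.mapEmbedding_apply, shuffleSign_map_succ, wordOf_map_succ,
        (Finset.mem_powersetCard.1 hA).2, smul_smul]
      push_cast
      rfl
    rcases p with _ | p
    · rw [W_succ, if_pos rfl, zero_add, ← hA, huniv]
      simp
    · rw [W_succ, if_neg (by simp), huniv, Finset.powersetCard_succ_insert h0, Finset.sum_union,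
        hA, add_comm]
      · congr 1
        rw [Finset.sum_image, Finset.powersetCard_map, Finset.sum_map]
        · rw [← ih]
          refine Finset.sum_congr rfl fun A hA => ?_
          rw [RelEmbedding.coe_toEmbedding, Finset.mapEmbedding_apply, shuffleSign_insert_zero, wordOf_insert_zero]
        · intro A hA B hB h
          have hA' : (0 : Fin (m + 1)) ∉ A := fun h' =>
            h0 ((Finset.mem_powersetCard.1 hA).1 h')
          have hB' : (0 : Fin (m + 1)) ∉ B := fun h' =>
            h0 ((Finset.mem_powersetCard.1 hB).1 h')
          rw [← Finset.erase_insert hA', ← Finset.erase_insert hB']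
          exact congrArg (fun s => Finset.erase s 0) h
      · rw [Finset.disjoint_left]
        intro A hA hA'
        obtain ⟨B, hB, rfl⟩ := Finset.mem_image.1 hA'
        exact h0 ((Finset.mem_powersetCard.1 hA).1 (Finset.mem_insert_self _ _))

theorem stp_wordOf {m : ℕ} (A : Finset (Fin m)) (k : ℕ) :
    stp true (wordOf A) k = (A.filter fun i => i.val < k).card := by
  induction m generalizing k with
  | zero =>
    rw [Finset.eq_empty_of_isEmpty A]
    simp [wordOf, stp_apply]
  | succ m ih =>
    obtain ⟨B, hB⟩ : ∃ B : Finset (Fin m), A = insert 0 (B.map (Fin.succEmb m)) ∨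
        A = B.map (Fin.succEmb m) := by
      refine ⟨Finset.univ.filter fun i => i.succ ∈ A, ?_⟩
      by_cases h : 0 ∈ A
      · left
        ext i
        induction i using Fin.cases <;> simp [h]
      · right
        ext i
        induction i using Fin.cases <;> simp [h]
    have hmap : ∀ k, ((B.map (Fin.succEmb m)).filter fun i => i.val < k + 1).card =
        (B.filter fun i => i.val < k).card := by
      intro k
      rw [Finset.filter_map, Finset.card_map]
      congr 1
      ext i
      simp
    rcases k with _ | k
    · rw [stp_zero]
      simp
    rcases hB with rfl | rfl
    · rw [wordOf_insert_zero, stp_cons_self, sh_succ, ih, Finset.filter_insert, if_pos (by simp),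
        Finset.card_insert_of_notMem (by simp), hmap]
    · rw [wordOf_map_succ, stp_cons_ne (by simp), cz_succ, ih, hmap]

theorem stp_false_wordOf {m : ℕ} (A : Finset (Fin m)) :
    stp false (wordOf A) = stp true (wordOf Aᶜ) := by
  ext k
  have h : wordOf Aᶜ = (wordOf A).map not := by
    rw [wordOf, wordOf, List.map_ofFn]
    congr 1
    ext i
    simp
  rw [stp_apply, stp_apply, h, ← List.map_take]
  generalize (wordOf A).take k = l
  induction l with
  | nil => rfl
  | cons a l ih => cases a <;> simp [ih]

theorem stepMap_eq {m p : ℕ} (A : Finset (Fin m)) (hA : A.card = p) :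
    stepMap A hA = toHom m p (stp true (wordOf A)) :=
  hom_ext_val fun k => by
    rw [toHom_apply, stp_wordOf, min_eq_left ((Finset.card_filter_le _ _).trans hA.le)]
    rfl

theorem gr_shuffle {S : SSet.{u}} {T : SSet.{v}} {p q m : ℕ} (h : p + q = m) (s : S _⦋p⦌)
    (t : T _⦋q⦌) : gr R (prodS S T) m (shuffle R h s t) = nab R S T (bs R ⟨p, s⟩) (bs R ⟨q, t⟩) := by
  rw [nab_bs (m := m) (p := p) _ _ h.symm rfl, ← sum_powersetCard_word, shuffle]
  refine (map_sum (gr R (prodS S T) m) _ _).trans ?_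
  rw [Finset.sum_subtype (Finset.powersetCard p Finset.univ) (p := fun A => A.card = p)
    (fun A => by simp [Finset.mem_powersetCard])]
  refine Finset.sum_congr rfl fun A _ => ?_
  refine (gr_single (prodS S T) _ _).trans ?_
  congr 2
  rw [stepMap_eq, stepMap_eq, stp_false_wordOf]
  rfl

end

/-! ### Kan's group and principal objects -/

/-- The function of `[f 0, …, f m, n]`. -/
def fsn (m n : ℕ) (f : ℕ →o ℕ) : ℕ →o ℕ := ⟨fun k => if k ≤ m then min (f k) n else n, fun a b h => by
  have := f.monotone h
  dsimp only; split_ifs <;> omega⟩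

/-- The function of `[f 0, …, f m, n + 1]`. -/
def fex (m n : ℕ) (f : ℕ →o ℕ) : ℕ →o ℕ :=
  ⟨fun k => if k ≤ m then min (f k) n else n + 1, fun a b h => by
  have := f.monotone h
  dsimp only; split_ifs <;> omega⟩

theorem fsn_apply (m n : ℕ) (f : ℕ →o ℕ) (k : ℕ) : fsn m n f k = if k ≤ m then min (f k) n else n :=
  rfl

theorem fex_apply (m n : ℕ) (f : ℕ →o ℕ) (k : ℕ) :
    fex m n f k = if k ≤ m then min (f k) n else n + 1 := rfl

theorem snocMap_toHom (m n : ℕ) (f : ℕ →o ℕ) :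
    snocMap (toHom m n f) = toHom (m + 1) n (fsn m n f) :=
  hom_ext_val fun k => by
    induction k using Fin.lastCases with
    | last =>
      refine (congrArg Fin.val (snocMap_last (toHom m n f))).trans ?_
      rw [toHom_apply, fsn_apply]
      simp
    | cast k =>
      refine (congrArg Fin.val (snocMap_castSucc (toHom m n f) k)).trans ?_
      have hk : k.val ≤ m := Nat.le_of_lt_succ k.isLt
      refine (min_eq_left ?_).symm.trans (congrArg (min · n) (if_pos hk).symm)
      exact min_le_right _ _

theorem snocMap_lastFace_toHom (m n : ℕ) (f : ℕ →o ℕ) :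
    snocMap (toHom m n f) ≫ lastFace ⦋n⦌ = toHom (m + 1) (n + 1) (fsn m n f) :=
  hom_ext_val fun k => by
    rw [snocMap_toHom]
    refine (congrArg Fin.val (lastFace_apply ⦋n⦌ ((toHom (m + 1) n (fsn m n f)).toOrderHom k))).trans ?_
    rw [Fin.val_castSucc, toHom_apply, toHom_apply, fsn_apply]
    split_ifs <;> omega

theorem extMap_toHom (m n : ℕ) (f : ℕ →o ℕ) :
    extMap (toHom m n f) = toHom (m + 1) (n + 1) (fex m n f) :=
  hom_ext_val fun k => by
    induction k using Fin.lastCases with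
    | last =>
      refine (congrArg Fin.val (extMap_last (toHom m n f))).trans ?_
      rw [toHom_apply, fex_apply]
      simp
    | cast k =>
      refine (congrArg Fin.val (extMap_castSucc (toHom m n f) k)).trans ?_
      have hk : k.val ≤ m := Nat.le_of_lt_succ k.isLt
      refine (min_eq_left ?_).symm.trans (congrArg (min · (n + 1)) (if_pos hk).symm)
      exact (min_le_right _ _).trans (Nat.le_succ n)

theorem lastDegen_toHom (n : ℕ) : lastDegen ⦋n⦌ = toHom (n + 1) n (dup n) :=
  σ_eq_toHom (Fin.last n)

/-- The underlying simplicial set of Kan's simplicial group. -/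
abbrev GS (X : SSet.{u}) : SSet.{u} := underlying (kanG X)

/-- If the last two vertices coincide, then the simplex is of the form `s_m y`, and its symbol is
one of the relations of Kan's group. -/
theorem kanTau_one {X : SSet.{u}} {m : ℕ} (x : Smp X) (f : ℕ →o ℕ)
    (h : min (f (m + 1)) x.1 = min (f m) x.1) : kanTau (a := ⦋m⦌) (sbv x (m + 1) f) = 1 := by
  have h1 : sbv x (m + 1) f = X.map (lastDegen ⦋m⦌).op (sbv x m f) := by
    rw [lastDegen_toHom]
    have h2 := sbv_sb x f (dup m) (m := m) (l := m + 1) (by rw [dup_apply]; split_ifs <;> omega)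
    refine Eq.trans ?_ h2.symm
    refine sbv_congr _ fun k hk => ?_
    rw [ocomp_apply, dup_apply]
    split_ifs with h'
    · rfl
    · obtain rfl : k = m + 1 := by omega
      exact h
  rw [h1, kanTau_lastDegen]

theorem kanMap_toHom {X : SSet.{u}} {m n : ℕ} (f : ℕ →o ℕ) (x : X _⦋n + 1⦌) :
    kanMap X (toHom m n f) (kanTau (a := ⦋n⦌) x) =
      (kanTau (a := ⦋m⦌) (sbv ⟨n + 1, x⟩ (m + 1) (fsn m n f)))⁻¹ *
        kanTau (a := ⦋m⦌) (sbv ⟨n + 1, x⟩ (m + 1) (fex m n f)) := by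
  rw [kanMap_kanTau, snocMap_lastFace_toHom, extMap_toHom]
  rfl

/-- If `f` maps the last vertex to the last vertex, then `f^* (τ x) = τ [f 0, …, f m, n + 1]_x`. -/
theorem kanMap_toHom_of_last {X : SSet.{u}} {m n : ℕ} {f : ℕ →o ℕ} (hf : n ≤ f m) (x : X _⦋n + 1⦌) :
    kanMap X (toHom m n f) (kanTau (a := ⦋n⦌) x) =
        kanTau (a := ⦋m⦌) (sbv ⟨n + 1, x⟩ (m + 1) (fex m n f)) := by
  rw [kanMap_toHom, kanTau_one, inv_one, one_mul]
  rw [fsn_apply, fsn_apply]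
  simp [hf]

/-- The homomorphism induced by a natural family. -/
def kanF {X : SSet.{u}} {Y : SSet.{v}} (F : SMap X Y) (n : ℕ) :
    KanGroup X ⦋n⦌ →* KanGroup Y ⦋n⦌ :=
  kanLift (fun x => kanTau (a := ⦋n⦌) (F.app (n + 1) x)) fun y => by
    have : F.app (n + 1) (X.map (lastDegen ⦋n⦌).op y) = Y.map (lastDegen ⦋n⦌).op (F.app n y) := F.nat _ y
    exact (congrArg _ this).trans (kanTau_lastDegen (a := ⦋n⦌) _)

theorem kanF_kanTau {X : SSet.{u}} {Y : SSet.{v}} (F : SMap X Y) {n : ℕ} (x : X _⦋n + 1⦌) :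
    kanF F n (kanTau (a := ⦋n⦌) x) = kanTau (a := ⦋n⦌) (F.app (n + 1) x) := kanLift_kanTau _ _ _

theorem kanF_kanMap {X : SSet.{u}} {Y : SSet.{v}} (F : SMap X Y) {m n : ℕ} (f : ⦋m⦌ ⟶ ⦋n⦌)
    (g : KanGroup X ⦋n⦌) : kanF F m (kanMap X f g) = kanMap Y f (kanF F n g) := by
  rw [← MonoidHom.comp_apply, ← MonoidHom.comp_apply]
  congr 1
  refine kanHom_ext fun x => ?_
  have hx := kanF_kanTau F (n := n) x
  rw [MonoidHom.comp_apply, MonoidHom.comp_apply, hx, kanMap_kanTau, kanMap_kanTau, map_mul, map_inv]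
  have h1 := kanF_kanTau F (n := m) (X.map (snocMap f ≫ lastFace ⦋n⦌).op x)
  have h2 := kanF_kanTau F (n := m) (X.map (extMap f).op x)
  have e1 : F.app (m + 1) (X.map (snocMap f ≫ lastFace ⦋n⦌).op x) = _ := F.nat _ x
  have e2 : F.app (m + 1) (X.map (extMap f).op x) = _ := F.nat _ x
  rw [e1] at h1
  rw [e2] at h2
  exact congrArg₂ (fun a b => a⁻¹ * b) h1 h2

/-- The natural family `GX → GY` induced by `X → Y`. -/
def SMap.kan {X : SSet.{u}} {Y : SSet.{v}} (F : SMap X Y) : SMap (GS X) (GS Y) where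
  app n g := kanF F n g
  nat f g := kanF_kanMap F f g

theorem kanF_principal {X : SSet.{u}} {Y : SSet.{v}} (F : SMap X Y) {m n : ℕ} (f : ⦋m⦌ ⟶ ⦋n⦌)
    (x : X _⦋n⦌) (g : KanGroup X ⦋n⦌) :
    kanF F m (kanTau (a := ⦋m⦌) (X.map (snocMap f).op x) * kanMap X f g) =
      kanTau (a := ⦋m⦌) (Y.map (snocMap f).op (F.app n x)) * kanMap Y f (kanF F n g) := by
  have h := kanF_kanTau F (n := m) (X.map (snocMap f).op x)
  have h' : F.app (m + 1) (X.map (snocMap f).op x) = _ := F.nat _ x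
  rw [h'] at h
  rw [map_mul, kanF_kanMap]
  exact congrArg (· * kanMap Y f (kanF F n g)) h

/-- The natural family `X ×_τ GX → Y ×_τ GY` induced by `X → Y`. -/
def SMap.principal {X : SSet.{u}} {Y : SSet.{v}} (F : SMap X Y) :
    SMap (principal X) (principal Y) where
  app n s := (F.app n s.1, kanF F n s.2)
  nat f s := Prod.ext (F.nat f s.1) (kanF_principal F f s.1 s.2)

/-! ### Cone structures on Kan's group and on the principal object -/

namespace Cone

variable {X : SSet.{u}} (C : Cone X)

theorem D_sbv (x : Smp X) (m : ℕ) (f : ℕ →o ℕ) :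
    C.D m (sbv x m f) = sbv (C.fn x) (m + 1) (sh f) := (C.nat f x.2).symm

/-- The cone operator of Kan's group, `τ J ↦ τ J̃`. -/
def kanD (n : ℕ) : KanGroup X ⦋n⦌ →* KanGroup X ⦋n + 1⦌ :=
  kanLift (fun x => kanTau (a := ⦋n + 1⦌) (C.D (n + 1) x)) fun y => by
    have h1 : X.map (lastDegen ⦋n⦌).op y = sbv ⟨n, y⟩ (n + 1) (dup n) := by
      rw [lastDegen_toHom]; rfl
    -- Adding a vertex at the beginning preserves the repetition at the end, so the relations are
    -- respected.
    have h2 : kanTau (a := ⦋n + 1⦌) (C.D (n + 1) (sbv ⟨n, y⟩ (n + 1) (dup n))) = 1 := by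
      rw [C.D_sbv, kanTau_one]
      rw [sh_succ, sh_succ, dup_apply, dup_apply]
      simp
    exact (congrArg (fun z => kanTau (a := ⦋n + 1⦌) (C.D (n + 1) z)) h1).trans h2

theorem kanD_kanTau {n : ℕ} (x : X _⦋n + 1⦌) :
    C.kanD n (kanTau (a := ⦋n⦌) x) = kanTau (a := ⦋n + 1⦌) (C.D (n + 1) x) := kanLift_kanTau _ _ _

theorem kanD_zero {n : ℕ} (g : KanGroup X ⦋n⦌) :
    kanMap X (toHom n (n + 1) (iv 1)) (C.kanD n g) = g := by
  rw [← MonoidHom.comp_apply]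
  refine DFunLike.congr_fun (g := MonoidHom.id _) (kanHom_ext fun (x : X _⦋n + 1⦌) => ?_) g
  change kanMap X _ (C.kanD n (kanTau (a := ⦋n⦌) x)) = kanTau (a := ⦋n⦌) x
  rw [kanD_kanTau, kanMap_toHom_of_last (by rw [iv_apply]; omega)]
  congr 1
  refine Eq.trans ?_ (C.zero (n := n + 1) x)
  refine sbv_congr (⟨n + 2, C.D (n + 1) x⟩ : Smp X) fun k hk => ?_
  rw [fex_apply, iv_apply]
  split_ifs <;> simp <;> omega

theorem kanD_nat {m n : ℕ} (f : ℕ →o ℕ) (g : KanGroup X ⦋n⦌) :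
    kanMap X (toHom (m + 1) (n + 1) (sh f)) (C.kanD n g) = C.kanD m (kanMap X (toHom m n f) g) := by
  rw [← MonoidHom.comp_apply, ← MonoidHom.comp_apply]
  refine DFunLike.congr_fun (kanHom_ext fun (x : X _⦋n + 1⦌) => ?_) g
  change kanMap X _ (C.kanD n (kanTau (a := ⦋n⦌) x)) = C.kanD m (kanMap X _ (kanTau (a := ⦋n⦌) x))
  have h1 := C.kanD_kanTau (sbv (⟨n + 1, x⟩ : Smp X) (m + 1) (fsn m n f))
  have h2 := C.kanD_kanTau (sbv (⟨n + 1, x⟩ : Smp X) (m + 1) (fex m n f))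
  rw [kanD_kanTau, kanMap_toHom, kanMap_toHom, map_mul, map_inv, h1, h2, C.D_sbv, C.D_sbv]
  refine congrArg₂ (fun a b => a⁻¹ * b)
    (congrArg _ (sbv_congr (⟨n + 2, C.D (n + 1) x⟩ : Smp X) fun k hk => ?_))
    (congrArg _ (sbv_congr (⟨n + 2, C.D (n + 1) x⟩ : Smp X) fun k hk => ?_))
  · rw [fsn_apply, sh_apply, sh_apply, fsn_apply]
    split_ifs <;> omega
  · rw [fex_apply, sh_apply, sh_apply, fex_apply]
    split_ifs <;> omega

/-- The cone structure of `GX`. -/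
def kan : Cone (GS X) where
  D n g := C.kanD n g
  zero g := C.kanD_zero g
  nat f g := C.kanD_nat f g

/-- The operator `d_0` on `D x` keeps the last vertex, even if `x` is itself a vertex; so the
twisting factor is trivial. -/
theorem principal_zero {n : ℕ} (x : X _⦋n⦌) (g : KanGroup X ⦋n⦌) :
    kanTau (a := ⦋n⦌) (X.map (snocMap (toHom n (n + 1) (iv 1))).op (C.D n x)) *
      kanMap X (toHom n (n + 1) (iv 1)) (C.kanD n g) = g := by
  rw [kanD_zero, snocMap_toHom]
  have h := kanTau_one (m := n) (⟨n + 1, C.D n x⟩ : Smp X) (fsn n (n + 1) (iv 1)) (by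
    simp only [fsn_apply, iv_apply]; split_ifs <;> omega)
  exact (congrArg (· * g) h).trans (one_mul _)

theorem principal_nat {m n : ℕ} (f : ℕ →o ℕ) (x : X _⦋n⦌) (g : KanGroup X ⦋n⦌) :
    kanTau (a := ⦋m + 1⦌) (X.map (snocMap (toHom (m + 1) (n + 1) (sh f))).op (C.D n x)) *
        kanMap X (toHom (m + 1) (n + 1) (sh f)) (C.kanD n g) =
      C.kanD m (kanTau (a := ⦋m⦌) (X.map (snocMap (toHom m n f)).op x) * kanMap X (toHom m n f) g) := by
  rw [map_mul, kanD_nat, snocMap_toHom, snocMap_toHom]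
  congr 1
  refine Eq.trans ?_ (C.kanD_kanTau (sbv (⟨n, x⟩ : Smp X) (m + 1) (fsn m n f))).symm
  rw [C.D_sbv]
  refine congrArg _ (sbv_congr (⟨n + 1, C.D n x⟩ : Smp X) fun k hk => ?_)
  rw [fsn_apply, sh_apply, sh_apply, fsn_apply]
  split_ifs <;> omega

/-- The cone structure of `X ×_τ GX`. -/
def principal : Cone (principal X) where
  D n s := (C.D n s.1, C.kanD n s.2)
  zero s := Prod.ext (C.zero s.1) (C.principal_zero s.1 s.2)
  nat f s := Prod.ext (C.nat f s.1) (C.principal_nat f s.1 s.2)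

end Cone

/-! ### Actions of Kan's group on chains -/

section

variable {X : SSet.{u}} {Γ : SimplicialObject GrpCat.{w}} {Z : SSet.{v}}
variable (τ : TwistingFunction X Γ) (ρ : SimplicialAction Γ Z)

theorem TwistingFunction.toHom_kanTau {n : ℕ} (x : X _⦋n + 1⦌) :
    τ.toHom (kanTau (a := ⦋n⦌) x) = τ.tau x := kanLift_kanTau _ _ _

theorem TwistingFunction.map_toHom {m n : ℕ} (f : ⦋m⦌ ⟶ ⦋n⦌) (g : KanGroup X ⦋n⦌) :
    Γ.map f.op (τ.toHom g) = τ.toHom (kanMap X f g) := by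
  change (Γ.map f.op).hom (τ.toHom g) = _
  rw [← MonoidHom.comp_apply, ← MonoidHom.comp_apply]
  refine DFunLike.congr_fun (kanHom_ext fun (x : X _⦋n + 1⦌) => ?_) g
  have h := τ.mapTau f x
  have h0 := τ.toHom_kanTau x
  have h1 := τ.toHom_kanTau (n := m) (X.map (snocMap f ≫ lastFace ⦋n⦌).op x)
  have h2 := τ.toHom_kanTau (n := m) (X.map (extMap f).op x)
  rw [MonoidHom.comp_apply, MonoidHom.comp_apply, kanMap_kanTau, map_mul, map_inv]
  refine (congrArg (Γ.map f.op).hom h0).trans (h.trans ?_)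
  exact congrArg₂ (fun a b => a⁻¹ * b) h1.symm h2.symm

theorem kanAct_mul {n : ℕ} (g h : KanGroup X ⦋n⦌) (z : Z _⦋n⦌) :
    kanAct τ ρ (g * h) z = kanAct τ ρ g (kanAct τ ρ h z) := by
  rw [kanAct, map_mul, ρ.mul_act]; rfl

theorem kanAct_one {n : ℕ} (z : Z _⦋n⦌) : kanAct τ ρ (1 : KanGroup X ⦋n⦌) z = z := by
  rw [kanAct, map_one, ρ.one_act]

theorem kanAct_kanTau {n : ℕ} (x : X _⦋n + 1⦌) (z : Z _⦋n⦌) :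
    kanAct τ ρ (kanTau (a := ⦋n⦌) x) z = ρ.act (a := op ⦋n⦌) (τ.tau x) z := by
  rw [kanAct, τ.toHom_kanTau]

theorem map_kanAct {m n : ℕ} (f : ⦋m⦌ ⟶ ⦋n⦌) (g : KanGroup X ⦋n⦌) (z : Z _⦋n⦌) :
    Z.map f.op (kanAct τ ρ g z) = kanAct τ ρ (kanMap X f g) (Z.map f.op z) := by
  rw [kanAct, ρ.map_act, τ.map_toHom]; rfl

theorem kanAct_self {n : ℕ} (g h : KanGroup X ⦋n⦌) :
    kanAct (universalTwisting X) (selfAction (kanG X)) g h = g * h := by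
  have : (universalTwisting X).toHom (a := ⦋n⦌) = MonoidHom.id _ :=
    kanHom_ext fun x => (universalTwisting X).toHom_kanTau x
  exact congrArg (· * h) (DFunLike.congr_fun this g)

theorem kanAct_self_act {n : ℕ} (g h : KanGroup X ⦋n⦌) (z : Z _⦋n⦌) :
    kanAct τ ρ (kanAct (universalTwisting X) (selfAction (kanG X)) g h) z =
      kanAct τ ρ g (kanAct τ ρ h z) := by
  rw [kanAct_self, kanAct_mul]

theorem tcp_map_kanAct {m n : ℕ} (f : ⦋m⦌ ⟶ ⦋n⦌) (x : X _⦋n⦌) (g : KanGroup X ⦋n⦌) (z : Z _⦋n⦌) :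
    ρ.act (a := op ⦋m⦌) (τ.tau (n := m) (X.map (snocMap f).op x)) (Z.map f.op (kanAct τ ρ g z)) =
      kanAct τ ρ (kanTau (a := ⦋m⦌) (X.map (snocMap f).op x) * kanMap X f g) (Z.map f.op z) := by
  rw [map_kanAct, kanAct_mul]
  exact (kanAct_kanTau τ ρ _ _).symm

/-- The action of `GX` on `Z`. -/
def SMap.act : SMap (prodS (GS X) Z) Z where
  app _ s := kanAct τ ρ s.1 s.2
  nat f s := (map_kanAct τ ρ f s.1 s.2).symm

/-- The map `((x, g), z) ↦ (x, g z)`. -/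
def SMap.tact : SMap (prodS (Brown.principal X) Z) (tcp τ ρ) where
  app _ s := (s.1.1, kanAct τ ρ s.1.2 s.2)
  nat f s := Prod.ext rfl (tcp_map_kanAct τ ρ f s.1.1 s.1.2 s.2).symm

/-- The multiplication of `GX`. -/
abbrev SMap.mul (X : SSet.{u}) : SMap (prodS (GS X) (GS X)) (GS X) :=
  SMap.act (universalTwisting X) (selfAction (kanG X))

/-- The right multiplication on `X ×_τ GX`. -/
abbrev SMap.pmul (X : SSet.{u}) : SMap (prodS (Brown.principal X) (GS X)) (Brown.principal X) :=
  SMap.tact (universalTwisting X) (selfAction (kanG X))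

variable {R : Type r} [CommRing R]

theorem dot_act_assoc (a b : Ch R (GS X)) (c : Ch R Z) :
    dot R (SMap.act τ ρ) (dot R (SMap.mul X) a b) c =
      dot R (SMap.act τ ρ) a (dot R (SMap.act τ ρ) b c) := by
  refine dot_assoc (μ := SMap.mul X) (μ' := SMap.act τ ρ) (ν := SMap.act τ ρ) (ν' := SMap.act τ ρ)
    (fun _ g h z => kanAct_self_act τ ρ g h z) a b c

theorem dot_tact_assoc (a : Ch R (principal X)) (b : Ch R (GS X)) (c : Ch R Z) :
    dot R (SMap.tact τ ρ) (dot R (SMap.pmul X) a b) c =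
      dot R (SMap.tact τ ρ) a (dot R (SMap.act τ ρ) b c) := by
  refine dot_assoc (μ := SMap.pmul X) (μ' := SMap.tact τ ρ) (ν := SMap.act τ ρ)
    (ν' := SMap.tact τ ρ) (fun _ s h z => Prod.ext rfl (kanAct_self_act τ ρ s.2 h z)) a b c

theorem kanF_kanAct_self {Y : SSet.{v}} (F : SMap X Y) {n : ℕ} (g h : KanGroup X ⦋n⦌) :
    kanAct (universalTwisting Y) (selfAction (kanG Y)) (kanF F n g) (kanF F n h) =
      kanF F n (kanAct (universalTwisting X) (selfAction (kanG X)) g h) := by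
  rw [kanAct_self, kanAct_self, map_mul]

theorem dot_mul_cm {Y : SSet.{v}} (F : SMap X Y) (a b : Ch R (GS X)) :
    dot R (SMap.mul Y) (cm R F.kan a) (cm R F.kan b) = cm R F.kan (dot R (SMap.mul X) a b) :=
  dot_cm (μ := SMap.mul X) (μ' := SMap.mul Y) (F := F.kan) (G := F.kan) (H := F.kan)
    (fun _ g h => kanF_kanAct_self F g h) a b

theorem dot_pmul_cm {Y : SSet.{v}} (F : SMap X Y) (a : Ch R (principal X)) (b : Ch R (GS X)) :
    dot R (SMap.pmul Y) (cm R F.principal a) (cm R F.kan b) =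
      cm R F.principal (dot R (SMap.pmul X) a b) :=
  dot_cm (μ := SMap.pmul X) (μ' := SMap.pmul Y) (F := F.principal) (G := F.kan) (H := F.principal)
    (fun _ s h => Prod.ext rfl (kanF_kanAct_self F s.2 h)) a b

theorem gr_dot {S : SSet.{u}} {T : SSet.{v}} {U : SSet.{w}} (μ : SMap (prodS S T) U) {p q m : ℕ}
    (h : p + q = m) (c : S _⦋p⦌ →₀ R) (t : T _⦋q⦌) :
    gr R U m (c.sum fun s a => a • Finsupp.mapDomain (μ.app m) (shuffle R h s t)) =
      dot R μ (gr R S p c) (bs R ⟨q, t⟩) := by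
  have h1 (s : S _⦋p⦌) : gr R U m (Finsupp.mapDomain (μ.app m) (shuffle R h s t)) =
      dot R μ (bs R ⟨p, s⟩) (bs R ⟨q, t⟩) := by
    rw [dot_apply, ← gr_shuffle h]
    have h2 : gr R U m ∘ₗ Finsupp.lmapDomain R R (μ.app m) = cm R μ ∘ₗ gr R (prodS S T) m := by
      refine lin_ext fun s => ?_
      rw [bs, LinearMap.comp_apply, LinearMap.comp_apply, Finsupp.lmapDomain_apply,
        Finsupp.mapDomain_single, gr_single, gr_single, map_smul, cm_bs]
      rfl
    exact LinearMap.congr_fun h2 _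
  have h3 : gr R U m ∘ₗ Finsupp.linearCombination R
      (fun s => Finsupp.mapDomain (μ.app m) (shuffle R h s t)) =
      (dot R μ).flip (bs R ⟨q, t⟩) ∘ₗ gr R S p := by
    refine lin_ext fun s => ?_
    rw [LinearMap.comp_apply, LinearMap.comp_apply, lin_bs, h1]
    have h4 : gr R S p (bs R s) = bs R ⟨p, s⟩ := by rw [bs, gr_single, one_smul]
    rw [h4]
    rfl
  exact LinearMap.congr_fun h3 c

theorem gr_gDot {k q m : ℕ} (h : k + q = m) (c : KanGroup X ⦋k⦌ →₀ R) (z : Z _⦋q⦌) :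
    gr R Z m (gDot R τ ρ h c z) = dot R (SMap.act τ ρ) (gr R (GS X) k c) (bs R ⟨q, z⟩) :=
  gr_dot (SMap.act τ ρ) h c z

theorem gr_principalDot {p q m : ℕ} (h : p + q = m) (c : (principal X) _⦋p⦌ →₀ R) (z : Z _⦋q⦌) :
    gr R (tcp τ ρ) m (principalDot R τ ρ h c z) =
      dot R (SMap.tact τ ρ) (gr R (principal X) p c) (bs R ⟨q, z⟩) :=
  gr_dot (SMap.tact τ ρ) h c z

theorem gr_lmapDomain {S : SSet.{u}} {T : SSet.{v}} {k m : ℕ} (f : S _⦋k⦌ → T _⦋m⦌)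
    (φ : Ch R S →ₗ[R] Ch R T) (h : ∀ s, φ (bs R ⟨k, s⟩) = bs R ⟨m, f s⟩) (c : S _⦋k⦌ →₀ R) :
    gr R T m (Finsupp.lmapDomain R R f c) = φ (gr R S k c) := by
  have h2 : gr R T m ∘ₗ Finsupp.lmapDomain R R f = φ ∘ₗ gr R S k := by
    refine lin_ext fun s => ?_
    rw [bs, LinearMap.comp_apply, LinearMap.comp_apply, Finsupp.lmapDomain_apply,
      Finsupp.mapDomain_single, gr_single, gr_single, map_smul, h]
  exact LinearMap.congr_fun h2 c

theorem kanFunctor_eq {X Y : SSet.{u}} (F : X ⟶ Y) (m : ℕ) :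
    kanFunctor F ⦋m⦌ = kanF (SMap.ofHom F) m :=
  kanHom_ext fun x => (kanLift_kanTau _ _ x).trans (kanF_kanTau (SMap.ofHom F) x).symm

theorem derivedWord_eq (n m : ℕ) : derivedWord.{u} n m = (stdCone n).kanD m :=
  kanHom_ext (a := ⦋m⦌) fun x => (kanLift_kanTau _ _ x).trans ((stdCone n).kanD_kanTau x).symm

theorem gr_evalAt {n m : ℕ} (x : X _⦋n⦌) (c : (principal Δ[n]) _⦋m⦌ →₀ R) :
    gr R (principal X) m (evalAt R x c) =
      cm R (SMap.cls x).principal (gr R (principal Δ[n]) m c) := by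
  rw [evalAt, kanFunctor_eq]
  exact gr_lmapDomain (S := principal Δ[n]) _ _ (fun _ => cm_bs (SMap.cls x).principal _) c

theorem gr_derivedOp {n m : ℕ} (c : (principal (Δ[n] : SSet.{u})) _⦋m⦌ →₀ R) :
    gr R (principal (Δ[n] : SSet.{u})) (m + 1) (derivedOp R n m c) =
      cD R (stdCone n).principal (gr R (principal Δ[n]) m c) := by
  rw [derivedOp, derivedWord_eq]
  exact gr_lmapDomain (S := principal Δ[n]) _ _ (fun _ => cD_bs (stdCone n).principal _) c

end

/-! ### Signed sums over permutations -/

section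

variable (R : Type r) [CommRing R] {M : Type v} [AddCommGroup M] [Module R M]

/-- The signed sum of the values of `F` on the permutations of the list `l` of length `n`. -/
def PS {M : Type v} [AddCommGroup M] [Module R M] (n : ℕ) (l : List ℕ) (F : List ℕ → M) : M :=
  match n with
  | 0 => F []
  | n + 1 => ∑ t ∈ Finset.range (n + 1),
      (-1 : R) ^ t • PS n (l.eraseIdx t) fun w => F (l.getD t 0 :: w)

variable {R}

theorem PS_zero (l : List ℕ) (F : List ℕ → M) : PS R 0 l F = F [] := rfl

theorem PS_succ (n : ℕ) (l : List ℕ) (F : List ℕ → M) : PS R (n + 1) l F =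
    ∑ t ∈ Finset.range (n + 1), (-1 : R) ^ t •
      PS R n (l.eraseIdx t) fun w => F (l.getD t 0 :: w) := rfl

theorem PS_of_pos {n : ℕ} (hn : n ≠ 0) (l : List ℕ) (F : List ℕ → M) : PS R n l F =
    ∑ t ∈ Finset.range n, (-1 : R) ^ t •
      PS R (n - 1) (l.eraseIdx t) fun w => F (l.getD t 0 :: w) := by
  obtain ⟨n, rfl⟩ := Nat.exists_eq_succ_of_ne_zero hn
  rfl

theorem getD_cons_eraseIdx_perm {l : List ℕ} {t : ℕ} (h : t < l.length) :
    (l.getD t 0 :: l.eraseIdx t).Perm l := by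
  rw [List.getD_eq_getElem _ _ h]
  exact List.getElem_cons_eraseIdx_perm h

theorem PS_congr {n : ℕ} {l : List ℕ} (hl : l.length = n) {F G : List ℕ → M}
    (h : ∀ w : List ℕ, w.Perm l → F w = G w) : PS R n l F = PS R n l G := by
  induction n generalizing l F G with
  | zero =>
    obtain rfl := List.eq_nil_of_length_eq_zero hl
    exact h [] (List.Perm.refl _)
  | succ n ih =>
    rw [PS_succ, PS_succ]
    refine Finset.sum_congr rfl fun t ht => ?_
    have ht' : t < l.length := by rw [hl]; exact Finset.mem_range.1 ht
    rw [ih (by rw [List.length_eraseIdx_of_lt ht']; omega) fun w hw => h _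
      ((List.Perm.cons _ hw).trans (getD_cons_eraseIdx_perm ht'))]

theorem PS_map {N : Type w} [AddCommGroup N] [Module R N] (φ : M →ₗ[R] N) (n : ℕ) (l : List ℕ)
    (F : List ℕ → M) : φ (PS R n l F) = PS R n l fun w => φ (F w) := by
  induction n generalizing l F with
  | zero => rfl
  | succ n ih =>
    rw [PS_succ, PS_succ, map_sum]
    exact Finset.sum_congr rfl fun t _ => by rw [map_smul, ih]

theorem PS_map_list (f : ℕ → ℕ) {n : ℕ} {l : List ℕ} (hl : l.length = n) (F : List ℕ → M) :
    PS R n (l.map f) F = PS R n l fun w => F (w.map f) := by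
  induction n generalizing l F with
  | zero => rfl
  | succ n ih =>
    rw [PS_succ, PS_succ]
    refine Finset.sum_congr rfl fun t ht => ?_
    have ht' : t < l.length := by rw [hl]; exact Finset.mem_range.1 ht
    rw [List.eraseIdx_map, ih (by rw [List.length_eraseIdx_of_lt ht']; omega)]
    congr 2
    ext w
    rw [List.map_cons, List.getD_eq_getElem _ _ (by simpa using ht'), List.getElem_map,
      List.getD_eq_getElem _ _ ht']

theorem W_PS (m p n : ℕ) (l : List ℕ) (F : List Bool → List ℕ → M) :
    W R m p (fun A => PS R n l (F A)) = PS R n l fun u => W R m p fun A => F A u := by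
  induction n generalizing l F with
  | zero => rfl
  | succ n ih =>
    simp only [PS_succ]
    rw [W_sum]
    exact Finset.sum_congr rfl fun t _ => by rw [W_smul, ih]

theorem PS_swap (n n' : ℕ) (l l' : List ℕ) (F : List ℕ → List ℕ → M) :
    PS R n l (fun u => PS R n' l' (F u)) = PS R n' l' fun u' => PS R n l fun u => F u u' := by
  induction n generalizing l F with
  | zero => rfl
  | succ n ih =>
    have : (fun u' => PS R (n + 1) l fun u => F u u') = fun u' =>
      ∑ t ∈ Finset.range (n + 1), (-1 : R) ^ t •
        PS R n (l.eraseIdx t) fun w => F (l.getD t 0 :: w) u' := rfl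
    rw [this, PS_succ]
    have h2 := PS_map (R := R) (∑ t ∈ Finset.range (n + 1), (-1 : R) ^ t •
      (LinearMap.proj t : (ℕ → M) →ₗ[R] M)) n' l' fun u' t =>
        PS R n (l.eraseIdx t) fun w => F (l.getD t 0 :: w) u'
    simp only [LinearMap.sum_apply, LinearMap.smul_apply, LinearMap.proj_apply] at h2
    rw [← h2]
    refine Finset.sum_congr rfl fun t _ => ?_
    rw [ih]
    congr 1
    exact (PS_map (LinearMap.proj t : (ℕ → M) →ₗ[R] M) n' l' fun u' t =>
        PS R n (l.eraseIdx t) fun w => F (l.getD t 0 :: w) u').symm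

/-- Splitting the permutations of a list with letters of two kinds. -/
theorem PS_append (P : ℕ → Bool) {p q m : ℕ} (hm : p + q = m) {l l' : List ℕ} (hl : l.length = p)
    (hl' : l'.length = q) (h : ∀ a ∈ l, P a = true) (h' : ∀ a ∈ l', P a = false)
    (F : List Bool → List ℕ → List ℕ → M) :
    PS R m (l ++ l') (fun w => F (w.map P) (w.filter P) (w.filter fun a => !P a)) =
      W R m p fun A => PS R p l fun u => PS R q l' fun u' => F A u u' := by
  induction m generalizing p q l l' F with
  | zero =>
    obtain rfl : p = 0 := by omega
    obtain rfl : q = 0 := by omega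
    rfl
  | succ m ih =>
    -- The first letter comes from `l` or from `l'`. In the second case it has to pass the `p`
    -- letters of `l`, which gives the sign in the recursion for `W`.
    rw [PS_succ, ← hm, Finset.sum_range_add, hm, W_succ]
    congr 1
    · by_cases hp : p = 0
      · rw [hp, Finset.sum_range_zero, if_pos rfl]
      rw [if_neg hp]
      simp only [PS_of_pos hp l]
      rw [W_sum]
      refine Finset.sum_congr rfl fun t ht => ?_
      have ht' : t < l.length := by rw [hl]; exact Finset.mem_range.1 ht
      rw [W_smul, List.eraseIdx_append_of_lt_length ht',
        ← ih (by omega) (by rw [List.length_eraseIdx_of_lt ht', hl]) hl'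
          (fun a ha => h a (List.mem_of_mem_eraseIdx ha)) h']
      congr 2
      ext w
      have h1 : (l ++ l').getD t 0 = l.getD t 0 := by
        rw [List.getD_append _ _ _ _ ht']
      have h2 : P (l.getD t 0) = true := by
        rw [List.getD_eq_getElem _ _ ht']; exact h _ (List.getElem_mem _)
      rw [h1]
      rw [List.map_cons, List.filter_cons, List.filter_cons, h2]
      simp
    · by_cases hq : q = 0
      · rw [hq, Finset.sum_range_zero, W_of_lt (by omega), smul_zero]
      have h0 : (fun w : List Bool => PS R p l fun u => PS R q l' fun u' => F (false :: w) u u') =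
          fun w => ∑ t ∈ Finset.range q, (-1 : R) ^ t • PS R p l fun u =>
            PS R (q - 1) (l'.eraseIdx t) fun u' => F (false :: w) u (l'.getD t 0 :: u') := by
        ext w
        rw [PS_swap, PS_of_pos hq]
        exact Finset.sum_congr rfl fun t _ => by rw [PS_swap]
      rw [h0, W_sum, Finset.smul_sum]
      refine Finset.sum_congr rfl fun t ht => ?_
      have ht' : t < l'.length := by rw [hl']; exact Finset.mem_range.1 ht
      rw [W_smul, smul_smul, ← pow_add, List.eraseIdx_append_of_length_le (by omega), hl,
        Nat.add_sub_cancel_left,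
        ← ih (by omega) hl (by rw [List.length_eraseIdx_of_lt ht', hl']) h
          (fun a ha => h' a (List.mem_of_mem_eraseIdx ha))]
      congr 2
      ext w
      have h1 : (l ++ l').getD (p + t) 0 = l'.getD t 0 := by
        rw [List.getD_append_right _ _ _ _ (by omega), hl, Nat.add_sub_cancel_left]
      have h2 : P (l'.getD t 0) = false := by
        rw [List.getD_eq_getElem _ _ ht']; exact h' _ (List.getElem_mem _)
      rw [h1]
      rw [List.map_cons, List.filter_cons, List.filter_cons, h2]
      simp

/-- A permutation is determined by its value `t` at `0` and by the order in which it lists the other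
elements. The inverse of `Fin.cycleRange t` sends `0` to `t`, keeps the order of the rest, and has
sign `(-1)^t`. -/
theorem sum_perm_succ {n : ℕ} (F : Equiv.Perm (Fin (n + 1)) → M) :
    ∑ g, F g = ∑ t : Fin (n + 1), ∑ g : Equiv.Perm (Fin n),
      F ((Fin.cycleRange t)⁻¹ * Equiv.Perm.decomposeFin.symm (0, g)) := by
  rw [← Fintype.sum_prod_type']
  refine (Function.Bijective.sum_comp (g := F)
    (e := fun tg : Fin (n + 1) × Equiv.Perm (Fin n) =>
      (Fin.cycleRange tg.1)⁻¹ * Equiv.Perm.decomposeFin.symm (0, tg.2)) ?_).symm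
  rw [Fintype.bijective_iff_injective_and_card]
  refine ⟨fun a b hab => ?_, ?_⟩
  · obtain ⟨t, g⟩ := a
    obtain ⟨t', g'⟩ := b
    dsimp only at hab
    have h0 : t = t' := by
      have := DFunLike.congr_fun hab 0
      simpa [Equiv.Perm.mul_apply] using this
    subst h0
    have := mul_left_cancel hab
    simpa using this
  · simp [Fintype.card_perm, Nat.factorial_succ]

theorem sum_perm_eq_PS {n : ℕ} (J : Fin n → ℕ) (F : List ℕ → M) :
    ∑ g : Equiv.Perm (Fin n), ((Equiv.Perm.sign g : ℤ) : R) • F (List.ofFn fun i => J (g i)) =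
      PS R n (List.ofFn J) F := by
  induction n generalizing F with
  | zero => simp [PS_zero]
  | succ n ih =>
    rw [sum_perm_succ, PS_succ, Finset.sum_range]
    refine Finset.sum_congr rfl fun t _ => ?_
    have h1 : (List.ofFn J).eraseIdx t = List.ofFn fun i => J (t.succAbove i) := by
      refine List.ext_getElem (by simp [List.length_eraseIdx]; omega) fun i h1 h2 => ?_
      rw [List.getElem_eraseIdx]
      simp only [List.getElem_ofFn]
      split_ifs with hi
      · congr 1
        rw [Fin.succAbove_of_castSucc_lt _ _ (by simpa [Fin.lt_def] using hi)]
        rfl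
      · congr 1
        rw [Fin.succAbove_of_le_castSucc _ _ (by simpa [Fin.le_def] using Nat.le_of_not_lt hi)]
        rfl
    rw [h1, ← ih, Finset.smul_sum]
    refine Finset.sum_congr rfl fun g _ => ?_
    have h2 : (Equiv.Perm.sign ((Fin.cycleRange t)⁻¹ * Equiv.Perm.decomposeFin.symm (0, g)) : ℤ) =
        (-1) ^ t.val * Equiv.Perm.sign g := by
      simp [Fin.sign_cycleRange]
    rw [h2, smul_smul]
    congr 1
    · push_cast; rfl
    · congr 1
      rw [List.ofFn_succ]
      congr 1
      · rw [List.getD_eq_getElem _ _ (by simp; omega), List.getElem_ofFn]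
        simp [Equiv.Perm.mul_apply]
      · congr 1
        ext i
        congr 1
        simp [Equiv.Perm.mul_apply]

end

/-! ### The rows of the twisting cochain -/

/-- The largest element that is at most `r` of the list `l`, or `b` if this is larger. -/
def acc (b r : ℕ) (l : List ℕ) : ℕ := l.foldl (fun a k => if k ≤ r then max a k else a) b

theorem acc_nil (b r : ℕ) : acc b r [] = b := rfl

theorem acc_cons (b r k : ℕ) (l : List ℕ) :
    acc b r (k :: l) = acc (if k ≤ r then max b k else b) r l := rfl

/-- The universal property of the maximum. Bounds, monotonicity and the comparison with `alpha` are
read off from it without unfolding the fold again. -/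
theorem acc_le_iff (b r N : ℕ) (l : List ℕ) : acc b r l ≤ N ↔ b ≤ N ∧ ∀ k ∈ l, k ≤ r → k ≤ N := by
  induction l generalizing b with
  | nil => simp [acc_nil]
  | cons k l ih =>
    rw [acc_cons, ih, List.forall_mem_cons]
    split_ifs with h
    · simp only [max_le_iff, h, true_imp_iff, and_assoc]
    · simp only [h, false_imp_iff, true_and]

theorem acc_le (b r : ℕ) (l : List ℕ) : acc b r l ≤ max b r :=
  (acc_le_iff _ _ _ _).2 ⟨le_max_left _ _, fun _ _ h => h.trans (le_max_right _ _)⟩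

theorem acc_take_mono (b r : ℕ) (l : List ℕ) {j k : ℕ} (h : j ≤ k) :
    acc b r (l.take j) ≤ acc b r (l.take k) :=
  (acc_le_iff _ _ _ _).2 ⟨((acc_le_iff b r _ _).1 le_rfl).1, fun i hi hr =>
    ((acc_le_iff b r _ _).1 le_rfl).2 i ((List.take_sublist_take_left h).subset hi) hr⟩

/-- The letters that are removed either exceed the cut-off `r` or are at most the initial value `b`,
so they never change the running maximum. -/
theorem acc_filter (P : ℕ → Bool) (b r : ℕ) (l : List ℕ)
    (h : ∀ k ∈ l, P k = false → k ≤ r → k ≤ b) : acc b r (l.filter P) = acc b r l := by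
  refine eq_of_forall_ge_iff fun N => ?_
  rw [acc_le_iff, acc_le_iff]
  refine and_congr_right fun hb => ?_
  constructor
  · intro H k hk hr
    by_cases hP : P k = true
    · exact H k (List.mem_filter.2 ⟨hk, hP⟩) hr
    · exact (h k hk (by simpa using hP) hr).trans hb
  · exact fun H k hk => H k (List.mem_filter.1 hk).1

theorem acc_map_add (i b r : ℕ) (l : List ℕ) :
    acc (i + b) (i + r) (l.map fun k => i + k) = i + acc b r l := by
  induction l generalizing b with
  | nil => rfl
  | cons k l ih =>
    rw [List.map_cons, acc_cons, acc_cons, ← ih]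
    congr 1
    split_ifs <;> omega

theorem alpha_eq_acc {n : ℕ} (g : Equiv.Perm (Fin n)) (r j : ℕ) :
    alpha g r j = acc 0 r ((List.ofFn fun i => (g i).val + 1).take j) := by
  refine eq_of_forall_ge_iff fun N => ?_
  rw [acc_le_iff, alpha, Finset.sup_le_iff]
  constructor
  · intro h
    refine ⟨Nat.zero_le _, fun k hk hr => h k ?_⟩
    rw [List.mem_take_iff_getElem] at hk
    obtain ⟨i, hi, rfl⟩ := hk
    rw [List.length_ofFn] at hi
    rw [Finset.mem_inter, Finset.mem_range]
    refine ⟨Nat.lt_succ_of_le hr, Finset.mem_insert_of_mem (Finset.mem_image.2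
      ⟨⟨i, by omega⟩, Finset.mem_filter.2 ⟨Finset.mem_univ _, show i < j by omega⟩, ?_⟩)⟩
    rw [List.getElem_ofFn]
  · rintro ⟨-, h⟩ k hk
    rw [Finset.mem_inter, Finset.mem_range, Finset.mem_insert, Finset.mem_image] at hk
    obtain ⟨hr, rfl | ⟨i, hi, rfl⟩⟩ := hk
    · exact Nat.zero_le _
    · refine h _ ?_ (Nat.le_of_lt_succ hr)
      rw [List.mem_take_iff_getElem]
      refine ⟨i.val, ?_, ?_⟩
      · rw [List.length_ofFn]
        have := (Finset.mem_filter.1 hi).2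
        have := i.isLt
        omega
      · rw [List.getElem_ofFn]
        rfl

/-- The row `[b, α_1, …, α_n, r + 1]` that belongs to the word `w`. -/
def rowF (b n r : ℕ) (w : List ℕ) : ℕ →o ℕ :=
  ⟨fun k => if k ≤ n then acc b r (w.take k) else max b (r + 1), fun j k h => by
    have h1 := acc_take_mono b r w h
    have h2 := acc_le b r (w.take j)
    dsimp only; split_ifs <;> omega⟩

theorem rowF_apply (b n r : ℕ) (w : List ℕ) (k : ℕ) :
    rowF b n r w k = if k ≤ n then acc b r (w.take k) else max b (r + 1) := rfl

theorem rowF_zero (b n r : ℕ) (w : List ℕ) : rowF b n r w 0 = b := rfl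

/-- A first letter `i ≤ r` lifts the running maximum to `i` at once, so after the initial `0` the
row looks as if it started at `i`. In the next lemma the letter exceeds `r` and is invisible, so the
entry `0` is repeated. -/
theorem rowF_cons_of_le {n r i : ℕ} (h : i ≤ r) (w : List ℕ) :
    rowF 0 (n + 1) r (i :: w) = cz (rowF i n r w) := by
  ext k
  rcases k with _ | k
  · rfl
  · rw [cz_succ, rowF_apply, rowF_apply, List.take_succ_cons, acc_cons, if_pos h]
    split_ifs <;> simp <;> omega

theorem rowF_cons_of_lt {n r i : ℕ} (h : r < i) (w : List ℕ) :
    rowF 0 (n + 1) r (i :: w) = cz (rowF 0 n r w) := by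
  ext k
  rcases k with _ | k
  · rfl
  · rw [cz_succ, rowF_apply, rowF_apply, List.take_succ_cons, acc_cons, if_neg (show ¬i ≤ r by omega)]
    split_ifs <;> simp <;> omega

/-! ### Products of values of the twisting function on the rows -/

section

variable {X : SSet.{u}}

/-- The product of the values of `τ` on the rows indexed by `rs`. -/
def tc (x : Smp X) (b n : ℕ) (w rs : List ℕ) : KanGroup X ⦋n⦌ :=
  (rs.map fun r => kanTau (a := ⦋n⦌) (sbv x (n + 1) (rowF b n r w))).prod

theorem tc_append (x : Smp X) (b n : ℕ) (w rs rs' : List ℕ) :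
    tc x b n w (rs ++ rs') = tc x b n w rs * tc x b n w rs' := by
  rw [tc, tc, tc, List.map_append, List.prod_append]

theorem tc_congr {x x' : Smp X} {b b' n : ℕ} {w w' rs : List ℕ}
    (h : ∀ r ∈ rs, sbv x (n + 1) (rowF b n r w) = sbv x' (n + 1) (rowF b' n r w')) :
    tc x b n w rs = tc x' b' n w' rs := by
  rw [tc, tc, List.map_congr_left fun r hr => congrArg (kanTau (a := ⦋n⦌)) (h r hr)]

theorem kanTau_cz {C : Cone X} {x : Smp X} (hx : C.Based x) (n : ℕ) (f : ℕ →o ℕ) :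
    kanTau (a := ⦋n + 1⦌) (sbv x (n + 2) (cz f)) =
      C.kanD n (kanTau (a := ⦋n⦌) (sbv x (n + 1) f)) := by
  rw [C.kanD_kanTau]
  exact congrArg _ (eq_of_heq (Sigma.mk.inj (hx.sb_cz (n + 1) f)).2)

/-- The first letter `i` separates the rows: those with `r < i` stay at `0`, the others continue
from `i`. In both cases a leading `0` is all that distinguishes them from shorter rows, and for
based `x` this is the cone operator, which is multiplicative on Kan's group. -/
theorem tc_cons {C : Cone X} {x : Smp X} (hx : C.Based x) (n i j : ℕ) (w : List ℕ) :
    tc x 0 (n + 1) (i :: w) (List.range' 0 i ++ List.range' i j) =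
      C.kanD n (tc x 0 n w (List.range' 0 i) * tc x i n w (List.range' i j)) := by
  rw [tc_append, map_mul, tc, tc, tc, tc, map_list_prod, map_list_prod, List.map_map, List.map_map]
  congr 2
  · refine List.map_congr_left fun r hr => ?_
    rw [List.mem_range'_1] at hr
    rw [rowF_cons_of_lt (by omega), kanTau_cz hx]
    rfl
  · refine List.map_congr_left fun r hr => ?_
    rw [List.mem_range'_1] at hr
    rw [rowF_cons_of_le hr.1, kanTau_cz hx]
    rfl

theorem kanMap_tc (x : Smp X) (b : ℕ) {m p : ℕ} {f : ℕ →o ℕ} (hf : p ≤ f m) {u w rs : List ℕ}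
    (h : ∀ r ∈ rs, ∀ k ≤ m, acc b r (u.take (min (f k) p)) = acc b r (w.take k)) :
    kanMap X (toHom m p f) (tc x b p u rs) = tc x b m w rs := by
  rw [tc, tc, map_list_prod, List.map_map]
  congr 1
  refine List.map_congr_left fun r hr => ?_
  refine (kanMap_toHom_of_last hf _).trans (congrArg _ ?_)
  refine (sbv_sb x (m := p + 1) (l := m + 1) _ _ ?_).trans (sbv_congr _ fun k hk => ?_)
  · rw [fex_apply]; split_ifs <;> omega
  · rw [ocomp_apply, fex_apply]
    split_ifs with h1
    · rw [rowF_apply, rowF_apply, if_pos (min_le_right _ _), if_pos h1, h r hr k h1]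
    · rw [rowF_apply, rowF_apply, if_neg (by omega), if_neg h1]

/-- The rows with `r ≤ p` involve only the vertices up to `p + 1`, so they may be evaluated on the
front face or on `x`. -/
theorem tc_front (x : Smp X) (p : ℕ) (w : List ℕ) :
    tc (sb x (p + 1) OrderHom.id) 0 p w (List.range' 0 (p + 1)) =
      tc x 0 p w (List.range' 0 (p + 1)) := by
  refine tc_congr fun r hr => ?_
  rw [List.mem_range'_1] at hr
  rw [sbv_sb]
  · exact sbv_congr _ fun _ _ => rfl
  · rw [rowF_apply]; split_ifs <;> omega

/-- On a back face, vertices, letters and row indices are all shifted by `i`. -/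
theorem tc_back (x : Smp X) (i q : ℕ) (w : List ℕ) :
    tc (sb x (q + 1) (iv i)) 0 q w (List.range' 0 (q + 1)) =
      tc x i q (w.map fun k => i + k) (List.range' i (q + 1)) := by
  have h : List.range' i (q + 1) = (List.range' 0 (q + 1)).map fun k => i + k := by
    rw [List.map_add_range']; simp
  rw [h, tc, tc, List.map_map]
  congr 1
  refine List.map_congr_left fun r hr => congrArg _ ?_
  rw [List.mem_range'_1] at hr
  rw [sbv_sb]
  · refine sbv_congr _ fun k hk => ?_
    rw [ocomp_apply, iv_apply, rowF_apply, rowF_apply, ← List.map_take]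
    have := acc_map_add i 0 r (w.take k)
    rw [add_zero] at this
    beta_reduce
    rw [this]
    split_ifs <;> omega
  · rw [rowF_apply]; split_ifs <;> omega

end

/-! ### The signed sum of the `Tcx(g)` -/

section

variable (R : Type r) [CommRing R] {X : SSet.{u}}

/-- The signed sum of the `Tcx(g)`, for `x` of positive dimension. -/
def phiT (x : Smp X) : Ch R (GS X) :=
  match x with
  | ⟨0, _⟩ => 0
  | ⟨n + 1, x⟩ => ∑ g : Equiv.Perm (Fin n),
      ((Equiv.Perm.sign g : ℤ) : R) • bs R (⟨n, tcGroup x g⟩ : Smp (GS X))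

variable {R}

theorem phiT_zero {x : Smp X} (h : x.1 = 0) : phiT R x = 0 := by
  obtain ⟨n, x⟩ := x
  subst h
  rfl

theorem tcGroup_eq {n : ℕ} (x : X _⦋n + 1⦌) (g : Equiv.Perm (Fin n)) :
    tcGroup x g = tc ⟨n + 1, x⟩ 0 n (List.ofFn fun i => (g i).val + 1) (List.range' 0 (n + 1)) := by
  rw [tcGroup, tc, ← List.range_eq_range', ← List.map_coe_finRange_eq_range, List.map_map,
    List.ofFn_eq_map]
  congr 1
  refine List.map_congr_left fun r _ => ?_
  refine congrArg (fun f : ⦋n + 1⦌ ⟶ ⦋n + 1⦌ => kanTau (a := ⦋n⦌) (X.map f.op x)) ?_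
  refine hom_ext_val fun k => ?_
  change _ = ((toHom (n + 1) (n + 1) (rowF 0 n r.val _)).toOrderHom k).val
  rw [toHom_apply, rowF_apply, ← alpha_eq_acc]
  have h1 := alpha_le g r k
  have h2 := r.isLt
  change (if k.val ≤ n then (⟨alpha g r k, _⟩ : Fin (n + 2)) else r.succ).val = _
  split_ifs
  · change alpha g r k = min _ (n + 1)
    omega
  · change r.val + 1 = min _ (n + 1)
    omega

theorem phiT_eq {x : Smp X} {n : ℕ} (h : x.1 = n + 1) : phiT R x =
    PS R n (List.range' 1 n) fun w =>
      bs R (⟨n, tc x 0 n w (List.range' 0 (n + 1))⟩ : Smp (GS X)) := by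
  obtain ⟨k, x⟩ := x
  subst h
  have : List.range' 1 n = List.ofFn fun i : Fin n => i.val + 1 := by
    refine List.ext_getElem (by simp) fun i h1 h2 => ?_
    simp [add_comm]
  rw [this, ← sum_perm_eq_PS]
  refine Finset.sum_congr rfl fun g _ => ?_
  rw [tcGroup_eq]

theorem phiT_deg {x : Smp X} : phiT R x ∈ deg R (GS X) (x.1 - 1) := by
  obtain ⟨n, x⟩ := x
  rcases n with _ | n
  · exact Submodule.zero_mem _
  · exact Submodule.sum_mem _ fun g _ => Submodule.smul_mem _ _ (bs_mem_deg rfl)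

theorem phiT_one {x : Smp X} (h : x.1 = 1) :
    phiT R x = bs R (⟨0, kanTau (a := ⦋0⦌) (sbv x 1 OrderHom.id)⟩ : Smp (GS X)) := by
  rw [phiT_eq h, PS_zero]
  refine congrArg (fun g : KanGroup X ⦋0⦌ => bs R (⟨0, g⟩ : Smp (GS X))) ?_
  rw [tc]
  simp only [zero_add, List.range'_one, List.map_cons, List.map_nil, List.prod_cons, List.prod_nil, mul_one]
  refine congrArg _ (sbv_congr _ fun k hk => ?_)
  rcases k with _ | k
  · rfl
  · rw [rowF_apply, if_neg (by omega), oid_apply]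
    omega

theorem cm_phiT {Y : SSet.{v}} (F : SMap X Y) (x : Smp X) :
    cm R F.kan (phiT R x) = phiT R (F.fn x) := by
  obtain ⟨n, x⟩ := x
  rcases n with _ | n
  · exact map_zero _
  · refine (map_sum (cm R F.kan) _ _).trans (Finset.sum_congr rfl fun g _ => ?_)
    rw [map_smul, cm_bs]
    refine congrArg (fun y : KanGroup Y ⦋n⦌ => _ • bs R (⟨n, y⟩ : Smp (GS Y))) ?_
    change kanF F n (tcGroup x g) = tcGroup (F.app (n + 1) x) g
    rw [tcGroup, tcGroup, map_list_prod, List.map_ofFn]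
    congr 2
    ext r
    refine (kanF_kanTau F _).trans (congrArg _ ?_)
    exact F.nat _ _

end

/-! ### Front and back faces -/

/-- The front face `[0, …, i]_x`. -/
def fr {S : SSet.{u}} (x : Smp S) (i : ℕ) : Smp S := sb x i OrderHom.id

/-- The back face `[i, …, n]_x`. -/
def bk {S : SSet.{u}} (x : Smp S) (i : ℕ) : Smp S := sb x (x.1 - i) (iv i)

/-- The face `d_i x`. -/
def fc {S : SSet.{u}} (x : Smp S) (i : ℕ) : Smp S := sb x (x.1 - 1) (del i)

theorem fr_fst {S : SSet.{u}} (x : Smp S) (i : ℕ) : (fr x i).1 = i := rfl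
theorem bk_fst {S : SSet.{u}} (x : Smp S) (i : ℕ) : (bk x i).1 = x.1 - i := rfl
theorem fc_fst {S : SSet.{u}} (x : Smp S) (i : ℕ) : (fc x i).1 = x.1 - 1 := rfl

/-! ### The twisting cochain on based simplices -/

theorem stp_false_map (P : ℕ → Bool) (w : List ℕ) :
    stp false (w.map P) = stp true (w.map fun a => !P a) := by
  ext k
  rw [stp_apply, stp_apply, ← List.map_take, ← List.map_take]
  induction w.take k with
  | nil => rfl
  | cons a l ih =>
    rw [List.map_cons, List.map_cons, List.count_cons, List.count_cons, ih]
    cases P a <;> rfl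

theorem stp_map_eq (P : ℕ → Bool) (w : List ℕ) (k : ℕ) :
    stp true (w.map P) k = ((w.take k).filter P).length := by
  rw [stp_apply, ← List.map_take]
  induction w.take k with
  | nil => rfl
  | cons a l ih =>
    rw [List.map_cons, List.count_cons, ih, List.filter_cons]
    cases P a <;> simp

theorem take_filter (P : ℕ → Bool) (w : List ℕ) (k : ℕ) :
    (w.filter P).take (stp true (w.map P) k) = (w.take k).filter P := by
  rw [stp_map_eq]
  conv_lhs => rw [← List.take_append_drop k w, List.filter_append]
  rw [List.take_append_drop, List.take_left]

theorem length_filter_append {P : ℕ → Bool} {l l' : List ℕ} (h : ∀ a ∈ l, P a = true)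
    (h' : ∀ a ∈ l', P a = false) : ((l ++ l').filter P).length = l.length := by
  rw [List.filter_append, List.filter_eq_self.2 h, List.filter_eq_nil_iff.2, List.append_nil]
  exact fun a ha => by rw [h' a ha]; decide

theorem length_filter_not_append {P : ℕ → Bool} {l l' : List ℕ} (h : ∀ a ∈ l, P a = true)
    (h' : ∀ a ∈ l', P a = false) : ((l ++ l').filter fun a => !P a).length = l'.length := by
  rw [List.filter_append, List.filter_eq_nil_iff.2, List.filter_eq_self.2, List.nil_append]
  · exact fun a ha => by rw [h' a ha]; rfl
  · exact fun a ha => by rw [h a ha]; decide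

section

variable {R : Type r} [CommRing R] {X : SSet.{u}}

theorem dot_mul_bs {p q m : ℕ} (hm : m = p + q) (g : KanGroup X ⦋p⦌) (h : KanGroup X ⦋q⦌) :
    dot R (SMap.mul X) (bs R (⟨p, g⟩ : Smp (GS X))) (bs R (⟨q, h⟩ : Smp (GS X))) =
      W R m p fun A => bs R (⟨m, kanMap X (toHom m p (stp true A)) g *
        kanMap X (toHom m q (stp false A)) h⟩ : Smp (GS X)) := by
  rw [dot_apply, nab_bs (⟨p, g⟩ : Smp (GS X)) (⟨q, h⟩ : Smp (GS X)) hm rfl, W_map]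
  refine W_congr fun A _ _ => ?_
  rw [cm_bs]
  refine congrArg (fun k : KanGroup X ⦋m⦌ => bs R (⟨m, k⟩ : Smp (GS X))) ?_
  exact kanAct_self _ _

/-- The degeneracy that belongs to a shuffle repeats an entry of each row at every position of a
foreign letter. The rows of the full word do the same, because foreign letters do not raise the
running maximum. -/
theorem kanMap_tc_filter (x : Smp X) (b : ℕ) (P : ℕ → Bool) {m p : ℕ} {w rs : List ℕ}
    (hw : w.length = m) (hp : (w.filter P).length = p)
    (h : ∀ r ∈ rs, ∀ k ∈ w, P k = false → k ≤ r → k ≤ b) :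
    kanMap X (toHom m p (stp true (w.map P))) (tc x b p (w.filter P) rs) = tc x b m w rs := by
  refine kanMap_tc x b ?_ fun r hr k hk => ?_
  · rw [stp_map_eq, ← hw, List.take_length, hp]
  · rw [min_eq_left, take_filter, acc_filter]
    · exact fun a ha => h r hr a (List.mem_of_mem_take ha)
    · rw [stp_map_eq, ← hp]
      exact ((List.take_sublist k w).filter P).length_le

theorem dot_mul_PS {p q : ℕ} (l l' : List ℕ) (F G : List ℕ → Ch R (GS X)) :
    dot R (SMap.mul X) (PS R p l F) (PS R q l' G) =
      PS R p l fun u => PS R q l' fun u' => dot R (SMap.mul X) (F u) (G u') := by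
  rw [← LinearMap.flip_apply, PS_map]
  congr 1
  ext1 u
  rw [LinearMap.flip_apply, PS_map]

/-- Two permutations together with a shuffle amount to a permutation `w` of the union of both sets
of letters, with matching signs (`PS_append`). Both factors can be written with `w` itself: letters
above `p + 1` are invisible in the rows `r ≤ p`, and letters up to `p` lie below the starting value
`p + 1` of the other rows. -/
theorem dot_phiT {x : Smp X} {p q n : ℕ} (hx : x.1 = n + 2) (hn : p + q = n) :
    dot R (SMap.mul X) (phiT R (fr x (p + 1))) (phiT R (bk x (p + 1))) =
      PS R n (List.range' 1 p ++ List.range' (p + 2) q) fun w =>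
        bs R (⟨n, tc x 0 n w (List.range' 0 (p + 1)) *
          tc x (p + 1) n w (List.range' (p + 1) (q + 1))⟩ : Smp (GS X)) := by
  have hbk : bk x (p + 1) = sb x (q + 1) (iv (p + 1)) := by
    rw [bk, show x.1 - (p + 1) = q + 1 by omega]
  have h2 : List.range' (p + 2) q = (List.range' 1 q).map fun k => p + 1 + k := by
    rw [List.map_add_range']
  have h3 (u : List ℕ) : tc (sb x (q + 1) (iv (p + 1))) 0 q u (List.range' 0 (q + 1)) = _ :=
    tc_back x (p + 1) q u
  have h4 (u : List ℕ) : tc (fr x (p + 1)) 0 p u (List.range' 0 (p + 1)) = _ := tc_front x p u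
  rw [hbk, phiT_eq (n := p) (by rw [fr_fst]), phiT_eq (n := q) (by rw [sb_fst])]
  simp only [h3, h4]
  rw [dot_mul_PS]
  have h5 (u : List ℕ) := PS_map_list (R := R) (fun k => p + 1 + k) (n := q)
    (l := List.range' 1 q) (by simp) (fun u' => dot R (SMap.mul X)
      (bs R (⟨p, tc x 0 p u (List.range' 0 (p + 1))⟩ : Smp (GS X)))
      (bs R (⟨q, tc x (p + 1) q u' (List.range' (p + 1) (q + 1))⟩ : Smp (GS X))))
  simp only [← h5, ← h2]
  simp only [dot_mul_bs hn.symm]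
  simp only [← W_PS]
  rw [← PS_append (fun a => decide (a ≤ p)) hn (by simp) (by simp)
    (by intro a ha; rw [List.mem_range'_1] at ha; simp; omega)
    (by intro a ha; rw [List.mem_range'_1] at ha; simp; omega)]
  refine PS_congr (by simp [hn]) fun w hw => ?_
  have hl : w.length = n := by rw [hw.length_eq]; simp [hn]
  have hP : ∀ a ∈ List.range' 1 p, decide (a ≤ p) = true := fun a ha => by
    rw [List.mem_range'_1] at ha; simp; omega
  have hP' : ∀ a ∈ List.range' (p + 2) q, decide (a ≤ p) = false := fun a ha => by
    rw [List.mem_range'_1] at ha; simp; omega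
  have e1 := (hw.filter fun a => decide (a ≤ p)).length_eq.trans
    ((length_filter_append hP hP').trans List.length_range')
  have e2 := (hw.filter fun a => !decide (a ≤ p)).length_eq.trans
    ((length_filter_not_append hP hP').trans List.length_range')
  rw [stp_false_map, kanMap_tc_filter x 0 _ hl e1, kanMap_tc_filter x (p + 1) _ hl e2]
  · intro r hr k hk h _
    simp at h
    omega
  · intro r hr k hk h h'
    rw [List.mem_range'_1] at hr
    simp at h
    omega

/-- Sort the permutations by their first letter `t + 1`: `tc_cons` extracts the cone operator, and
what remains is the product computed in `dot_phiT`. -/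
theorem phiT_based {C : Cone X} {x : Smp X} (hx : C.Based x) {n : ℕ} (hn : x.1 = n + 2) :
    phiT R x = cD R C.kan (∑ t ∈ Finset.range (n + 1), (-1 : R) ^ t •
      dot R (SMap.mul X) (phiT R (fr x (t + 1))) (phiT R (bk x (t + 1)))) := by
  rw [phiT_eq (n := n + 1) (by rw [hn]), PS_succ, map_sum]
  refine Finset.sum_congr rfl fun t ht => ?_
  have ht' : t ≤ n := Nat.le_of_lt_succ (Finset.mem_range.1 ht)
  rw [map_smul, dot_phiT (p := t) (q := n - t) hn (by omega), PS_map]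
  have h1 : (List.range' 1 (n + 1)).eraseIdx t = List.range' 1 t ++ List.range' (t + 2) (n - t) := by
    have h : List.range' 1 (n + 1) = List.range' 1 t ++ (t + 1) :: List.range' (t + 2) (n - t) := by
      have h0 : (t + 1) :: List.range' (t + 2) (n - t) = List.range' (1 + t) (n - t + 1) := by
        rw [List.range'_succ, add_comm 1 t]
      rw [h0, List.range'_append_1]
      congr 1; omega
    rw [h, List.eraseIdx_append_of_length_le (by simp)]
    simp
  have h2 : (List.range' 1 (n + 1)).getD t 0 = t + 1 := by
    rw [List.getD_eq_getElem _ _ (by simp; omega)]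
    simp [add_comm]
  have h3 : List.range' 0 (n + 1 + 1) = List.range' 0 (t + 1) ++ List.range' (t + 1) (n - t + 1) := by
    rw [show n + 1 + 1 = (t + 1) + (n - t + 1) by omega, ← List.range'_append]
    simp
  rw [h1]
  congr 2
  ext1 w
  rw [cD_bs, h2, h3]
  exact congrArg (fun g : KanGroup X ⦋n + 1⦌ => bs R (⟨n + 1, g⟩ : Smp (GS X)))
    (tc_cons hx n (t + 1) (n - t + 1) w)

end

/-! ### Iterated faces -/

section

variable {S : SSet.{u}} (x : Smp S)

theorem sb_sb_congr {m m' l : ℕ} {f f' g g' : ℕ →o ℕ} (h : g l ≤ m) (h' : g' l ≤ m')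
    (e : ∀ k ≤ l, f (g k) = f' (g' k)) : sb (sb x m f) l g = sb (sb x m' f') l g' := by
  rw [sb_sb x f g h, sb_sb x f' g' h']
  exact sb_congr x rfl e

theorem sb_sb_eq {m l : ℕ} {f g f' : ℕ →o ℕ} (h : g l ≤ m)
    (e : ∀ k ≤ l, f (g k) = f' k) : sb (sb x m f) l g = sb x l f' := by
  rw [sb_sb x f g h]
  exact sb_congr x rfl e

theorem fr_fr {i j : ℕ} (h : j ≤ i) : fr (fr x i) j = fr x j :=
  sb_sb_eq x h fun _ _ => rfl

theorem bk_bk {i j : ℕ} (h : i + j ≤ x.1) : bk (bk x i) j = bk x (i + j) := by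
  rw [bk, bk_fst, bk, bk, Nat.sub_sub]
  exact sb_sb_eq x (by rw [iv_apply]; omega) fun k _ => by simp only [iv_apply]; omega

theorem bk_fr {i j : ℕ} (h : i + j ≤ x.1) : bk (fr x (i + j)) i = fr (bk x i) j := by
  rw [bk, fr_fst, fr, fr, bk, Nat.add_sub_cancel_left]
  refine sb_sb_congr x ?_ ?_ fun k _ => ?_
  · rw [iv_apply]
  · rw [oid_apply]; omega
  · rfl

theorem bk_zero : bk x 0 = x := sb_id x rfl fun k _ => by rw [iv_apply, zero_add]

theorem fr_fc_of_lt {i k : ℕ} (h : i < k) (hk : k ≤ x.1) : fr (fc x k) i = fr x i :=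
  sb_sb_eq x (by rw [oid_apply]; omega) fun j hj => by
    simp only [oid_apply]
    rw [del_apply, if_pos (by omega)]

theorem bk_fc_of_lt {i k : ℕ} (h : i < k) (hk : k ≤ x.1) :
    bk (fc x k) i = fc (bk x i) (k - i) := by
  rw [bk, fc_fst, fc, fc, bk_fst, bk, show x.1 - 1 - i = x.1 - i - 1 by omega]
  refine sb_sb_congr x ?_ ?_ fun j _ => ?_
  · rw [iv_apply]; omega
  · rw [del_apply]; split_ifs <;> omega
  · simp only [iv_apply, del_apply]
    split_ifs <;> omega

theorem fr_fc_of_le {i k : ℕ} (h : k ≤ i) (hi : i < x.1) : fr (fc x k) i = fc (fr x (i + 1)) k := by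
  rw [fr, fc, fc, fr_fst, fr, Nat.add_sub_cancel]
  refine sb_sb_congr x ?_ ?_ fun j _ => ?_
  · rw [oid_apply]; omega
  · rw [del_apply]; split_ifs <;> omega
  · simp only [oid_apply]

theorem bk_fc_of_le {i k : ℕ} (h : k ≤ i) (hi : i < x.1) : bk (fc x k) i = bk x (i + 1) := by
  rw [bk, fc_fst, fc, bk, show x.1 - 1 - i = x.1 - (i + 1) by omega]
  refine sb_sb_eq x ?_ fun j _ => ?_
  · rw [iv_apply]; omega
  · simp only [iv_apply, del_apply]
    split_ifs <;> omega

theorem fc_fc {i j : ℕ} (h : i ≤ j) (hj : j + 2 ≤ x.1) : fc (fc x (j + 1)) i = fc (fc x i) j := by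
  rw [fc, fc_fst, fc, fc, fc_fst, fc]
  refine sb_sb_congr x ?_ ?_ fun k _ => ?_
  · rw [del_apply]; split_ifs <;> omega
  · rw [del_apply]; split_ifs <;> omega
  · simp only [del_apply]
    split_ifs <;> omega

theorem SMap.fn_fr {T : SSet.{v}} (F : SMap S T) (i : ℕ) : F.fn (fr x i) = fr (F.fn x) i :=
  F.fn_sb _ _ _

theorem SMap.fn_bk {T : SSet.{v}} (F : SMap S T) (i : ℕ) : F.fn (bk x i) = bk (F.fn x) i :=
  F.fn_sb _ _ _

theorem SMap.fn_fc {T : SSet.{v}} (F : SMap S T) (i : ℕ) : F.fn (fc x i) = fc (F.fn x) i :=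
  F.fn_sb _ _ _

end

/-! ### Double sums over faces -/

section

variable {M : Type v} [AddCommGroup M]

theorem sum_range_tri (n : ℕ) (f : ℕ → ℕ → M) :
    ∑ i ∈ Finset.range (n + 1), ∑ j ∈ Finset.range (i + 1), f i j =
      ∑ j ∈ Finset.range (n + 1), ∑ l ∈ Finset.range (n - j + 1), f (j + l) j := by
  have := Finset.sum_range_diag_flip (n + 1) fun a b => f (a + b) a
  rw [Finset.sum_congr rfl fun i hi => Finset.sum_congr rfl fun j hj => ?_] at this
  · refine this.trans (Finset.sum_congr rfl fun j hj => ?_)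
    have := Finset.mem_range.1 hj
    rw [show n + 1 - j = n - j + 1 by omega]
  · have := Finset.mem_range.1 hj
    rw [show j + (i - j) = i by omega]

/-- Reindexes front and back faces of the `d_k x`: for `k > i` the face operator acts on the back
part, as its face number `k - i`, and for `k ≤ i` on the front part `[0, …, i + 1]`. The parameter
`a` decides whether `d_0` takes part. -/
theorem sum_faces {a : ℕ} (ha : a ≤ 1) (n : ℕ) (f h : ℕ → ℕ → M) :
    ∑ k ∈ Finset.Ico a n, (∑ i ∈ Finset.range k, f i (k - i) +
      ∑ i ∈ Finset.Ico k n, h (i + 1) k) =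
      ∑ i ∈ Finset.range (n + 1), ∑ k ∈ Finset.Ico 1 (n - i), f i k +
      ∑ i ∈ Finset.range (n + 1), ∑ k ∈ Finset.Ico a i, h i k := by
  rw [Finset.sum_add_distrib]
  congr 1
  · rw [Finset.sum_sigma', Finset.sum_sigma']
    refine Finset.sum_nbij' (fun p => ⟨p.2, p.1 - p.2⟩) (fun p => ⟨p.1 + p.2, p.1⟩) ?_ ?_ ?_ ?_ ?_
    all_goals
      rintro ⟨i, k⟩ hik
      simp only [Finset.mem_sigma, Finset.mem_Ico, Finset.mem_range] at hik ⊢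
    · omega
    · omega
    · congr 1; omega
    · congr 1; omega
  · rw [Finset.sum_sigma', Finset.sum_sigma']
    refine Finset.sum_nbij' (fun p => ⟨p.2 + 1, p.1⟩) (fun p => ⟨p.2, p.1 - 1⟩) ?_ ?_ ?_ ?_ ?_
    all_goals
      rintro ⟨i, k⟩ hik
      simp only [Finset.mem_sigma, Finset.mem_Ico, Finset.mem_range] at hik ⊢
    · omega
    · omega
    · congr 1
    · congr 1; omega

end

/-! ### The boundary of the twisting cochain -/

section

variable (R : Type r) [CommRing R] {X : SSet.{u}}

/-- The cup product `∑ (-1)^i φ[0, …, i]_x · φ[i, …, n]_x`. -/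
def phiCup (x : Smp X) : Ch R (GS X) :=
  ∑ i ∈ Finset.range (x.1 + 1), (-1 : R) ^ i •
    dot R (SMap.mul X) (phiT R (fr x i)) (phiT R (bk x i))

/-- The alternating sum of the `φ d_k x`, `0 < k < n`. -/
def phiFaces (x : Smp X) : Ch R (GS X) :=
  ∑ k ∈ Finset.Ico 1 x.1, (-1 : R) ^ k • phiT R (fc x k)

variable {R}

theorem cm_phiCup {Y : SSet.{v}} (F : SMap X Y) (x : Smp X) :
    cm R F.kan (phiCup R x) = phiCup R (F.fn x) := by
  rw [phiCup, map_sum]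
  refine Finset.sum_congr rfl fun i _ => ?_
  rw [map_smul, ← dot_mul_cm, cm_phiT, cm_phiT, F.fn_fr, F.fn_bk]

theorem cm_phiFaces {Y : SSet.{v}} (F : SMap X Y) (x : Smp X) :
    cm R F.kan (phiFaces R x) = phiFaces R (F.fn x) := by
  rw [phiFaces, map_sum]
  refine Finset.sum_congr rfl fun i _ => ?_
  rw [map_smul, cm_phiT, F.fn_fc]

theorem phiCup_eq {x : Smp X} {n : ℕ} (hn : x.1 = n + 2) :
    phiCup R x = -∑ t ∈ Finset.range (n + 1), (-1 : R) ^ t •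
      dot R (SMap.mul X) (phiT R (fr x (t + 1))) (phiT R (bk x (t + 1))) := by
  rw [phiCup, hn, Finset.sum_range_succ, Finset.sum_range_succ', phiT_zero (fr_fst x 0),
    map_zero, LinearMap.zero_apply, smul_zero, add_zero,
    phiT_zero (show (bk x (n + 2)).1 = 0 by rw [bk_fst]; omega), map_zero, smul_zero, add_zero,
    ← Finset.sum_neg_distrib]
  exact Finset.sum_congr rfl fun t _ => by rw [pow_succ, mul_neg_one, neg_smul]

theorem phiT_based' {C : Cone X} {x : Smp X} (hx : C.Based x) (hn : 2 ≤ x.1) :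
    phiT R x = -cD R C.kan (phiCup R x) := by
  obtain ⟨n, hn⟩ := Nat.exists_eq_add_of_le' hn
  rw [phiCup_eq hn, map_neg, neg_neg, phiT_based hx hn]

theorem phiCup_deg {x : Smp X} {n : ℕ} (hn : x.1 = n + 2) : phiCup R x ∈ deg R (GS X) n := by
  rw [phiCup_eq hn]
  refine Submodule.neg_mem _ (Submodule.sum_mem _ fun t ht => Submodule.smul_mem _ _ ?_)
  have := dot_deg (SMap.mul X) (phiT_deg (R := R) (x := fr x (t + 1)))
    (phiT_deg (R := R) (x := bk x (t + 1)))
  have ht' := Finset.mem_range.1 ht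
  rwa [fr_fst, bk_fst, show t + 1 - 1 + (x.1 - (t + 1) - 1) = n by omega] at this

/-- The Leibniz rule and the formula for lower dimensions produce triple products and products with
one inner face. The triple products cancel by associativity; the others assemble to the cup products
of the faces. -/
theorem bd_phiCup {x : Smp X} (ih : ∀ y : Smp X, y.1 < x.1 →
    bd R (GS X) (phiT R y) = phiFaces R y - phiCup R y) :
    bd R (GS X) (phiCup R x) = -∑ k ∈ Finset.Ico 1 x.1, (-1 : R) ^ k • phiCup R (fc x k) := by
  have h1 (i : ℕ) (hi : i ∈ Finset.range (x.1 + 1)) : bd R (GS X) ((-1 : R) ^ i •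
      dot R (SMap.mul X) (phiT R (fr x i)) (phiT R (bk x i))) =
      ((-1 : R) ^ i • dot R (SMap.mul X) (phiFaces R (fr x i)) (phiT R (bk x i)) -
        dot R (SMap.mul X) (phiT R (fr x i)) (phiFaces R (bk x i))) -
      ((-1 : R) ^ i • dot R (SMap.mul X) (phiCup R (fr x i)) (phiT R (bk x i)) -
        dot R (SMap.mul X) (phiT R (fr x i)) (phiCup R (bk x i))) := by
    have hi' := Finset.mem_range.1 hi
    rw [map_smul, bd_dot _ phiT_deg]
    have e1 : dot R (SMap.mul X) (bd R (GS X) (phiT R (fr x i))) (phiT R (bk x i)) =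
        dot R (SMap.mul X) (phiFaces R (fr x i)) (phiT R (bk x i)) -
        dot R (SMap.mul X) (phiCup R (fr x i)) (phiT R (bk x i)) := by
      -- For `i = n` the front face is `x` itself, to which the induction hypothesis does not apply;
      -- but then the other factor is zero.
      by_cases h : i < x.1
      · rw [ih _ (by rw [fr_fst]; exact h), map_sub, LinearMap.sub_apply]
      · rw [phiT_zero (x := bk x i) (by rw [bk_fst]; omega)]
        simp
    have e2 : (-1 : R) ^ i • (-1 : R) ^ ((fr x i).1 - 1) •
        dot R (SMap.mul X) (phiT R (fr x i)) (bd R (GS X) (phiT R (bk x i))) =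
        -(dot R (SMap.mul X) (phiT R (fr x i)) (phiFaces R (bk x i)) -
        dot R (SMap.mul X) (phiT R (fr x i)) (phiCup R (bk x i))) := by
      rcases i with _ | i
      · rw [phiT_zero (x := fr x 0) rfl]
        simp
      · rw [ih _ (by rw [bk_fst]; omega), map_sub, smul_smul, fr_fst, Nat.add_sub_cancel, pow_succ,
          mul_neg_one, neg_mul, ← pow_add, ← two_mul, pow_mul]
        simp
    rw [e1, smul_add, e2, smul_sub]
    abel
  rw [phiCup, map_sum, Finset.sum_congr rfl h1, Finset.sum_sub_distrib, Finset.sum_sub_distrib,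
    Finset.sum_sub_distrib]
  -- Both sides run over the triple products `φ[0, …, j] · φ[j, …, i] · φ[i, …, n]`.
  have h2 : ∑ i ∈ Finset.range (x.1 + 1),
      (-1 : R) ^ i • dot R (SMap.mul X) (phiCup R (fr x i)) (phiT R (bk x i)) =
      ∑ i ∈ Finset.range (x.1 + 1),
        dot R (SMap.mul X) (phiT R (fr x i)) (phiCup R (bk x i)) := by
    simp only [phiCup, map_sum, LinearMap.sum_apply, map_smul, LinearMap.smul_apply,
      Finset.smul_sum, smul_smul, dot_act_assoc]
    simp only [fr_fst, bk_fst]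
    rw [sum_range_tri]
    refine Finset.sum_congr rfl fun j hj => Finset.sum_congr rfl fun l hl => ?_
    rw [Finset.mem_range] at hj hl
    rw [fr_fr _ (by omega), bk_fr _ (by omega), bk_bk _ (by omega), ← pow_add,
      show j + l + j = 2 * j + l by omega, pow_add, pow_mul]
    simp
  rw [h2, sub_self, sub_zero]
  have h3 := sum_faces (le_refl 1) x.1
    (fun i k => (-1 : R) ^ k • dot R (SMap.mul X) (phiT R (fr x i)) (phiT R (fc (bk x i) k)))
    (fun i k => -((-1 : R) ^ i • (-1 : R) ^ k • dot R (SMap.mul X) (phiT R (fc (fr x i) k))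
      (phiT R (bk x i))))
  simp only [phiFaces, map_sum, LinearMap.sum_apply, map_smul, LinearMap.smul_apply,
      Finset.smul_sum, bk_fst, fr_fst]
  simp only [Finset.sum_neg_distrib] at h3
  rw [← neg_sub, ← sub_eq_add_neg] at *
  rw [← h3]
  congr 1
  refine Finset.sum_congr rfl fun k hk => ?_
  rw [Finset.mem_Ico] at hk
  rw [phiCup, fc_fst, show x.1 - 1 + 1 = x.1 by omega,
    ← Finset.sum_range_add_sum_Ico _ (show k ≤ x.1 by omega), smul_add, Finset.smul_sum,
    Finset.smul_sum, ← Finset.sum_neg_distrib]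
  congr 1
  · refine Finset.sum_congr rfl fun i hi => ?_
    rw [Finset.mem_range] at hi
    rw [fr_fc_of_lt _ hi (by omega), bk_fc_of_lt _ hi (by omega), smul_smul, ← pow_add]
    congr 1
    rw [show k + i = (k - i) + 2 * i by omega, pow_add, pow_mul]
    simp
  · refine Finset.sum_congr rfl fun i hi => ?_
    rw [Finset.mem_Ico] at hi
    rw [fr_fc_of_le _ hi.1 hi.2, bk_fc_of_le _ hi.1 hi.2, smul_smul, smul_smul, ← neg_smul]
    congr 1
    ring

theorem kanMap_kanTau_sbv (x : Smp X) {m n : ℕ} (f g : ℕ →o ℕ) :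
    kanMap X (toHom m n f) (kanTau (a := ⦋n⦌) (sbv x (n + 1) g)) =
      (kanTau (a := ⦋m⦌) (sbv x (m + 1) (g.comp (fsn m n f))))⁻¹ *
        kanTau (a := ⦋m⦌) (sbv x (m + 1) (g.comp (fex m n f))) := by
  have h1 := sbv_sb x g (fsn m n f) (m := n + 1) (l := m + 1)
    (by rw [fsn_apply]; split_ifs <;> omega)
  have h2 := sbv_sb x g (fex m n f) (m := n + 1) (l := m + 1)
    (by rw [fex_apply]; split_ifs <;> omega)
  rw [kanMap_toHom, ← h1, ← h2]
  rfl

theorem kanTau_faces (x : Smp X) (f g : ℕ →o ℕ) (i : ℕ) :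
    kanMap X (toHom 0 1 (del i)) (kanTau (a := ⦋1⦌) (sbv x 2 f) * kanTau (a := ⦋1⦌) (sbv x 2 g)) =
      (kanTau (a := ⦋0⦌) (sbv x 1 (f.comp (fsn 0 1 (del i)))))⁻¹ *
        kanTau (a := ⦋0⦌) (sbv x 1 (f.comp (fex 0 1 (del i)))) *
      ((kanTau (a := ⦋0⦌) (sbv x 1 (g.comp (fsn 0 1 (del i)))))⁻¹ *
        kanTau (a := ⦋0⦌) (sbv x 1 (g.comp (fex 0 1 (del i))))) := by
  rw [map_mul, kanMap_kanTau_sbv, kanMap_kanTau_sbv]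

/-- Here `φ x = τ[0,0,1] τ[0,1,2]`, with `d_0 φ x = τ[0,1] τ[1,2]` and `d_1 φ x = τ[0,2]`. This is
the start of the induction, since the cup product has degree `0` and `bd_cD` is not available. -/
theorem bd_phiT_two {x : Smp X} (h : x.1 = 2) :
    bd R (GS X) (phiT R x) = phiFaces R x - phiCup R x := by
  have hone (g : ℕ →o ℕ) (hg : g 1 = g 0) : kanTau (a := ⦋0⦌) (sbv x 1 g) = 1 :=
    kanTau_one x g (by rw [hg])
  have hc (g g' : ℕ →o ℕ) (h0 : g 0 = g' 0) (h1 : g 1 = g' 1) :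
      kanTau (a := ⦋0⦌) (sbv x 1 g) = kanTau (a := ⦋0⦌) (sbv x 1 g') := by
    refine congrArg _ (sbv_congr x fun k hk => ?_)
    rcases k with _ | k
    · exact congrArg (min · x.1) h0
    · obtain rfl : k = 0 := by omega
      exact congrArg (min · x.1) h1
  have e0 : phiT R x = bs R (⟨1, kanTau (a := ⦋1⦌) (sbv x 2 (rowF 0 1 0 [1])) *
      kanTau (a := ⦋1⦌) (sbv x 2 (rowF 0 1 1 [1]))⟩ : Smp (GS X)) := by
    rw [phiT_eq h, PS_succ, Finset.sum_range_one, pow_zero, one_smul, PS_zero]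
    refine congrArg (fun g : KanGroup X ⦋1⦌ => bs R (⟨1, g⟩ : Smp (GS X))) ?_
    change _ * (_ * 1) = _
    rw [mul_one]
    rfl
  have e1 : phiFaces R x = -bs R (⟨0, kanTau (a := ⦋0⦌) (sbv x 1 (del 1))⟩ : Smp (GS X)) := by
    rw [phiFaces, h, Finset.sum_Ico_eq_sum_range, Finset.sum_range_one, phiT_one (by rw [fc_fst, h])]
    rw [fc, sbv_sb _ _ _ (by rw [oid_apply, h])]
    simp
  have e2 : phiCup R x = -bs R (⟨0, kanTau (a := ⦋0⦌) (sbv x 1 OrderHom.id) *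
      kanTau (a := ⦋0⦌) (sbv x 1 (iv 1))⟩ : Smp (GS X)) := by
    rw [phiCup_eq h, Finset.sum_range_one, pow_zero, one_smul, phiT_one (fr_fst x 1),
      phiT_one (by rw [bk_fst, h]), dot_mul_bs rfl, W_zero_right]
    congr 1
    refine congrArg (fun g : KanGroup X ⦋0⦌ => bs R (⟨0, g⟩ : Smp (GS X))) ?_
    have hid (f : ℕ →o ℕ) (hf : f 0 = 0) (g : KanGroup X ⦋0⦌) : kanMap X (toHom 0 0 f) g = g := by
      rw [toHom_of_le_id, kanMap_id]
      · rfl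
      · intro k hk
        rw [Nat.le_zero.1 hk, hf]
    refine congrArg₂ (· * ·) ((hid _ (stp_zero _ _) _).trans ?_) ((hid _ (stp_zero _ _) _).trans ?_)
    · rw [fr, sbv_sb _ _ _ (by rw [oid_apply])]
      rfl
    · rw [bk, sbv_sb _ _ _ (by rw [oid_apply, h])]
      rfl
  rw [e0, e1, e2, bd_bs_pos (by exact one_ne_zero)]
  rw [Finset.sum_range_succ, Finset.sum_range_one, pow_zero, one_smul, pow_one, neg_one_smul,
    sub_neg_eq_add, add_comm]
  congr 1
  · congr 1
    refine congrArg (fun g : KanGroup X ⦋0⦌ => bs R (⟨0, g⟩ : Smp (GS X))) ?_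
    refine (kanTau_faces x _ _ 1).trans ?_
    rw [hone ((rowF 0 1 0 [1]).comp (fsn 0 1 (del 1))) rfl,
      hc ((rowF 0 1 0 [1]).comp (fex 0 1 (del 1))) OrderHom.id rfl rfl,
      hc ((rowF 0 1 1 [1]).comp (fsn 0 1 (del 1))) OrderHom.id rfl rfl,
      hc ((rowF 0 1 1 [1]).comp (fex 0 1 (del 1))) (del 1) rfl rfl]
    group
  · refine congrArg (fun g : KanGroup X ⦋0⦌ => bs R (⟨0, g⟩ : Smp (GS X))) ?_
    refine (kanTau_faces x _ _ 0).trans ?_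
    rw [hone ((rowF 0 1 0 [1]).comp (fsn 0 1 (del 0))) rfl,
      hc ((rowF 0 1 0 [1]).comp (fex 0 1 (del 0))) OrderHom.id rfl rfl,
      hone ((rowF 0 1 1 [1]).comp (fsn 0 1 (del 0))) rfl,
      hc ((rowF 0 1 1 [1]).comp (fex 0 1 (del 0))) (iv 1) rfl rfl]
    group

/-- The boundary of the twisting cochain. -/
theorem bd_phiT (x : Smp X) : bd R (GS X) (phiT R x) = phiFaces R x - phiCup R x := by
  induction hn : x.1 using Nat.strong_induction_on generalizing X with
  | _ n ih =>
  subst hn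
  by_cases h2 : x.1 < 2
  · have e1 : bd R (GS X) (phiT R x) = 0 := bd_deg_zero (by
      have := phiT_deg (R := R) (x := x)
      rwa [show x.1 - 1 = 0 by omega] at this)
    have e2 : phiFaces R x = 0 := by
      rw [phiFaces, Finset.Ico_eq_empty (by omega), Finset.sum_empty]
    have e3 : phiCup R x = 0 := by
      refine Finset.sum_eq_zero fun i _ => ?_
      by_cases hi : i = 0
      · rw [phiT_zero (x := fr x i) (by rw [fr_fst, hi]), map_zero, LinearMap.zero_apply, smul_zero]
      · rw [phiT_zero (x := bk x i) (by rw [bk_fst]; omega), map_zero, smul_zero]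
    rw [e1, e2, e3, sub_zero]
  by_cases h3 : x.1 = 2
  · exact bd_phiT_two h3
  obtain ⟨n, x⟩ := x
  rw [← SMap.cls_fundamental x, ← cm_phiT, bd_cm, ← cm_phiFaces, ← cm_phiCup, ← map_sub]
  congr 1
  dsimp only at h2 h3 ih
  clear x
  have hb := stdCone_based.{u} n
  set y : Smp (Δ[n] : SSet.{u}) := ⟨n, fundamental n⟩ with hy
  have hyn : y.1 = n := rfl
  -- From dimension three on, the cup product has positive degree and the faces still have dimension
  -- at least two, so that `bd_cD` and `phiT_based'` apply.
  obtain ⟨m, rfl⟩ : ∃ m, n = m + 3 := ⟨n - 3, by omega⟩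
  have key : cD R (stdCone (m + 3)).kan (∑ k ∈ Finset.Ico 1 y.1, (-1 : R) ^ k • phiCup R (fc y k)) =
      -phiFaces R y := by
    rw [map_sum, phiFaces, ← Finset.sum_neg_distrib]
    refine Finset.sum_congr rfl fun k hk => ?_
    rw [Finset.mem_Ico] at hk
    -- Only the faces with `0 < k < n` occur; they keep the vertex `0`, so their own values of `φ`
    -- are given by the recursion.
    have hk' : (stdCone (m + 3)).Based (fc y k) := hb.sb _ (by rw [del_apply, if_pos (by omega)])
    rw [map_smul, phiT_based' hk' (by rw [fc_fst]; omega), smul_neg, neg_neg]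
  rw [phiT_based' hb (by omega), map_neg, bd_cD _ (phiCup_deg (n := m + 1) (by omega)),
    bd_phiCup fun z hz => ih z.1 hz z rfl, map_neg, key]
  abel

end

/-! ### The twisted tensor product, without grading -/

/-- The total space of the tensor product of chains. -/
abbrev TT (R : Type r) [CommRing R] (X : SSet.{u}) (Z : SSet.{v}) : Type (max u v r) :=
  (Smp X × Smp Z) →₀ R

section

variable (R : Type r) [CommRing R] {X : SSet.{u}} {Γ : SimplicialObject GrpCat.{w}} {Z : SSet.{v}}

/-- The map `c ↦ x ⊗ c`. -/
def te (Z : SSet.{v}) (x : Smp X) : Ch R Z →ₗ[R] TT R X Z :=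
  Finsupp.lmapDomain R R fun z => (x, z)

variable {R}

theorem te_bs (x : Smp X) (z : Smp Z) : te R Z x (bs R z) = bs R (x, z) := by
  rw [te, bs, Finsupp.lmapDomain_apply, Finsupp.mapDomain_single, bs]

theorem tt_ext {M : Type w} [AddCommGroup M] [Module R M] {f g : TT R X Z →ₗ[R] M}
    (h : ∀ x c, f (te R Z x c) = g (te R Z x c)) : f = g :=
  lin_ext fun p => by
    obtain ⟨x, z⟩ := p
    rw [← te_bs, h]

variable (R)

/-- The sum `∑_{k < n} (-1)^k d_k x ⊗ c`. -/
def tA (Z : SSet.{v}) (x : Smp X) : Ch R Z →ₗ[R] TT R X Z :=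
  ∑ k ∈ Finset.range x.1, (-1 : R) ^ k • te R Z (fc x k)

variable (τ : TwistingFunction X Γ) (ρ : SimplicialAction Γ Z)

/-- The sum `∑ [0, …, i]_x ⊗ φ[i, …, n]_x · c`. -/
def tC (x : Smp X) : Ch R Z →ₗ[R] TT R X Z :=
  ∑ i ∈ Finset.range (x.1 + 1), te R Z (fr x i) ∘ₗ dot R (SMap.act τ ρ) (phiT R (bk x i))

/-- The part of the differential that does not involve the differential of the second factor. -/
def tL (x : Smp X) : Ch R Z →ₗ[R] TT R X Z := tA R Z x + (-1 : R) ^ x.1 • tC R τ ρ x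

/-- The differential of the twisted tensor product. -/
def td : TT R X Z →ₗ[R] TT R X Z :=
  Finsupp.linearCombination R fun p =>
    tL R τ ρ p.1 (bs R p.2) + (-1 : R) ^ p.1.1 • te R Z p.1 (bd R Z (bs R p.2))

variable {R}

theorem tA_apply (x : Smp X) (c : Ch R Z) :
    tA R Z x c = ∑ k ∈ Finset.range x.1, (-1 : R) ^ k • te R Z (fc x k) c := by
  simp [tA]

theorem tC_apply (x : Smp X) (c : Ch R Z) : tC R τ ρ x c = ∑ i ∈ Finset.range (x.1 + 1),
    te R Z (fr x i) (dot R (SMap.act τ ρ) (phiT R (bk x i)) c) := by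
  simp [tC]

theorem tL_apply (x : Smp X) (c : Ch R Z) :
    tL R τ ρ x c = tA R Z x c + (-1 : R) ^ x.1 • tC R τ ρ x c := rfl

theorem td_te (x : Smp X) (c : Ch R Z) :
    td R τ ρ (te R Z x c) = tL R τ ρ x c + (-1 : R) ^ x.1 • te R Z x (bd R Z c) := by
  refine lin_ext_apply (f := td R τ ρ ∘ₗ te R Z x)
    (g := tL R τ ρ x + (-1 : R) ^ x.1 • te R Z x ∘ₗ bd R Z) (fun z => ?_) c
  rw [LinearMap.comp_apply, te_bs, td, lin_bs]
  rfl

/-- The usual cancellation of iterated faces survives when the last face is omitted at both stages: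
the pairing `d_j d_i = d_i d_{j+1}` never leaves the remaining range. -/
theorem sum_tA_fc (x : Smp X) (c : Ch R Z) :
    ∑ k ∈ Finset.range x.1, (-1 : R) ^ k • tA R Z (fc x k) c = 0 := by
  have h (k : ℕ) (hk : k ∈ Finset.range x.1) : (-1 : R) ^ k • tA R Z (fc x k) c =
      ∑ j ∈ Finset.range k, (-1 : R) ^ (k + j) • te R Z (fc (fc x k) j) c +
      ∑ j ∈ Finset.Ico k (x.1 - 1), (-1 : R) ^ (k + j) • te R Z (fc (fc x k) j) c := by
    have := Finset.mem_range.1 hk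
    rw [tA_apply, Finset.smul_sum, fc_fst, ← Finset.sum_range_add_sum_Ico _
      (show k ≤ x.1 - 1 by omega)]
    simp only [smul_smul, ← pow_add]
  rw [Finset.sum_congr rfl h, Finset.sum_add_distrib, add_eq_zero_iff_eq_neg,
    ← Finset.sum_neg_distrib, Finset.sum_sigma']
  simp only [← Finset.sum_neg_distrib]
  rw [Finset.sum_sigma']
  refine Finset.sum_nbij' (fun p => ⟨p.2, p.1 - 1⟩) (fun p => ⟨p.2 + 1, p.1⟩) ?_ ?_ ?_ ?_ ?_
  all_goals
    rintro ⟨i, k⟩ hik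
    simp only [Finset.mem_sigma, Finset.mem_Ico, Finset.mem_range] at hik ⊢
  · omega
  · omega
  · congr 1; omega
  · congr 1
  · obtain ⟨i, rfl⟩ : ∃ j, i = j + 1 := ⟨i - 1, by omega⟩
    rw [Nat.add_sub_cancel, fc_fc x (by omega) (by omega), ← neg_smul]
    congr 1
    ring

theorem sum_tC_fr (x : Smp X) (c : Ch R Z) :
    ∑ i ∈ Finset.range (x.1 + 1), (-1 : R) ^ i •
      tC R τ ρ (fr x i) (dot R (SMap.act τ ρ) (phiT R (bk x i)) c) =
    ∑ i ∈ Finset.range (x.1 + 1), (-1 : R) ^ i •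
      te R Z (fr x i) (dot R (SMap.act τ ρ) (phiCup R (bk x i)) c) := by
  simp only [tC_apply, phiCup, map_sum, LinearMap.sum_apply, map_smul, LinearMap.smul_apply,
    Finset.smul_sum, smul_smul, dot_act_assoc]
  simp only [fr_fst, bk_fst]
  rw [sum_range_tri]
  refine Finset.sum_congr rfl fun j hj => Finset.sum_congr rfl fun l hl => ?_
  rw [Finset.mem_range] at hj hl
  rw [fr_fr _ (by omega), bk_fr _ (by omega), bk_bk _ (by omega), ← pow_add]

/-- Faces of the second part occur only for `0 < k`, faces of the first part from `k = 0` on; the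
last face is left out on both sides. -/
theorem sum_tC_fc (x : Smp X) (c : Ch R Z) :
    ∑ k ∈ Finset.range x.1, (-1 : R) ^ k • tC R τ ρ (fc x k) c =
    ∑ i ∈ Finset.range (x.1 + 1), (-1 : R) ^ i •
      te R Z (fr x i) (dot R (SMap.act τ ρ) (phiFaces R (bk x i)) c) +
    ∑ i ∈ Finset.range (x.1 + 1),
      tA R Z (fr x i) (dot R (SMap.act τ ρ) (phiT R (bk x i)) c) := by
  have h3 := sum_faces (M := TT R X Z) zero_le_one x.1
    (fun i k => (-1 : R) ^ i • (-1 : R) ^ k • te R Z (fr x i)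
      (dot R (SMap.act τ ρ) (phiT R (fc (bk x i) k)) c))
    (fun i k => (-1 : R) ^ k • te R Z (fc (fr x i) k)
      (dot R (SMap.act τ ρ) (phiT R (bk x i)) c))
  have h4 (i : ℕ) : (-1 : R) ^ i •
      te R Z (fr x i) (dot R (SMap.act τ ρ) (phiFaces R (bk x i)) c) =
      ∑ k ∈ Finset.Ico 1 (x.1 - i), (-1 : R) ^ i • (-1 : R) ^ k • te R Z (fr x i)
      (dot R (SMap.act τ ρ) (phiT R (fc (bk x i) k)) c) := by
    simp only [phiFaces, map_sum, LinearMap.sum_apply, map_smul, LinearMap.smul_apply,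
      Finset.smul_sum, bk_fst]
  have h5 (i : ℕ) : tA R Z (fr x i) (dot R (SMap.act τ ρ) (phiT R (bk x i)) c) =
      ∑ k ∈ Finset.Ico 0 i, (-1 : R) ^ k • te R Z (fc (fr x i) k)
      (dot R (SMap.act τ ρ) (phiT R (bk x i)) c) := by
    rw [tA_apply, fr_fst, Finset.range_eq_Ico]
  rw [Finset.sum_congr rfl fun i _ => h4 i, Finset.sum_congr rfl fun i _ => h5 i]
  refine Eq.trans ?_ h3
  rw [Finset.range_eq_Ico]
  refine Finset.sum_congr rfl fun k hk => ?_
  rw [Finset.mem_Ico] at hk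
  rw [tC_apply, fc_fst, show x.1 - 1 + 1 = x.1 by omega,
    ← Finset.sum_range_add_sum_Ico _ (show k ≤ x.1 by omega), smul_add, Finset.smul_sum,
    Finset.smul_sum]
  refine congrArg₂ (· + ·) ?_ ?_
  · refine Finset.sum_congr rfl fun i hi => ?_
    rw [Finset.mem_range] at hi
    rw [fr_fc_of_lt _ hi (by omega), bk_fc_of_lt _ hi (by omega), smul_smul, ← pow_add,
      Nat.add_sub_cancel' hi.le]
  · refine Finset.sum_congr rfl fun i hi => ?_
    rw [Finset.mem_Ico] at hi
    rw [fr_fc_of_le _ hi.1 hi.2, bk_fc_of_le _ hi.1 hi.2]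

theorem neg_one_pow_pred {n : ℕ} (h : 0 < n) : (-1 : R) ^ (n - 1) = -(-1) ^ n := by
  obtain ⟨n, rfl⟩ := Nat.exists_eq_succ_of_ne_zero h.ne'
  rw [Nat.succ_eq_add_one, Nat.add_sub_cancel, pow_succ]
  ring

theorem td_tA (x : Smp X) (c : Ch R Z) : td R τ ρ (tA R Z x c) =
    -((-1 : R) ^ x.1 • ∑ k ∈ Finset.range x.1, (-1 : R) ^ k • tC R τ ρ (fc x k) c) -
      (-1 : R) ^ x.1 • tA R Z x (bd R Z c) := by
  rw [← zero_add (-_), ← sum_tA_fc (R := R) (Z := Z) x c]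
  rw [tA_apply, map_sum, tA_apply, Finset.smul_sum, Finset.smul_sum, ← sub_eq_add_neg,
    ← Finset.sum_sub_distrib, ← Finset.sum_sub_distrib]
  refine Finset.sum_congr rfl fun k hk => ?_
  have := Finset.mem_range.1 hk
  rw [map_smul, td_te, tL_apply, fc_fst, neg_one_pow_pred (by omega)]
  simp only [smul_add, neg_smul, smul_neg, smul_comm ((-1 : R) ^ k) ((-1 : R) ^ x.1)]
  abel

theorem td_tC (x : Smp X) (c : Ch R Z) : td R τ ρ (tC R τ ρ x c) =
    ∑ k ∈ Finset.range x.1, (-1 : R) ^ k • tC R τ ρ (fc x k) c -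
      (-1 : R) ^ x.1 • tC R τ ρ x (bd R Z c) := by
  have h (i : ℕ) (hi : i ∈ Finset.range (x.1 + 1)) :
      td R τ ρ (te R Z (fr x i) (dot R (SMap.act τ ρ) (phiT R (bk x i)) c)) =
      tA R Z (fr x i) (dot R (SMap.act τ ρ) (phiT R (bk x i)) c) +
      (-1 : R) ^ i • te R Z (fr x i) (dot R (SMap.act τ ρ) (phiFaces R (bk x i)) c) +
      ((-1 : R) ^ i • tC R τ ρ (fr x i) (dot R (SMap.act τ ρ) (phiT R (bk x i)) c) -
      (-1 : R) ^ i • te R Z (fr x i) (dot R (SMap.act τ ρ) (phiCup R (bk x i)) c)) -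
      (-1 : R) ^ x.1 • te R Z (fr x i) (dot R (SMap.act τ ρ) (phiT R (bk x i)) (bd R Z c)) := by
    have hi' := Finset.mem_range.1 hi
    rw [td_te, tL_apply, bd_dot _ phiT_deg, bd_phiT, map_sub, LinearMap.sub_apply, map_add, map_sub,
      map_smul, bk_fst, fr_fst, smul_add, smul_smul, smul_sub]
    have e : ((-1 : R) ^ i * (-1) ^ (x.1 - i - 1)) •
        te R Z (fr x i) (dot R (SMap.act τ ρ) (phiT R (bk x i)) (bd R Z c)) =
        -((-1 : R) ^ x.1 •
          te R Z (fr x i) (dot R (SMap.act τ ρ) (phiT R (bk x i)) (bd R Z c))) := by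
      by_cases h : i = x.1
      · rw [phiT_zero (x := bk x i) (by rw [bk_fst]; omega)]
        simp
      · rw [← pow_add, show i + (x.1 - i - 1) = x.1 - 1 by omega, neg_one_pow_pred (by omega),
          neg_smul]
    rw [e]
    abel
  rw [tC_apply, map_sum, Finset.sum_congr rfl h, Finset.sum_sub_distrib, Finset.sum_add_distrib,
    Finset.sum_add_distrib, Finset.sum_sub_distrib, sum_tC_fr, sub_self, add_zero, sum_tC_fc,
    tC_apply, Finset.smul_sum]
  abel

/-- Inside `td_tC`, the terms quadratic in `φ` cancel against the cup product in `bd_phiT`. What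
`td_tA` and `td_tC` leave over is the same sum of the `tC (d_k x)` with opposite signs, and terms in
`d c` that cancel those of `x ⊗ d c`. -/
theorem td_td (t : TT R X Z) : td R τ ρ (td R τ ρ t) = 0 := by
  refine LinearMap.congr_fun (tt_ext (f := td R τ ρ ∘ₗ td R τ ρ) (g := 0) fun x c => ?_) t
  rw [LinearMap.comp_apply, td_te, map_add, tL_apply, map_add, map_smul, map_smul, td_tA, td_tC,
    td_te, bd_bd, map_zero, smul_zero, add_zero, tL_apply]
  simp only [smul_add, smul_sub, LinearMap.zero_apply]
  abel

end

/-! ### Comparison with the graded twisted tensor product -/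

section

variable {R : Type r} [CommRing R]

theorem δ_eq_fc {S : SSet.{u}} {n : ℕ} (x : S _⦋n + 1⦌) (i : Fin (n + 2)) :
    (⟨n, S.δ i x⟩ : Smp S) = fc ⟨n + 1, x⟩ i.val := by
  refine mk_map_eq x (SimplexCategory.δ i) (del i.val) fun k => ?_
  rw [δ_eq_toHom, toHom_apply]

theorem front_eq_fr {S : SSet.{u}} {i n : ℕ} (h : i ≤ n) (x : S _⦋n⦌) :
    (⟨i, S.map (frontMap h).op x⟩ : Smp S) = fr ⟨n, x⟩ i :=
  mk_map_eq x (frontMap h) OrderHom.id fun k => by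
    have := k.isLt
    change k.val = min k.val n
    omega

theorem back_eq_bk {S : SSet.{u}} {i k n : ℕ} (h : i + k = n) (x : S _⦋n⦌) :
    (⟨k, S.map (backMap h).op x⟩ : Smp S) = bk ⟨n, x⟩ i := by
  rw [bk, show (⟨n, x⟩ : Smp S).1 - i = k by simp only []; omega]
  refine mk_map_eq x (backMap h) (iv i) fun j => ?_
  have := j.isLt
  change i + j.val = min (i + j.val) n
  omega

theorem fc_last {S : SSet.{u}} (x : Smp S) {n : ℕ} (h : x.1 = n + 1) : fc x (n + 1) = fr x n := by
  rw [fc, fr, h]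
  refine sb_congr x rfl fun k hk => ?_
  rw [del_apply, oid_apply, if_pos (by omega)]

theorem bd_single {S : SSet.{u}} {n : ℕ} (x : S _⦋n + 1⦌) : bd R S (bs R ⟨n + 1, x⟩) =
    ∑ i : Fin (n + 2), (-1 : R) ^ i.val • bs R (⟨n, S.δ i x⟩ : Smp S) := by
  rw [bd_bs_pos (by exact Nat.succ_ne_zero n), Finset.sum_range]
  refine Finset.sum_congr rfl fun i _ => ?_
  rw [δ_eq_fc]
  rfl

end

/-! ### The graded and the ungraded differential -/

section

variable {R : Type r} [CommRing R]
variable {X : SSet.{u}} {Γ : SimplicialObject GrpCat.{w}} {Z : SSet.{v}}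
variable (τ : TwistingFunction X Γ) (ρ : SimplicialAction Γ Z)

/-- The unit of `GX`, as a chain. -/
def unitChain (R : Type r) [CommRing R] (X : SSet.{u}) : Ch R (GS X) :=
  bs R (⟨0, (1 : KanGroup X ⦋0⦌)⟩ : Smp (GS X))

theorem dot_unitChain (c : Ch R Z) : dot R (SMap.act τ ρ) (unitChain R X) c = c := by
  refine lin_ext_apply (g := LinearMap.id) (fun z => ?_) c
  rw [dot_apply, unitChain, nab_zero_left rfl rfl, cm_bs]
  refine congrArg (bs R) (Sigma.ext rfl (heq_of_eq ?_))
  have h1 : sbv (⟨0, (1 : KanGroup X ⦋0⦌)⟩ : Smp (GS X)) z.1 (stp true (List.replicate z.1 false)) =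
    (1 : KanGroup X ⦋z.1⦌) :=
    map_one (kanMap X (toHom z.1 0 (stp true (List.replicate z.1 false))))
  have h2 : sbv z z.1 OrderHom.id = z.2 := sbv_id z fun _ _ => rfl
  exact (congrArg₂ (fun g z => kanAct τ ρ g z) h1 h2).trans (kanAct_one τ ρ _)

theorem gr_phi {n : ℕ} (x : X _⦋n + 1⦌) :
    gr R (GS X) n (phi R x) = phiT R ⟨n + 1, x⟩ - if n = 0 then unitChain R X else 0 := by
  have h1 (g : KanGroup X ⦋n⦌) (a : R) : gr R (GS X) n (Finsupp.single g a) =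
    a • bs R (⟨n, g⟩ : Smp (GS X)) := gr_single (GS X) g a
  rw [phi]
  refine (map_sub (gr R (GS X) n) _ _).trans (congrArg₂ (· - ·) ?_ ?_)
  · exact (map_sum (gr R (GS X) n) _ _).trans (Finset.sum_congr rfl fun g _ => h1 _ _)
  · split_ifs with h
    · subst h
      exact (h1 1 1).trans (one_smul _ _)
    · exact map_zero (gr R (GS X) n)

variable (R X Z)

/-- The inclusion of the part of degree `m`. -/
def grT (m : ℕ) : Tensor R X Z m →ₗ[R] TT R X Z :=
  Finsupp.lmapDomain R R fun e => (⟨e.p, e.x⟩, ⟨e.q, e.z⟩)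

variable {R X Z}

theorem grT_single {m : ℕ} (e : TensorBasis X Z m) (a : R) :
    grT R X Z m (Finsupp.single e a) = a • te R Z ⟨e.p, e.x⟩ (bs R ⟨e.q, e.z⟩) := by
  rw [grT, Finsupp.lmapDomain_apply, Finsupp.mapDomain_single, te_bs, bs, Finsupp.smul_single_one]

theorem grT_injective (m : ℕ) : Function.Injective (grT R X Z m) := by
  refine Finsupp.mapDomain_injective fun e e' h => ?_
  obtain ⟨p, q, h1, x, z⟩ := e
  obtain ⟨p', q', h1', x', z'⟩ := e'
  rw [Prod.mk.injEq, Sigma.mk.injEq, Sigma.mk.injEq] at h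
  obtain ⟨⟨rfl, hx⟩, rfl, hz⟩ := h
  obtain rfl := eq_of_heq hx
  obtain rfl := eq_of_heq hz
  rfl

/-- The last face `d_{p+1} x = [0, …, p]_x` is split off; it is cancelled by the extra term in
`grT_dPhi`. -/
theorem grT_dLeft {m p q : ℕ} (h : p + 1 + q = m + 1) (x : X _⦋p + 1⦌) (z : Z _⦋q⦌) :
    grT R X Z m (dLeft R (p + 1) q h x z) =
      tA R Z ⟨p + 1, x⟩ (bs R ⟨q, z⟩) + (-1 : R) ^ (p + 1) • te R Z (fr ⟨p + 1, x⟩ p) (bs R ⟨q, z⟩) := by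
  rw [dLeft, map_sum, tA_apply, ← fc_last ⟨p + 1, x⟩ rfl, ← Finset.sum_range_succ, Finset.sum_range]
  refine Finset.sum_congr rfl fun i _ => ?_
  rw [grT_single]
  dsimp only
  rw [δ_eq_fc]

theorem grT_dRight {m p q : ℕ} (h : p + q = m + 1) (x : X _⦋p⦌) (z : Z _⦋q⦌) :
    grT R X Z m (dRight R p q h x z) = (-1 : R) ^ p • te R Z ⟨p, x⟩ (bd R Z (bs R ⟨q, z⟩)) := by
  rcases q with _ | q
  · rw [bd_bs_zero rfl, map_zero, smul_zero]
    exact map_zero _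
  · rw [dRight, map_sum, bd_single, map_sum, Finset.smul_sum]
    refine Finset.sum_congr rfl fun i _ => ?_
    rw [grT_single, map_smul, smul_smul]

theorem grT_mapDomain {m p q : ℕ} (h : p + q = m) (x : X _⦋p⦌) (c : Z _⦋q⦌ →₀ R) :
    grT R X Z m (Finsupp.mapDomain (fun z => (⟨p, q, h, x, z⟩ : TensorBasis X Z m)) c) =
      te R Z ⟨p, x⟩ (gr R Z q c) := by
  have : grT R X Z m ∘ₗ Finsupp.lmapDomain R R (fun z => (⟨p, q, h, x, z⟩ : TensorBasis X Z m)) =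
      te R Z ⟨p, x⟩ ∘ₗ gr R Z q := by
    refine lin_ext fun z => ?_
    rw [LinearMap.comp_apply, LinearMap.comp_apply, bs, Finsupp.lmapDomain_apply,
      Finsupp.mapDomain_single, grT_single, gr_single, map_smul]
  exact LinearMap.congr_fun this c

theorem grT_dPhi_term {n m i k q : ℕ} (hi : i ≤ n) (hk : i + (k + 1) = n) (hm : i + (k + q) = m)
    (x : X _⦋n⦌) (z : Z _⦋q⦌) : grT R X Z m (Finsupp.mapDomain
        (fun z' : Z _⦋k + q⦌ => (⟨i, k + q, hm, X.map (frontMap hi).op x, z'⟩ : TensorBasis X Z m))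
        (gDot R τ ρ rfl (phi R (X.map (backMap hk).op x)) z)) =
      te R Z (fr ⟨n, x⟩ i) (dot R (SMap.act τ ρ) (phiT R (bk ⟨n, x⟩ i)) (bs R ⟨q, z⟩)) -
        if k = 0 then te R Z (fr ⟨n, x⟩ i) (bs R ⟨q, z⟩) else 0 := by
  rw [grT_mapDomain, gr_gDot, gr_phi, front_eq_fr, back_eq_bk, map_sub, LinearMap.sub_apply, map_sub]
  congr 1
  split_ifs
  · rw [dot_unitChain]
  · simp

theorem grT_dPhi {m p q : ℕ} (h : p + 1 + q = m + 1) (x : X _⦋p + 1⦌) (z : Z _⦋q⦌) :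
    grT R X Z m (dPhi R τ ρ (p + 1) q h x z) =
      (-1 : R) ^ (p + 1) • tC R τ ρ ⟨p + 1, x⟩ (bs R ⟨q, z⟩) -
        (-1 : R) ^ (p + 1) • te R Z (fr ⟨p + 1, x⟩ p) (bs R ⟨q, z⟩) := by
  rw [dPhi, map_smul, map_sum, ← smul_sub]
  congr 1
  refine (Finset.sum_congr rfl fun i _ => grT_dPhi_term τ ρ _ _ _ x z).trans ?_
  rw [Finset.sum_sub_distrib, tC_apply, Finset.sum_range_succ,
    phiT_zero (x := bk (⟨p + 1, x⟩ : Smp X) (p + 1)) (by rw [bk_fst]; simp)]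
  congr 1
  · rw [map_zero, LinearMap.zero_apply, map_zero, add_zero, Finset.sum_range]
  -- The summand `-1` of `φ` occurs only on edges, that is, for the back face `[p, p + 1]_x`.
  · rw [Finset.sum_eq_single (Fin.last p)]
    · simp
    · intro i _ hi
      have := i.isLt
      have : i.val ≠ p := fun h => hi (Fin.ext h)
      rw [if_neg (by omega)]
    · simp

theorem grT_tensorDiff {m : ℕ} (t : Tensor R X Z (m + 1)) :
    grT R X Z m (tensorDiff R τ ρ m t) = td R τ ρ (grT R X Z (m + 1) t) := by
  refine LinearMap.congr_fun (f := grT R X Z m ∘ₗ tensorDiff R τ ρ m)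
    (g := td R τ ρ ∘ₗ grT R X Z (m + 1)) (lin_ext fun e => ?_) t
  rw [LinearMap.comp_apply, LinearMap.comp_apply, tensorDiff, lin_bs, bs, grT_single, one_smul,
    td_te, tL_apply, map_add, map_add, grT_dRight]
  obtain ⟨p, q, h, x, z⟩ := e
  rcases p with _ | p
  · have e1 : tA R Z ⟨0, x⟩ (bs R ⟨q, z⟩) = 0 := by rw [tA_apply, Finset.sum_range_zero]
    have e2 : tC R τ ρ ⟨0, x⟩ (bs R ⟨q, z⟩) = 0 := by
      rw [tC_apply, Finset.sum_range_one, phiT_zero (by rw [bk_fst, Nat.sub_zero]), map_zero,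
        LinearMap.zero_apply, map_zero]
    have e3 : grT R X Z m (dLeft R 0 q h x z) = 0 := map_zero _
    have e4 : grT R X Z m (dPhi R τ ρ 0 q h x z) = 0 := map_zero _
    dsimp only
    rw [e1, e2, e3, e4, smul_zero, add_zero, add_zero]
  · dsimp only
    rw [grT_dLeft, grT_dPhi]
    abel

theorem tensorDiff_comp (m : ℕ) : tensorDiff R τ ρ m ∘ₗ tensorDiff R τ ρ (m + 1) = 0 := by
  refine LinearMap.ext fun t => grT_injective m ?_
  rw [LinearMap.comp_apply, grT_tensorDiff, grT_tensorDiff, td_td, LinearMap.zero_apply, map_zero]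

end

/-! ### Naturality of the principal object -/

theorem SMap.ext' {S : SSet.{u}} {T : SSet.{v}} {F G : SMap S T}
    (h : ∀ n (s : S _⦋n⦌), F.app n s = G.app n s) : F = G := by
  obtain ⟨f, _⟩ := F
  obtain ⟨g, _⟩ := G
  obtain rfl : f = g := by
    ext n s
    exact h n s
  rfl

theorem SMap.cls_comp {X Y : SSet.{u}} (F : SMap X Y) {n : ℕ} (x : X _⦋n⦌) :
    F.comp (SMap.cls x) = SMap.cls (F.app n x) :=
  SMap.ext' fun m s => by
    obtain ⟨f, rfl⟩ := SSet.stdSimplex.objEquiv.symm.surjective s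
    exact F.nat f x

theorem SMap.cls_id (n : ℕ) : SMap.cls (fundamental.{u} n) = SMap.id _ :=
  SMap.ext' fun m s => by
    obtain ⟨f, rfl⟩ := SSet.stdSimplex.objEquiv.symm.surjective s
    rw [SMap.cls_app, fundamental, SSet.stdSimplex.map_objEquiv_symm, Category.comp_id]
    rfl

theorem kanF_comp {X : SSet.{u}} {Y : SSet.{v}} {V : SSet.{w}} (G : SMap Y V) (F : SMap X Y) {n : ℕ}
    (g : KanGroup X ⦋n⦌) : kanF G n (kanF F n g) = kanF (G.comp F) n g := by
  rw [← MonoidHom.comp_apply]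
  refine DFunLike.congr_fun (kanHom_ext fun (x : X _⦋n + 1⦌) => ?_) g
  refine (congrArg (kanF G n) (kanF_kanTau F x)).trans ?_
  exact (kanF_kanTau G _).trans (kanF_kanTau (G.comp F) x).symm

theorem kanF_id {X : SSet.{u}} {n : ℕ} (g : KanGroup X ⦋n⦌) : kanF (SMap.id X) n g = g :=
  DFunLike.congr_fun (g := MonoidHom.id _)
    (kanHom_ext fun (x : X _⦋n + 1⦌) => kanF_kanTau (SMap.id X) x) g

theorem SMap.principal_comp {X : SSet.{u}} {Y : SSet.{v}} {V : SSet.{w}} (G : SMap Y V)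
    (F : SMap X Y) : G.principal.comp F.principal = (G.comp F).principal :=
  SMap.ext' fun _ s => Prod.ext rfl (kanF_comp G F s.2)

theorem SMap.principal_id (X : SSet.{u}) : (SMap.id X).principal = SMap.id _ :=
  SMap.ext' fun _ s => Prod.ext rfl (kanF_id s.2)

section

variable {R : Type r} [CommRing R]
variable {X : SSet.{u}} {Γ : SimplicialObject GrpCat.{w}} {Z : SSet.{v}}
variable (τ : TwistingFunction X Γ) (ρ : SimplicialAction Γ Z)

/-! ### The map `Ψ` without grading -/

variable (R)

/-- The chain `Ψ (x ⊗ 1)`. -/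
def Pone (x : Smp X) : Ch R (principal X) :=
  cm R (SMap.cls x.2).principal (gr R (principal Δ[x.1]) x.1 (psiUniv R x.1))

/-- The map `Ψ`, without grading. -/
def Psi : TT R X Z →ₗ[R] Ch R (tcp τ ρ) :=
  Finsupp.linearCombination R fun p => dot R (SMap.tact τ ρ) (Pone R p.1) (bs R p.2)

/-- The map `Ψ` for the principal object. -/
abbrev PsiG (X : SSet.{u}) : TT R X (GS X) →ₗ[R] Ch R (principal X) :=
  Psi R (universalTwisting X) (selfAction (kanG X))

/-- The differential of `x ⊗ 1`. -/
abbrev tOne (x : Smp X) : TT R X (GS X) :=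
  tL R (universalTwisting X) (selfAction (kanG X)) x (unitChain R X)

variable {R}

theorem gr_psiOne {n : ℕ} (x : X _⦋n⦌) : gr R (principal X) n (psiOne R x) = Pone R ⟨n, x⟩ :=
  gr_evalAt x _

theorem gr_mem_deg {S : SSet.{u}} {n : ℕ} (c : S _⦋n⦌ →₀ R) : gr R S n c ∈ deg R S n := by
  induction c using Finsupp.induction_linear with
  | zero => rw [map_zero]; exact Submodule.zero_mem _
  | add a b ha hb => rw [map_add]; exact Submodule.add_mem _ ha hb
  | single s a => rw [gr_single]; exact Submodule.smul_mem _ _ (bs_mem_deg rfl)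

theorem Pone_deg (x : Smp X) : Pone R x ∈ deg R (principal X) x.1 := cm_deg _ (gr_mem_deg _)

theorem Psi_te (x : Smp X) (c : Ch R Z) :
    Psi R τ ρ (te R Z x c) = dot R (SMap.tact τ ρ) (Pone R x) c :=
  lin_ext_apply (f := Psi R τ ρ ∘ₗ te R Z x) (fun z => by
    rw [LinearMap.comp_apply, te_bs, Psi, lin_bs]) c

theorem gr_psi {m : ℕ} (t : Tensor R X Z m) :
    gr R (tcp τ ρ) m (psi R τ ρ m t) = Psi R τ ρ (grT R X Z m t) := by
  refine LinearMap.congr_fun (f := gr R (tcp τ ρ) m ∘ₗ psi R τ ρ m)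
    (g := Psi R τ ρ ∘ₗ grT R X Z m) (lin_ext fun e => ?_) t
  rw [LinearMap.comp_apply, LinearMap.comp_apply, psi, psiOf, lin_bs, bs, grT_single, one_smul,
    Psi_te, gr_principalDot, gr_evalAt]
  rfl

theorem cm_Pone {Y : SSet.{u}} (F : SMap X Y) (x : Smp X) :
    cm R F.principal (Pone R x) = Pone R (F.fn x) := by
  rw [Pone, cm_cm, SMap.principal_comp, SMap.cls_comp]
  rfl

theorem Pone_fundamental (n : ℕ) : Pone R (⟨n, fundamental n⟩ : Smp (Δ[n] : SSet.{u})) =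
    gr R (principal Δ[n]) n (psiUniv R n) := by
  rw [Pone]
  dsimp only
  rw [SMap.cls_id, SMap.principal_id, cm_id]

theorem Pone_zero (x : X _⦋0⦌) :
    Pone R (⟨0, x⟩ : Smp X) = bs R (⟨0, (x, (1 : KanGroup X ⦋0⦌))⟩ : Smp (principal X)) := by
  rw [Pone, psiUniv]
  refine (congrArg _ (gr_single (principal Δ[0]) _ 1)).trans ?_
  rw [one_smul, cm_bs]
  refine congrArg (fun s : X _⦋0⦌ × KanGroup X ⦋0⦌ => bs R (⟨0, s⟩ : Smp (principal X))) ?_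
  refine Prod.ext ?_ (map_one (kanF (SMap.cls x) 0))
  exact eq_of_heq (Sigma.mk.inj (SMap.cls_fundamental x)).2

theorem grT_tensorOne {n : ℕ} (x : X _⦋n⦌) :
    grT R X (GS X) n (tensorOne R x) = te R (GS X) ⟨n, x⟩ (unitChain R X) := by
  rw [tensorOne, grT_single, one_smul]
  rfl

theorem td_tOne (x : Smp X) : td R (universalTwisting X) (selfAction (kanG X))
    (te R (GS X) x (unitChain R X)) = tOne R x := by
  rw [td_te, unitChain, bd_bs_zero rfl, map_zero, smul_zero, add_zero]
  rfl

theorem Pone_succ (n : ℕ) : Pone R (⟨n + 1, fundamental (n + 1)⟩ : Smp (Δ[n + 1] : SSet.{u})) =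
    cD R (stdCone (n + 1)).principal
      (PsiG R _ (tOne R (⟨n + 1, fundamental (n + 1)⟩ : Smp (Δ[n + 1] : SSet.{u})))) := by
  rw [Pone_fundamental, psiUniv, gr_derivedOp]
  congr 1
  have h : psiOf R (universalTwisting (Δ[n + 1] : SSet.{u})) (selfAction (kanG Δ[n + 1]))
        (fun k => if _h : k < n + 1 then psiUniv R k else 0) n =
      psi R (universalTwisting Δ[n + 1]) (selfAction (kanG Δ[n + 1])) n := by
    refine lin_ext fun e => ?_
    -- In degree `n` all first factors have dimension at most `n`, so the default value in the
    -- recursion for `psiUniv` is never reached.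
    rw [psi, psiOf, psiOf, lin_bs, lin_bs, dif_pos (by have := e.add_eq; omega)]
  rw [h, ← td_tOne, ← grT_tensorOne, ← grT_tensorDiff]
  exact gr_psi _ _ _

theorem dot_mul_unitChain (c : Ch R (GS X)) : dot R (SMap.mul X) c (unitChain R X) = c := by
  refine lin_ext_apply (g := LinearMap.id) (f := (dot R (SMap.mul X)).flip (unitChain R X))
    (fun z => ?_) c
  rw [LinearMap.flip_apply, dot_apply, unitChain, nab_zero_right rfl rfl, cm_bs]
  refine congrArg (bs R) (Sigma.ext rfl (heq_of_eq ?_))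
  have h1 : sbv (⟨0, (1 : KanGroup X ⦋0⦌)⟩ : Smp (GS X)) z.1 (stp false (List.replicate z.1 true)) =
      (1 : KanGroup X ⦋z.1⦌) :=
    map_one (kanMap X (toHom z.1 0 (stp false (List.replicate z.1 true))))
  have h2 : sbv z z.1 OrderHom.id = z.2 := sbv_id z fun _ _ => rfl
  refine (kanAct_self _ _).trans ?_
  exact (congrArg₂ (fun g h : KanGroup X ⦋z.1⦌ => g * h) h2 h1).trans (mul_one _)

theorem tOne_eq (x : Smp X) : tOne R x =
    ∑ k ∈ Finset.range x.1, (-1 : R) ^ k • te R (GS X) (fc x k) (unitChain R X) +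
      (-1 : R) ^ x.1 • ∑ i ∈ Finset.range x.1, te R (GS X) (fr x i) (phiT R (bk x i)) := by
  rw [tOne, tL_apply, tA_apply, tC_apply, Finset.sum_range_succ,
    phiT_zero (x := bk x x.1) (by rw [bk_fst, Nat.sub_self]), map_zero, LinearMap.zero_apply,
    map_zero, add_zero]
  simp only [dot_mul_unitChain]

theorem tL_eq (x : Smp X) (c : Ch R Z) : tL R τ ρ x c =
    ∑ k ∈ Finset.range x.1, (-1 : R) ^ k • te R Z (fc x k) c + (-1 : R) ^ x.1 •
      ∑ i ∈ Finset.range x.1, te R Z (fr x i) (dot R (SMap.act τ ρ) (phiT R (bk x i)) c) := by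
  rw [tL_apply, tA_apply, tC_apply, Finset.sum_range_succ,
    phiT_zero (x := bk x x.1) (by rw [bk_fst, Nat.sub_self]), map_zero, LinearMap.zero_apply,
    map_zero, add_zero]

theorem PsiG_te_dot (x : Smp X) (a : Ch R (GS X)) (c : Ch R Z) :
    dot R (SMap.tact τ ρ) (PsiG R X (te R (GS X) x a)) c =
      Psi R τ ρ (te R Z x (dot R (SMap.act τ ρ) a c)) := by
  rw [Psi_te, Psi_te]
  exact dot_tact_assoc τ ρ _ _ _

/-- By associativity, `Ψ` is compatible with multiplication by chains on the right; so the
differential of `x ⊗ 1` determines the part of the differential of `x ⊗ c` that does not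
differentiate `c`. -/
theorem PsiG_tOne_dot (x : Smp X) (c : Ch R Z) :
    dot R (SMap.tact τ ρ) (PsiG R X (tOne R x)) c = Psi R τ ρ (tL R τ ρ x c) := by
  rw [tOne_eq, tL_eq]
  simp only [map_add, map_sum, map_smul, LinearMap.add_apply, LinearMap.sum_apply,
    LinearMap.smul_apply, PsiG_te_dot, dot_unitChain]

theorem cm_unitChain {Y : SSet.{v}} (F : SMap X Y) : cm R F.kan (unitChain R X) = unitChain R Y := by
  rw [unitChain, cm_bs]
  exact congrArg (fun g : KanGroup Y ⦋0⦌ => bs R (⟨0, g⟩ : Smp (GS Y))) (map_one (kanF F 0))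

theorem cm_PsiG_te {Y : SSet.{u}} (F : SMap X Y) (x : Smp X) (a : Ch R (GS X)) :
    cm R F.principal (PsiG R X (te R (GS X) x a)) =
      PsiG R Y (te R (GS Y) (F.fn x) (cm R F.kan a)) := by
  rw [Psi_te, Psi_te, ← cm_Pone]
  exact (dot_pmul_cm F _ _).symm

theorem cm_PsiG_tOne {Y : SSet.{u}} (F : SMap X Y) (x : Smp X) :
    cm R F.principal (PsiG R X (tOne R x)) = PsiG R Y (tOne R (F.fn x)) := by
  rw [tOne_eq, tOne_eq]
  simp only [map_add, map_sum, map_smul, cm_PsiG_te, cm_unitChain, cm_phiT, F.fn_fr, F.fn_fc, F.fn_bk]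
  rfl

/-- The Leibniz rule for `Ψ (x ⊗ 1) · c` reduces the chain map property to `x ⊗ 1`. -/
theorem bd_Psi_te {x : Smp X} (hx : bd R (principal X) (Pone R x) = PsiG R X (tOne R x))
    (c : Ch R Z) : bd R (tcp τ ρ) (Psi R τ ρ (te R Z x c)) = Psi R τ ρ (td R τ ρ (te R Z x c)) := by
  rw [Psi_te, bd_dot _ (Pone_deg x), hx, td_te, map_add, map_smul, Psi_te, PsiG_tOne_dot]

theorem PsiG_tOne_deg {x : Smp X} {n : ℕ} (hx : x.1 = n + 1) :
    PsiG R X (tOne R x) ∈ deg R (principal X) n := by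
  rw [tOne_eq, map_add, map_smul, map_sum, map_sum]
  refine Submodule.add_mem _ (Submodule.sum_mem _ fun k hk => ?_)
    (Submodule.smul_mem _ _ (Submodule.sum_mem _ fun i hi => ?_))
  · rw [map_smul, Psi_te]
    refine Submodule.smul_mem _ _ ?_
    have := dot_deg (SMap.pmul X) (Pone_deg (R := R) (fc x k))
      (c' := unitChain R X) (q := 0) (bs_mem_deg rfl)
    rwa [fc_fst, hx] at this
  · rw [Psi_te]
    have := dot_deg (SMap.pmul X) (Pone_deg (R := R) (fr x i)) (phiT_deg (R := R) (x := bk x i))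
    have hi' := Finset.mem_range.1 hi
    rwa [fr_fst, bk_fst, show i + (x.1 - i - 1) = n by omega] at this

/-- The differential of `x ⊗ 1` involves only first factors of lower dimension, on which `Ψ` already
commutes with the differentials; then `d² = 0` applies. -/
theorem bd_PsiG_tOne {x : Smp X}
    (ih : ∀ y : Smp X, y.1 < x.1 → bd R (principal X) (Pone R y) = PsiG R X (tOne R y)) :
    bd R (principal X) (PsiG R X (tOne R x)) = 0 := by
  have h : bd R (principal X) (PsiG R X (tOne R x)) =
      PsiG R X (td R (universalTwisting X) (selfAction (kanG X)) (tOne R x)) := by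
    rw [tOne_eq]
    simp only [map_add, map_sum, map_smul]
    refine congrArg₂ (· + ·) (Finset.sum_congr rfl fun k hk => ?_)
      (congrArg _ (Finset.sum_congr rfl fun i hi => ?_))
    · have := Finset.mem_range.1 hk
      exact congrArg _ (bd_Psi_te _ _ (ih _ (by rw [fc_fst]; omega)) _)
    · exact bd_Psi_te _ _ (ih _ (Finset.mem_range.1 hi)) _
  rw [h, ← td_tOne, td_td, map_zero]

theorem dot_pmul_zero (x : X _⦋0⦌) (g : KanGroup X ⦋0⦌) (h : KanGroup X ⦋0⦌) :
    dot R (SMap.pmul X) (bs R (⟨0, (x, g)⟩ : Smp (principal X))) (bs R (⟨0, h⟩ : Smp (GS X))) =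
      bs R (⟨0, (x, g * h)⟩ : Smp (principal X)) := by
  rw [dot_apply]
  refine (congrArg _ (nab_zero_zero (S := principal X) (T := GS X) _ _)).trans ?_
  rw [cm_bs]
  refine congrArg (fun s : X _⦋0⦌ × KanGroup X ⦋0⦌ => bs R (⟨0, s⟩ : Smp (principal X))) ?_
  exact Prod.ext rfl (kanAct_self g h)

theorem principal_fc_one {x : X _⦋1⦌} (g : KanGroup X ⦋1⦌) :
    fc (⟨1, (x, g)⟩ : Smp (principal X)) 1 =
      ⟨0, (sbv ⟨1, x⟩ 0 (del 1), kanTau (a := ⦋0⦌) (sbv ⟨1, x⟩ 1 OrderHom.id) *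
        kanMap X (toHom 0 1 (del 1)) g)⟩ := by
  refine congrArg (fun s : X _⦋0⦌ × KanGroup X ⦋0⦌ => (⟨0, s⟩ : Smp (principal X))) ?_
  refine Prod.ext rfl ?_
  change kanTau (a := ⦋0⦌) (X.map (snocMap (toHom 0 1 (del 1))).op x) * _ = _
  rw [snocMap_toHom]
  refine congrArg₂ (· * ·) (congrArg _ (sbv_congr ⟨1, x⟩ fun k hk => ?_)) rfl
  rcases k with _ | k
  · rfl
  · obtain rfl : k = 0 := by omega
    rfl

/-- For an edge, `Ψ (d (y ⊗ 1))` is the difference of `(d_0 y, 1)` and `(d_1 y, τ y)`. It has degree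
`0`, so the faces of the two cones must be computed directly. -/
theorem bd_Pone_one {C : Cone X} {y : Smp X} (hy : C.Based y) (h : y.1 = 1) :
    bd R (principal X) (cD R C.principal (PsiG R X (tOne R y))) = PsiG R X (tOne R y) := by
  have h1 : PsiG R X (tOne R y) =
      bs R (⟨0, (sbv y 0 (del 0), (1 : KanGroup X ⦋0⦌))⟩ : Smp (principal X)) -
      bs R (⟨0, (sbv y 0 OrderHom.id, kanTau (a := ⦋0⦌) (sbv y 1 OrderHom.id))⟩ :
        Smp (principal X)) := by
    have e1 : fc y 0 = ⟨0, sbv y 0 (del 0)⟩ := by rw [fc, h]; rfl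
    have e2 : fr y 0 = ⟨0, sbv y 0 OrderHom.id⟩ := rfl
    rw [tOne_eq, h, Finset.sum_range_one, Finset.sum_range_one, pow_zero, one_smul, pow_one,
      neg_one_smul, map_add, map_neg, Psi_te, Psi_te, bk_zero, phiT_one h, e1, e2, Pone_zero,
      Pone_zero, ← sub_eq_add_neg, unitChain]
    refine congrArg₂ (· - ·) ((dot_pmul_zero _ _ _).trans ?_) ((dot_pmul_zero _ _ _).trans ?_)
    · rw [mul_one]
    · rw [one_mul]
  have hD (f : ℕ →o ℕ) (n : ℕ) : C.D n (sbv y n f) = sbv y (n + 1) (cz f) :=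
    (eq_of_heq (Sigma.mk.inj (hy.sb_cz n f)).2).symm
  have ht1 (g : ℕ →o ℕ) (hg : g 1 = g 0) : kanTau (a := ⦋0⦌) (sbv y 1 g) = 1 :=
    kanTau_one y g (by rw [hg])
  have hs {f g : ℕ →o ℕ} (n : ℕ) (hfg : ∀ k ≤ n, f k = g k) : sbv y n f = sbv y n g :=
    sbv_congr y fun k hk => by rw [hfg k hk]
  rw [h1, map_sub, cD_bs, cD_bs, map_sub, bd_bs_pos (by exact one_ne_zero),
    bd_bs_pos (by exact one_ne_zero)]
  have hz (x : Smp (principal X)) (hx : x.1 = 0) : sb (C.principal.fn x) 0 (del 0) = x := by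
    have := C.principal.sb_zero x
    rwa [hx] at this
  have h2 (x : Smp (principal X)) (hx : x.1 = 0) :
      ∑ i ∈ Finset.range ((C.principal.fn x).1 + 1), (-1 : R) ^ i •
        bs R (sb (C.principal.fn x) ((C.principal.fn x).1 - 1) (del i)) =
      bs R x - bs R (fc (C.principal.fn x) 1) := by
    have e : (C.principal.fn x).1 = 1 := by rw [Cone.fn]; simp [hx]
    rw [e, Finset.sum_range_succ, Finset.sum_range_one, hz x hx, fc, e]
    simp [sub_eq_add_neg]
  rw [h2 _ rfl, h2 _ rfl]
  -- Both cones have the face `d_1` equal to the vertex `0` paired with `τ[0,1]_y`. For the first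
  -- this factor comes from the twisting, for the second from `d_1 τ[0,0,1]_y`.
  suffices h3 : fc (C.principal.fn
      (⟨0, (sbv y 0 (del 0), (1 : KanGroup X ⦋0⦌))⟩ : Smp (principal X))) 1 =
      fc (C.principal.fn (⟨0, (sbv y 0 OrderHom.id, kanTau (a := ⦋0⦌) (sbv y 1 OrderHom.id))⟩ :
        Smp (principal X))) 1 by
    rw [h3]; abel
  refine (principal_fc_one (x := C.D 0 (sbv y 0 (del 0))) (C.kanD 0 1)).trans
    (Eq.trans ?_ (principal_fc_one (x := C.D 0 (sbv y 0 OrderHom.id))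
      (C.kanD 0 (kanTau (a := ⦋0⦌) (sbv y 1 OrderHom.id)))).symm)
  rw [map_one, map_one, C.kanD_kanTau, hD, hD, hD, kanMap_kanTau_sbv]
  have hb1 (f g : ℕ →o ℕ) (n : ℕ) (hg : g n ≤ 1) :
      sbv (⟨1, sbv y 1 f⟩ : Smp X) n g = sbv y n (f.comp g) := sbv_sb y f g hg
  rw [hb1 _ _ _ (by decide), hb1 _ _ _ (by decide), hb1 _ _ _ (by decide), hb1 _ _ _ (by decide),
    ht1 ((cz OrderHom.id).comp OrderHom.id) rfl,
    ht1 ((cz OrderHom.id).comp (fsn 0 1 (del 1))) rfl, mul_one, inv_one, one_mul, one_mul]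
  refine congrArg (fun s : X _⦋0⦌ × KanGroup X ⦋0⦌ => (⟨0, s⟩ : Smp (principal X))) ?_
  refine Prod.ext (hs 0 fun k hk => ?_) (congrArg (kanTau (a := ⦋0⦌)) (hs 1 fun k hk => ?_))
  · obtain rfl : k = 0 := by omega
    rfl
  · rcases k with _ | k
    · rfl
    · obtain rfl : k = 0 := by omega
      rfl

/-- For fundamental simplices of dimension at least two, `∂ D Ψ (d (x ⊗ 1)) = Ψ (d (x ⊗ 1)) - D ∂ Ψ
(d (x ⊗ 1))`, and the last term is zero by induction. -/
theorem bd_Pone (x : Smp X) : bd R (principal X) (Pone R x) = PsiG R X (tOne R x) := by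
  induction hn : x.1 using Nat.strong_induction_on generalizing X with
  | _ n ih =>
  subst hn
  obtain ⟨n, x⟩ := x
  rcases n with _ | n
  · rw [tOne_eq, bd_deg_zero (Pone_deg (R := R) (⟨0, x⟩ : Smp X)), Finset.sum_range_zero,
      Finset.sum_range_zero, smul_zero, add_zero, map_zero]
  rw [← SMap.cls_fundamental x, ← cm_Pone, bd_cm, ← cm_PsiG_tOne]
  congr 1
  rcases n with _ | n
  · rw [Pone_succ, bd_Pone_one (stdCone_based 1) rfl]
  · rw [Pone_succ, bd_cD _ (PsiG_tOne_deg (n := n + 1) rfl), bd_PsiG_tOne, map_zero, sub_zero]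
    exact fun y hy => ih y.1 hy y rfl

theorem bd_Psi (t : TT R X Z) : bd R (tcp τ ρ) (Psi R τ ρ t) = Psi R τ ρ (td R τ ρ t) :=
  LinearMap.congr_fun (tt_ext (f := bd R (tcp τ ρ) ∘ₗ Psi R τ ρ) (g := Psi R τ ρ ∘ₗ td R τ ρ)
    fun x c => bd_Psi_te τ ρ (bd_Pone x) c) t

end

/-! ### The chain map in graded form -/

section

variable {R : Type r} [CommRing R]
variable {X : SSet.{u}} {Γ : SimplicialObject GrpCat.{w}} {Z : SSet.{v}}
variable (τ : TwistingFunction X Γ) (ρ : SimplicialAction Γ Z)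

theorem sum_hom_apply {M N : ModuleCat.{v} R} {n : ℕ} (f : Fin n → (M ⟶ N)) (x : M) :
    (∑ i, (-1 : ℤ) ^ i.val • f i).hom x = ∑ i, (-1 : R) ^ i.val • (f i).hom x := by
  rw [ModuleCat.hom_sum, LinearMap.sum_apply]
  refine Finset.sum_congr rfl fun i _ => ?_
  rw [ModuleCat.hom_zsmul, LinearMap.smul_apply, ← Int.cast_smul_eq_zsmul R]
  push_cast
  rfl

theorem gr_chains_d {S : SSet.{v}} (m : ℕ) (c : S _⦋m + 1⦌ →₀ R) :
    gr R S m (((chains R S).d (m + 1) m).hom c) = bd R S (gr R S (m + 1) c) := by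
  refine lin_ext_apply (f := gr R S m ∘ₗ ((chains R S).d (m + 1) m).hom)
    (g := bd R S ∘ₗ gr R S (m + 1)) (fun s => ?_) c
  have h : (chains R S).d (m + 1) m =
      ∑ i : Fin (m + 2), (-1 : ℤ) ^ i.val • (freeSimplicial R S).δ i :=
    AlgebraicTopology.AlternatingFaceMapComplex.obj_d_eq (freeSimplicial R S) m
  have h2 (i : Fin (m + 2)) : gr R S m (((freeSimplicial R S).δ i).hom (bs R s)) =
      bs R (⟨m, S.δ i s⟩ : Smp S) := by
    refine (congrArg (gr R S m) (Finsupp.mapDomain_single (f := S.map (SimplexCategory.δ i).op))).trans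
      ((gr_single S _ 1).trans (one_smul _ _))
  have h3 : gr R S (m + 1) (bs R s) = bs R (⟨m + 1, s⟩ : Smp S) :=
    (gr_single S s 1).trans (one_smul _ _)
  refine (congrArg (fun f => gr R S m (f.hom (bs R s))) h).trans ?_
  refine Eq.trans ?_ ((bd_single (R := R) s).symm.trans (congrArg (bd R S) h3.symm))
  refine (congrArg (gr R S m) (sum_hom_apply _ _)).trans ((map_sum (gr R S m) _ _).trans ?_)
  refine Finset.sum_congr rfl fun i _ => ?_
  rw [← h2]
  exact map_smul (gr R S m) _ _

theorem psiHom_comm (hd : ∀ m, tensorDiff R τ ρ m ∘ₗ tensorDiff R τ ρ (m + 1) = 0) (m : ℕ) :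
    psiHom R τ ρ (m + 1) ≫ (chains R (tcp τ ρ)).d (m + 1) m =
      (twistedTensor R τ ρ hd).d (m + 1) m ≫ psiHom R τ ρ m := by
  ext1
  refine LinearMap.ext fun t => gr_injective _ m ?_
  have h : (twistedTensor R τ ρ hd).d (m + 1) m = ModuleCat.ofHom (tensorDiff R τ ρ m) :=
    ChainComplex.of_d (fun m => ModuleCat.of R (Tensor R X Z m))
      (fun m => ModuleCat.ofHom (tensorDiff R τ ρ m)) m
  rw [h]
  refine (gr_chains_d (S := tcp τ ρ) m (psi R τ ρ (m + 1) t)).trans ?_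
  rw [gr_psi, bd_Psi, ← grT_tensorDiff, ← gr_psi]
  rfl

end

/-! ### The leading term of `Ψ` -/

section

variable (R : Type r) [CommRing R] {X : SSet.{u}}

/-- The chains in the principal object that live over a given set of simplices. -/
def lying (P : Smp X → Prop) : Submodule R (Ch R (principal X)) :=
  Finsupp.supported R R {s | P ⟨s.1, s.2.1⟩}

variable {R}

theorem bs_mem_over {P : Smp X → Prop} {s : Smp (principal X)} (h : P ⟨s.1, s.2.1⟩) :
    bs R s ∈ lying R P := Finsupp.single_mem_supported R _ h

theorem over_map {P : Smp X → Prop} {M : Type v} [AddCommGroup M] [Module R M]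
    {f : Ch R (principal X) →ₗ[R] M} {N : Submodule R M}
    (h : ∀ s : Smp (principal X), P ⟨s.1, s.2.1⟩ → f (bs R s) ∈ N) {c : Ch R (principal X)}
    (hc : c ∈ lying R P) : f c ∈ N := by
  rw [lying, Finsupp.supported_eq_span_single] at hc
  refine Submodule.span_le (p := N.comap f).2 ?_ hc
  rintro _ ⟨s, hs, rfl⟩
  exact h s hs

theorem over_mono {P Q : Smp X → Prop} (h : ∀ x, P x → Q x) : lying R P ≤ lying R Q :=
  Finsupp.supported_mono fun _ hs => h _ hs

/-- Right multiplication changes the base component only by degeneracies, so a set of simplices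
closed under simplicial operators is preserved. -/
theorem dot_over {P : Smp X → Prop} (hP : ∀ x m f, P x → P (sb x m f)) {c : Ch R (principal X)}
    (hc : c ∈ lying R P) (c' : Ch R (GS X)) : dot R (SMap.pmul X) c c' ∈ lying R P := by
  refine over_map (f := (dot R (SMap.pmul X)).flip c') (fun s hs => ?_) hc
  rw [LinearMap.flip_apply]
  refine Finsupp.induction_linear c' ?_ (fun a b ha hb => ?_) (fun t a => ?_)
  · rw [map_zero]; exact Submodule.zero_mem _
  · rw [map_add]; exact Submodule.add_mem _ ha hb
  · rw [← Finsupp.smul_single_one, map_smul, dot_apply]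
    refine Submodule.smul_mem _ _ ?_
    change cm R (SMap.pmul X) (nab R _ _ (bs R s) (bs R t)) ∈ _
    rw [nab_bs s t rfl rfl, W_map]
    refine W_mem fun w _ _ => ?_
    rw [cm_bs]
    exact bs_mem_over (hP ⟨s.1, s.2.1⟩ _ _ hs)

theorem dot_pmul_unitChain (c : Ch R (principal X)) :
    dot R (SMap.pmul X) c (unitChain R X) = c := by
  refine lin_ext_apply (g := LinearMap.id) (f := (dot R (SMap.pmul X)).flip (unitChain R X))
    (fun z => ?_) c
  rw [LinearMap.flip_apply, dot_apply, unitChain, nab_zero_right rfl rfl, cm_bs]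
  refine congrArg (bs R) (Sigma.ext rfl (heq_of_eq ?_))
  have h1 : sbv (⟨0, (1 : KanGroup X ⦋0⦌)⟩ : Smp (GS X)) z.1 (stp false (List.replicate z.1 true)) =
      (1 : KanGroup X ⦋z.1⦌) :=
    map_one (kanMap X (toHom z.1 0 (stp false (List.replicate z.1 true))))
  have h2 : sbv z z.1 OrderHom.id = z.2 := sbv_id z fun _ _ => rfl
  have h3 : (sbv z z.1 OrderHom.id).1 = z.2.1 := by rw [h2]
  have h4 : (sbv z z.1 OrderHom.id).2 = z.2.2 := by rw [h2]
  refine Prod.ext h3 ?_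
  refine (kanAct_self _ _).trans ?_
  exact (congrArg₂ (fun g h : KanGroup X ⦋z.1⦌ => g * h) 
    h4 h1).trans (mul_one _)

/-- The faces of `y` that do not contain all vertices `k, k + 1, …` of `y`. -/
def Miss (k : ℕ) (y z : Smp X) : Prop :=
  ∃ m f j, k ≤ j ∧ j ≤ y.1 ∧ (∀ l, min (f l) y.1 ≠ j) ∧ z = sb y m f

/-- A self-map of `ℕ` truncated at a given value. -/
def trunc (n : ℕ) (f : ℕ →o ℕ) : ℕ →o ℕ := ⟨fun k => min (f k) n, fun _ _ h =>
  min_le_min_right n (f.monotone h)⟩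

theorem sb_sb_trunc {S : SSet.{u}} (y : Smp S) (m l : ℕ) (f g : ℕ →o ℕ) :
    sb (sb y m f) l g = sb y l (f.comp (trunc m g)) := by
  rw [← sb_sb y f (trunc m g) (min_le_right _ _)]
  refine sb_congr_min _ rfl fun k hk => ?_
  change min (g k) m = min (min (g k) m) m
  rw [min_assoc, min_self]

theorem Miss.face {y x z : Smp X} {k : ℕ} {m : ℕ} {f : ℕ →o ℕ} (hx : x = Brown.sb y m f)
    {j : ℕ} (hk : k ≤ j) (hj : j ≤ y.1) (hf : ∀ l ≤ m, min (f l) y.1 ≠ j)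
    (hz : ∃ l g, z = Brown.sb x l g) : Miss k y z := by
  subst hx
  obtain ⟨l, g, rfl⟩ := hz
  exact ⟨l, f.comp (trunc m g), j, hk, hj, fun i => hf _ (min_le_right _ _), sb_sb_trunc y m l f g⟩

theorem Pone_mem_over (x : Smp X) : Pone R x ∈ lying R fun z => ∃ m f, z = sb x m f := by
  rw [Pone]
  generalize gr R (principal Δ[x.1]) x.1 (psiUniv R x.1) = c
  refine Finsupp.induction_linear c ?_ (fun a b ha hb => ?_) (fun t a => ?_)
  · rw [map_zero]; exact Submodule.zero_mem _
  · rw [map_add]; exact Submodule.add_mem _ ha hb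
  · rw [← Finsupp.smul_single_one, map_smul]
    refine Submodule.smul_mem _ _ ?_
    change cm R _ (bs R t) ∈ _
    rw [cm_bs]
    refine bs_mem_over ?_
    obtain ⟨m, s, g⟩ := t
    obtain ⟨f, rfl⟩ := SSet.stdSimplex.objEquiv.symm.surjective s
    exact ⟨m, homFun f, (sb_eq_map x.2 f).symm⟩

theorem sb_sb_of_closed (x y : Smp X) (m : ℕ) (f : ℕ →o ℕ) (h : ∃ l g, x = sb y l g) :
    ∃ l g, sb x m f = sb y l g := by
  obtain ⟨l, g, rfl⟩ := h
  exact ⟨m, g.comp (trunc l f), sb_sb_trunc y l m g f⟩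

theorem PsiG_te_over (x : Smp X) (c : Ch R (GS X)) :
    PsiG R X (te R (GS X) x c) ∈ lying R fun z => ∃ m f, z = sb x m f := by
  rw [Psi_te]
  exact dot_over (fun z m f hz => sb_sb_of_closed z x m f hz) (Pone_mem_over x) c

/-- The chain `(x, 1)`. -/
def lead (R : Type r) [CommRing R] (x : Smp X) : Ch R (principal X) :=
  bs R (⟨x.1, (x.2, (1 : KanGroup X ⦋x.1⦌))⟩ : Smp (principal X))

theorem cm_lead {Y : SSet.{u}} (F : SMap X Y) (x : Smp X) :
    cm R F.principal (lead R x) = lead R (F.fn x) := by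
  rw [lead, cm_bs]
  exact congrArg (fun g : KanGroup Y ⦋x.1⦌ => bs R (⟨x.1, (F.app x.1 x.2, g)⟩ : Smp (principal Y)))
    (map_one (kanF F x.1))

theorem cD_lead (C : Cone X) (x : Smp X) : cD R C.principal (lead R x) = lead R (C.fn x) := by
  rw [lead, cD_bs]
  exact congrArg (fun g : KanGroup X ⦋x.1 + 1⦌ =>
    bs R (⟨x.1 + 1, (C.D x.1 x.2, g)⟩ : Smp (principal X))) (map_one (C.kanD x.1))

theorem Miss.fn {Y : SSet.{v}} (F : SMap X Y) {k : ℕ} {y z : Smp X} (h : Miss k y z) :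
    Miss k (F.fn y) (F.fn z) := by
  obtain ⟨m, f, j, h1, h2, h3, rfl⟩ := h
  exact ⟨m, f, j, h1, h2, h3, F.fn_sb y m f⟩

/-- The cone operator adds only the vertex `0`, so a missing vertex `j ≥ 1` stays missing. -/
theorem Miss.cone {C : Cone X} {y z : Smp X} (hy : C.Based y) (h : Miss 1 y z) :
    Miss 0 y (C.fn z) := by
  obtain ⟨m, f, j, h1, h2, h3, rfl⟩ := h
  refine ⟨m + 1, cz f, j, Nat.zero_le _, h2, fun l => ?_, (hy.sb_cz m f).symm⟩
  rw [cz_apply]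
  split_ifs
  · omega
  · exact h3 _

/-- Modulo simplices that miss a vertex `j ≥ 1`, the chain `Ψ (d (y ⊗ 1))` is `(d_0 y, 1)`: a face
`d_{k+1} y` misses `k + 1`, and the front faces `[0, …, i]` with `i ≤ n` miss `n + 1`. Applying `D`
turns `d_0 y` into `y`. -/
theorem cD_PsiG_tOne {C : Cone X} {y : Smp X} (hy : C.Based y) {n : ℕ} (hn : y.1 = n + 1)
    (ih : Pone R (fc y 0) - lead R (fc y 0) ∈ lying R (Miss 0 (fc y 0))) :
    cD R C.principal (PsiG R X (tOne R y)) - lead R y ∈ lying R (Miss 0 y) := by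
  have h0 : cD R C.principal (lead R (fc y 0)) = lead R y := by
    rw [cD_lead, fc, hy.fn_face (by omega)]
  have h1 : PsiG R X (tOne R y) - lead R (fc y 0) ∈ lying R (Miss 1 y) := by
    rw [tOne_eq, hn, Finset.sum_range_succ', pow_zero, one_smul, map_add, map_add, map_smul,
      Psi_te _ _ (fc y 0), add_right_comm, add_sub_assoc]
    refine Submodule.add_mem _ (Submodule.add_mem _ ?_ (Submodule.smul_mem _ _ ?_)) ?_
    · rw [map_sum]
      refine Submodule.sum_mem _ fun k hk => ?_
      have hk := Finset.mem_range.1 hk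
      rw [map_smul]
      refine Submodule.smul_mem _ _ (over_mono (fun z hz => ?_) (PsiG_te_over (fc y (k + 1)) _))
      refine Miss.face (j := k + 1) rfl (by omega) (by omega) (fun l hl => ?_) hz
      rw [del_apply]
      split_ifs <;> omega
    · rw [map_sum]
      refine Submodule.sum_mem _ fun i hi => ?_
      have hi := Finset.mem_range.1 hi
      refine over_mono (fun z hz => ?_) (PsiG_te_over (fr y i) _)
      refine Miss.face (j := n + 1) rfl (by omega) (by omega) (fun l hl => ?_) hz
      rw [oid_apply]
      omega
    · rw [show dot R (SMap.tact (universalTwisting X) (selfAction (kanG X))) (Pone R (fc y 0))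
        (unitChain R X) = Pone R (fc y 0) from dot_pmul_unitChain _]
      refine over_mono (fun z hz => ?_) ih
      -- The vertex `j` of `d_0 y` is the vertex `j + 1` of `y`, so it is not the vertex that the
      -- cone operator restores.
      obtain ⟨m, f, j, -, h2, h3, rfl⟩ := hz
      rw [fc_fst] at h2 h3
      refine ⟨m, (del 0).comp (trunc (y.1 - 1) f), j + 1, by omega, by omega, fun l => ?_, sb_sb_trunc y _ m (del 0) f⟩
      have := h3 l
      change min (del 0 (min (f l) (y.1 - 1))) y.1 ≠ j + 1
      rw [del_apply, if_neg (by omega)]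
      omega
  rw [← h0, ← map_sub]
  exact over_map (fun s hs => by
    rw [cD_bs]
    exact bs_mem_over (Miss.cone hy hs)) h1

theorem Pone_sub_lead (x : Smp X) : Pone R x - lead R x ∈ lying R (Miss 0 x) := by
  induction hn : x.1 generalizing X with
  | zero =>
    obtain ⟨n, x⟩ := x
    obtain rfl : n = 0 := hn
    rw [Pone_zero, lead, sub_self]
    exact Submodule.zero_mem _
  | succ n ih =>
    obtain ⟨m, x⟩ := x
    obtain rfl : m = n + 1 := hn
    rw [← SMap.cls_fundamental x, ← cm_Pone, ← cm_lead, ← map_sub]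
    have h := cD_PsiG_tOne (R := R) (stdCone_based (n + 1)) rfl
      (ih (fc (⟨n + 1, fundamental (n + 1)⟩ : Smp (Δ[n + 1] : SSet.{u})) 0) rfl)
    rw [← Pone_succ] at h
    exact over_map (fun s hs => by
      rw [cm_bs]
      exact bs_mem_over (Miss.fn (SMap.cls x) hs)) h

theorem Miss.mem_skeleton {n m : ℕ} {x : X _⦋n⦌} {y : X _⦋m⦌} (h : Miss 0 (⟨n, x⟩ : Smp X) ⟨m, y⟩) :
    y ∈ (X.skeleton n).obj (op ⦋m⦌) := by
  obtain ⟨m', f, j, -, h2, h3, h4⟩ := h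
  obtain rfl : m' = m := (congrArg Sigma.fst h4).symm
  have h4 := eq_of_heq (Sigma.mk.inj h4).2
  simp only at h2 h3
  rcases n with _ | n
  · exact absurd (h3 0) (by omega)
  -- A map that omits the value `j` factors through `del j`. For `j = 0` the truncated difference
  -- gives `dup 0`, which lowers all positive values by one, as required.
  have h5 : y = sbv (Brown.sb (⟨n + 1, x⟩ : Smp X) n (del j)) m' ((dup (j - 1)).comp (trunc (n + 1) f)) := by
    rw [h4, sbv_sb]
    · refine sbv_congr _ fun k hk => ?_
      have h6 := h3 k
      change min (f k) (n + 1) = min (del j (dup (j - 1) (min (f k) (n + 1)))) (n + 1)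
      rw [dup_apply, del_apply]
      split_ifs <;> omega
    · have h6 := h3 m'
      change dup (j - 1) (min (f m') (n + 1)) ≤ n
      rw [dup_apply]
      split_ifs <;> omega
  rw [h5]
  exact (X.skeleton (n + 1)).map _ (X.mem_skeleton _ (Nat.lt_succ_self n))

theorem psiOne_sub_pairOne {n : ℕ} (x : X _⦋n⦌) :
    psiOne R x - pairOne R x ∈ skeletalFiltration R X n n := by
  have h1 : gr R (principal X) n (psiOne R x - pairOne R x) ∈ lying R (Miss 0 ⟨n, x⟩) := by
    rw [map_sub, gr_psiOne]
    have : gr R (principal X) n (pairOne R x) = lead R ⟨n, x⟩ :=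
      (gr_single (principal X) _ 1).trans (one_smul _ _)
    rw [this]
    exact Pone_sub_lead _
  generalize psiOne R x - pairOne R x = c at h1
  rw [← Finsupp.sum_single c]
  refine Submodule.sum_mem _ fun s hs => ?_
  rw [← Finsupp.smul_single_one]
  refine Submodule.smul_mem _ _ (Submodule.subset_span ⟨s.1, s.2, ?_, rfl⟩)
  have h2 : (⟨n, s⟩ : Smp (principal X)) ∈ (gr R (principal X) n c).support := by
    have : gr R (principal X) n c ⟨n, s⟩ = c s :=
      Finsupp.mapDomain_apply (f := fun s => (⟨n, s⟩ : Smp (principal X)))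
        (fun _ _ h => eq_of_heq (Sigma.mk.inj h).2) c s
    rw [Finsupp.mem_support_iff, this]
    exact Finsupp.mem_support_iff.1 hs
  exact Miss.mem_skeleton ((Finsupp.mem_supported R _).1 h1 h2)

end

/-! ### Reduction to standard simplices -/

/-- The simplices that are degeneracies of simplices of dimension `< p`. -/
def Rk {S : SSet.{u}} (p : ℕ) (x : Smp S) : Prop :=
  ∃ n, n < p ∧ ∃ (y : S _⦋n⦌) (f : ⦋x.1⦌ ⟶ ⦋n⦌), x.2 = S.map f.op y

theorem Rk.lt_of_nonDegenerate {S : SSet.{u}} {p n : ℕ} {y : S _⦋n⦌} (hy : y ∈ S.nonDegenerate n)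
    (h : Rk p (⟨n, y⟩ : Smp S)) : n < p := by
  obtain ⟨m, hm, z, f, hz⟩ := h
  refine (S.mem_skeleton_obj_iff_of_nonDegenerate ⟨y, hy⟩ p).1 ?_
  change y ∈ _
  rw [show y = S.map f.op z from hz]
  exact (S.skeleton p).map _ (S.mem_skeleton z hm)

/-- An epimorphism has a section, so `y` is in turn an image of `f^* y` under a simplicial operator.
-/
theorem Rk.of_map_epi {S : SSet.{u}} {p m n : ℕ} {y : S _⦋n⦌} (f : ⦋m⦌ ⟶ ⦋n⦌) [Epi f]
    (h : Rk p (⟨m, S.map f.op y⟩ : Smp S)) : Rk p (⟨n, y⟩ : Smp S) := by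
  obtain ⟨k, hk, z, g, hz⟩ := h
  obtain ⟨⟨s, hs⟩⟩ := isSplitEpi_of_epi f
  refine ⟨k, hk, z, s ≫ g, ?_⟩
  have h1 : y = S.map s.op (S.map f.op y) := by
    rw [map_comp_op, hs, op_id, S.map_id]
    rfl
  change y = _
  rw [← map_comp_op, ← show S.map f.op y = S.map g.op z from hz]
  exact h1

theorem Rk.fn {S : SSet.{u}} {T : SSet.{v}} (F : SMap S T) {p : ℕ} {x : Smp S} (h : Rk p x) :
    Rk p (F.fn x) := by
  obtain ⟨k, hk, z, g, hz⟩ := h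
  refine ⟨k, hk, F.app k z, g, ?_⟩
  change F.app x.1 x.2 = _
  rw [hz]
  exact F.nat g z

theorem rk_of_not_epi {m p : ℕ} (f : ⦋m⦌ ⟶ ⦋p⦌) (hf : ¬ Epi f) :
    Rk p (⟨m, SSet.stdSimplex.objEquiv.symm f⟩ : Smp (Δ[p] : SSet.{u})) := by
  rw [SimplexCategory.epi_iff_surjective] at hf
  rcases p with _ | p
  · refine absurd (fun b => ⟨0, ?_⟩) hf
    exact Subsingleton.elim (α := Fin 1) _ _
  · obtain ⟨i, g, rfl⟩ := SimplexCategory.eq_comp_δ_of_not_surjective f hf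
    exact ⟨p, Nat.lt_succ_self p, SSet.stdSimplex.objEquiv.symm (SimplexCategory.δ i), g,
      (SSet.stdSimplex.map_objEquiv_symm _ _).symm⟩

/-- A simplex is a degeneracy of a nondegenerate one, whose dimension the filtration bounds by `p`.
-/
theorem rk_cases {S : SSet.{u}} {p : ℕ} {x : Smp S} (h : Rk (p + 1) x) :
    Rk p x ∨ ∃ (y : S.nonDegenerate p) (f : ⦋x.1⦌ ⟶ ⦋p⦌), Epi f ∧ x.2 = S.map f.op y.1 := by
  obtain ⟨m, f, hf, y, hy⟩ := S.exists_nonDegenerate x.2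
  have h1 : m < p + 1 := by
    refine Rk.lt_of_nonDegenerate y.2 (Rk.of_map_epi f ?_)
    rw [← hy]
    exact h
  rcases Nat.lt_succ_iff_lt_or_eq.1 h1 with h2 | rfl
  · exact Or.inl ⟨m, h2, y.1, f, hy⟩
  · exact Or.inr ⟨y, f, hf, hy⟩

section

variable (R : Type r) [CommRing R] (Y : ℕ → Type v)

/-- The free module with basis the pairs that consist of a simplex of `S` and a label in a set
that depends on the dimension of the simplex. -/
abbrev Lab (S : SSet.{u}) : Type (max u v r) := (Σ x : Smp S, Y x.1) →₀ R

/-- Naturality of the module of labelled simplices. -/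
def Lab.push {S : SSet.{u}} {T : SSet.{w}} (F : SMap S T) : Lab R Y S →ₗ[R] Lab R Y T :=
  Finsupp.lmapDomain R R fun b => ⟨F.fn b.1, b.2⟩

/-- The skeletal filtration. -/
def Lab.filt (S : SSet.{u}) (p : ℕ) : Submodule R (Lab R Y S) :=
  Finsupp.supported R R {b | Rk p b.1}

namespace Lab

variable {R Y} {S : SSet.{u}} {T : SSet.{w}}

theorem push_bs (F : SMap S T) (b : Σ x : Smp S, Y x.1) :
    push R Y F (bs R b) = bs R (⟨F.fn b.1, b.2⟩ : Σ x : Smp T, Y x.1) := by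
  rw [push, Finsupp.lmapDomain_apply, bs, Finsupp.mapDomain_single, bs]

theorem bs_mem_filt {p : ℕ} {b : Σ x : Smp S, Y x.1} (h : Rk p b.1) : bs R b ∈ filt R Y S p :=
  Finsupp.single_mem_supported R _ h

theorem filt_map {p : ℕ} {M : Type w} [AddCommGroup M] [Module R M]
    {f : Lab R Y S →ₗ[R] M} {N : Submodule R M}
    (h : ∀ b : Σ x : Smp S, Y x.1, Rk p b.1 → f (bs R b) ∈ N) {c : Lab R Y S}
    (hc : c ∈ filt R Y S p) : f c ∈ N := by
  rw [filt, Finsupp.supported_eq_span_single] at hc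
  refine Submodule.span_le (p := N.comap f).2 ?_ hc
  rintro _ ⟨s, hs, rfl⟩
  exact h s hs

theorem push_mem_filt_of_lt {n p : ℕ} (h : n < p) (y : S _⦋n⦌) (c : Lab R Y Δ[n]) :
    push R Y (SMap.cls y) c ∈ filt R Y S p := by
  refine Finsupp.induction_linear c ?_ (fun a b ha hb => ?_) (fun t a => ?_)
  · rw [map_zero]; exact Submodule.zero_mem _
  · rw [map_add]; exact Submodule.add_mem _ ha hb
  · rw [← Finsupp.smul_single_one, map_smul]
    refine Submodule.smul_mem _ _ ?_
    change push R Y _ (bs R t) ∈ _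
    rw [push_bs]
    obtain ⟨⟨m, s⟩, t⟩ := t
    obtain ⟨f, rfl⟩ := SSet.stdSimplex.objEquiv.symm.surjective s
    exact bs_mem_filt ⟨n, h, y, f, rfl⟩

theorem push_mem_filt (F : SMap S T) {p : ℕ} {c : Lab R Y S} (hc : c ∈ filt R Y S p) :
    push R Y F c ∈ filt R Y T p :=
  filt_map (fun b hb => by
    rw [push_bs]
    exact bs_mem_filt (hb.fn F)) hc

theorem exists_push {m n : ℕ} {x : S _⦋m⦌} (t : Y m) (y : S _⦋n⦌) (f : ⦋m⦌ ⟶ ⦋n⦌)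
    (h : x = S.map f.op y) : bs R (⟨⟨m, x⟩, t⟩ : Σ x : Smp S, Y x.1) =
      push R Y (SMap.cls y) (bs R (⟨⟨m, SSet.stdSimplex.objEquiv.symm f⟩, t⟩ :
        Σ x : Smp (Δ[n] : SSet.{u}), Y x.1)) := by
  subst h
  rw [push_bs]
  rfl

theorem mem_filt_zero {c : Lab R Y S} (hc : c ∈ filt R Y S 0) : c = 0 := by
  have h : LinearMap.id c ∈ (⊥ : Submodule R (Lab R Y S)) :=
    filt_map (f := LinearMap.id) (fun b hb => by
      obtain ⟨n, hn, _⟩ := hb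
      exact absurd hn (Nat.not_lt_zero n)) hc
  exact (Submodule.mem_bot R).1 h

theorem filt_mono {p q : ℕ} (h : p ≤ q) : filt R Y S p ≤ filt R Y S q :=
  Finsupp.supported_mono fun _ ⟨n, hn, hb⟩ => ⟨n, hn.trans_le h, hb⟩

theorem exists_mem_filt (c : Lab R Y S) : ∃ p, c ∈ filt R Y S p := by
  refine Finsupp.induction_linear c ⟨0, Submodule.zero_mem _⟩ (fun a b ha hb => ?_) (fun t a => ?_)
  · obtain ⟨p, hp⟩ := ha
    obtain ⟨q, hq⟩ := hb
    exact ⟨max p q, Submodule.add_mem _ (filt_mono (le_max_left p q) hp)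
      (filt_mono (le_max_right p q) hq)⟩
  · rw [← Finsupp.smul_single_one]
    refine ⟨t.1.1 + 1, Submodule.smul_mem _ _ (bs_mem_filt ⟨t.1.1, Nat.lt_succ_self _, t.1.2, 𝟙 _, ?_⟩)⟩
    rw [op_id, S.map_id]
    rfl

variable (R Y) in
/-- The projection to the simplices that are degeneracies of `y`. -/
def proj {p : ℕ} (y : S _⦋p⦌) : Lab R Y S →ₗ[R] Lab R Y Δ[p] :=
  open Classical in
  Finsupp.linearCombination R fun b =>
    if h : ∃ f : ⦋b.1.1⦌ ⟶ ⦋p⦌, Epi f ∧ b.1.2 = S.map f.op y then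
      bs R (⟨⟨b.1.1, SSet.stdSimplex.objEquiv.symm h.choose⟩, b.2⟩ :
        Σ x : Smp (Δ[p] : SSet.{u}), Y x.1)
    else 0

theorem proj_filt {p : ℕ} (y : S.nonDegenerate p) {c : Lab R Y S} (hc : c ∈ filt R Y S p) :
    proj R Y y.1 c = 0 := by
  refine (Submodule.mem_bot R).1 (filt_map (fun b hb => ?_) hc)
  rw [proj, lin_bs, dif_neg]
  · exact Submodule.zero_mem _
  · rintro ⟨f, hf, h⟩
    refine absurd (Rk.lt_of_nonDegenerate y.2 (Rk.of_map_epi (p := p) f ?_)) (lt_irrefl p)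
    rw [← h]
    exact hb

/-- A simplex of `Δ[p]` given by an epimorphism is recovered from its image, since that epimorphism
is unique for nondegenerate `y`. All other simplices of `Δ[p]` lie in lower filtration and are
killed by the projection. -/
theorem proj_push_self {p : ℕ} (y : S.nonDegenerate p) (c : Lab R Y Δ[p]) :
    proj R Y y.1 (push R Y (SMap.cls y.1) c) - c ∈ filt R Y Δ[p] p := by
  refine Finsupp.induction_linear c ?_ (fun a b ha hb => ?_) (fun t a => ?_)
  · rw [map_zero, map_zero, sub_zero]; exact Submodule.zero_mem _
  · rw [map_add, map_add, add_sub_add_comm]; exact Submodule.add_mem _ ha hb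
  · rw [← Finsupp.smul_single_one, map_smul, map_smul, ← smul_sub]
    refine Submodule.smul_mem _ _ ?_
    change proj R Y y.1 (push R Y _ (bs R t)) - bs R t ∈ _
    obtain ⟨⟨m, s⟩, t⟩ := t
    obtain ⟨f, rfl⟩ := SSet.stdSimplex.objEquiv.symm.surjective s
    by_cases hf : Epi f
    · have h : ∃ g : ⦋m⦌ ⟶ ⦋p⦌, Epi g ∧ S.map f.op y.1 = S.map g.op y.1 := ⟨f, hf, rfl⟩
      have h1 : h.choose = f :=
        (S.unique_nonDegenerate_map _ f y rfl h.choose y h.choose_spec.2).symm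
      have h2 : proj R Y y.1 (push R Y (SMap.cls y.1) (bs R
          (⟨⟨m, SSet.stdSimplex.objEquiv.symm f⟩, t⟩ : Σ x : Smp (Δ[p] : SSet.{u}), Y x.1))) =
          bs R ⟨⟨m, SSet.stdSimplex.objEquiv.symm f⟩, t⟩ := by
        rw [push_bs, proj, lin_bs]
        exact (dif_pos h).trans (congrArg (fun g : ⦋m⦌ ⟶ ⦋p⦌ => bs R
          (⟨⟨m, SSet.stdSimplex.objEquiv.symm g⟩, t⟩ : Σ x : Smp (Δ[p] : SSet.{u}), Y x.1)) h1)
      rw [h2, sub_self]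
      exact Submodule.zero_mem _
    · have h1 : bs R (⟨⟨m, SSet.stdSimplex.objEquiv.symm f⟩, t⟩ :
          Σ x : Smp (Δ[p] : SSet.{u}), Y x.1) ∈ filt R Y Δ[p] p := bs_mem_filt (rk_of_not_epi f hf)
      rw [proj_filt y (push_mem_filt _ h1), zero_sub]
      exact Submodule.neg_mem _ h1

theorem proj_push_ne {p : ℕ} {y y' : S.nonDegenerate p} (hy : y' ≠ y) (c : Lab R Y Δ[p]) :
    proj R Y y.1 (push R Y (SMap.cls y'.1) c) = 0 := by
  refine Finsupp.induction_linear c ?_ (fun a b ha hb => ?_) (fun t a => ?_)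
  · rw [map_zero, map_zero]
  · rw [map_add, map_add, ha, hb, add_zero]
  · rw [← Finsupp.smul_single_one, map_smul, map_smul]
    change a • proj R Y y.1 (push R Y _ (bs R t)) = _
    obtain ⟨⟨m, s⟩, t⟩ := t
    obtain ⟨f, rfl⟩ := SSet.stdSimplex.objEquiv.symm.surjective s
    rw [push_bs, proj, lin_bs, dif_neg, smul_zero]
    rintro ⟨g, hg, h⟩
    have h : S.map f.op y'.1 = S.map g.op y.1 := h
    exact hy (S.unique_nonDegenerate_simplex _ g y h f y' rfl).symm

/-- The graded piece of the filtration is generated by copies of the labelled simplices of `Δ[p]`,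
one for each nondegenerate `p`-simplex; together, `proj_push_self` and `proj_push_ne` separate these
copies. -/
theorem exists_decomposition {p : ℕ} {c : Lab R Y S} (hc : c ∈ filt R Y S (p + 1)) :
    ∃ (I : Finset (S.nonDegenerate p)) (e : S.nonDegenerate p → Lab R Y Δ[p]),
      c - ∑ y ∈ I, push R Y (SMap.cls y.1) (e y) ∈ filt R Y S p := by
  classical
  let Φ : (S.nonDegenerate p →₀ Lab R Y Δ[p]) →ₗ[R] Lab R Y S :=
    Finsupp.lsum ℕ fun y => push R Y (SMap.cls y.1)
  have h : c ∈ LinearMap.range Φ ⊔ filt R Y S p := by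
    refine filt_map (f := LinearMap.id) (fun b hb => ?_) hc
    rcases rk_cases hb with h | ⟨y, f, -, h⟩
    · exact Submodule.mem_sup_right (bs_mem_filt h)
    · refine Submodule.mem_sup_left ⟨Finsupp.single y (bs R ⟨⟨b.1.1, SSet.stdSimplex.objEquiv.symm f⟩, b.2⟩), ?_⟩
      rw [Finsupp.lsum_single]
      exact (exists_push b.2 y.1 f h).symm
  obtain ⟨_, ⟨e, rfl⟩, d, hd, rfl⟩ := Submodule.mem_sup.1 h
  refine ⟨e.support, e, ?_⟩
  have : Φ e = ∑ y ∈ e.support, push R Y (SMap.cls y.1) (e y) := rfl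
  rw [← this, add_sub_cancel_left]
  exact hd

variable {Obj : SSet.{u} → Type u'} (pull : ∀ {S T : SSet.{u}}, SMap S T → Obj T → Obj S)
  (D : ∀ {S : SSet.{u}}, Obj S → Lab R Y S →ₗ[R] Lab R Y S)

/-- A generator of filtration `p` comes from some `Δ[n]` with `n < p`, and by naturality so does its
differential. -/
theorem filt_stable (nat : ∀ {S T : SSet.{u}} (F : SMap S T) (τ : Obj T) (c : Lab R Y S),
      D τ (push R Y F c) = push R Y F (D (pull F τ) c)) (τ : Obj S) {p : ℕ} {c : Lab R Y S}
    (hc : c ∈ filt R Y S p) : D τ c ∈ filt R Y S p :=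
  filt_map (fun b ⟨n, hn, y, f, h⟩ => by
    rw [show bs R b = _ from exists_push b.2 y f h, nat]
    exact push_mem_filt_of_lt hn _ _) hc

/-- Acyclicity of a natural differential can be checked on standard simplices. -/
theorem acyclic_filt (sq : ∀ {S : SSet.{u}} (τ : Obj S) (c : Lab R Y S), D τ (D τ c) = 0)
    (nat : ∀ {S T : SSet.{u}} (F : SMap S T) (τ : Obj T) (c : Lab R Y S),
      D τ (push R Y F c) = push R Y F (D (pull F τ) c))
    (acyc : ∀ (n : ℕ) (τ : Obj Δ[n]) (c : Lab R Y Δ[n]), D τ c = 0 → ∃ e, D τ e = c)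
    (p : ℕ) (τ : Obj S) {c : Lab R Y S} (hc : c ∈ filt R Y S p) (h : D τ c = 0) :
    ∃ e ∈ filt R Y S p, D τ e = c := by
  classical
  induction p generalizing S c with
  | zero => exact ⟨0, Submodule.zero_mem _, by rw [map_zero, mem_filt_zero hc]⟩
  | succ p ih =>
    obtain ⟨I, e, hd⟩ := exists_decomposition hc
    -- Projecting `D c = 0` to the simplices over `y` removes the other summands and the lower
    -- filtration, and leaves `D e_y` modulo lower filtration.
    have h1 (y : S.nonDegenerate p) (hy : y ∈ I) :
        D (pull (SMap.cls y.1) τ) (e y) ∈ filt R Y Δ[p] p := by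
      have h2 := proj_filt y (filt_stable pull D nat τ hd)
      rw [map_sub, h, zero_sub, map_neg, neg_eq_zero, map_sum, map_sum,
        Finset.sum_eq_single_of_mem y hy] at h2
      · rw [nat] at h2
        have h3 := proj_push_self y (D (pull (SMap.cls y.1) τ) (e y))
        rw [h2, zero_sub] at h3
        exact (Submodule.neg_mem_iff _).1 h3
      · intro y' _ hy'
        rw [nat]
        exact proj_push_ne hy' _
    -- The chain `D e_y` is a cycle of lower filtration over `Δ[p]`, so by induction it is `D a` for
    -- a chain `a` of lower filtration. Then `e_y - a` is a cycle over `Δ[p]` and hence a boundary.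
    have h2 (y : S.nonDegenerate p) : ∃ b a, y ∈ I → a ∈ filt R Y Δ[p] p ∧
        D (pull (SMap.cls y.1) τ) b = e y - a := by
      by_cases hy : y ∈ I
      · obtain ⟨a, ha, ha'⟩ := ih (pull (SMap.cls y.1) τ) (h1 y hy) (sq _ _)
        obtain ⟨b, hb⟩ := acyc p (pull (SMap.cls y.1) τ) (e y - a) (by rw [map_sub, ha', sub_self])
        exact ⟨b, a, fun _ => ⟨ha, hb⟩⟩
      · exact ⟨0, 0, fun h => absurd h hy⟩
    choose b a hba using h2
    -- Subtracting a boundary thus lowers the filtration of `c`.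
    have h3 : c - D τ (∑ y ∈ I, push R Y (SMap.cls y.1) (b y)) ∈ filt R Y S p := by
      have h4 : D τ (∑ y ∈ I, push R Y (SMap.cls y.1) (b y)) =
          ∑ y ∈ I, push R Y (SMap.cls y.1) (e y) - ∑ y ∈ I, push R Y (SMap.cls y.1) (a y) := by
        rw [map_sum, ← Finset.sum_sub_distrib]
        refine Finset.sum_congr rfl fun y hy => ?_
        rw [nat, (hba y hy).2, map_sub]
      rw [h4, ← sub_add]
      exact Submodule.add_mem _ hd (Submodule.sum_mem _ fun y hy =>
        push_mem_filt _ (hba y hy).1)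
    obtain ⟨d, hd, hd'⟩ := ih τ h3 (by rw [map_sub, h, sq, sub_zero])
    refine ⟨d + ∑ y ∈ I, push R Y (SMap.cls y.1) (b y), Submodule.add_mem _
      (filt_mono (Nat.le_succ p) hd) (Submodule.sum_mem _ fun y _ =>
        push_mem_filt_of_lt (Nat.lt_succ_self p) _ _), ?_⟩
    rw [map_add, hd', sub_add_cancel]

theorem acyclic (sq : ∀ {S : SSet.{u}} (τ : Obj S) (c : Lab R Y S), D τ (D τ c) = 0)
    (nat : ∀ {S T : SSet.{u}} (F : SMap S T) (τ : Obj T) (c : Lab R Y S),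
      D τ (push R Y F c) = push R Y F (D (pull F τ) c))
    (acyc : ∀ (n : ℕ) (τ : Obj Δ[n]) (c : Lab R Y Δ[n]), D τ c = 0 → ∃ e, D τ e = c)
    (τ : Obj S) {c : Lab R Y S} (h : D τ c = 0) : ∃ e, D τ e = c := by
  obtain ⟨p, hp⟩ := exists_mem_filt c
  obtain ⟨e, -, he⟩ := acyclic_filt pull D sq nat acyc p τ hp h
  exact ⟨e, he⟩

end Lab

end

/-! ### Naturality in the twisting function -/

section

variable {R : Type r} [CommRing R]
variable {X : SSet.{u}} {X' : SSet.{u}} {Γ : SimplicialObject GrpCat.{w}} {Z : SSet.{v}}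

/-- The pullback of a twisting function. -/
def TwistingFunction.pull (F : SMap X X') (τ : TwistingFunction X' Γ) : TwistingFunction X Γ where
  tau x := τ.tau (F.app _ x)
  face x i := (τ.face _ i).trans (congrArg τ.tau (F.nat (SimplexCategory.δ i.castSucc.castSucc) x).symm)
  face_last {n} x := (τ.face_last _).trans (congrArg₂ (fun a b : Γ _⦋n⦌ => a⁻¹ * b)
    (congrArg τ.tau (F.nat (SimplexCategory.δ (Fin.last (n + 2))) x).symm)
    (congrArg τ.tau (F.nat (SimplexCategory.δ (Fin.last (n + 1)).castSucc) x).symm))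
  degen x i := (τ.degen _ i).trans (congrArg τ.tau (F.nat (SimplexCategory.σ i.castSucc) x).symm)
  degen_last {n} y :=
    (congrArg τ.tau (F.nat (SimplexCategory.σ (Fin.last n)) y)).trans (τ.degen_last _)

variable (F : SMap X X') (τ : TwistingFunction X' Γ) (ρ : SimplicialAction Γ Z)

theorem kanAct_pull {n : ℕ} (g : KanGroup X ⦋n⦌) (z : Z _⦋n⦌) :
    kanAct (τ.pull F) ρ g z = kanAct τ ρ (kanF F n g) z := by
  have h : (τ.pull F).toHom g = τ.toHom (kanF F n g) := by
    refine DFunLike.congr_fun (f := (τ.pull F).toHom (a := ⦋n⦌))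
      (g := (τ.toHom (a := ⦋n⦌)).comp (kanF F n)) (kanHom_ext fun (x : X _⦋n + 1⦌) => ?_) g
    refine ((τ.pull F).toHom_kanTau x).trans ?_
    exact (τ.toHom_kanTau _).symm.trans (congrArg τ.toHom (kanF_kanTau F x).symm)
  exact congrArg (fun g => ρ.act (a := op ⦋n⦌) g z) h

/-- Naturality of the twisted product in the base. -/
def SMap.tcp : SMap (Brown.tcp (τ.pull F) ρ) (Brown.tcp τ ρ) where
  app n s := (F.app n s.1, s.2)
  nat {m _} f s := Prod.ext (F.nat f s.1)
    (congrArg (fun t => ρ.act (a := op ⦋m⦌) (τ.tau t) (Z.map f.op s.2)) (F.nat (snocMap f) s.1))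

variable (R Z)

/-- Naturality of the twisted tensor product in the base. -/
def pT : TT R X Z →ₗ[R] TT R X' Z := Finsupp.lmapDomain R R fun p => (F.fn p.1, p.2)

variable {R Z}

theorem pT_te (x : Smp X) (c : Ch R Z) : pT R Z F (te R Z x c) = te R Z (F.fn x) c :=
  lin_ext_apply (f := pT R Z F ∘ₗ te R Z x) (fun z => by
    rw [LinearMap.comp_apply, te_bs, te_bs, pT, Finsupp.lmapDomain_apply, bs,
      Finsupp.mapDomain_single, bs]) c

theorem dot_act_pull (a : Ch R (GS X)) (c : Ch R Z) :
    dot R (SMap.act (τ.pull F) ρ) a c = dot R (SMap.act τ ρ) (cm R F.kan a) c := by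
  have h := dot_cm (R := R) (μ := SMap.act (τ.pull F) ρ) (μ' := SMap.act τ ρ) (F := F.kan)
    (G := SMap.id Z) (H := SMap.id Z) (fun n s t => (kanAct_pull F τ ρ s t).symm) a c
  rw [cm_id, cm_id] at h
  exact h.symm

theorem td_pT (t : TT R X Z) : td R τ ρ (pT R Z F t) = pT R Z F (td R (τ.pull F) ρ t) := by
  refine LinearMap.congr_fun (tt_ext (f := td R τ ρ ∘ₗ pT R Z F)
    (g := pT R Z F ∘ₗ td R (τ.pull F) ρ) fun x c => ?_) t
  rw [LinearMap.comp_apply, LinearMap.comp_apply, pT_te, td_te, td_te, tL_eq, tL_eq]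
  simp only [map_add, map_sum, map_smul, pT_te, dot_act_pull, cm_phiT, F.fn_fr, F.fn_fc, F.fn_bk]
  rfl

theorem Psi_pT (t : TT R X Z) :
    Psi R τ ρ (pT R Z F t) = cm R (F.tcp τ ρ) (Psi R (τ.pull F) ρ t) := by
  refine LinearMap.congr_fun (tt_ext (f := Psi R τ ρ ∘ₗ pT R Z F)
    (g := cm R (F.tcp τ ρ) ∘ₗ Psi R (τ.pull F) ρ) fun x c => ?_) t
  rw [LinearMap.comp_apply, LinearMap.comp_apply, pT_te, Psi_te, Psi_te, ← cm_Pone]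
  have h := dot_cm (R := R) (μ := SMap.tact (τ.pull F) ρ) (μ' := SMap.tact τ ρ) (F := F.principal)
    (G := SMap.id Z) (H := F.tcp τ ρ)
    (fun n s t => Prod.ext rfl (kanAct_pull F τ ρ s.2 t).symm) (Pone R x) c
  rw [cm_id] at h
  exact h

end

/-! ### The mapping cone of `Ψ` -/

section

variable (R : Type r) [CommRing R]

/-- The labels that describe the basis of the mapping cone of `Ψ`. -/
abbrev ConeLab (Z : SSet.{v}) (n : ℕ) : Type v := Smp Z ⊕ Z _⦋n⦌

variable {X X' : SSet.{u}} {Γ : SimplicialObject GrpCat.{w}} {Z : SSet.{v}}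

variable (X Z) in
/-- The inclusion of the twisted tensor product into the mapping cone. -/
def inT : TT R X Z →ₗ[R] Lab R (ConeLab Z) X :=
  Finsupp.lmapDomain R R fun p => ⟨p.1, Sum.inl p.2⟩

variable (X Z) in
/-- The projection of the mapping cone to the twisted tensor product. -/
def prT : Lab R (ConeLab Z) X →ₗ[R] TT R X Z :=
  Finsupp.linearCombination R fun b => Sum.elim (fun z => bs R (b.1, z)) (fun _ => 0) b.2

variable (τ : TwistingFunction X Γ) (ρ : SimplicialAction Γ Z)

/-- The inclusion of the twisted product into the mapping cone. -/
def inC : Ch R (tcp τ ρ) →ₗ[R] Lab R (ConeLab Z) X :=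
  Finsupp.lmapDomain R R fun s => ⟨⟨s.1, s.2.1⟩, Sum.inr s.2.2⟩

/-- The projection of the mapping cone to the twisted product. -/
def prC : Lab R (ConeLab Z) X →ₗ[R] Ch R (tcp τ ρ) :=
  Finsupp.linearCombination R fun b =>
    Sum.elim (fun _ => 0) (fun z => bs R (⟨b.1.1, (b.1.2, z)⟩ : Smp (tcp τ ρ))) b.2

/-- The differential of the mapping cone. -/
def coneD : Lab R (ConeLab Z) X →ₗ[R] Lab R (ConeLab Z) X :=
  inT R X Z ∘ₗ td R τ ρ ∘ₗ prT R X Z +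
    inC R τ ρ ∘ₗ (Psi R τ ρ ∘ₗ prT R X Z - bd R (tcp τ ρ) ∘ₗ prC R τ ρ)

variable {R}

theorem inT_bs (x : Smp X) (z : Smp Z) : inT R X Z (bs R (x, z)) = bs R ⟨x, Sum.inl z⟩ := by
  rw [inT, Finsupp.lmapDomain_apply, bs, Finsupp.mapDomain_single, bs]

theorem inC_bs (s : Smp (tcp τ ρ)) : inC R τ ρ (bs R s) = bs R ⟨⟨s.1, s.2.1⟩, Sum.inr s.2.2⟩ := by
  rw [inC, Finsupp.lmapDomain_apply, bs, Finsupp.mapDomain_single, bs]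

theorem prT_inl (x : Smp X) (z : Smp Z) :
    prT R X Z (bs R (⟨x, Sum.inl z⟩ : Σ x : Smp X, ConeLab Z x.1)) = bs R (x, z) := by
  rw [prT, lin_bs]; rfl

theorem prT_inr (x : Smp X) (z : Z _⦋x.1⦌) :
    prT R X Z (bs R (⟨x, Sum.inr z⟩ : Σ x : Smp X, ConeLab Z x.1)) = 0 := by
  rw [prT, lin_bs]; rfl

theorem prC_inl (x : Smp X) (z : Smp Z) :
    prC R τ ρ (bs R (⟨x, Sum.inl z⟩ : Σ x : Smp X, ConeLab Z x.1)) = 0 := by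
  rw [prC, lin_bs]; rfl

theorem prC_inr (x : Smp X) (z : Z _⦋x.1⦌) :
    prC R τ ρ (bs R (⟨x, Sum.inr z⟩ : Σ x : Smp X, ConeLab Z x.1)) =
      bs R (⟨x.1, (x.2, z)⟩ : Smp (tcp τ ρ)) := by
  rw [prC, lin_bs]; rfl

theorem prT_inT (t : TT R X Z) : prT R X Z (inT R X Z t) = t :=
  lin_ext_apply (f := prT R X Z ∘ₗ inT R X Z) (g := LinearMap.id) (fun p => by
    rw [LinearMap.comp_apply, inT_bs, prT_inl]; rfl) t

theorem prT_inC (c : Ch R (tcp τ ρ)) : prT R X Z (inC R τ ρ c) = 0 :=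
  lin_ext_apply (f := prT R X Z ∘ₗ inC R τ ρ) (g := 0) (fun p => by
    rw [LinearMap.comp_apply, inC_bs, prT_inr]; rfl) c

theorem prC_inT (t : TT R X Z) : prC R τ ρ (inT R X Z t) = 0 :=
  lin_ext_apply (f := prC R τ ρ ∘ₗ inT R X Z) (g := 0) (fun p => by
    rw [LinearMap.comp_apply, inT_bs, prC_inl]; rfl) t

theorem prC_inC (c : Ch R (tcp τ ρ)) : prC R τ ρ (inC R τ ρ c) = c :=
  lin_ext_apply (f := prC R τ ρ ∘ₗ inC R τ ρ) (g := LinearMap.id) (fun p => by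
    rw [LinearMap.comp_apply, inC_bs, prC_inr]; rfl) c

theorem inT_prT_add (c : Lab R (ConeLab Z) X) :
    inT R X Z (prT R X Z c) + inC R τ ρ (prC R τ ρ c) = c :=
  lin_ext_apply (f := inT R X Z ∘ₗ prT R X Z + inC R τ ρ ∘ₗ prC R τ ρ) (g := LinearMap.id)
    (fun ⟨x, b⟩ => by
      rw [LinearMap.add_apply, LinearMap.comp_apply, LinearMap.comp_apply]
      rcases b with z | z
      · rw [prT_inl, prC_inl, map_zero, add_zero, inT_bs]; rfl
      · rw [prT_inr, prC_inr, map_zero, zero_add, inC_bs]; rfl) c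

theorem coneD_apply (c : Lab R (ConeLab Z) X) : coneD R τ ρ c =
    inT R X Z (td R τ ρ (prT R X Z c)) +
      inC R τ ρ (Psi R τ ρ (prT R X Z c) - bd R (tcp τ ρ) (prC R τ ρ c)) := rfl

theorem prT_coneD (c : Lab R (ConeLab Z) X) :
    prT R X Z (coneD R τ ρ c) = td R τ ρ (prT R X Z c) := by
  rw [coneD_apply, map_add, prT_inT, prT_inC, add_zero]

theorem prC_coneD (c : Lab R (ConeLab Z) X) : prC R τ ρ (coneD R τ ρ c) =
    Psi R τ ρ (prT R X Z c) - bd R (tcp τ ρ) (prC R τ ρ c) := by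
  rw [coneD_apply, map_add, prC_inT, prC_inC, zero_add]

/-- The mixed component vanishes because `Ψ` is a chain map. -/
theorem coneD_coneD (c : Lab R (ConeLab Z) X) : coneD R τ ρ (coneD R τ ρ c) = 0 := by
  rw [coneD_apply τ ρ (coneD R τ ρ c), prT_coneD, prC_coneD, td_td, map_sub (bd R _), bd_bd,
    bd_Psi, sub_zero, sub_self, map_zero, map_zero, add_zero]

variable (F : SMap X X') (σ : TwistingFunction X' Γ)

theorem push_inT (t : TT R X Z) :
    Lab.push R (ConeLab Z) F (inT R X Z t) = inT R X' Z (pT R Z F t) :=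
  lin_ext_apply (f := Lab.push R (ConeLab Z) F ∘ₗ inT R X Z) (g := inT R X' Z ∘ₗ pT R Z F)
    (fun p => by
      rw [LinearMap.comp_apply, LinearMap.comp_apply, inT_bs, Lab.push_bs, ← te_bs, pT_te, te_bs,
        inT_bs]
      rfl) t

theorem push_inC (c : Ch R (tcp (σ.pull F) ρ)) :
    Lab.push R (ConeLab Z) F (inC R (σ.pull F) ρ c) = inC R σ ρ (cm R (F.tcp σ ρ) c) :=
  lin_ext_apply (f := Lab.push R (ConeLab Z) F ∘ₗ inC R (σ.pull F) ρ)
    (g := inC R σ ρ ∘ₗ cm R (F.tcp σ ρ)) (fun p => by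
      rw [LinearMap.comp_apply, LinearMap.comp_apply, inC_bs, Lab.push_bs, cm_bs, inC_bs]
      rfl) c

theorem coneD_push (c : Lab R (ConeLab Z) X) : coneD R σ ρ (Lab.push R (ConeLab Z) F c) =
    Lab.push R (ConeLab Z) F (coneD R (σ.pull F) ρ c) := by
  conv_lhs => rw [← inT_prT_add (σ.pull F) ρ c]
  rw [map_add, push_inT, push_inC, coneD_apply, map_add (prT R X' Z), map_add (prC R σ ρ), prT_inT,
    prT_inC, prC_inT, prC_inC, add_zero, zero_add, td_pT, Psi_pT, bd_cm, ← map_sub, coneD_apply, map_add, push_inT,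
    push_inC]

end

/-! ### Contraction of the twisted tensor product over a cone -/

section

variable {R : Type r} [CommRing R]
variable {X : SSet.{u}} {Γ : SimplicialObject GrpCat.{w}} {Z : SSet.{v}}

namespace Cone

variable (C : Cone X) (x : Smp X)

theorem fc_zero : fc (C.fn x) 0 = x := C.sb_zero x

theorem fc_succ {k : ℕ} (h : k < x.1) : fc (C.fn x) (k + 1) = C.fn (fc x k) := by
  rw [fc, fc, ← C.sb_sh, sh_del]
  exact sb_congr _ (by change x.1 = x.1 - 1 + 1; omega) fun _ _ => rfl

theorem fr_succ (i : ℕ) : fr (C.fn x) (i + 1) = C.fn (fr x i) := by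
  rw [fr, fr, ← C.sb_sh]
  refine sb_congr _ rfl fun k _ => ?_
  rw [oid_apply, sh_apply, oid_apply]
  split_ifs <;> omega

theorem bk_succ {i : ℕ} (h : i ≤ x.1) : bk (C.fn x) (i + 1) = bk x i := by
  conv_rhs => rw [← C.sb_zero x, bk, sb_fst]
  rw [sb_sb _ _ _ (by rw [iv_apply]; omega), bk]
  refine sb_congr _ (by change x.1 + 1 - (i + 1) = x.1 - i; omega) fun k _ => ?_
  rw [ocomp_apply, del_apply, iv_apply, iv_apply]
  split_ifs <;> omega

end Cone

variable (R Z) in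
/-- The map `x ⊗ z ↦ Dx ⊗ z` for a cone operator `D`. -/
def tD (C : Cone X) : TT R X Z →ₗ[R] TT R X Z := Finsupp.lmapDomain R R fun p => (C.fn p.1, p.2)

theorem tD_te (C : Cone X) (x : Smp X) (c : Ch R Z) :
    tD R Z C (te R Z x c) = te R Z (C.fn x) c :=
  lin_ext_apply (f := tD R Z C ∘ₗ te R Z x) (fun z => by
    rw [LinearMap.comp_apply, te_bs, te_bs, tD, Finsupp.lmapDomain_apply, bs,
      Finsupp.mapDomain_single, bs]) c

variable (τ : TwistingFunction X Γ) (ρ : SimplicialAction Γ Z)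

variable (R) in
/-- The map `x ⊗ z ↦ (-1)^n φ(Dx) z`. -/
def tR (C : Cone X) : TT R X Z →ₗ[R] Ch R Z :=
  Finsupp.linearCombination R fun p =>
    (-1 : R) ^ p.1.1 • dot R (SMap.act τ ρ) (phiT R (C.fn p.1)) (bs R p.2)

theorem tR_te (C : Cone X) (x : Smp X) (c : Ch R Z) : tR R τ ρ C (te R Z x c) =
    (-1 : R) ^ x.1 • dot R (SMap.act τ ρ) (phiT R (C.fn x)) c :=
  lin_ext_apply (f := tR R τ ρ C ∘ₗ te R Z x)
    (g := (-1 : R) ^ x.1 • dot R (SMap.act τ ρ) (phiT R (C.fn x))) (fun z => by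
    rw [LinearMap.comp_apply, te_bs, tR, lin_bs]; rfl) c

/-- The face `d_0 D x` gives back `x`; the other faces and the front faces `[0, …, i + 1]` of `D x`
are cones over those of `x`, with the opposite sign. The only remaining front face is the cone
vertex `v`, and it carries the coefficient `φ (D x) z`. -/
theorem td_tD {C : Cone X} {v : Smp X} (hv : ∀ x, fr (C.fn x) 0 = v) (t : TT R X Z) :
    td R τ ρ (tD R Z C t) = t - te R Z v (tR R τ ρ C t) - tD R Z C (td R τ ρ t) := by
  refine LinearMap.congr_fun (tt_ext (f := td R τ ρ ∘ₗ tD R Z C)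
    (g := LinearMap.id - te R Z v ∘ₗ tR R τ ρ C - tD R Z C ∘ₗ td R τ ρ) fun x c => ?_) t
  rw [LinearMap.sub_apply, LinearMap.sub_apply, LinearMap.comp_apply, LinearMap.comp_apply,
    LinearMap.comp_apply, LinearMap.id_apply, tD_te, td_te, td_te, tL_eq, tL_eq, tR_te, map_add,
    map_add, map_smul, map_smul, map_smul, map_sum, map_sum, tD_te, show (C.fn x).1 = x.1 + 1 from rfl,
    Finset.sum_range_succ', Finset.sum_range_succ', hv, C.fc_zero, bk_zero, pow_succ]
  have h1 : ∑ k ∈ Finset.range x.1, (-1 : R) ^ (k + 1) • te R Z (fc (C.fn x) (k + 1)) c =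
      - ∑ k ∈ Finset.range x.1, tD R Z C ((-1 : R) ^ k • te R Z (fc x k) c) := by
    rw [← Finset.sum_neg_distrib]
    refine Finset.sum_congr rfl fun k hk => ?_
    rw [C.fc_succ x (Finset.mem_range.1 hk), map_smul, tD_te, pow_succ, mul_neg_one, neg_smul]
  have h2 : ∑ i ∈ Finset.range x.1, te R Z (fr (C.fn x) (i + 1))
        (dot R (SMap.act τ ρ) (phiT R (bk (C.fn x) (i + 1))) c) =
      ∑ i ∈ Finset.range x.1, tD R Z C (te R Z (fr x i)
        (dot R (SMap.act τ ρ) (phiT R (bk x i)) c)) :=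
    Finset.sum_congr rfl fun i hi => by
      rw [C.fr_succ, C.bk_succ x (Finset.mem_range.1 hi).le, tD_te]
  rw [h1, h2, pow_zero, one_smul, mul_neg_one, neg_smul, neg_smul, smul_add]
  abel

end

/-! ### The twisted product over a standard simplex -/

section

variable {R : Type r} [CommRing R]
variable {n : ℕ} {Γ : SimplicialObject GrpCat.{w}} {Z : SSet.{v}}
variable (τ : TwistingFunction (Δ[n] : SSet.{u}) Γ) (ρ : SimplicialAction Γ Z)

/-- The element `τ [J 0, …, J m, n]`. -/
def gam {m : ℕ} (J : (Δ[n] : SSet.{u}) _⦋m⦌) : Γ _⦋m⦌ :=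
  τ.tau (n := m) (SSet.stdSimplex.objEquiv.symm (snocMap (SSet.stdSimplex.objEquiv J)))

/-- Over a standard simplex the twisting is a coboundary. This is `mapTau` for the simplex `[J, n]`,
whose two relevant images are `[J f, J k]` and `[J f, n]`. -/
theorem gam_map {m k : ℕ} (f : ⦋m⦌ ⟶ ⦋k⦌) (J : (Δ[n] : SSet.{u}) _⦋k⦌) :
    gam τ ((Δ[n] : SSet.{u}).map f.op J) =
      τ.tau (n := m) ((Δ[n] : SSet.{u}).map (snocMap f).op J) * Γ.map f.op (gam τ J) := by
  obtain ⟨J, rfl⟩ := SSet.stdSimplex.objEquiv.symm.surjective J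
  have h := τ.mapTau f (SSet.stdSimplex.objEquiv.symm (snocMap J))
  have e1 : (Δ[n] : SSet.{u}).map (snocMap f ≫ lastFace ⦋k⦌).op
      (SSet.stdSimplex.objEquiv.symm (snocMap J)) =
      (Δ[n] : SSet.{u}).map (snocMap f).op (SSet.stdSimplex.objEquiv.symm J) := by
    refine (SSet.stdSimplex.map_objEquiv_symm _ _).trans ?_
    refine Eq.trans ?_ (SSet.stdSimplex.map_objEquiv_symm _ _).symm
    refine congrArg _ ?_
    refine (Category.assoc _ _ _).trans ?_
    exact congrArg (fun g => snocMap f ≫ g) (lastFace_snocMap J)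
  have e2 : (Δ[n] : SSet.{u}).map (extMap f).op (SSet.stdSimplex.objEquiv.symm (snocMap J)) =
      SSet.stdSimplex.objEquiv.symm (snocMap (f ≫ J)) := by
    refine (SSet.stdSimplex.map_objEquiv_symm _ _).trans ?_
    exact congrArg _ (extMap_snocMap f J)
  have e3 : gam τ ((Δ[n] : SSet.{u}).map f.op (SSet.stdSimplex.objEquiv.symm J)) =
      τ.tau (n := m) (SSet.stdSimplex.objEquiv.symm (snocMap (f ≫ J))) := by
    rw [gam, SSet.stdSimplex.map_objEquiv_symm]
    rfl
  rw [e3]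
  refine eq_mul_of_inv_mul_eq (h.trans ?_).symm
  exact congrArg₂ (fun a b : Γ _⦋m⦌ => a⁻¹ * b) (congrArg (τ.tau (n := m)) e1) (congrArg τ.tau e2)

theorem act_inv_act {m : ℕ} (g : Γ _⦋m⦌) (z : Z _⦋m⦌) :
    ρ.act (a := op ⦋m⦌) g (ρ.act (a := op ⦋m⦌) g⁻¹ z) = z := by
  rw [← ρ.mul_act, mul_inv_cancel, ρ.one_act]

/-- The trivialization of the twisted product, projected to the second factor. -/
def triv : SMap (tcp τ ρ) Z where
  app m s := ρ.act (a := op ⦋m⦌) (gam τ s.1)⁻¹ s.2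
  nat {m k} f s := by
    change ρ.act (a := op ⦋m⦌) (gam τ ((Δ[n] : SSet.{u}).map f.op s.1))⁻¹
      (ρ.act (a := op ⦋m⦌) (τ.tau (n := m) ((Δ[n] : SSet.{u}).map (snocMap f).op s.1))
        (Z.map f.op s.2)) = Z.map f.op (ρ.act (a := op ⦋k⦌) (gam τ s.1)⁻¹ s.2)
    rw [gam_map, ← ρ.mul_act, ρ.map_act, mul_inv_rev, inv_mul_cancel_right, map_inv]

/-- The inverse of the trivialization of the twisted product. -/
def untriv : SMap (prodS (Δ[n] : SSet.{u}) Z) (tcp τ ρ) where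
  app m s := (s.1, ρ.act (a := op ⦋m⦌) (gam τ s.1) s.2)
  nat {m k} f s := by
    refine Prod.ext rfl ?_
    change ρ.act (a := op ⦋m⦌) (gam τ ((Δ[n] : SSet.{u}).map f.op s.1)) (Z.map f.op s.2) =
      ρ.act (a := op ⦋m⦌) (τ.tau (n := m) ((Δ[n] : SSet.{u}).map (snocMap f).op s.1))
        (Z.map f.op (ρ.act (a := op ⦋k⦌) (gam τ s.1) s.2))
    rw [gam_map, ρ.map_act, ρ.mul_act]

theorem untriv_triv {m : ℕ} (s : (tcp τ ρ) _⦋m⦌) :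
    (untriv τ ρ).app m (pairS s.1 ((triv τ ρ).app m s)) = s :=
  Prod.ext rfl (act_inv_act ρ _ _)

/-- The simplex of `Δ[n]` with all vertices `0`. -/
def base (n m : ℕ) : (Δ[n] : SSet.{u}) _⦋m⦌ :=
  SSet.stdSimplex.objEquiv.symm (toHom m n ⟨fun _ => 0, fun _ _ _ => le_rfl⟩)

theorem base_map {m k : ℕ} (f : ⦋m⦌ ⟶ ⦋k⦌) :
    (Δ[n] : SSet.{u}).map f.op (base n k) = base n m := by
  rw [base, SSet.stdSimplex.map_objEquiv_symm]
  exact congrArg _ (hom_ext_val fun _ => rfl)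

/-- The contraction of `Δ[n]` to the vertex `0`, as a function `Δ[1] × Δ[n] → Δ[n]`. -/
def contract (n : ℕ) : SMap (prodS (Δ[1] : SSet.{u}) (Δ[n] : SSet.{u})) (Δ[n] : SSet.{u}) where
  app m s := SSet.stdSimplex.objEquiv.symm (toHom m n
    ⟨fun k => homFun (SSet.stdSimplex.objEquiv s.1) k * homFun (SSet.stdSimplex.objEquiv s.2) k,
      fun _ _ h => Nat.mul_le_mul ((homFun _).monotone h) ((homFun _).monotone h)⟩)
  nat {m k} f s := by
    obtain ⟨s, t⟩ := s
    obtain ⟨s, rfl⟩ := SSet.stdSimplex.objEquiv.symm.surjective s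
    obtain ⟨t, rfl⟩ := SSet.stdSimplex.objEquiv.symm.surjective t
    rw [SSet.stdSimplex.map_objEquiv_symm]
    refine congrArg _ (hom_ext_val fun j => ?_)
    have e (l : ℕ) (g : ⦋k⦌ ⟶ ⦋l⦌) : homFun (f ≫ g) j.val = homFun g (f.toOrderHom j).val := by
      rw [homFun_apply, homFun_apply]
      rfl
    change min (homFun (f ≫ s) j.val * homFun (f ≫ t) j.val) n =
      min (homFun s (f.toOrderHom j).val * homFun t (f.toOrderHom j).val) n
    rw [e, e]

/-- The vertex `i` of `Δ[1]`. -/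
def vtx (i : ℕ) : Smp (Δ[1] : SSet.{u}) :=
  ⟨0, SSet.stdSimplex.objEquiv.symm (toHom 0 1 ⟨fun _ => i, fun _ _ _ => le_rfl⟩)⟩

theorem contract_vtx_zero {m : ℕ} (f : ℕ →o ℕ) (J : (Δ[n] : SSet.{u}) _⦋m⦌) :
    (contract n).app m (pairS (sbv (vtx 0) m f) J) = base n m := by
  refine congrArg _ (hom_ext_val fun j => ?_)
  change min (0 * _) n = 0
  rw [zero_mul]; rfl

theorem contract_vtx_one {m : ℕ} (f : ℕ →o ℕ) (J : (Δ[n] : SSet.{u}) _⦋m⦌) :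
    (contract n).app m (pairS (sbv (vtx 1) m f) J) = J := by
  obtain ⟨g, rfl⟩ := SSet.stdSimplex.objEquiv.symm.surjective J
  refine congrArg _ (hom_ext_val fun j => ?_)
  change min (1 * homFun g j.val) n = _
  rw [one_mul, homFun_apply, min_eq_left (Nat.le_of_lt_succ (Fin.isLt _))]

/-- The contraction of the twisted product to the fibre over the vertex `0`. -/
def retract : SMap (prodS (Δ[1] : SSet.{u}) (tcp τ ρ)) (tcp τ ρ) where
  app m s := (untriv τ ρ).app m ((contract n).app m (pairS s.1 s.2.1), (triv τ ρ).app m s.2)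
  nat {m k} f s := by
    refine Eq.trans ?_ ((untriv τ ρ).nat f _)
    refine congrArg ((untriv τ ρ).app m) (Prod.ext ?_ ?_)
    · exact (contract n).nat f (pairS s.1 s.2.1)
    · exact (triv τ ρ).nat f s.2

/-- On constant simplices the twisting factor in `gam_map` is trivial, since `τ` is evaluated at a
last degeneracy. -/
theorem gam_base_map {m k : ℕ} (f : ⦋m⦌ ⟶ ⦋k⦌) :
    gam τ (base n m) = Γ.map f.op (gam τ (base n k)) := by
  have h := gam_map τ f (base n k)
  have h1 : (Δ[n] : SSet.{u}).map (snocMap f).op (base n k) =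
      (Δ[n] : SSet.{u}).map (lastDegen ⦋m⦌).op (base n m) :=
    (base_map (snocMap f)).trans (base_map (lastDegen ⦋m⦌)).symm
  have h2 : τ.tau (n := m) ((Δ[n] : SSet.{u}).map (snocMap f).op (base n k)) = 1 :=
    (congrArg (τ.tau (n := m)) h1).trans (τ.tau_map_lastDegen _)
  rw [base_map, h2, one_mul] at h
  exact h

/-- The retraction of the twisted product to the fibre over the vertex `0`. -/
def fibre : SMap (tcp τ ρ) Z where
  app m s := ρ.act (a := op ⦋m⦌) (gam τ (base n m)) ((triv τ ρ).app m s)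
  nat {m k} f s := by
    rw [(triv τ ρ).nat, gam_base_map τ f, ρ.map_act]

variable (n) in
/-- The vertex `0` of `Δ[n]`. -/
abbrev vert : Smp (Δ[n] : SSet.{u}) := ⟨0, base n 0⟩

theorem principal_map_one {X : SSet.{u}} {m : ℕ} (f : ⦋m⦌ ⟶ ⦋0⦌) (x : X _⦋0⦌) :
    (principal X).map f.op (x, (1 : KanGroup X ⦋0⦌)) =
      (X.map f.op x, (1 : KanGroup X ⦋m⦌)) := by
  have h : f.toOrderHom (Fin.last m) = Fin.last 0 := Subsingleton.elim (α := Fin 1) _ _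
  refine (tcp_map_of_last (universalTwisting X) (selfAction (kanG X)) f h x
    (1 : KanGroup X ⦋0⦌)).trans ?_
  exact Prod.ext rfl (map_one (kanMap X f))

/-- Over a vertex, `Ψ (v ⊗ 1) = (v, 1)`, and the shuffle product with a simplex of dimension zero
has a single term; so `Ψ` is the inclusion of the fibre. -/
theorem Psi_base (z : Smp Z) : Psi R τ ρ (te R Z (vert n) (bs R z)) =
    bs R (⟨z.1, (base n z.1, z.2)⟩ : Smp (tcp τ ρ)) := by
  rw [Psi_te, Pone_zero, dot_apply, nab_zero_left rfl rfl, cm_bs]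
  refine congrArg (fun s : (Δ[n] : SSet.{u}) _⦋z.1⦌ × Z _⦋z.1⦌ => bs R (⟨z.1, s⟩ : Smp (tcp τ ρ))) ?_
  have h1 := principal_map_one (toHom z.1 0 (stp true (List.replicate z.1 false))) (base.{u} n 0)
  rw [base_map] at h1
  refine (congrArg₂ (fun s t => (SMap.tact τ ρ).app z.1 (pairS s t)) h1
    (sbv_id z fun _ _ => rfl)).trans ?_
  exact Prod.ext rfl (kanAct_one τ ρ z.2)

theorem fibre_base (c : Ch R Z) :
    cm R (fibre τ ρ) (Psi R τ ρ (te R Z (vert n) c)) = c := by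
  refine lin_ext_apply (f := cm R (fibre τ ρ) ∘ₗ Psi R τ ρ ∘ₗ te R Z (vert n))
    (g := LinearMap.id) (fun z => ?_) c
  rw [LinearMap.comp_apply, LinearMap.comp_apply, Psi_base, cm_bs]
  exact congrArg (fun t => bs R (⟨z.1, t⟩ : Smp Z)) (act_inv_act ρ _ _)

variable (R) in
/-- The chain homotopy given by the contraction of the twisted product. -/
def shrink : Ch R (tcp τ ρ) →ₗ[R] Ch R (tcp τ ρ) :=
  cm R (retract τ ρ) ∘ₗ nab R (Δ[1] : SSet.{u}) (tcp τ ρ) (bs R ⟨1, fundamental 1⟩)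

theorem bd_interval : bd R (Δ[1] : SSet.{u}) (bs R ⟨1, fundamental 1⟩) =
    bs R (vtx 1) - bs R (vtx 0) := by
  have h (i : ℕ) (hi : i ≤ 1) : sb (⟨1, fundamental 1⟩ : Smp (Δ[1] : SSet.{u})) 0 (del i) =
      vtx (1 - i) := by
    refine Sigma.ext rfl (heq_of_eq ?_)
    refine (SSet.stdSimplex.map_objEquiv_symm _ _).trans (congrArg _ ?_)
    refine (Category.comp_id _).trans (toHom_congr fun k hk => ?_)
    obtain rfl : k = 0 := by omega
    rw [del_apply]
    change _ = min (1 - i) 1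
    change min _ 1 = min (1 - i) 1
    split_ifs <;> omega
  rw [bd_bs_pos (by exact one_ne_zero)]
  change ∑ i ∈ Finset.range 2,
    (-1 : R) ^ i • bs R (sb (⟨1, fundamental 1⟩ : Smp (Δ[1] : SSet.{u})) 0 (del i)) = _
  rw [Finset.sum_range_succ, Finset.sum_range_one, h 0 (by omega), h 1 le_rfl, pow_zero, one_smul, pow_one, neg_one_smul, ← sub_eq_add_neg]

theorem retract_one (c : Ch R (tcp τ ρ)) :
    cm R (retract τ ρ) (nab R (Δ[1] : SSet.{u}) (tcp τ ρ) (bs R (vtx 1)) c) = c := by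
  refine lin_ext_apply (f := cm R (retract τ ρ) ∘ₗ nab R (Δ[1] : SSet.{u}) _ (bs R (vtx 1)))
    (g := LinearMap.id) (fun s => ?_) c
  rw [LinearMap.comp_apply, nab_zero_left rfl rfl, cm_bs]
  refine congrArg (bs R) (Sigma.ext rfl (heq_of_eq ?_))
  have h : sbv s s.1 OrderHom.id = s.2 := sbv_id s fun _ _ => rfl
  refine (congrArg (fun t => (retract τ ρ).app s.1 (pairS (sbv (vtx 1) s.1 _) t)) h).trans ?_
  refine (congrArg (fun J => (untriv τ ρ).app s.1 (pairS J ((triv τ ρ).app s.1 s.2)))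
    (contract_vtx_one _ s.2.1)).trans ?_
  exact untriv_triv τ ρ s.2

theorem retract_zero (c : Ch R (tcp τ ρ)) :
    cm R (retract τ ρ) (nab R (Δ[1] : SSet.{u}) (tcp τ ρ) (bs R (vtx 0)) c) =
      Psi R τ ρ (te R Z (vert n) (cm R (fibre τ ρ) c)) := by
  refine lin_ext_apply (f := cm R (retract τ ρ) ∘ₗ nab R (Δ[1] : SSet.{u}) _ (bs R (vtx 0)))
    (g := Psi R τ ρ ∘ₗ te R Z (vert n) ∘ₗ cm R (fibre τ ρ)) (fun s => ?_) c
  rw [LinearMap.comp_apply, LinearMap.comp_apply, LinearMap.comp_apply, nab_zero_left rfl rfl,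
    cm_bs, cm_bs, Psi_base]
  refine congrArg (bs R) (Sigma.ext rfl (heq_of_eq ?_))
  have h : sbv s s.1 OrderHom.id = s.2 := sbv_id s fun _ _ => rfl
  refine (congrArg (fun t => (retract τ ρ).app s.1 (pairS (sbv (vtx 0) s.1 _) t)) h).trans ?_
  exact congrArg (fun J => (untriv τ ρ).app s.1 (pairS J ((triv τ ρ).app s.1 s.2)))
    (contract_vtx_zero _ s.2.1)

/-- The prism formula. The contraction is the identity at the vertex `1` of the interval, and at the
vertex `0` it is the retraction to the fibre followed by `Ψ`. -/
theorem bd_shrink (c : Ch R (tcp τ ρ)) : bd R (tcp τ ρ) (shrink R τ ρ c) =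
    c - Psi R τ ρ (te R Z (vert n) (cm R (fibre τ ρ) c)) - shrink R τ ρ (bd R (tcp τ ρ) c) := by
  rw [shrink, LinearMap.comp_apply, LinearMap.comp_apply, bd_cm, bd_nab (bs_mem_deg (n := 1) rfl),
    bd_interval, map_sub (nab R _ _), LinearMap.sub_apply, map_add, map_sub, retract_one,
    retract_zero, pow_one, map_smul, neg_one_smul, ← sub_eq_add_neg]

theorem fr_stdCone (x : Smp (Δ[n] : SSet.{u})) : fr ((stdCone n).fn x) 0 = vert n := by
  obtain ⟨m, x⟩ := x
  obtain ⟨f, rfl⟩ := SSet.stdSimplex.objEquiv.symm.surjective x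
  refine Sigma.ext rfl (heq_of_eq ?_)
  refine (SSet.stdSimplex.map_objEquiv_symm (derivedMap f) _).trans ?_
  refine congrArg _ (hom_ext_val fun j => ?_)
  obtain rfl : j = 0 := Subsingleton.elim (α := Fin 1) _ _
  rfl

/-- Over a standard simplex the mapping cone of `Ψ` is acyclic. -/
theorem coneD_acyclic_stdSimplex (c : Lab R (ConeLab Z) (Δ[n] : SSet.{u}))
    (h : coneD R τ ρ c = 0) : ∃ e, coneD R τ ρ e = c := by
  have ha : td R τ ρ (prT R _ Z c) = 0 := by rw [← prT_coneD, h, map_zero]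
  have hb : Psi R τ ρ (prT R _ Z c) = bd R (tcp τ ρ) (prC R τ ρ c) := by
    rw [← sub_eq_zero, ← prC_coneD, h, map_zero]
  rw [← inT_prT_add τ ρ c]
  generalize prT R _ Z c = a at ha hb
  generalize prC R τ ρ c = b at hb
  -- The cone over `a` is a first candidate for a preimage; it is wrong by a term `v ⊗ w` in the
  -- fibre.
  have h1 := td_tD τ ρ (C := stdCone n) fr_stdCone a
  rw [ha, map_zero, sub_zero] at h1
  set H := tD R Z (stdCone n) a
  set w := tR R τ ρ (stdCone n) a
  -- The error `w` bounds in the fibre: there `∂ b = Ψ a` and `Ψ (v ⊗ w)` retracts to `w`. The chain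
  -- `w'` that does this also makes the retraction of `b - Ψ a'` vanish.
  have hw : bd R Z (cm R (fibre τ ρ) (b - Psi R τ ρ H)) = w := by
    rw [bd_cm, map_sub, ← hb, bd_Psi, h1, map_sub (Psi R τ ρ), sub_sub_cancel, fibre_base]
  set w' := cm R (fibre τ ρ) (b - Psi R τ ρ H) with hw'
  have htd : td R τ ρ (te R Z (vert n) w') = te R Z (vert n) w := by
    rw [td_te, tL_eq, hw]
    simp
  have h2 : td R τ ρ (H + te R Z (vert n) w') = a := by
    rw [map_add, h1, htd, sub_add_cancel]
  set a' := H + te R Z (vert n) w' with ha'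
  have h3 : bd R (tcp τ ρ) (b - Psi R τ ρ a') = 0 := by
    rw [map_sub, bd_Psi, h2, hb, sub_self]
  have h4 : cm R (fibre τ ρ) (b - Psi R τ ρ a') = 0 := by
    rw [ha', map_add, ← sub_sub, map_sub (cm R _), fibre_base, ← hw', sub_self]
  -- A cycle of the twisted product with zero image in the fibre is the boundary of its contraction.
  have h5 := bd_shrink τ ρ (b - Psi R τ ρ a')
  rw [h3, h4, map_zero, map_zero, map_zero, sub_zero, sub_zero] at h5
  refine ⟨inT R _ Z a' - inC R τ ρ (shrink R τ ρ (b - Psi R τ ρ a')), ?_⟩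
  rw [coneD_apply, map_sub (prT R _ Z), map_sub (prC R τ ρ), prT_inT, prT_inC, prC_inT, prC_inC,
    sub_zero, zero_sub, map_neg, sub_neg_eq_add, h5, h2, add_sub_cancel]

end

/-! ### Acyclicity of the mapping cone over an arbitrary base -/

section

variable {R : Type r} [CommRing R]
variable {X : SSet.{u}} {Γ : SimplicialObject GrpCat.{w}} {Z : SSet.{v}}
variable (τ : TwistingFunction X Γ) (ρ : SimplicialAction Γ Z)

/-- The objects that vary with the base are the twisting functions, which pull back along the
classifying maps; the fibre `Z` and the group stay fixed. -/
theorem coneD_acyclic (c : Lab R (ConeLab Z) X) (h : coneD R τ ρ c = 0) :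
    ∃ e, coneD R τ ρ e = c :=
  Lab.acyclic (Obj := fun X => TwistingFunction X Γ) (fun F τ => τ.pull F)
    (fun τ => coneD R τ ρ) (fun τ c => coneD_coneD τ ρ c) (fun F τ c => coneD_push ρ F τ c)
    (fun _ τ c h => coneD_acyclic_stdSimplex τ ρ c h) τ h

theorem exists_preimage {a : TT R X Z} {b : Ch R (tcp τ ρ)} (ha : td R τ ρ a = 0)
    (hb : bd R (tcp τ ρ) b = Psi R τ ρ a) :
    ∃ a' b', td R τ ρ a' = a ∧ Psi R τ ρ a' - bd R (tcp τ ρ) b' = b := by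
  obtain ⟨e, he⟩ := coneD_acyclic τ ρ (inT R X Z a + inC R τ ρ b) (by
    rw [coneD_apply, map_add (prT R X Z), map_add (prC R τ ρ), prT_inT, prT_inC, prC_inT, prC_inC, add_zero, zero_add,
      ha, hb, sub_self, map_zero, map_zero, add_zero])
  refine ⟨prT R X Z e, prC R τ ρ e, ?_, ?_⟩
  · rw [← prT_coneD, he, map_add, prT_inT, prT_inC, add_zero]
  · rw [← prC_coneD, he, map_add, prC_inT, prC_inC, zero_add]

end

/-! ### Chain homotopy equivalences of projective complexes -/

section

variable {R : Type r} [CommRing R]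

theorem exists_lift_of_forall {P : Type u} {M : Type v} {N : Type w} [AddCommGroup P] [Module R P]
    [AddCommGroup M] [Module R M] [AddCommGroup N] [Module R N] [Module.Projective R P]
    (f : M →ₗ[R] N) (g : P →ₗ[R] N) (h : ∀ x, ∃ y, f y = g x) :
    ∃ l : P →ₗ[R] M, ∀ x, f (l x) = g x := by
  obtain ⟨l, hl⟩ := Module.projective_lifting_property f.rangeRestrict
    (g.codRestrict (LinearMap.range f) fun x => h x) f.surjective_rangeRestrict
  exact ⟨l, fun x => congrArg Subtype.val (LinearMap.congr_fun hl x)⟩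

theorem exists_sequence {α : ℕ → Type u} {P : ∀ m, α m → Prop} {Q : ∀ m, α m → α (m + 1) → Prop}
    {x₀ : α 0} (h₀ : P 0 x₀) (h : ∀ m x, P m x → ∃ y, P (m + 1) y ∧ Q m x y) :
    ∃ f : ∀ m, α m, f 0 = x₀ ∧ ∀ m, Q m (f m) (f (m + 1)) := by
  choose s hs using h
  let F : ∀ m, {x : α m // P m x} := fun m =>
    Nat.rec ⟨x₀, h₀⟩ (fun m x => ⟨s m x.1 x.2, (hs m x.1 x.2).1⟩) m
  exact ⟨fun m => (F m).1, rfl, fun m => (hs m (F m).1 (F m).2).2⟩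

variable {T K : ℕ → Type u} [∀ m, AddCommGroup (T m)] [∀ m, Module R (T m)]
  [∀ m, AddCommGroup (K m)] [∀ m, Module R (K m)]

/-- The cycles of a complex that starts in degree `0`. -/
def IsCyc (d : ∀ m, T (m + 1) →ₗ[R] T m) (m : ℕ) (a : T m) : Prop :=
  match m, a with
  | 0, _ => True
  | m + 1, a => d m a = 0

variable {dT : ∀ m, T (m + 1) →ₗ[R] T m} {dK : ∀ m, K (m + 1) →ₗ[R] K m} {ψ : ∀ m, T m →ₗ[R] K m}

/-- The pair `(α, β)` takes values in the cycles of the mapping cone. Exactness provides preimages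
pointwise, and projectivity makes their choice linear. -/
theorem exists_lift_cone {P : Type v} [AddCommGroup P] [Module R P] [Module.Projective R P]
    (ex : ∀ m (a : T m) (b : K (m + 1)), IsCyc dT m a → dK m b = ψ m a →
      ∃ a' b', dT m a' = a ∧ ψ (m + 1) a' - dK (m + 1) b' = b)
    {m : ℕ} (α : P →ₗ[R] T m) (β : P →ₗ[R] K (m + 1)) (hα : ∀ x, IsCyc dT m (α x))
    (hβ : ∀ x, dK m (β x) = ψ m (α x)) :
    ∃ (p : P →ₗ[R] T (m + 1)) (q : P →ₗ[R] K (m + 2)),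
      ∀ x, dT m (p x) = α x ∧ ψ (m + 1) (p x) - dK (m + 1) (q x) = β x := by
  obtain ⟨l, hl⟩ := exists_lift_of_forall
    ((dT m ∘ₗ LinearMap.fst R (T (m + 1)) (K (m + 2))).prod
      (ψ (m + 1) ∘ₗ LinearMap.fst R _ _ - dK (m + 1) ∘ₗ LinearMap.snd R _ _))
    (α.prod β) fun x => by
      obtain ⟨a, b, h1, h2⟩ := ex m (α x) (β x) (hα x) (hβ x)
      exact ⟨(a, b), Prod.ext h1 h2⟩
  exact ⟨LinearMap.fst R _ _ ∘ₗ l, LinearMap.snd R _ _ ∘ₗ l, fun x =>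
    ⟨congrArg Prod.fst (hl x), congrArg Prod.snd (hl x)⟩⟩

/-- In each step `(g, -k)` is a lift of `b ↦ (g (d b), b - k (d b))`. This is a cycle of the mapping
cone by the relation already obtained in the preceding degree, which is needed there only on cycles.
-/
theorem exists_homotopyInverse [∀ m, Module.Projective R (K m)]
    (hK : ∀ m b, dK m (dK (m + 1) b) = 0)
    (ex₀ : ∀ b : K 0, ∃ a b', ψ 0 a - dK 0 b' = b)
    (ex : ∀ m (a : T m) (b : K (m + 1)), IsCyc dT m a → dK m b = ψ m a →
      ∃ a' b', dT m a' = a ∧ ψ (m + 1) a' - dK (m + 1) b' = b) :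
    ∃ (g : ∀ m, K m →ₗ[R] T m) (k : ∀ m, K m →ₗ[R] K (m + 1)),
      (∀ m b, dT m (g (m + 1) b) = g m (dK m b)) ∧
      (∀ b, b - ψ 0 (g 0 b) = dK 0 (k 0 b)) ∧
      ∀ m b, b - ψ (m + 1) (g (m + 1) b) = dK (m + 1) (k (m + 1) b) + k m (dK m b) := by
  obtain ⟨l, hl⟩ := exists_lift_of_forall (ψ 0 ∘ₗ LinearMap.fst R _ _ - dK 0 ∘ₗ LinearMap.snd R _ _)
    (LinearMap.id : K 0 →ₗ[R] K 0) fun b => by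
      obtain ⟨a, b', h⟩ := ex₀ b
      exact ⟨(a, b'), h⟩
  have h₀ (b : K 0) : b - ψ 0 (LinearMap.fst R _ _ (l b)) = dK 0 (-LinearMap.snd R _ _ (l b)) := by
    have h : ψ 0 (LinearMap.fst R _ _ (l b)) - dK 0 (LinearMap.snd R _ _ (l b)) = b := hl b
    rw [map_neg, sub_eq_iff_eq_add, neg_add_eq_sub, h]
  obtain ⟨f, hf₀, hf⟩ := exists_sequence
    (α := fun m => (K m →ₗ[R] T m) × (K m →ₗ[R] K (m + 1)))
    (P := fun m f => ∀ b, IsCyc dK m b → IsCyc dT m (f.1 b) ∧ b - ψ m (f.1 b) = dK m (f.2 b))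
    (Q := fun m f f' => ∀ b, dT m (f'.1 b) = f.1 (dK m b) ∧
      b - ψ (m + 1) (f'.1 b) = dK (m + 1) (f'.2 b) + f.2 (dK m b))
    (x₀ := (LinearMap.fst R _ _ ∘ₗ l, -(LinearMap.snd R _ _ ∘ₗ l)))
    (fun b _ => ⟨trivial, h₀ b⟩) (fun m f hf => by
      have hc (b : K (m + 1)) : IsCyc dK m (dK m b) := by
        cases m with
        | zero => trivial
        | succ m => exact hK m b
      obtain ⟨p, q, hpq⟩ := exists_lift_cone ex (f.1 ∘ₗ dK m) (LinearMap.id - f.2 ∘ₗ dK m)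
        (fun b => (hf _ (hc b)).1) (fun b => by
          have h := (hf _ (hc b)).2
          change dK m (b - f.2 (dK m b)) = ψ m (f.1 (dK m b))
          rw [map_sub, ← h, sub_sub_cancel])
      have h1 (b : K (m + 1)) : dT m (p b) = f.1 (dK m b) := (hpq b).1
      have h2 (b : K (m + 1)) : b - ψ (m + 1) (p b) = dK (m + 1) ((-q) b) + f.2 (dK m b) := by
        have h : ψ (m + 1) (p b) - dK (m + 1) (q b) = b - f.2 (dK m b) := (hpq b).2
        rw [LinearMap.neg_apply, map_neg, sub_eq_iff_eq_add.1 h]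
        abel
      refine ⟨(p, -q), fun b hb => ⟨?_, ?_⟩, fun b => ⟨h1 b, h2 b⟩⟩
      · change dT m (p b) = 0
        rw [h1, show dK m b = 0 from hb, map_zero]
      · change b - ψ (m + 1) (p b) = _
        rw [h2, show dK m b = 0 from hb, map_zero, add_zero])
  refine ⟨fun m => (f m).1, fun m => (f m).2, fun m b => (hf m b).1, fun b => ?_,
    fun m b => (hf m b).2⟩
  change b - ψ 0 ((f 0).1 b) = dK 0 ((f 0).2 b)
  rw [hf₀]
  exact h₀ b

/-- The homotopy `h` is built together with maps `q` from `T m` to `K (m + 2)` such that `ψ h - d q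
= k ψ` on cycles. These make `(1 - h d - g ψ, k ψ - q d)` a cycle of the mapping cone in the next
degree, so that exactness applies again. -/
theorem exists_homotopy_id [∀ m, Module.Projective R (T m)]
    (hT : ∀ m a, dT m (dT (m + 1) a) = 0) (hψ : ∀ m a, dK m (ψ (m + 1) a) = ψ m (dT m a))
    (ex : ∀ m (a : T m) (b : K (m + 1)), IsCyc dT m a → dK m b = ψ m a →
      ∃ a' b', dT m a' = a ∧ ψ (m + 1) a' - dK (m + 1) b' = b)
    {g : ∀ m, K m →ₗ[R] T m} {k : ∀ m, K m →ₗ[R] K (m + 1)}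
    (hg : ∀ m b, dT m (g (m + 1) b) = g m (dK m b))
    (hk₀ : ∀ b, b - ψ 0 (g 0 b) = dK 0 (k 0 b))
    (hk : ∀ m b, b - ψ (m + 1) (g (m + 1) b) = dK (m + 1) (k (m + 1) b) + k m (dK m b)) :
    ∃ h : ∀ m, T m →ₗ[R] T (m + 1), (∀ a, a - g 0 (ψ 0 a) = dT 0 (h 0 a)) ∧
      ∀ m a, a - g (m + 1) (ψ (m + 1) a) = dT (m + 1) (h (m + 1) a) + h m (dT m a) := by
  obtain ⟨p₀, q₀, h₀⟩ := exists_lift_cone (m := 0) ex (LinearMap.id - g 0 ∘ₗ ψ 0) (k 0 ∘ₗ ψ 0)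
    (fun _ => trivial) (fun a => by
      change dK 0 (k 0 (ψ 0 a)) = ψ 0 (a - g 0 (ψ 0 a))
      rw [← hk₀, map_sub])
  obtain ⟨f, hf₀, hf⟩ := exists_sequence
    (α := fun m => (T m →ₗ[R] T (m + 1)) × (T m →ₗ[R] K (m + 2)))
    (P := fun m f => ∀ a, IsCyc dT m a → dT m (f.1 a) = a - g m (ψ m a) ∧
      ψ (m + 1) (f.1 a) - dK (m + 1) (f.2 a) = k m (ψ m a))
    (Q := fun m f f' => ∀ a,
      a - g (m + 1) (ψ (m + 1) a) = dT (m + 1) (f'.1 a) + f.1 (dT m a))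
    (x₀ := (p₀, q₀)) (fun a _ => h₀ a) (fun m f hf => by
      have hc (a : T (m + 1)) : IsCyc dT m (dT m a) := by
        cases m with
        | zero => trivial
        | succ m => exact hT m a
      obtain ⟨p, q, hpq⟩ := exists_lift_cone ex
        (LinearMap.id - f.1 ∘ₗ dT m - g (m + 1) ∘ₗ ψ (m + 1))
        (k (m + 1) ∘ₗ ψ (m + 1) - f.2 ∘ₗ dT m)
        (fun a => by
          change dT m (a - f.1 (dT m a) - g (m + 1) (ψ (m + 1) a)) = 0
          rw [map_sub, map_sub, (hf _ (hc a)).1, hg, hψ]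
          abel)
        (fun a => by
          change dK (m + 1) (k (m + 1) (ψ (m + 1) a) - f.2 (dT m a)) =
            ψ (m + 1) (a - f.1 (dT m a) - g (m + 1) (ψ (m + 1) a))
          have h1 := hk m (ψ (m + 1) a)
          have h2 := (hf _ (hc a)).2
          rw [hψ, ← h2] at h1
          rw [map_sub, map_sub, map_sub, eq_comm, sub_right_comm, h1]
          abel)
      have h1 (a : T (m + 1)) : dT (m + 1) (p a) = a - f.1 (dT m a) - g (m + 1) (ψ (m + 1) a) :=
        (hpq a).1
      refine ⟨(p, q), fun a ha => ?_, fun a => ?_⟩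
      · have ha : dT m a = 0 := ha
        have h2 : ψ (m + 2) (p a) - dK (m + 2) (q a) = k (m + 1) (ψ (m + 1) a) - f.2 (dT m a) :=
          (hpq a).2
        rw [ha, map_zero, sub_zero] at h2
        refine ⟨?_, h2⟩
        change dT (m + 1) (p a) = _
        rw [h1, ha, map_zero, sub_zero]
      · change _ = dT (m + 1) (p a) + _
        rw [h1]
        abel)
  refine ⟨fun m => (f m).1, fun a => ?_, fun m a => hf m a⟩
  change a - g 0 (ψ 0 a) = dT 0 ((f 0).1 a)
  rw [hf₀]
  exact (h₀ a).1.symm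

end

/-! ### Chain homotopies and homotopy equivalences from their components -/

section

variable {V : Type u} [Category.{v} V] [Preadditive V] {P Q : ChainComplex V ℕ}

/-- A homotopy given by its components. -/
def homotopyOfComponents {f g : P ⟶ Q} (h : ∀ m, P.X m ⟶ Q.X (m + 1))
    (h₀ : f.f 0 = h 0 ≫ Q.d 1 0 + g.f 0)
    (h₁ : ∀ m, f.f (m + 1) = P.d (m + 1) m ≫ h m + h (m + 1) ≫ Q.d (m + 2) (m + 1) + g.f (m + 1)) :
    Homotopy f g where
  hom i j := if e : i + 1 = j then h i ≫ eqToHom (by rw [e]) else 0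
  zero i j hij := dif_neg hij
  comm i := by
    rcases i with _ | m
    · rw [Homotopy.dNext_zero_chainComplex, Homotopy.prevD_chainComplex, dif_pos rfl, zero_add,
        eqToHom_refl, Category.comp_id, h₀]
    · rw [Homotopy.dNext_succ_chainComplex, Homotopy.prevD_chainComplex, dif_pos rfl, dif_pos rfl,
        eqToHom_refl, eqToHom_refl, Category.comp_id, Category.comp_id, h₁]

end

section

variable {R : Type r} [CommRing R]

/-- A chain map between bounded below complexes of projective modules is a homotopy equivalence if
its mapping cone is exact. -/
theorem exists_homotopyEquiv {P Q : ChainComplex (ModuleCat.{u} R) ℕ} (φ : P ⟶ Q)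
    [∀ m, Module.Projective R (P.X m)] [∀ m, Module.Projective R (Q.X m)]
    (ex₀ : ∀ b : Q.X 0, ∃ a b', (φ.f 0).hom a - (Q.d 1 0).hom b' = b)
    (ex : ∀ m (a : P.X m) (b : Q.X (m + 1)), IsCyc (T := fun m => P.X m)
        (fun m => (P.d (m + 1) m).hom) m a →
      (Q.d (m + 1) m).hom b = (φ.f m).hom a →
      ∃ a' b', (P.d (m + 1) m).hom a' = a ∧
        (φ.f (m + 1)).hom a' - (Q.d (m + 2) (m + 1)).hom b' = b) :
    ∃ e : HomotopyEquiv P Q, e.hom = φ := by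
  have hd (S : ChainComplex (ModuleCat.{u} R) ℕ) (m : ℕ) (b : S.X (m + 2)) :
      (S.d (m + 1) m).hom ((S.d (m + 2) (m + 1)).hom b) = 0 := by
    rw [← LinearMap.comp_apply, ← ModuleCat.hom_comp, S.d_comp_d]
    rfl
  have hφ (m : ℕ) (a : P.X (m + 1)) : (Q.d (m + 1) m).hom ((φ.f (m + 1)).hom a) =
      (φ.f m).hom ((P.d (m + 1) m).hom a) := by
    rw [← LinearMap.comp_apply, ← ModuleCat.hom_comp, φ.comm, ModuleCat.hom_comp,
      LinearMap.comp_apply]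
  obtain ⟨g, k, hg, hk₀, hk⟩ := exists_homotopyInverse (T := fun m => P.X m) (K := fun m => Q.X m)
    (dT := fun m => (P.d (m + 1) m).hom) (dK := fun m => (Q.d (m + 1) m).hom)
    (ψ := fun m => (φ.f m).hom) (hd Q) ex₀ ex
  obtain ⟨h, hh₀, hh⟩ := exists_homotopy_id (T := fun m => P.X m) (K := fun m => Q.X m)
    (dT := fun m => (P.d (m + 1) m).hom) (dK := fun m => (Q.d (m + 1) m).hom)
    (ψ := fun m => (φ.f m).hom) (hd P) hφ ex hg hk₀ hk
  let γ : Q ⟶ P :=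
    { f := fun m => ModuleCat.ofHom (g m)
      comm' := fun i j hij => by
        obtain rfl : j + 1 = i := hij
        ext b
        exact hg j b }
  refine ⟨⟨φ, γ, (homotopyOfComponents (fun m => ModuleCat.ofHom (h m)) ?_ fun m => ?_).symm,
    (homotopyOfComponents (fun m => ModuleCat.ofHom (k m)) ?_ fun m => ?_).symm⟩, rfl⟩
  · ext a
    exact sub_eq_iff_eq_add.1 (hh₀ a)
  · ext a
    refine (sub_eq_iff_eq_add.1 (hh m a)).trans ?_
    rw [add_comm (((P.d (m + 2) (m + 1)).hom) _)]
    rfl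
  · ext b
    exact sub_eq_iff_eq_add.1 (hk₀ b)
  · ext b
    refine (sub_eq_iff_eq_add.1 (hk m b)).trans ?_
    rw [add_comm (((Q.d (m + 2) (m + 1)).hom) _)]
    rfl

end

/-! ### Homogeneous parts -/

section

variable (R : Type r) [CommRing R]

/-- The part of degree `m` of a chain. -/
def part (S : SSet.{u}) (m : ℕ) : Ch R S →ₗ[R] (S _⦋m⦌ →₀ R) :=
  Finsupp.lcomapDomain (fun s => (⟨m, s⟩ : Smp S)) fun _ _ h => eq_of_heq (Sigma.mk.inj h).2

/-- The part of degree `m` of an element of the twisted tensor product. -/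
def partT (X : SSet.{u}) (Z : SSet.{v}) (m : ℕ) : TT R X Z →ₗ[R] Tensor R X Z m :=
  Finsupp.lcomapDomain (fun e : TensorBasis X Z m => ((⟨e.p, e.x⟩ : Smp X), (⟨e.q, e.z⟩ : Smp Z)))
    fun e e' h => by
      obtain ⟨p, q, h1, x, z⟩ := e
      obtain ⟨p', q', h1', x', z'⟩ := e'
      rw [Prod.mk.injEq, Sigma.mk.injEq, Sigma.mk.injEq] at h
      obtain ⟨⟨rfl, hx⟩, rfl, hz⟩ := h
      obtain rfl := eq_of_heq hx
      obtain rfl := eq_of_heq hz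
      rfl

variable {R}

theorem part_gr {S : SSet.{u}} {m : ℕ} (c : S _⦋m⦌ →₀ R) : part R S m (gr R S m c) = c :=
  Finsupp.leftInverse_lcomapDomain_mapDomain _ _ c

theorem partT_grT {X : SSet.{u}} {Z : SSet.{v}} {m : ℕ} (c : Tensor R X Z m) :
    partT R X Z m (grT R X Z m c) = c :=
  Finsupp.leftInverse_lcomapDomain_mapDomain _ _ c

theorem part_gr_ne {S : SSet.{u}} {m n : ℕ} (h : n ≠ m) (c : S _⦋n⦌ →₀ R) :
    part R S m (gr R S n c) = 0 := by
  ext s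
  refine Finsupp.mapDomain_of_notMem_range _ _ ?_
  rintro ⟨s', hs⟩
  exact h (congrArg Sigma.fst hs)

theorem partT_grT_ne {X : SSet.{u}} {Z : SSet.{v}} {m n : ℕ} (h : n ≠ m) (c : Tensor R X Z n) :
    partT R X Z m (grT R X Z n c) = 0 := by
  ext e
  refine Finsupp.mapDomain_of_notMem_range _ _ ?_
  rintro ⟨e', he⟩
  have h1 : e'.p = e.p := congrArg (fun t => t.1.1) he
  have h2 : e'.q = e.q := congrArg (fun t => t.2.1) he
  exact h (by rw [← e.add_eq, ← e'.add_eq, h1, h2])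

theorem bs_eq_gr {S : SSet.{u}} (s : Smp S) : bs R s = gr R S s.1 (bs R s.2) :=
  ((gr_single S s.2 1).trans (one_smul _ _)).symm

theorem bs_eq_grT {X : SSet.{u}} {Z : SSet.{v}} (x : Smp X) (z : Smp Z) :
    bs R (x, z) = grT R X Z (x.1 + z.1) (bs R ⟨x.1, z.1, rfl, x.2, z.2⟩) := by
  rw [show bs R (⟨x.1, z.1, rfl, x.2, z.2⟩ : TensorBasis X Z (x.1 + z.1)) = Finsupp.single _ 1 from rfl,
    grT_single, one_smul, te_bs]

variable (R) in
/-- The differential of the chain complex of a simplicial set. -/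
def chD (S : SSet.{v}) (m : ℕ) : (S _⦋m + 1⦌ →₀ R) →ₗ[R] (S _⦋m⦌ →₀ R) :=
  ((chains R S).d (m + 1) m).hom

theorem gr_chD {S : SSet.{v}} (m : ℕ) (c : S _⦋m + 1⦌ →₀ R) :
    gr R S m (chD R S m c) = bd R S (gr R S (m + 1) c) := gr_chains_d m c

theorem part_bd {S : SSet.{v}} (m : ℕ) (c : Ch R S) :
    part R S m (bd R S c) = chD R S m (part R S (m + 1) c) := by
  refine lin_ext_apply (f := part R S m ∘ₗ bd R S)
    (g := chD R S m ∘ₗ part R S (m + 1)) (fun s => ?_) c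
  rw [LinearMap.comp_apply, LinearMap.comp_apply, bs_eq_gr]
  obtain ⟨n, s⟩ := s
  dsimp only
  generalize bs R s = c
  rcases n with _ | n
  · rw [bd_deg_zero (gr_mem_deg c), part_gr_ne (Nat.succ_ne_zero m).symm, map_zero, map_zero]
  · rw [← gr_chD]
    rcases eq_or_ne n m with rfl | h
    · rw [part_gr, part_gr]
    · rw [part_gr_ne (fun e => h (Nat.succ.inj e)), part_gr_ne h, map_zero]

variable {X : SSet.{u}} {Γ : SimplicialObject GrpCat.{w}} {Z : SSet.{v}}
variable (τ : TwistingFunction X Γ) (ρ : SimplicialAction Γ Z)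

theorem td_grT_zero (t : Tensor R X Z 0) : td R τ ρ (grT R X Z 0 t) = 0 := by
  refine lin_ext_apply (f := td R τ ρ ∘ₗ grT R X Z 0) (g := 0) (fun e => ?_) t
  obtain ⟨p, q, h, x, z⟩ := e
  obtain rfl : p = 0 := by omega
  obtain rfl : q = 0 := by omega
  rw [LinearMap.comp_apply, bs, grT_single, one_smul, td_te, tL_eq, bd_bs_zero rfl]
  simp

theorem partT_td_grT (m n : ℕ) (t : Tensor R X Z n) : partT R X Z m (td R τ ρ (grT R X Z n t)) =
    tensorDiff R τ ρ m (partT R X Z (m + 1) (grT R X Z n t)) := by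
  rcases n with _ | n
  · rw [td_grT_zero, partT_grT_ne (Nat.succ_ne_zero m).symm, map_zero, map_zero]
  · rw [← grT_tensorDiff]
    rcases eq_or_ne n m with rfl | h
    · rw [partT_grT, partT_grT]
    · rw [partT_grT_ne (fun e => h (Nat.succ.inj e)), partT_grT_ne h, map_zero]

theorem partT_td (m : ℕ) (t : TT R X Z) :
    partT R X Z m (td R τ ρ t) = tensorDiff R τ ρ m (partT R X Z (m + 1) t) := by
  refine lin_ext_apply (f := partT R X Z m ∘ₗ td R τ ρ)
    (g := tensorDiff R τ ρ m ∘ₗ partT R X Z (m + 1)) (fun p => ?_) t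
  rw [LinearMap.comp_apply, LinearMap.comp_apply, ← Prod.eta p, bs_eq_grT]
  exact partT_td_grT τ ρ m _ _

theorem part_Psi (m : ℕ) (t : TT R X Z) :
    part R (tcp τ ρ) m (Psi R τ ρ t) = psi R τ ρ m (partT R X Z m t) := by
  refine lin_ext_apply (f := part R (tcp τ ρ) m ∘ₗ Psi R τ ρ)
    (g := psi R τ ρ m ∘ₗ partT R X Z m) (fun p => ?_) t
  rw [LinearMap.comp_apply, LinearMap.comp_apply, ← Prod.eta p, bs_eq_grT, ← gr_psi]
  rcases eq_or_ne (p.1.1 + p.2.1) m with rfl | h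
  · rw [part_gr, partT_grT]
  · rw [part_gr_ne h, partT_grT_ne h, map_zero]

/-- An ungraded preimage need not be homogeneous. Since all maps respect degrees, its components in
the right degrees form a preimage too. -/
theorem exists_preimage_zero (b : (tcp τ ρ) _⦋0⦌ →₀ R) :
    ∃ a b', psi R τ ρ 0 a - chD R (tcp τ ρ) 0 b' = b := by
  obtain ⟨a', b', -, h⟩ := exists_preimage τ ρ (a := 0) (b := gr R (tcp τ ρ) 0 b) (map_zero _)
    (by rw [bd_deg_zero (gr_mem_deg b), map_zero])
  refine ⟨partT R X Z 0 a', part R (tcp τ ρ) 1 b', ?_⟩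
  rw [← part_Psi, ← part_bd, ← map_sub, h, part_gr]

theorem exists_preimage_succ (m : ℕ) (a : Tensor R X Z m) (b : (tcp τ ρ) _⦋m + 1⦌ →₀ R)
    (ha : IsCyc (T := Tensor R X Z) (tensorDiff R τ ρ) m a)
    (hb : chD R (tcp τ ρ) m b = psi R τ ρ m a) :
    ∃ a' b', tensorDiff R τ ρ m a' = a ∧
      psi R τ ρ (m + 1) a' - chD R (tcp τ ρ) (m + 1) b' = b := by
  have h1 : td R τ ρ (grT R X Z m a) = 0 := by
    rcases m with _ | m
    · exact td_grT_zero τ ρ a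
    · rw [← grT_tensorDiff, show tensorDiff R τ ρ m a = 0 from ha, map_zero]
  have h2 : bd R (tcp τ ρ) (gr R (tcp τ ρ) (m + 1) b) = Psi R τ ρ (grT R X Z m a) := by
    rw [← gr_chD, ← gr_psi, hb]
  obtain ⟨a', b', h3, h4⟩ := exists_preimage τ ρ h1 h2
  refine ⟨partT R X Z (m + 1) a', part R (tcp τ ρ) (m + 2) b', ?_, ?_⟩
  · rw [← partT_td, h3, partT_grT]
  · rw [← part_Psi, ← part_bd, ← map_sub, h4, part_gr]

/-- Both complexes consist of free modules, so the exactness of the mapping cone suffices. -/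
theorem psi_homotopyEquiv (hd : ∀ m, tensorDiff R τ ρ m ∘ₗ tensorDiff R τ ρ (m + 1) = 0)
    (hΨ : ∀ m, psiHom R τ ρ (m + 1) ≫ (chains R (tcp τ ρ)).d (m + 1) m =
      (twistedTensor R τ ρ hd).d (m + 1) m ≫ psiHom R τ ρ m) :
    ∃ e : HomotopyEquiv (twistedTensor R τ ρ hd) (chains R (tcp τ ρ)),
      e.hom = ChainComplex.ofHom (psiHom R τ ρ) hΨ := by
  have i1 (m : ℕ) : Module.Projective R ((twistedTensor R τ ρ hd).X m) :=
    inferInstanceAs (Module.Projective R (Tensor R X Z m))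
  have i2 (m : ℕ) : Module.Projective R ((chains R (tcp τ ρ)).X m) :=
    inferInstanceAs (Module.Projective R ((tcp τ ρ) _⦋m⦌ →₀ R))
  have hdT : (fun m => ((twistedTensor R τ ρ hd).d (m + 1) m).hom) = tensorDiff R τ ρ := by
    funext m
    have h : (twistedTensor R τ ρ hd).d (m + 1) m = ModuleCat.ofHom (tensorDiff R τ ρ m) :=
      ChainComplex.of_d (fun m => ModuleCat.of R (Tensor R X Z m))
        (fun m => ModuleCat.ofHom (tensorDiff R τ ρ m)) m
    rw [h]
    rfl
  refine exists_homotopyEquiv (R := R) (P := twistedTensor R τ ρ hd) (Q := chains R (tcp τ ρ))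
    (ChainComplex.ofHom (psiHom R τ ρ) hΨ) (exists_preimage_zero τ ρ) fun m a b ha hb => ?_
  have ha' : IsCyc (T := Tensor R X Z) (tensorDiff R τ ρ) m a := hdT ▸ ha
  obtain ⟨a', b', h1, h2⟩ := exists_preimage_succ τ ρ m a b ha' hb
  exact ⟨a', b', (LinearMap.congr_fun (congrFun hdT m) a').trans h1, h2⟩

end

end Brown

end

theorem mainTheorem2 (R : Type r) [CommRing R] (X : SSet.{u}) (Γ : SimplicialObject GrpCat.{w})
    (Z : SSet.{v}) (hX : Nonempty (Unique (X _⦋0⦌)))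
    (τ : Brown.TwistingFunction X Γ) (ρ : Brown.SimplicialAction Γ Z) :
    ∃ (hd : ∀ m, Brown.tensorDiff R τ ρ m ∘ₗ Brown.tensorDiff R τ ρ (m + 1) = 0)
      (hΨ : ∀ m, Brown.psiHom R τ ρ (m + 1) ≫ (Brown.chains R (Brown.tcp τ ρ)).d (m + 1) m =
        (Brown.twistedTensor R τ ρ hd).d (m + 1) m ≫ Brown.psiHom R τ ρ m),
      (∀ (n : ℕ) (x : X _⦋n⦌),
        Brown.psiOne R x - Brown.pairOne R x ∈ Brown.skeletalFiltration R X n n) ∧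
      ∃ e : HomotopyEquiv (Brown.twistedTensor R τ ρ hd) (Brown.chains R (Brown.tcp τ ρ)),
        e.hom = ChainComplex.ofHom (Brown.psiHom R τ ρ) hΨ := by
  have hd := fun m => Brown.tensorDiff_comp (R := R) τ ρ m
  exact ⟨hd, fun m => Brown.psiHom_comm τ ρ hd m, fun n x => Brown.psiOne_sub_pairOne x,
    Brown.psi_homotopyEquiv τ ρ hd _⟩
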